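/- Let $D$ be a diagram of an oriented link, let $v$ be a positive crossing of $D$, and let $D_A$ and $D_B$ be the diagrams obtained from $D$ by the Kauffman $A$-smoothing and $B$-smoothing of $v$. Since $v$ is positive, the $A$-smoothing respects the orientation, and $D_A$ carries the orientation inherited from $D$. Assume that $D_B$ is a diagram of the trivial knot (it may have crossings) and give it any orientation. Let $w=w(D)$ and $w_B=w(D_B)$ be the writhes. Let $H^{i,j}$ denote integral Khovanov homology, in the normalization $H^{i,j}(D)=H_{w-2i,\,3w-2j}(D)$, where $H_{a,b}(D)$ is the framed Khovanov homology of $D$: the homology of the complex $C_{a,b}(D)\to C_{a-2,b}(D)$ freely generated over $\mathbb{Z}$ by the enhanced Kauffman states with $a=\sigma$ and $b=\sigma+2\tau$, where $\sigma$ is the number of $A$-labels minus the number of $B$-labels and $\tau$ is the sum of the signs of the circles. Let $\alpha\colon C_{a+1,b+1}(D_B)\to C_{a,b}(D)$ be the inclusion of the states of $D_B$ as the states of $D$ with label $B$ at $v$ (with signs making it a chain map; all the signs are $+1$ if $v$ comes first in the order of the crossings), let $\beta\colon C_{a,b}(D)\to C_{a-1,b-1}(D_A)$ be the projection onto the states with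 label $A$ at $v$, let $\alpha_*,\beta_*$ be the induced maps on homology, and let $\gamma_*$ be the connecting homomorphism of $0\to C(D_B)\xrightarrow{\alpha} C(D)\xrightarrow{\beta} C(D_A)\to 0$. Then $u=\frac{w-w_B+1}{2}$ is an integer, and the following hold. 1. For all integers $i,j$ with $(i,j)\notin\{(u,3u),(u,3u-2),(u-1,3u),(u-1,3u-2)\}$, $$H^{i,j}(D)\cong H^{i,j-1}(D_A).$$ 2. The following sequences are exact, where in (a) the group $\mathbb{Z}$ stands for $H^{0,1}(D_B)\cong\mathbb{Z}$, and in (b) for $H^{0,-1}(D_B)\cong\mathbb{Z}$: (a) $$0\to H^{u-1,3u}(D)\xrightarrow{\beta_*}H^{u-1,3u-1}(D_A)\xrightarrow{\gamma_*}\mathbb{Z}\xrightarrow{\alpha_*}H^{u,3u}(D)\xrightarrow{\beta_*}H^{u,3u-1}(D_A)\to 0,$$ (b) $$0\to H^{u-1,3u-2}(D)\xrightarrow{\beta_*}H^{u-1,3u-3}(D_A)\xrightarrow{\gamma_*}\mathbb{Z}\xrightarrow{\alpha_*}H^{u,3u-2}(D)\xrightarrow{\beta_*}H^{u,3u-3}(D_A)\to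 0.$$ 3. For all integers $i,j$ with $(i,j)\notin\{(u,3u),(u,3u-2)\}$, the torsion subgroups satisfy $$\operatorname{tor}H^{i,j}(D)\cong\operatorname{tor}H^{i,j-1}(D_A).$$ -/

import Mathlib

/-!
Link diagrams as planar diagram codes, Reidemeister moves, framed and classical Khovanov homology
over `ℤ`, and the maps of the long exact sequence of a crossing.
-/

/-- A planar diagram code with `n` ordered crossings and `m` bivalent vertices, whose edges are
labelled by `E`.  `crossing i` lists the four edge ends at the crossing `i` in counterclockwise
order, so that the ends `0`, `2` belong to the under-strand and the ends `1`, `3` to the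
over-strand.  `arc j` lists the two edge ends at the bivalent vertex `j`, which is an ordinary point
of the link (bivalent vertices allow components without crossings: a circle is an edge with both
ends at one bivalent vertex). -/
structure PD (E : Type) (n m : ℕ) where
  crossing : Fin n → Fin 4 → E
  arc : Fin m → Fin 2 → E

namespace PD

variable {E E' E'' : Type} {n m n' m' n'' m'' : ℕ}

/-! ### Planarity -/

/-- The ends of edges at the vertices. -/
abbrev Slot (n m : ℕ) : Type := (Fin n × Fin 4) ⊕ (Fin m × Fin 2)

/-- The edge to which an end belongs. -/
def label (D : PD E n m) : Slot n m → E
  | .inl (i, k) => D.crossing i k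
  | .inr (j, k) => D.arc j k

/-- The next end around the same vertex, counterclockwise. -/
def rot : Slot n m → Slot n m
  | .inl (i, k) => .inl (i, k + 1)
  | .inr (j, k) => .inr (j, k + 1)

/-- An end `h` stands for the corner between `h` and `rot h`; the next corner along the boundary of
the same face stands at the other end of the edge of `rot h`. -/
def FaceStep (D : PD E n m) (h h' : Slot n m) : Prop :=
  rot h ≠ h' ∧ D.label (rot h) = D.label h'

/-- The faces of the underlying ribbon graph. -/
def Face (D : PD E n m) : Type := Quot D.FaceStep

/-- Two edges meet at a common vertex. -/
def Incident (D : PD E n m) (x y : E) : Prop :=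
  (∃ i k l, D.crossing i k = x ∧ D.crossing i l = y) ∨ ∃ j k l, D.arc j k = x ∧ D.arc j l = y

/-- The connected components of the underlying graph. -/
def Piece (D : PD E n m) : Type := Quot D.Incident

/-- The code describes a link diagram on the sphere: each edge has exactly two ends, and the Euler
characteristic `V - E + F` of the surface carrying the graph is twice the number of its connected
components, so each of them is a sphere. -/
structure IsLinkDiagram (D : PD E n m) : Prop where
  two_ends : ∀ x : E, Nat.card {h : Slot n m // D.label h = x} = 2
  planar : n + m + Nat.card D.Face = Nat.card E + 2 * Nat.card D.Piece

/-! ### Orientations and the writhe -/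

/-- An orientation of the link: for every end of an edge, whether the edge points into the vertex
there, consistently along edges and along the strands through the vertices. -/
structure Orientation (D : PD E n m) where
  inward : Slot n m → Bool
  along_edge : ∀ h h', h ≠ h' → D.label h = D.label h' → inward h ≠ inward h'
  through_crossing : ∀ i k, inward (.inl (i, k + 2)) ≠ inward (.inl (i, k))
  through_arc : ∀ j, inward (.inr (j, 1)) ≠ inward (.inr (j, 0))

/-- The sign of a crossing: it is positive when the under-strand runs from `0` to `2` and the
over-strand from `3` to `1`, or both run the other way. -/
def Orientation.sign {D : PD E n m} (o : D.Orientation) (i : Fin n) : ℤ :=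
  if o.inward (.inl (i, 0)) = o.inward (.inl (i, 3)) then 1 else -1

/-- The writhe. -/
def Orientation.writhe {D : PD E n m} (o : D.Orientation) : ℤ := ∑ i, o.sign i

/-! ### Smoothing one crossing -/

/-- The `A`-smoothing at `v`: the regions swept by the over-strand when it turns counterclockwise
are joined. -/
def smoothA (D : PD E (n + 1) m) (v : Fin (n + 1)) : PD E n (m + 2) where
  crossing i := D.crossing (v.succAbove i)
  arc := Matrix.vecCons ![D.crossing v 0, D.crossing v 1]
    (Matrix.vecCons ![D.crossing v 2, D.crossing v 3] D.arc)

/-- The `B`-smoothing at `v`: the other two regions are joined. -/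
def smoothB (D : PD E (n + 1) m) (v : Fin (n + 1)) : PD E n (m + 2) where
  crossing i := D.crossing (v.succAbove i)
  arc := Matrix.vecCons ![D.crossing v 1, D.crossing v 2]
    (Matrix.vecCons ![D.crossing v 3, D.crossing v 0] D.arc)

/-- The end of an edge of the original diagram which becomes a given end in the `A`-smoothing. -/
def slotA (v : Fin (n + 1)) : Slot n (m + 2) → Slot (n + 1) m
  | .inl (i, k) => .inl (v.succAbove i, k)
  | .inr (j, k) => (Matrix.vecCons (.inl (v, ![0, 1] k))
      (Matrix.vecCons (.inl (v, ![2, 3] k)) fun l => .inr (l, k)) : Fin (m + 2) → _) j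

theorem label_slotA (D : PD E (n + 1) m) (v : Fin (n + 1)) (h : Slot n (m + 2)) :
    D.label (slotA v h) = (D.smoothA v).label h := by
  rcases h with ⟨i, k⟩ | ⟨j, k⟩
  · rfl
  · refine Fin.cases ?_ (fun j => Fin.cases ?_ (fun j => ?_) j) j
    · fin_cases k <;> rfl
    · fin_cases k <;> rfl
    · rfl

theorem slotA_injective (v : Fin (n + 1)) :
    Function.Injective (slotA v : Slot n (m + 2) → Slot (n + 1) m) := by
  have key : ∀ (i : Fin n) (k : Fin 4) (j : Fin (m + 2)) (l : Fin 2),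
      slotA v (.inl (i, k) : Slot n (m + 2)) ≠ slotA (m := m) v (.inr (j, l)) := by
    intro i k j l
    refine Fin.cases ?_ (fun j => Fin.cases ?_ (fun j => ?_) j) j <;>
      simp [slotA, Fin.succAbove_ne]
  rintro (⟨i, k⟩ | ⟨j, k⟩) (⟨i', k'⟩ | ⟨j', k'⟩) h
  · simpa [slotA] using h
  · exact (key _ _ _ _ h).elim
  · exact (key _ _ _ _ h.symm).elim
  · revert h
    refine Fin.cases ?_ (fun j => Fin.cases ?_ (fun j => ?_) j) j <;>
      refine Fin.cases ?_ (fun j' => Fin.cases ?_ (fun j' => ?_) j') j' <;>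
      fin_cases k <;> fin_cases k' <;> simp [slotA]

/-- At a positive crossing the `A`-smoothing respects the orientation, and this is the orientation
which it inherits. -/
def Orientation.smoothA {D : PD E (n + 1) m} (o : D.Orientation) (v : Fin (n + 1))
    (hv : o.sign v = 1) : (D.smoothA v).Orientation where
  inward h := o.inward (slotA v h)
  along_edge h h' hne hl := by
    refine o.along_edge _ _ (fun e => hne (slotA_injective v e)) ?_
    rw [label_slotA, label_slotA, hl]
  through_crossing i k := o.through_crossing (v.succAbove i) k
  through_arc j := by
    have h03 : o.inward (.inl (v, 0)) = o.inward (.inl (v, 3)) := by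
      by_contra hne
      simp [Orientation.sign, hne] at hv
    have h2 := o.through_crossing v 0
    have h1 := o.through_crossing v 1
    have e2 : (0 + 2 : Fin 4) = 2 := rfl
    have e3 : (1 + 2 : Fin 4) = 3 := rfl
    rw [e2] at h2
    rw [e3] at h1
    refine Fin.cases ?_ (fun j => Fin.cases ?_ (fun j => ?_) j) j
    · change o.inward (.inl (v, 1)) ≠ o.inward (.inl (v, 0))
      rw [h03]; exact h1.symm
    · change o.inward (.inl (v, 3)) ≠ o.inward (.inl (v, 2))
      rw [← h03]; exact h2.symm
    · exact o.through_arc j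

/-! ### Reidemeister moves and the trivial knot -/

/-- Change of the labels of the edges. -/
def map (f : E → E') (D : PD E n m) : PD E' n m where
  crossing i k := f (D.crossing i k)
  arc j k := f (D.arc j k)

/-- The crossing with ends `a`, `b`, `c`, `d` in counterclockwise order in which the strand from `a`
to `c` is the under-strand if `under` is true, and the over-strand otherwise. -/
def crossingOf (under : Bool) (a b c d : E) : Fin 4 → E :=
  if under then ![a, b, c, d] else ![b, c, d, a]

/-- Elementary moves on codes.  The first five do not change the diagram up to planar isotopy
(renaming of edges and vertices, and removal of a bivalent vertex); the others are the Reidemeister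
moves.  In the latter the edges inside the disc where the move takes place are the new labels
`.inr _`, and all the others are old labels. -/
inductive Move : ∀ {E E' : Type} {n m n' m' : ℕ}, PD E n m → PD E' n' m' → Prop
  | relabel {E E' : Type} {n m : ℕ} (f : E ≃ E') (D : PD E n m) : Move D (D.map f)
  | reorder {E : Type} {n m : ℕ} (σ : Equiv.Perm (Fin n)) (ρ : Equiv.Perm (Fin m))
      (D : PD E n m) : Move D ⟨D.crossing ∘ σ, D.arc ∘ ρ⟩
  | halfTurn {E : Type} {n m : ℕ} (i : Fin n) (D : PD E n m) :
      Move D ⟨Function.update D.crossing i fun k => D.crossing i (k + 2), D.arc⟩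
  | flipArc {E : Type} {n m : ℕ} (j : Fin m) (D : PD E n m) :
      Move D ⟨D.crossing, Function.update D.arc j fun k => D.arc j (k + 1)⟩
  /- The bivalent vertex joining the edge `none` to the edge `some y` is removed, and the two edges
  become one edge `y`. -/
  | removeArc {E : Type} {n m : ℕ} (y : E) (D : PD (Option E) n m) :
      Move ⟨D.crossing, Matrix.vecCons ![none, some y] D.arc⟩ (D.map fun x => x.getD y)
  | reidemeister₁ {E : Type} {n m : ℕ} (under : Bool) (p q : E) (D : PD E n m) :
      Move
        (⟨Matrix.vecCons (crossingOf under (.inr 0) (.inr 0) (.inl p) (.inl q))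
            (D.map .inl).crossing,
          (D.map .inl).arc⟩ : PD (E ⊕ Fin 1) (n + 1) m)
        ⟨D.crossing, Matrix.vecCons ![p, q] D.arc⟩
  /- The strand from `p` to `q` passes over the strand from `r` to `s` twice. -/
  | reidemeister₂ {E : Type} {n m : ℕ} (p q r s : E) (D : PD E n m) :
      Move
        (⟨Matrix.vecCons ![.inr 1, .inl p, .inl r, .inr 0]
            (Matrix.vecCons ![.inl s, .inl q, .inr 1, .inr 0] (D.map .inl).crossing),
          (D.map .inl).arc⟩ : PD (E ⊕ Fin 2) (n + 2) m)
        ⟨D.crossing, Matrix.vecCons ![p, q] (Matrix.vecCons ![r, s] D.arc)⟩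
  /- The six points `p 0, …, p 5` follow each other counterclockwise on the boundary of a disc, and
  for `i = 1, 2, 3` the `i`-th strand runs from `p (i - 1)` to `p (i + 2)`.  `uᵢⱼ` tells whether the
  `i`-th strand passes under the `j`-th one; the hypothesis says that the three strands lie one
  above another. -/
  | reidemeister₃ {E : Type} {n m : ℕ} (u₁₂ u₁₃ u₂₃ : Bool) (hu : u₁₂ = u₂₃ → u₁₃ = u₁₂)
      (p : Fin 6 → E) (D : PD E n m) :
      Move
        (⟨Matrix.vecCons (crossingOf u₁₂ (.inl (p 0)) (.inl (p 1)) (.inr 0) (.inr 1))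
            (Matrix.vecCons (crossingOf u₁₃ (.inr 0) (.inl (p 2)) (.inl (p 3)) (.inr 2))
              (Matrix.vecCons (crossingOf u₂₃ (.inr 1) (.inr 2) (.inl (p 4)) (.inl (p 5)))
                (D.map .inl).crossing)),
          (D.map .inl).arc⟩ : PD (E ⊕ Fin 3) (n + 3) m)
        (⟨Matrix.vecCons (crossingOf u₁₂ (.inr 0) (.inr 1) (.inl (p 3)) (.inl (p 4)))
            (Matrix.vecCons (crossingOf u₁₃ (.inl (p 0)) (.inr 2) (.inr 0) (.inl (p 5)))
              (Matrix.vecCons (crossingOf u₂₃ (.inl (p 1)) (.inl (p 2)) (.inr 1) (.inr 2))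
                (D.map .inl).crossing)),
          (D.map .inl).arc⟩ : PD (E ⊕ Fin 3) (n + 3) m)

/-- Link diagrams related by a finite sequence of moves through link diagrams and their inverses. -/
inductive Isotopic : ∀ {E E' : Type} {n m n' m' : ℕ}, PD E n m → PD E' n' m' → Prop
  | move {E E' : Type} {n m n' m' : ℕ} {D : PD E n m} {D' : PD E' n' m'}
      (hD : D.IsLinkDiagram) (hD' : D'.IsLinkDiagram) (h : Move D D') : Isotopic D D'
  | refl {E : Type} {n m : ℕ} (D : PD E n m) : Isotopic D D
  | symm {E E' : Type} {n m n' m' : ℕ} {D : PD E n m} {D' : PD E' n' m'}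
      (h : Isotopic D D') : Isotopic D' D
  | trans {E E' E'' : Type} {n m n' m' n'' m'' : ℕ} {D : PD E n m} {D' : PD E' n' m'}
      {D'' : PD E'' n'' m''} (h : Isotopic D D') (h' : Isotopic D' D'') : Isotopic D D''

/-- The circle without crossings. -/
def circle : PD Unit 0 1 := ⟨Fin.elim0, fun _ _ => ()⟩

/-- The diagram represents the trivial knot (with an arbitrary framing). -/
def IsTrivialKnot (D : PD E n m) : Prop := Isotopic D circle

/-! ### Enhanced Kauffman states -/

/-- The label of a crossing in a Kauffman state. -/
inductive Marker
  | A
  | B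
  deriving DecidableEq

instance : Fintype Marker := ⟨{.A, .B}, fun x => by cases x <;> simp⟩

/-- `D.Joined s x y`: smoothing the crossings of `D` according to `s` joins an end of `x` to an end
of `y`. -/
inductive Joined (D : PD E n m) (s : Fin n → Marker) : E → E → Prop
  | A₁ (i : Fin n) (h : s i = .A) : Joined D s (D.crossing i 0) (D.crossing i 1)
  | A₂ (i : Fin n) (h : s i = .A) : Joined D s (D.crossing i 2) (D.crossing i 3)
  | B₁ (i : Fin n) (h : s i = .B) : Joined D s (D.crossing i 1) (D.crossing i 2)
  | B₂ (i : Fin n) (h : s i = .B) : Joined D s (D.crossing i 3) (D.crossing i 0)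
  | arc (j : Fin m) : Joined D s (D.arc j 0) (D.arc j 1)

/-- The circles of the smoothed diagram `sD`, as classes of edges. -/
def Circle (D : PD E n m) (s : Fin n → Marker) : Type := Quot (D.Joined s)

instance [Finite E] (D : PD E n m) (s : Fin n → Marker) : Finite (D.Circle s) :=
  inferInstanceAs (Finite (Quot _))

/-- An enhanced state: a Kauffman state with a sign for each of its circles, that is, a sign for
each edge which is constant along the circles. -/
@[ext]
structure EnhancedState (D : PD E n m) where
  marker : Fin n → Marker
  sign : E → ℤˣ
  sign_eq : ∀ x y, D.Joined marker x y → sign x = sign y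

instance [Finite E] (D : PD E n m) : Finite D.EnhancedState :=
  Finite.of_injective (fun s : D.EnhancedState => (s.marker, s.sign)) fun _ _ h =>
    EnhancedState.ext (congrArg Prod.fst h) (congrArg Prod.snd h)

noncomputable instance [Finite E] (D : PD E n m) : Fintype D.EnhancedState := Fintype.ofFinite _

namespace EnhancedState

variable {D : PD E n m}

/-- The circle through an edge. -/
def circle (s : D.EnhancedState) (x : E) : D.Circle s.marker := Quot.mk _ x

/-- The sign of a circle. -/
def circleSign (s : D.EnhancedState) : D.Circle s.marker → ℤˣ := Quot.lift s.sign s.sign_eq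

/-- The number of `A`-labels minus the number of `B`-labels. -/
def a (s : D.EnhancedState) : ℤ :=
  ((Finset.univ.filter fun i => s.marker i = .A).card : ℤ) -
    ((Finset.univ.filter fun i => s.marker i = .B).card : ℤ)

/-- The sum of the signs of the circles. -/
noncomputable def τ (s : D.EnhancedState) : ℤ := ∑ᶠ c : D.Circle s.marker, (s.circleSign c : ℤ)

noncomputable def b (s : D.EnhancedState) : ℤ := s.a + 2 * s.τ

/-- `s'` is adjacent to `s` with changed crossing `v`.  The circles common to `sD` and `s'D` are
those which do not run through `v`. -/
structure AdjacentAt (s s' : D.EnhancedState) (v : Fin n) : Prop where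
  a_eq : s'.a = s.a - 2
  b_eq : s'.b = s.b
  marker_left : s.marker v = .A
  marker_right : s'.marker = Function.update s.marker v .B
  sign_eq : ∀ x, (∀ k, s.circle x ≠ s.circle (D.crossing v k)) → s'.sign x = s.sign x

open Classical in
/-- The incidence number `(s : s')`: `0` if `s'` is not adjacent to `s`, and otherwise `(-1) ^ t`
with `t` the number of `B`-labelled crossings of `s` after the changed crossing. -/
noncomputable def incidence (s s' : D.EnhancedState) : ℤ :=
  ∑ v : Fin n, if s.AdjacentAt s' v then
    (-1) ^ (Finset.univ.filter fun w => v < w ∧ s.marker w = .B).card else 0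

end EnhancedState

/-! ### Khovanov homology -/

/-- The free abelian group on all the enhanced states. -/
abbrev Chain (D : PD E n m) : Type := D.EnhancedState →₀ ℤ

/-- The group `C_{a,b}(D)`, spanned by the enhanced states with the given `a` and `b`. -/
noncomputable def chains (D : PD E n m) (a b : ℤ) : Submodule ℤ D.Chain :=
  Finsupp.supported ℤ ℤ {s | s.a = a ∧ s.b = b}

/-- The differential; it maps `C_{a,b}(D)` to `C_{a-2,b}(D)`. -/
noncomputable def boundary [Finite E] (D : PD E n m) : D.Chain →ₗ[ℤ] D.Chain :=
  Finsupp.linearCombination ℤ fun s => ∑ s', s.incidence s' • Finsupp.single s' (1 : ℤ)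

/-- The kernel of the differential on `C_{a,b}(D)`. -/
noncomputable def cycles [Finite E] (D : PD E n m) (a b : ℤ) : Submodule ℤ D.Chain :=
  D.chains a b ⊓ LinearMap.ker D.boundary

/-- The image of the differential in `C_{a,b}(D)`. -/
noncomputable def boundaries [Finite E] (D : PD E n m) (a b : ℤ) : Submodule ℤ D.Chain :=
  (D.chains (a + 2) b).map D.boundary

/-- The framed Khovanov homology `H_{a,b}(D)`. -/
abbrev FramedKh [Finite E] (D : PD E n m) (a b : ℤ) : Type :=
  D.cycles a b ⧸ (D.boundaries a b).submoduleOf (D.cycles a b)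

/-- The homology class of a cycle. -/
noncomputable def homologyClass [Finite E] (D : PD E n m) {a b : ℤ} (z : D.Chain)
    (hz : z ∈ D.cycles a b) : D.FramedKh a b :=
  Submodule.Quotient.mk ⟨z, hz⟩

/-- The Khovanov homology `H^{i,j}` of the diagram `D` oriented by `o`. -/
abbrev Orientation.Kh [Finite E] {D : PD E n m} (o : D.Orientation) (i j : ℤ) : Type :=
  D.FramedKh (o.writhe - 2 * i) (3 * o.writhe - 2 * j)

/-! ### The maps of the long exact sequence of a crossing -/

theorem Joined.smoothA {D : PD E (n + 1) m} {v : Fin (n + 1)} {s : Fin (n + 1) → Marker}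
    (hs : s v = .A) {x y : E} (h : (D.smoothA v).Joined (v.removeNth s) x y) : D.Joined s x y := by
  cases h with
  | A₁ i h => exact Joined.A₁ (v.succAbove i) h
  | A₂ i h => exact Joined.A₂ (v.succAbove i) h
  | B₁ i h => exact Joined.B₁ (v.succAbove i) h
  | B₂ i h => exact Joined.B₂ (v.succAbove i) h
  | arc j =>
    refine Fin.cases ?_ (fun j => Fin.cases ?_ (fun j => ?_) j) j
    · exact Joined.A₁ v hs
    · exact Joined.A₂ v hs
    · exact Joined.arc j

theorem Joined.of_insertNth_B {D : PD E (n + 1) m} {v : Fin (n + 1)} {s : Fin n → Marker}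
    {x y : E} (h : D.Joined (v.insertNth Marker.B s : Fin (n + 1) → Marker) x y) :
    (D.smoothB v).Joined s x y := by
  have key : ∀ i : Fin (n + 1), i = v ∨ ∃ i', i = v.succAbove i' := fun i => by
    rcases Fin.eq_self_or_eq_succAbove v i with h | h
    · exact Or.inl h
    · exact Or.inr h
  cases h with
  | A₁ i h =>
    obtain rfl | ⟨i, rfl⟩ := key i
    · simp at h
    · exact Joined.A₁ (D := D.smoothB v) i (by simpa using h)
  | A₂ i h =>
    obtain rfl | ⟨i, rfl⟩ := key i
    · simp at h
    · exact Joined.A₂ (D := D.smoothB v) i (by simpa using h)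
  | B₁ i h =>
    obtain rfl | ⟨i, rfl⟩ := key i
    · exact Joined.arc (D := D.smoothB i) 0
    · exact Joined.B₁ (D := D.smoothB v) i (by simpa using h)
  | B₂ i h =>
    obtain rfl | ⟨i, rfl⟩ := key i
    · exact Joined.arc (D := D.smoothB i) 1
    · exact Joined.B₂ (D := D.smoothB v) i (by simpa using h)
  | arc j => exact Joined.arc (D := D.smoothB v) j.succ.succ

/-- The enhanced state of `D` with label `B` at `v` given by an enhanced state of `D_B`. -/
def EnhancedState.extendB {D : PD E (n + 1) m} {v : Fin (n + 1)}
    (s : (D.smoothB v).EnhancedState) : D.EnhancedState where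
  marker := v.insertNth Marker.B s.marker
  sign := s.sign
  sign_eq x y h := s.sign_eq x y h.of_insertNth_B

/-- The enhanced state of `D_A` given by an enhanced state of `D` with label `A` at `v`. -/
def EnhancedState.restrictA {D : PD E (n + 1) m} {v : Fin (n + 1)} (s : D.EnhancedState)
    (hs : s.marker v = .A) : (D.smoothA v).EnhancedState where
  marker := v.removeNth s.marker
  sign := s.sign
  sign_eq x y h := s.sign_eq x y (h.smoothA hs)

/-- The map `α : C(D_B) → C(D)`.  The sign, which is `1` if `v` is the first crossing, makes it
commute with the differentials for every position of `v` in the order of the crossings. -/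
noncomputable def alpha (D : PD E (n + 1) m) (v : Fin (n + 1)) :
    (D.smoothB v).Chain →ₗ[ℤ] D.Chain :=
  Finsupp.linearCombination ℤ fun s =>
    Finsupp.single s.extendB
      ((-1) ^ (Finset.univ.filter fun w => v.succAbove w < v ∧ s.marker w = .B).card)

/-- The map `β : C(D) → C(D_A)`. -/
noncomputable def beta (D : PD E (n + 1) m) (v : Fin (n + 1)) :
    D.Chain →ₗ[ℤ] (D.smoothA v).Chain :=
  Finsupp.linearCombination ℤ fun s =>
    if hs : s.marker v = .A then Finsupp.single (s.restrictA hs) 1 else 0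

/-- `F` is the map `[z] ↦ [f z]` induced by `f` on homology. -/
def IsInduced [Finite E] {D : PD E n m} {D' : PD E n' m'} {a b a' b' : ℤ}
    (f : D.Chain →ₗ[ℤ] D'.Chain) (F : D.FramedKh a b →ₗ[ℤ] D'.FramedKh a' b') : Prop :=
  ∀ (z : D.Chain) (hz : z ∈ D.cycles a b), ∃ hz' : f z ∈ D'.cycles a' b',
    F (D.homologyClass z hz) = D'.homologyClass (f z) hz'

/-- `γ` is the connecting map of `0 → C(D_B) → C(D) → C(D_A) → 0`: it maps `[β z]` to `[y]` if
`∂ z = α y`. -/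
def IsConnecting [Finite E] (D : PD E (n + 1) m) (v : Fin (n + 1)) {a b a' b' : ℤ}
    (γ : (D.smoothA v).FramedKh a b →ₗ[ℤ] (D.smoothB v).FramedKh a' b') : Prop :=
  ∀ z ∈ D.chains (a + 1) (b + 1), ∀ (hz : D.beta v z ∈ (D.smoothA v).cycles a b)
    (y : (D.smoothB v).Chain) (hy : y ∈ (D.smoothB v).cycles a' b'),
    D.boundary z = D.alpha v y →
      γ ((D.smoothA v).homologyClass _ hz) = (D.smoothB v).homologyClass y hy

end PD

/-! ### Sums of signs over the classes of an equivalence relation, and saddles -/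

/-! The enhanced states with label B at `v` span a subcomplex of C(D) which, up to signs, is C(D_B),
and the quotient is C(D_A). The theorem is the long exact homology sequence of this pair, evaluated
when D_B has the homology of the trivial knot. In the classical grading α_* runs from
H^{i-u,j-3u+1}(D_B) to H^{i,j}(D), β_* from H^{i,j}(D) to H^{i,j-1}(D_A), and γ_* from
H^{i,j-1}(D_A) to H^{i-u+1,j-3u+1}(D_B). As H(D_B) is ℤ in degrees (0,1) and (0,-1) and zero
elsewhere, α_* has a nonzero source only at (u,3u) and (u,3u-2), and γ_* has a nonzero target only
for i = u-1 and the same two values of j. Elsewhere β_* is an isomorphism, and in the exceptional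
degrees the two five-term sequences remain. For torsion the injectivity of β_* suffices: γ_* takes
values in a torsion-free group, so each torsion class of D_A lifts, and a lift along an injective
map is again torsion. The number u is an integer because crossing signs are odd and D has one
crossing more than D_B.

Two facts behind this need work: that the differential squares to zero, and that the homology of D_B
is that of the circle.

For the first, changing one marker must join two circles or split one, which fails for non-planar
codes. Planarity enters through the Euler characteristic: it forces the cellular complex mod 2 to be
exact at the edges. All valences are even, so the sum of all edges is a cycle, hence the boundary of
a set of faces; this is a checkerboard colouring (`exists_sourceSink`). It orients the edges
alternately in and out at every vertex, coherently for all smoothings, so that the circles of a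
state are the cycles of a permutation of the edges, and a change of marker multiplies this
permutation by a transposition (`dich_of_sourceSink`). The signs of circles now describe monomials
in variables with square zero, one variable for each circle: the sign + stands for the variable and
− for 1. Joining two circles identifies their variables (`push_merge`), and splitting multiplies by
the sum of the two new variables (`push_split`). These operations commute (`comp_comm`), and the
signs of the cube make the squares anticommute (`sum_incidence_mul`).

For the second, each Reidemeister move replaces a tangle glued into a fixed outside diagram
(`IsGlued`). From outside, a smoothing of the tangle is visible only through the connections of its
end points and a possible closed circle. A closed circle with sign − cancels against the smoothing
which absorbs it, and one with sign + against the smoothing from which it splits off; this is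
Gaussian elimination for complexes with a basis (`homology_equiv_of_matching`, `IsGlued.cancel`).
The second move leaves one smoothing. In the first move only one of the two signs cancels, and the
other survives with a shift of degree. The third move leaves five smoothings on each side, matched
by a finite table (`slide_valid`). Orientations are compared through their restriction to the
outside (`Shadow`); a shift of the writhe by c absorbs a shift of the framed degrees by (c, 3c).
Together these give `Isotopic.transport` and then `IsTrivialKnot.kh`. -/

namespace Saddle

variable {X Y : Type}

/-- The sum of the signs of the classes. -/
noncomputable def tau (r : Setoid X) (ε : X → ℤˣ) : ℤ := ∑ᶠ c : Quotient r, (ε c.out : ℤ)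

/-- `ε` is constant on the classes of `r`. -/
def Const (r : Setoid X) (ε : X → ℤˣ) : Prop := ∀ x y, r x y → ε x = ε y

/-- The signs `ε'` on the classes of `r'` occur in the image of the signs `ε` on the classes of `r`
under a saddle. -/
def Sad (r r' : Setoid X) (ε ε' : X → ℤˣ) : Prop :=
  tau r' ε' = tau r ε + 1 ∧ ∀ x, (∀ y, r x y ↔ r' x y) → ε' x = ε x

/-- `r'` is obtained from `r` by joining the different classes of `p` and `q`. -/
def Merge (r r' : Setoid X) (p q : X) : Prop :=
  ¬ r p q ∧ ∀ x y, r' x y ↔ r x y ∨ ((r x p ∨ r x q) ∧ (r y p ∨ r y q))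

theorem Const.out {r : Setoid X} {ε : X → ℤˣ} (h : Const r ε) (x : X) :
    ε (Quotient.mk r x).out = ε x :=
  h _ _ (Quotient.exact (Quotient.out_eq (Quotient.mk r x)))

theorem tau_neg (r : Setoid X) (ε : X → ℤˣ) : tau r (-ε) = - tau r ε := by
  simp [tau, finsum_neg_distrib]

/-- As `f` meets every class of `R`, it induces a bijection of classes which preserves signs. -/
theorem tau_comap [Finite Y] (R : Setoid Y) (f : X → Y) (hf : ∀ y, ∃ x, R y (f x)) {ε : Y → ℤˣ}
    (hε : Const R ε) : tau (R.comap f) (ε ∘ f) = tau R ε := by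
  refine finsum_eq_of_bijective (Quotient.map' (s₁ := R.comap f) (s₂ := R) f fun _ _ h => h) ⟨?_, ?_⟩ ?_
  · rintro ⟨a⟩ ⟨b⟩ h
    exact Quotient.sound (s := R.comap f) (Quotient.exact (s := R) h)
  · rintro ⟨y⟩
    obtain ⟨x, hx⟩ := hf y
    exact ⟨Quotient.mk _ x, Quotient.sound (s := R) (R.symm hx)⟩
  · rintro ⟨a⟩
    have h1 : Const (R.comap f) (ε ∘ f) := fun x y h => hε _ _ h
    have := h1.out a
    have h2 := hε.out (f a)
    simp only [Function.comp] at this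
    simp only [Function.comp]
    exact congrArg _ (this.trans h2.symm)

namespace Merge

variable {r r' : Setoid X} {p q : X}

theorem le (h : Merge r r' p q) {x y : X} (hxy : r x y) : r' x y := (h.2 x y).2 (Or.inl hxy)

theorem joined (h : Merge r r' p q) : r' p q :=
  (h.2 p q).2 (Or.inr ⟨Or.inl (r.refl p), Or.inr (r.refl q)⟩)

theorem rel_left (h : Merge r r' p q) {x : X} : r' x p ↔ r x p ∨ r x q := by
  rw [h.2]
  have : r p p := r.refl p
  tauto

theorem symm (h : Merge r r' p q) : Merge r r' q p :=
  ⟨fun e => h.1 (r.symm e), fun x y => by rw [h.2]; tauto⟩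

theorem congr (h : Merge r r' p q) {p' q' : X} (hp : r p p') (hq : r q q') : Merge r r' p' q' := by
  have e1 : ∀ x, r x p' ↔ r x p := fun x => ⟨fun e => r.trans e (r.symm hp), fun e => r.trans e hp⟩
  have e2 : ∀ x, r x q' ↔ r x q := fun x => ⟨fun e => r.trans e (r.symm hq), fun e => r.trans e hq⟩
  refine ⟨fun e => h.1 (r.trans hp ((e2 p').1 e)), fun x y => ?_⟩
  rw [h.2, e1, e1, e2, e2]

/-- Translates the clause about unchanged classes in `Sad` into a condition on `p` and `q` alone. -/
theorem unchanged_iff (h : Merge r r' p q) (x : X) :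
    (∀ y, r x y ↔ r' x y) ↔ ¬ r x p ∧ ¬ r x q := by
  constructor
  · intro hx
    constructor
    · intro hp
      exact h.1 (r.trans (r.symm hp) ((hx q).2 (r'.trans (h.le hp) h.joined)))
    · intro hq
      exact h.1 (r.symm (r.trans (r.symm hq) ((hx p).2 (r'.trans (h.le hq) (r'.symm h.joined)))))
  · rintro ⟨h1, h2⟩ y
    rw [h.2]
    tauto

/-- Away from `p` and `q` the classes of `r` and `r'` correspond with equal signs, so the sums agree
once the two old classes and the one new class are left out. -/
theorem tau_eq [Finite X] (h : Merge r r' p q) {ε ε' : X → ℤˣ} (hε : Const r ε) (hε' : Const r' ε')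
    (heq : ∀ x, ¬ r x p → ¬ r x q → ε' x = ε x) :
    tau r ε - ε p - ε q = tau r' ε' - ε' p := by
  classical
  have := Fintype.ofFinite (Quotient r)
  have := Fintype.ofFinite (Quotient r')
  have hne : (Quotient.mk r q) ≠ Quotient.mk r p := fun e => h.1 (r.symm (Quotient.exact e))
  rw [tau, tau, finsum_eq_sum_of_fintype, finsum_eq_sum_of_fintype,
    ← Finset.add_sum_erase Finset.univ _ (Finset.mem_univ (Quotient.mk r p)),
    ← Finset.add_sum_erase (Finset.univ.erase (Quotient.mk r p)) _
      (Finset.mem_erase.2 ⟨hne, Finset.mem_univ (Quotient.mk r q)⟩),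
    ← Finset.add_sum_erase Finset.univ _ (Finset.mem_univ (Quotient.mk r' p)),
    hε.out, hε.out, hε'.out]
  have key : ∑ x ∈ (Finset.univ.erase (Quotient.mk r p)).erase (Quotient.mk r q), (ε x.out : ℤ) =
      ∑ x ∈ Finset.univ.erase (Quotient.mk r' p), (ε' x.out : ℤ) := by
    have mem : ∀ x, Quotient.mk r x ∈ (Finset.univ.erase (Quotient.mk r p)).erase (Quotient.mk r q) ↔
        ¬ r x p ∧ ¬ r x q := fun x => by
      rw [Finset.mem_erase, Finset.mem_erase, Ne, Ne, Quotient.eq, Quotient.eq]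
      simp [and_comm]
    have mem' : ∀ x, Quotient.mk r' x ∈ Finset.univ.erase (Quotient.mk r' p) ↔
        ¬ r x p ∧ ¬ r x q := fun x => by
      rw [Finset.mem_erase, Ne, Quotient.eq, h.rel_left]
      simp
    refine Finset.sum_nbij (Quotient.map' (s₁ := r) (s₂ := r') id fun _ _ e => h.le e) ?_ ?_ ?_ ?_
    · intro c hx
      obtain ⟨x, rfl⟩ := Quotient.exists_rep c
      exact (mem' x).2 ((mem x).1 hx)
    · intro c hx c' hy e
      obtain ⟨x, rfl⟩ := Quotient.exists_rep c
      obtain ⟨y, rfl⟩ := Quotient.exists_rep c'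
      have hx := (mem x).1 hx
      refine Quotient.sound ?_
      rcases (h.2 x y).1 (Quotient.exact (s := r') e) with e | e
      · exact e
      · exact (e.1.elim hx.1 hx.2).elim
    · intro c hx
      obtain ⟨x, rfl⟩ := Quotient.exists_rep c
      exact ⟨Quotient.mk r x, (mem x).2 ((mem' x).1 hx), rfl⟩
    · intro c hx
      obtain ⟨x, rfl⟩ := Quotient.exists_rep c
      have hx := (mem x).1 hx
      exact congrArg _ ((hε.out x).trans ((heq x hx.1 hx.2).symm.trans (hε'.out x).symm))
  rw [key]
  ring

/-- This is the multiplication of ℤ[X]/(X²), with − for 1 and + for X: (−,−) gives −, (+,−) and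
(−,+) give +, and (+,+) gives nothing. -/
theorem sad_iff [Finite X] (h : Merge r r' p q) {ε ε' : X → ℤˣ} (hε : Const r ε)
    (hε' : Const r' ε') :
    Sad r r' ε ε' ↔
      (∀ x, ¬ r x p → ¬ r x q → ε' x = ε x) ∧ (ε' p : ℤ) = ε p + ε q + 1 := by
  have e : (∀ x, (∀ y, r x y ↔ r' x y) → ε' x = ε x) ↔
      ∀ x, ¬ r x p → ¬ r x q → ε' x = ε x :=
    forall_congr' fun x => by rw [h.unchanged_iff]; tauto
  rw [Sad, e]
  constructor
  · rintro ⟨h1, h2⟩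
    have := h.tau_eq hε hε' h2
    exact ⟨h2, by linarith⟩
  · rintro ⟨h2, h1⟩
    have := h.tau_eq hε hε' h2
    exact ⟨by linarith, h2⟩

/-- This is the comultiplication of the same algebra: − gives (+,−) and (−,+), while + gives (+,+).
-/
theorem sad_symm_iff [Finite X] (h : Merge r r' p q) {ε ε' : X → ℤˣ} (hε : Const r ε)
    (hε' : Const r' ε') :
    Sad r' r ε' ε ↔
      (∀ x, ¬ r x p → ¬ r x q → ε x = ε' x) ∧ (ε p + ε q : ℤ) = ε' p + 1 := by
  have e : (∀ x, (∀ y, r' x y ↔ r x y) → ε x = ε' x) ↔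
      ∀ x, ¬ r x p → ¬ r x q → ε x = ε' x :=
    forall_congr' fun x => by
      have : (∀ y, r' x y ↔ r x y) ↔ (∀ y, r x y ↔ r' x y) :=
        forall_congr' fun _ => Iff.comm
      rw [this, h.unchanged_iff]; tauto
  rw [Sad, e]
  constructor
  · rintro ⟨h1, h2⟩
    have := h.tau_eq hε hε' fun x a b => (h2 x a b).symm
    exact ⟨h2, by linarith⟩
  · rintro ⟨h2, h1⟩
    have := h.tau_eq hε hε' fun x a b => (h2 x a b).symm
    exact ⟨by linarith, h2⟩

/-- The number of classes drops by one. -/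
theorem tau_one [Finite X] (h : Merge r r' p q) : tau r 1 = tau r' 1 + 1 := by
  have := h.tau_eq (ε := 1) (ε' := 1) (fun _ _ _ => rfl) (fun _ _ _ => rfl) (fun _ _ _ => rfl)
  simp only [Pi.one_apply, Units.val_one] at this
  linarith

end Merge

end Saddle

/-! ### Circles of Kauffman states and the factorization of incidence numbers -/

namespace PD

open Saddle

variable {E : Type} {n m : ℕ}

/-- The equivalence relation on the edges whose classes are the circles. -/
def circles (D : PD E n m) (s : Fin n → Marker) : Setoid E := Relation.EqvGen.setoid (D.Joined s)

theorem circles_of_joined {D : PD E n m} {s : Fin n → Marker} {x y : E} (h : D.Joined s x y) :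
    D.circles s x y := Relation.EqvGen.rel _ _ h

theorem quot_mk_eq_iff {D : PD E n m} {s : Fin n → Marker} {x y : E} :
    (Quot.mk (D.Joined s) x = Quot.mk _ y) ↔ D.circles s x y :=
  ⟨fun h => Quot.eqvGen_exact h, fun h => Quot.eqvGen_sound h⟩

theorem circles_le {D : PD E n m} {s : Fin n → Marker} {r : Setoid E}
    (h : ∀ x y, D.Joined s x y → r x y) {x y : E} (hxy : D.circles s x y) : r x y := by
  have : D.circles s ≤ r := Setoid.eqvGen_le h
  exact this hxy

namespace EnhancedState

variable {D : PD E n m}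

theorem const (s : D.EnhancedState) : Const (D.circles s.marker) s.sign := by
  intro x y h
  exact circles_le (r := Setoid.ker s.sign) (fun x y h => s.sign_eq x y h) h

/-- The enhanced state with given signs, constant on the circles. -/
def ofConst (D : PD E n m) (t : Fin n → Marker) (ε : E → ℤˣ) (h : Const (D.circles t) ε) :
    D.EnhancedState := ⟨t, ε, fun x y e => h x y (circles_of_joined e)⟩

theorem tau_eq (s : D.EnhancedState) : s.τ = tau (D.circles s.marker) s.sign := by
  refine finsum_eq_of_bijective
    (Quot.map id fun x y h => circles_of_joined h :
      Quot (D.Joined s.marker) → Quot (D.circles s.marker)) ⟨?_, ?_⟩ ?_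
  · rintro ⟨a⟩ ⟨b⟩ h
    exact quot_mk_eq_iff.2 (Quotient.exact (s := D.circles s.marker) h)
  · rintro ⟨y⟩
    exact ⟨Quot.mk _ y, rfl⟩
  · rintro ⟨a⟩
    exact congrArg _ (s.const.out a).symm

end EnhancedState

/-- Changing the marker of one crossing joins two circles or splits a circle. -/
def Dich (D : PD E n m) : Prop := ∀ (s : Fin n → Marker) (v : Fin n), s v = .A →
  Merge (D.circles s) (D.circles (Function.update s v .B)) (D.crossing v 0) (D.crossing v 2) ∨
    Merge (D.circles (Function.update s v .B)) (D.circles s) (D.crossing v 0) (D.crossing v 2)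

/-- The difference between the numbers of `A`- and `B`-markers. -/
def markerSum (s : Fin n → Marker) : ℤ := ∑ i, if s i = .A then 1 else -1

theorem EnhancedState.a_eq {D : PD E n m} (s : D.EnhancedState) : s.a = markerSum s.marker := by
  have e : ∀ i, (if s.marker i = .A then (1 : ℤ) else -1) =
      (if s.marker i = .A then 1 else 0) - (if s.marker i = .B then 1 else 0) := by
    intro i
    cases s.marker i <;> simp
  simp only [EnhancedState.a, markerSum, e, Finset.sum_sub_distrib, Finset.sum_boole]

theorem markerSum_update (s : Fin n → Marker) (v : Fin n) (hv : s v = .A) :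
    markerSum (Function.update s v .B) = markerSum s - 2 := by
  rw [markerSum, markerSum, ← Finset.add_sum_erase _ _ (Finset.mem_univ v),
    ← Finset.add_sum_erase Finset.univ (fun i => if s i = .A then (1 : ℤ) else -1)
      (Finset.mem_univ v)]
  have : ∑ x ∈ Finset.univ.erase v, (if Function.update s v Marker.B x = .A then (1 : ℤ) else -1) =
      ∑ x ∈ Finset.univ.erase v, if s x = .A then (1 : ℤ) else -1 :=
    Finset.sum_congr rfl fun x hx => by rw [Function.update_of_ne (Finset.ne_of_mem_erase hx)]
  rw [this]
  simp [hv]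
  ring

/-- The sign of the change of the marker at `v`. -/
def edgeSign (s : Fin n → Marker) (v : Fin n) : ℤ :=
  (-1) ^ (Finset.univ.filter fun w => v < w ∧ s w = .B).card

/-- The incidence number of Kauffman states. -/
def ksgn (s s' : Fin n → Marker) : ℤ :=
  ∑ v : Fin n, if s v = .A ∧ s' = Function.update s v .B then edgeSign s v else 0

theorem update_B_injective {s : Fin n → Marker} {v w : Fin n} (hv : s v = .A)
    (h : Function.update s v .B = Function.update s w .B) : v = w := by
  by_contra hne
  have := congrFun h v
  rw [Function.update_self, Function.update_of_ne hne, hv] at this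
  cases this

theorem ksgn_update (s : Fin n → Marker) (v : Fin n) (hv : s v = .A) :
    ksgn s (Function.update s v .B) = edgeSign s v := by
  rw [ksgn, Finset.sum_eq_single v]
  · simp [hv]
  · intro w _ hw
    rw [if_neg]
    rintro ⟨h1, h2⟩
    exact hw (update_B_injective h1 h2.symm)
  · simp

theorem exists_of_ksgn_ne_zero {s s' : Fin n → Marker} (h : ksgn s s' ≠ 0) :
    ∃ v, s v = .A ∧ s' = Function.update s v .B := by
  by_contra! hc
  exact h (Finset.sum_eq_zero fun v _ => if_neg fun e => hc v e.1 e.2)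

-- The number `a` drops by 2 when a marker changes, so preservation of `b` means that τ rises by 1.
-- By the dichotomy the circles avoiding the crossing are the unchanged classes. The incidence
-- number thus separates into a sign depending on markers and a saddle condition depending only on
-- partitions of the edges.
open Classical in
theorem incidence_eq [Finite E] {D : PD E n m} (hD : D.Dich) (s s' : D.EnhancedState) :
    s.incidence s' = ksgn s.marker s'.marker *
      if Sad (D.circles s.marker) (D.circles s'.marker) s.sign s'.sign then 1 else 0 := by
  have key : ∀ v, s.AdjacentAt s' v ↔ (s.marker v = .A ∧
      s'.marker = Function.update s.marker v .B) ∧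
      Sad (D.circles s.marker) (D.circles s'.marker) s.sign s'.sign := by
    intro v
    -- The A-smoothing joins the ends 0, 1 and the ends 2, 3, so the ends 0 and 2 represent all
    -- circles through the crossing.
    have thr : ∀ x, s.marker v = .A → ((∀ k, s.circle x ≠ s.circle (D.crossing v k)) ↔
        ¬ D.circles s.marker x (D.crossing v 0) ∧ ¬ D.circles s.marker x (D.crossing v 2)) := by
      intro x hv
      have e : ∀ k, s.circle x ≠ s.circle (D.crossing v k) ↔
          ¬ D.circles s.marker x (D.crossing v k) := fun k => not_congr quot_mk_eq_iff
      simp only [e]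
      constructor
      · exact fun h => ⟨h 0, h 2⟩
      · rintro ⟨h0, h2⟩ k hk
        have h01 := circles_of_joined (Joined.A₁ (D := D) v hv)
        have h23 := circles_of_joined (Joined.A₂ (D := D) v hv)
        fin_cases k
        · exact h0 hk
        · exact h0 ((D.circles _).trans hk ((D.circles _).symm h01))
        · exact h2 hk
        · exact h2 ((D.circles _).trans hk ((D.circles _).symm h23))
    have sgn : s.marker v = .A → s'.marker = Function.update s.marker v .B →
        ((∀ x, (∀ k, s.circle x ≠ s.circle (D.crossing v k)) → s'.sign x = s.sign x) ↔
          ∀ x, (∀ y, D.circles s.marker x y ↔ D.circles s'.marker x y) →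
            s'.sign x = s.sign x) := by
      intro hv hs'
      refine forall_congr' fun x => ?_
      rw [thr x hv]
      rcases hD s.marker v hv with h | h
      · rw [hs', h.unchanged_iff]
      · have e1 : (∀ y, D.circles s.marker x y ↔ D.circles s'.marker x y) ↔
            ∀ y, D.circles s'.marker x y ↔ D.circles s.marker x y :=
          forall_congr' fun _ => Iff.comm
        rw [e1, hs', h.unchanged_iff, h.rel_left, h.symm.rel_left]
        tauto
    constructor
    · rintro ⟨h1, h2, h3, h4, h5⟩
      refine ⟨⟨h3, h4⟩, ?_, (sgn h3 h4).1 h5⟩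
      rw [EnhancedState.b, EnhancedState.b, EnhancedState.tau_eq, EnhancedState.tau_eq] at h2
      linarith
    · rintro ⟨⟨h3, h4⟩, h6, h5⟩
      have h1 : s'.a = s.a - 2 := by
        rw [EnhancedState.a_eq, EnhancedState.a_eq, h4, markerSum_update _ _ h3]
      refine ⟨h1, ?_, h3, h4, (sgn h3 h4).2 h5⟩
      rw [EnhancedState.b, EnhancedState.b, EnhancedState.tau_eq, EnhancedState.tau_eq]
      linarith
  rw [EnhancedState.incidence, ksgn, Finset.sum_mul]
  refine Finset.sum_congr rfl fun v _ => ?_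
  simp only [key, edgeSign]
  split_ifs with h1 h2 h3 h4 h5 <;> first | (exfalso; tauto) | simp

end PD

/-! ### Changing one smoothing of a planar diagram -/

namespace Equiv.Perm

variable {α : Type} {f : Perm α} {x y : α} [DecidableEq α]

/-- From `x` the new permutation follows the old cycle of `y`, which never meets `x`; when that
cycle closes up, it has reached `y`. -/
theorem sameCycle_mul_swap [Finite α] (h : ¬ f.SameCycle x y) : (f * swap x y).SameCycle x y := by
  classical
  have hex : ∃ k, 0 < k ∧ (f ^ k) y = y := by
    refine ⟨orderOf f, orderOf_pos f, ?_⟩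
    rw [pow_orderOf_eq_one]; rfl
  have key : ∀ j, j < Nat.find hex → ((f * swap x y) ^ (j + 1)) x = (f ^ (j + 1)) y := by
    intro j
    induction j with
    | zero => intro _; simp
    | succ j ih =>
      intro hj
      have h1 : (f ^ (j + 1)) y ≠ y := fun e => Nat.find_min hex hj ⟨Nat.succ_pos _, e⟩
      have h2 : (f ^ (j + 1)) y ≠ x := fun e => h (SameCycle.symm ⟨((j + 1 : ℕ) : ℤ), by rw [zpow_natCast]; exact e⟩)
      rw [pow_succ', mul_apply, ih (by omega), mul_apply, swap_apply_of_ne_of_ne h2 h1,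
        pow_succ' f (j + 1), mul_apply]
  obtain ⟨h1, h2⟩ := Nat.find_spec hex
  refine ⟨(Nat.find hex : ℕ), ?_⟩
  have := key (Nat.find hex - 1) (by omega)
  rw [Nat.sub_add_cancel h1, h2] at this
  simpa using this

/-- If `y` is first reached from `x` after k steps, the new orbit of `y` is the old segment from `f
x` to `y`, which closes up after k steps without meeting `x`. -/
theorem not_sameCycle_mul_swap [Finite α] (hxy : x ≠ y) (h : f.SameCycle x y) :
    ¬ (f * swap x y).SameCycle x y := by
  classical
  have hex : ∃ k : ℕ, (f ^ k) x = y := by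
    obtain ⟨k, _, hk⟩ := h.exists_pow_eq'
    exact ⟨k, hk⟩
  have hpos : 0 < Nat.find hex := by
    rcases Nat.eq_zero_or_pos (Nat.find hex) with e | e
    · have := Nat.find_spec hex
      rw [e] at this
      exact (hxy (by simpa using this)).elim
    · exact e
  have hx : ∀ j, 0 < j → j ≤ Nat.find hex → (f ^ j) x ≠ x := by
    intro j hj hjk e
    have hs := Nat.find_spec hex
    rw [← Nat.sub_add_cancel hjk, pow_add, mul_apply, e] at hs
    exact Nat.find_min hex (by omega : Nat.find hex - j < _) hs
  have key : ∀ j, j < Nat.find hex → ((f * swap x y) ^ (j + 1)) y = (f ^ (j + 1)) x := by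
    intro j
    induction j with
    | zero => intro _; simp
    | succ j ih =>
      intro hj
      have h1 : (f ^ (j + 1)) x ≠ y := Nat.find_min hex hj
      have h2 := hx (j + 1) (by omega) (by omega)
      rw [pow_succ', mul_apply, ih (by omega), mul_apply, swap_apply_of_ne_of_ne h2 h1,
        pow_succ' f (j + 1), mul_apply]
  have hy : ((f * swap x y) ^ Nat.find hex) y = y := by
    have := key (Nat.find hex - 1) (by omega)
    rwa [Nat.sub_add_cancel hpos, Nat.find_spec hex] at this
  intro hs
  obtain ⟨i, _, hi⟩ := hs.symm.exists_pow_eq'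
  have hfix : ∀ l, ((f * swap x y) ^ (Nat.find hex * l)) y = y := by
    intro l
    induction l with
    | zero => simp
    | succ l ih => rw [Nat.mul_succ, pow_add, mul_apply, hy, ih]
  rw [← Nat.mod_add_div i (Nat.find hex), pow_add, mul_apply, hfix] at hi
  have hlt := Nat.mod_lt i hpos
  rcases Nat.eq_zero_or_pos (i % Nat.find hex) with e | e
  · rw [e] at hi
    exact hxy (by simpa using hi.symm)
  · have := key (i % Nat.find hex - 1) (by omega)
    rw [Nat.sub_add_cancel e, hi] at this
    exact hx _ e hlt.le this.symm

end Equiv.Perm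

namespace Saddle

variable {X : Type}

/-- Joining the classes of `p` and `q`. -/
def join (r : Setoid X) (p q : X) : Setoid X where
  r x y := r x y ∨ ((r x p ∨ r x q) ∧ (r y p ∨ r y q))
  iseqv := by
    refine ⟨fun x => Or.inl (r.refl x), fun h => h.imp r.symm And.symm, fun {x y z} h1 h2 => ?_⟩
    rcases h1 with h1 | h1 <;> rcases h2 with h2 | h2
    · exact Or.inl (r.trans h1 h2)
    · exact Or.inr ⟨h2.1.imp (r.trans h1) (r.trans h1), h2.2⟩
    · exact Or.inr ⟨h1.1, h1.2.imp (r.trans (r.symm h2)) (r.trans (r.symm h2))⟩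
    · exact Or.inr ⟨h1.1, h2.2⟩

/-- The two relations share all generators except those at one crossing. Once `a` and `c` are
related, the special generators of either smoothing follow from those of the other. -/
theorem merge_of_generators {G G' : X → X → Prop} {a b c d : X}
    (hab : G a b) (hcd : G c d) (hbc : G' b c) (hda : G' d a)
    (hG : ∀ x y, G x y → G' x y ∨ (x = a ∧ y = b) ∨ (x = c ∧ y = d))
    (hG' : ∀ x y, G' x y → G x y ∨ (x = b ∧ y = c) ∨ (x = d ∧ y = a))
    (h : ¬ Relation.EqvGen.setoid G a c) (h' : Relation.EqvGen.setoid G' a c) :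
    Merge (Relation.EqvGen.setoid G) (Relation.EqvGen.setoid G') a c := by
  have le : Relation.EqvGen.setoid G ≤ Relation.EqvGen.setoid G' := by
    refine Setoid.eqvGen_le fun x y hxy => ?_
    have hbc : Relation.EqvGen.setoid G' b c := Relation.EqvGen.rel _ _ hbc
    have hda : Relation.EqvGen.setoid G' d a := Relation.EqvGen.rel _ _ hda
    rcases hG x y hxy with e | ⟨rfl, rfl⟩ | ⟨rfl, rfl⟩
    · exact Relation.EqvGen.rel _ _ e
    · exact Setoid.trans' _ h' (Setoid.symm' _ hbc)
    · exact Setoid.symm' _ (Setoid.trans' _ hda h')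
  have hab' : Relation.EqvGen.setoid G a b := Relation.EqvGen.rel _ _ hab
  have hcd' : Relation.EqvGen.setoid G c d := Relation.EqvGen.rel _ _ hcd
  have le' : Relation.EqvGen.setoid G' ≤ join (Relation.EqvGen.setoid G) a c := by
    refine Setoid.eqvGen_le fun x y hxy => ?_
    rcases hG' x y hxy with e | ⟨rfl, rfl⟩ | ⟨rfl, rfl⟩
    · exact Or.inl (Relation.EqvGen.rel _ _ e)
    · exact Or.inr ⟨Or.inl (Setoid.symm' _ hab'), Or.inr (Setoid.refl' _ _)⟩
    · exact Or.inr ⟨Or.inr (Setoid.symm' _ hcd'), Or.inl (Setoid.refl' _ _)⟩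
  refine ⟨h, fun x y => ⟨fun e => le' e, ?_⟩⟩
  rintro (e | ⟨e1 | e1, e2 | e2⟩)
  · exact le e
  · exact Setoid.trans' _ (le e1) (Setoid.symm' _ (le e2))
  · exact Setoid.trans' _ (le e1) (Setoid.trans' _ h' (Setoid.symm' _ (le e2)))
  · exact Setoid.trans' _ (le e1) (Setoid.trans' _ (Setoid.symm' _ h') (Setoid.symm' _ (le e2)))
  · exact Setoid.trans' _ (le e1) (Setoid.symm' _ (le e2))

end Saddle

namespace PD

open Saddle

variable {E : Type} {n m : ℕ}

/-- An alternating orientation: at each vertex, in-going and out-going ends alternate. -/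
def SourceSink (D : PD E n m) (ω : Slot n m → Bool) : Prop :=
  (∀ h h', h ≠ h' → D.label h = D.label h' → ω h ≠ ω h') ∧ ∀ h, ω (rot h) ≠ ω h

/-- The end to which an end is connected by the smoothing. -/
def turn (s : Fin n → Marker) : Slot n m → Slot n m
  | .inl (i, k) => .inl (i, if s i = .A then ![1, 0, 3, 2] k else ![3, 2, 1, 0] k)
  | .inr (j, k) => .inr (j, k + 1)

theorem turn_turn (s : Fin n → Marker) (h : Slot n m) : turn s (turn s h) = h := by
  rcases h with ⟨i, k⟩ | ⟨j, k⟩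
  · cases hs : s i <;> fin_cases k <;> simp [turn, hs]
  · fin_cases k <;> rfl

theorem joined_iff {D : PD E n m} {s : Fin n → Marker} {x y : E} :
    D.Joined s x y → ∃ h, D.label h = x ∧ D.label (turn s h) = y := by
  rintro (⟨i, hi⟩ | ⟨i, hi⟩ | ⟨i, hi⟩ | ⟨i, hi⟩ | ⟨j⟩)
  · exact ⟨.inl (i, 0), rfl, by simp [turn, hi, label]⟩
  · exact ⟨.inl (i, 2), rfl, by simp [turn, hi, label]⟩
  · exact ⟨.inl (i, 1), rfl, by simp [turn, hi, label]⟩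
  · exact ⟨.inl (i, 3), rfl, by simp [turn, hi, label]⟩
  · exact ⟨.inr (j, 0), rfl, rfl⟩

theorem circles_turn (D : PD E n m) (s : Fin n → Marker) (h : Slot n m) :
    D.circles s (D.label h) (D.label (turn s h)) := by
  have key : ∀ {x y}, D.Joined s x y → D.circles s x y ∧ D.circles s y x := fun e =>
    ⟨circles_of_joined e, (D.circles s).symm (circles_of_joined e)⟩
  rcases h with ⟨i, k⟩ | ⟨j, k⟩
  · cases hs : s i <;> fin_cases k <;> simp only [turn, label, hs]
    · exact (key (Joined.A₁ i hs)).1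
    · exact (key (Joined.A₁ i hs)).2
    · exact (key (Joined.A₂ i hs)).1
    · exact (key (Joined.A₂ i hs)).2
    · exact (key (Joined.B₂ i hs)).2
    · exact (key (Joined.B₁ i hs)).1
    · exact (key (Joined.B₁ i hs)).2
    · exact (key (Joined.B₂ i hs)).1
  · fin_cases k
    · exact (key (Joined.arc j)).1
    · exact (key (Joined.arc j)).2

/-- Both smoothings connect neighbouring ends, where an alternating orientation differs; hence it
orients the circles of every state. -/
theorem SourceSink.turn_ne {D : PD E n m} {ω : Slot n m → Bool} (hω : D.SourceSink ω)
    (s : Fin n → Marker) (h : Slot n m) : ω (turn s h) ≠ ω h := by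
  rcases h with ⟨i, k⟩ | ⟨j, k⟩
  · have h0 := hω.2 (.inl (i, 0))
    have h1 := hω.2 (.inl (i, 1))
    have h2 := hω.2 (.inl (i, 2))
    have h3 := hω.2 (.inl (i, 3))
    have e2 : (1 + 1 : Fin 4) = 2 := rfl
    have e3 : (2 + 1 : Fin 4) = 3 := rfl
    have e0 : (3 + 1 : Fin 4) = 0 := rfl
    simp only [rot, zero_add, e2, e3, e0] at h0 h1 h2 h3
    cases hs : s i <;> fin_cases k <;> simp only [turn, hs] <;>
      first | exact h0 | exact h1 | exact h2 | exact h3 | exact h0.symm | exact h1.symm |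
        exact h2.symm | exact h3.symm
  · exact hω.2 (.inr (j, k))

theorem exists_ends {D : PD E n m} (hD : ∀ x : E, Nat.card {h : Slot n m // D.label h = x} = 2)
    (x : E) : ∃ h h', h ≠ h' ∧ ∀ g, D.label g = x ↔ g = h ∨ g = h' := by
  obtain ⟨a, b, hab, hu⟩ := Nat.card_eq_two_iff.1 (hD x)
  refine ⟨a, b, fun e => hab (Subtype.ext e), fun g => ⟨fun hg => ?_, ?_⟩⟩
  · have : (⟨g, hg⟩ : {h : Slot n m // D.label h = x}) ∈ ({a, b} : Set _) := hu ▸ Set.mem_univ _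
    simpa [Subtype.ext_iff] using this
  · rintro (rfl | rfl)
    · exact a.2
    · exact b.2

/-- Running along each edge to its head and turning there permutes the edges, and its cycles are the
circles. The other smoothing at `v` composes this permutation with the transposition of the two
edges whose heads lie at `v`, which joins or splits cycles. -/
theorem dich_of_sourceSink [Finite E] {D : PD E n m}
    (hD : ∀ x : E, Nat.card {h : Slot n m // D.label h = x} = 2)
    {ω : Slot n m → Bool} (hω : D.SourceSink ω) : D.Dich := by
  classical
  have hhead : ∀ x, ∃ h, D.label h = x ∧ ω h = true := by
    intro x
    obtain ⟨h, h', hne, hx⟩ := exists_ends hD x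
    have e := hω.1 h h' hne (((hx h).2 (Or.inl rfl)).trans ((hx h').2 (Or.inr rfl)).symm)
    cases h1 : ω h
    · exact ⟨h', (hx h').2 (Or.inr rfl), by rw [h1] at e; simpa using e.symm⟩
    · exact ⟨h, (hx h).2 (Or.inl rfl), h1⟩
  choose head hl ht using hhead
  have uniq : ∀ h h', ω h = ω h' → D.label h = D.label h' → h = h' := fun h h' e1 e2 => by
    by_contra hne
    exact hω.1 h h' hne e2 e1
  have head_label : ∀ h, ω h = true → head (D.label h) = h := fun h e =>
    uniq _ _ (by rw [ht, e]) (hl _)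
  have inj : ∀ s, Function.Injective fun x => D.label (turn s (head x)) := by
    intro s x y e
    have e1 : turn s (head x) = turn s (head y) := by
      refine uniq _ _ ?_ e
      have h1 := hω.turn_ne s (head x)
      have h2 := hω.turn_ne s (head y)
      rw [ht] at h1 h2
      rw [Bool.eq_false_iff.2 h1, Bool.eq_false_iff.2 h2]
    have e2 := congrArg (turn s) e1
    rw [turn_turn, turn_turn] at e2
    rw [← hl x, ← hl y, e2]
  let next : (Fin n → Marker) → Equiv.Perm E := fun s =>
    Equiv.ofBijective _ (Finite.injective_iff_bijective.1 (inj s))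
  have next_label : ∀ s h, ω h = true → next s (D.label h) = D.label (turn s h) := by
    intro s h e
    change D.label (turn s (head (D.label h))) = _
    rw [head_label h e]
  have circ : ∀ s x y, D.circles s x y ↔ (next s).SameCycle x y := by
    intro s x y
    constructor
    · intro h
      refine circles_le (r := Equiv.Perm.SameCycle.setoid (next s)) ?_ h
      intro x y hxy
      obtain ⟨h, rfl, rfl⟩ := joined_iff hxy
      have e := hω.turn_ne s h
      change (next s).SameCycle _ _
      cases h1 : ω h
      · rw [h1] at e
        have := next_label s (turn s h) (by simpa using e)
        rw [turn_turn] at this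
        rw [← this]
        exact Equiv.Perm.SameCycle.symm ⟨1, by simp⟩
      · rw [← next_label s h h1]
        exact ⟨1, by simp⟩
    · intro h
      obtain ⟨k, -, rfl⟩ := h.exists_pow_eq'
      clear h
      induction k with
      | zero => exact (D.circles s).refl _
      | succ k ih =>
        rw [pow_succ', Equiv.Perm.mul_apply]
        refine (D.circles s).trans ih ?_
        have := D.circles_turn s (head (((next s) ^ k) x))
        rw [hl] at this
        exact this
  have main : ∀ s v, s v = .A → (D.circles (Function.update s v .B) (D.crossing v 0)
      (D.crossing v 2) ↔ ¬ D.circles s (D.crossing v 0) (D.crossing v 2)) := by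
    intro s v hv
    -- The heads at `v` are the opposite ends `k` and `k + 2`. The last two hypotheses say that the
    -- smoothings exchange the ends to which these heads are connected.
    have swp : ∀ k : Fin 4, ω (.inl (v, k)) = true → ω (.inl (v, k + 2)) = true →
        (turn s (.inl (v, k + 2)) : Slot n m) = turn (Function.update s v .B) (.inl (v, k)) →
        (turn s (.inl (v, k)) : Slot n m) = turn (Function.update s v .B) (.inl (v, k + 2)) →
        (D.circles (Function.update s v .B) (D.crossing v k) (D.crossing v (k + 2)) ↔
          ¬ D.circles s (D.crossing v k) (D.crossing v (k + 2))) := by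
      intro k h0 h2 t0 t2
      have hne : D.crossing v k ≠ D.crossing v (k + 2) := by
        intro e
        have := uniq (.inl (v, k)) (.inl (v, k + 2)) (by rw [h0, h2]) e
        simp at this
      have hnext : next (Function.update s v .B) =
          next s * Equiv.swap (D.crossing v k) (D.crossing v (k + 2)) := by
        ext x
        obtain ⟨h, rfl, hh⟩ : ∃ h, D.label h = x ∧ ω h = true := ⟨head x, hl x, ht x⟩
        rw [next_label _ _ hh, Equiv.Perm.mul_apply]
        by_cases e1 : h = .inl (v, k)
        · subst e1
          rw [← t0, ← next_label s _ h2]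
          congr 1
          exact (Equiv.swap_apply_left _ _).symm
        by_cases e2 : h = .inl (v, k + 2)
        · subst e2
          rw [← t2, ← next_label s _ h0]
          congr 1
          exact (Equiv.swap_apply_right _ _).symm
        rw [Equiv.swap_apply_of_ne_of_ne, next_label s _ hh]
        · rcases h with ⟨i, l⟩ | ⟨j, l⟩
          · have hi : i ≠ v := by
              rintro rfl
              have hk := hω.2 (.inl (i, k))
              have hk2 := hω.2 (.inl (i, k + 2))
              simp only [rot, h0, h2] at hk hk2
              have : l = k ∨ l = k + 1 ∨ l = k + 2 ∨ l = k + 2 + 1 := by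
                clear hk hk2 e1 e2 hh h0 h2 t0 t2 hne
                revert l k
                decide
              rcases this with rfl | rfl | rfl | rfl
              · exact e1 rfl
              · exact hk hh
              · exact e2 rfl
              · exact hk2 hh
            simp [turn, Function.update_of_ne hi]
          · rfl
        · intro e
          exact e1 (uniq h (.inl (v, k)) (by rw [hh, h0]) e)
        · intro e
          exact e2 (uniq h (.inl (v, k + 2)) (by rw [hh, h2]) e)
      rw [circ, circ, hnext]
      by_cases hc : (next s).SameCycle (D.crossing v k) (D.crossing v (k + 2))
      · simp [hc, Equiv.Perm.not_sameCycle_mul_swap hne hc]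
      · simp [hc, Equiv.Perm.sameCycle_mul_swap hc]
    have h0 := hω.2 (.inl (v, 0))
    have h1 := hω.2 (.inl (v, 1))
    have h2 := hω.2 (.inl (v, 2))
    have e1 : (0 + 1 : Fin 4) = 1 := rfl
    have e2 : (1 + 1 : Fin 4) = 2 := rfl
    have e3 : (2 + 1 : Fin 4) = 3 := rfl
    simp only [rot, e1, e2, e3] at h0 h1 h2
    have c01 := D.circles_turn s (.inl (v, 0))
    have c23 := D.circles_turn s (.inl (v, 2))
    have c12 := D.circles_turn (Function.update s v .B) (.inl (v, 1))
    have c30 := D.circles_turn (Function.update s v .B) (.inl (v, 3))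
    simp [turn, hv, label] at c01 c23 c12 c30
    -- The heads at `v` are the ends 1, 3 in the first case and 0, 2 in the second. In the first
    -- case the result is carried to the ends 0, 2 along the smoothed arcs.
    cases h00 : ω (.inl (v, 0))
    · have h10 : ω (.inl (v, 1)) = true := by rw [h00] at h0; simpa using h0
      have h20 : ω (.inl (v, 2)) = false := by rw [h10] at h1; simpa using h1
      have h30 : ω (.inl (v, 3)) = true := by rw [h20] at h2; simpa using h2
      have key := swp 1 h10 h30 (by simp [turn, hv]) (by simp [turn, hv])
      have e3' : (1 + 2 : Fin 4) = 3 := rfl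
      rw [e3'] at key
      constructor
      · intro h hc
        refine key.1 ?_ ?_
        · exact Setoid.trans' _ c12 (Setoid.trans' _ (Setoid.symm' _ h) (Setoid.symm' _ c30))
        · exact Setoid.trans' _ (Setoid.symm' _ c01) (Setoid.trans' _ hc c23)
      · intro h
        have := key.2 fun hc => h (Setoid.trans' _ c01 (Setoid.trans' _ hc (Setoid.symm' _ c23)))
        exact Setoid.trans' _ (Setoid.symm' _ c30) (Setoid.trans' _ (Setoid.symm' _ this) c12)
    · have h10 : ω (.inl (v, 1)) = false := by rw [h00] at h0; simpa using h0
      have h20 : ω (.inl (v, 2)) = true := by rw [h10] at h1; simpa using h1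
      exact swp 0 h00 h20 (by simp [turn, hv]) (by simp [turn, hv])
  intro s v hv
  have hs' : Function.update s v Marker.B v = .B := Function.update_self _ _ _
  have other : ∀ i, i ≠ v → Function.update s v Marker.B i = s i := fun i hi =>
    Function.update_of_ne hi _ _
  have G1 : ∀ x y, D.Joined s x y → D.Joined (Function.update s v .B) x y ∨
      (x = D.crossing v 0 ∧ y = D.crossing v 1) ∨ (x = D.crossing v 2 ∧ y = D.crossing v 3) := by
    rintro x y (⟨i, hi⟩ | ⟨i, hi⟩ | ⟨i, hi⟩ | ⟨i, hi⟩ | ⟨j⟩)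
    · by_cases e : i = v
      · subst e; tauto
      · exact Or.inl (Joined.A₁ i (by rw [other i e, hi]))
    · by_cases e : i = v
      · subst e; tauto
      · exact Or.inl (Joined.A₂ i (by rw [other i e, hi]))
    · by_cases e : i = v
      · subst e; rw [hv] at hi; cases hi
      · exact Or.inl (Joined.B₁ i (by rw [other i e, hi]))
    · by_cases e : i = v
      · subst e; rw [hv] at hi; cases hi
      · exact Or.inl (Joined.B₂ i (by rw [other i e, hi]))
    · exact Or.inl (Joined.arc j)
  have G2 : ∀ x y, D.Joined (Function.update s v .B) x y → D.Joined s x y ∨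
      (x = D.crossing v 1 ∧ y = D.crossing v 2) ∨ (x = D.crossing v 3 ∧ y = D.crossing v 0) := by
    rintro x y (⟨i, hi⟩ | ⟨i, hi⟩ | ⟨i, hi⟩ | ⟨i, hi⟩ | ⟨j⟩)
    · by_cases e : i = v
      · subst e; rw [hs'] at hi; cases hi
      · exact Or.inl (Joined.A₁ i (by rw [← other i e, hi]))
    · by_cases e : i = v
      · subst e; rw [hs'] at hi; cases hi
      · exact Or.inl (Joined.A₂ i (by rw [← other i e, hi]))
    · by_cases e : i = v
      · subst e; tauto
      · exact Or.inl (Joined.B₁ i (by rw [← other i e, hi]))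
    · by_cases e : i = v
      · subst e; tauto
      · exact Or.inl (Joined.B₂ i (by rw [← other i e, hi]))
    · exact Or.inl (Joined.arc j)
  by_cases hc : D.circles s (D.crossing v 0) (D.crossing v 2)
  · right
    have hn : ¬ D.circles (Function.update s v .B) (D.crossing v 0) (D.crossing v 2) := fun e =>
      (main s v hv).1 e hc
    have b1 := circles_of_joined (Joined.B₁ (D := D) v hs')
    have b2 := circles_of_joined (Joined.B₂ (D := D) v hs')
    have a1 := circles_of_joined (Joined.A₁ (D := D) v hv)
    have a2 := circles_of_joined (Joined.A₂ (D := D) v hv)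
    -- Shifting the ends by one exchanges the two smoothings, so the generators give a joining of
    -- the ends 1 and 3, which are then moved along the B-arcs to 2 and 0.
    have key : Merge (D.circles (Function.update s v .B)) (D.circles s)
        (D.crossing v 1) (D.crossing v 3) := by
      refine merge_of_generators (Joined.B₁ v hs') (Joined.B₂ v hs') (Joined.A₂ v hv)
        (Joined.A₁ v hv) G2 (fun x y h => ?_) ?_ ?_
      · have := G1 x y h; tauto
      · intro e
        exact hn (Setoid.trans' _ (Setoid.symm' _ b2) (Setoid.trans' _ (Setoid.symm' _ e) b1))
      · exact Setoid.trans' _ (Setoid.symm' _ a1) (Setoid.trans' _ hc a2)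
    exact (key.congr b1 b2).symm
  · left
    exact merge_of_generators (Joined.A₁ v hv) (Joined.A₂ v hv) (Joined.B₁ v hs')
      (Joined.B₂ v hs') G1 G2 hc ((main s v hv).2 hc)

end PD

/-! ### Checkerboard colourings of planar diagrams -/

namespace PD

open Saddle

variable {E : Type} {n m : ℕ}

/-- The vertex of an end. -/
def vert : Slot n m → Fin n ⊕ Fin m
  | .inl (i, _) => .inl i
  | .inr (j, _) => .inr j

theorem rot_bijective : Function.Bijective (rot : Slot n m → Slot n m) := by
  refine Finite.injective_iff_bijective.1 ?_
  rintro (⟨i, k⟩ | ⟨j, k⟩) (⟨i', k'⟩ | ⟨j', k'⟩) h <;> simp_all [rot]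

theorem vert_rot (h : Slot n m) : vert (rot h) = vert h := by
  rcases h with ⟨i, k⟩ | ⟨j, k⟩ <;> rfl

theorem eq_of_vert_eq {α : Type} {ψ : Slot n m → α} (hrot : ∀ h, ψ (rot h) = ψ h)
    {h h' : Slot n m} (e : vert h = vert h') : ψ h = ψ h' := by
  rcases h with ⟨i, k⟩ | ⟨j, k⟩ <;> rcases h' with ⟨i', k'⟩ | ⟨j', k'⟩
  · obtain rfl : i = i' := by simpa [vert] using e
    have h0 := hrot (.inl (i, 0))
    have h1 := hrot (.inl (i, 1))
    have h2 := hrot (.inl (i, 2))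
    have key : ∀ k, ψ (.inl (i, k)) = ψ (.inl (i, 0)) := by
      intro k
      fin_cases k
      · rfl
      · exact h0
      · exact h1.trans h0
      · exact h2.trans (h1.trans h0)
    rw [key k, key k']
  · simp [vert] at e
  · simp [vert] at e
  · obtain rfl : j = j' := by simpa [vert] using e
    have h0 := hrot (.inr (j, 0))
    have key : ∀ k, ψ (.inr (j, k)) = ψ (.inr (j, 0)) := by
      intro k
      fin_cases k
      · rfl
      · exact h0
    rw [key k, key k']

/-- A function of the ends which is constant at vertices and along edges comes from the connected
components. -/
theorem exists_piece {α : Type} {D : PD E n m} (hs : Function.Surjective D.label)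
    {ψ : Slot n m → α} (hrot : ∀ h, ψ (rot h) = ψ h)
    (hl : ∀ h h', D.label h = D.label h' → ψ h = ψ h') :
    ∃ φ : D.Piece → α, ∀ h, ψ h = φ (Quot.mk _ (D.label h)) := by
  choose pick hend using hs
  refine ⟨Quot.lift (fun x => ψ (pick x)) ?_, fun h => hl _ _ (hend _).symm⟩
  rintro x y (⟨i, k, l, rfl, rfl⟩ | ⟨j, k, l, rfl, rfl⟩)
  · have e1 : ψ (pick (D.crossing i k)) = ψ (.inl (i, k)) := hl _ _ (hend _)
    have e2 : ψ (pick (D.crossing i l)) = ψ (.inl (i, l)) := hl _ _ (hend _)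
    rw [e1, e2]
    exact eq_of_vert_eq hrot rfl
  · have e1 : ψ (pick (D.arc j k)) = ψ (.inr (j, k)) := hl _ _ (hend _)
    have e2 : ψ (pick (D.arc j l)) = ψ (.inr (j, l)) := hl _ _ (hend _)
    rw [e1, e2]
    exact eq_of_vert_eq hrot rfl

/-- Functions which factor through the pieces have dimension at most the number of pieces. This
bounds both the 2-cycles and the 0-cocycles of the surface mod 2. -/
theorem finrank_ker_le {D : PD E n m} [Finite D.Piece] {V W : Type} [AddCommGroup V]
    [Module (ZMod 2) V] [Module.Finite (ZMod 2) V] [AddCommGroup W] [Module (ZMod 2) W]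
    (f : V →ₗ[ZMod 2] W)
    (ev : V →ₗ[ZMod 2] (Slot n m → ZMod 2)) (hev : Function.Injective ev)
    (h : ∀ c, f c = 0 → ∃ φ : D.Piece → ZMod 2, ∀ h, ev c h = φ (Quot.mk _ (D.label h))) :
    Module.finrank (ZMod 2) (LinearMap.ker f) ≤ Nat.card D.Piece := by
  have := Fintype.ofFinite D.Piece
  let L : (D.Piece → ZMod 2) →ₗ[ZMod 2] (Slot n m → ZMod 2) :=
    LinearMap.funLeft _ _ fun h => Quot.mk _ (D.label h)
  calc Module.finrank (ZMod 2) (LinearMap.ker f)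
      = Module.finrank (ZMod 2) ((LinearMap.ker f).map ev) :=
        (LinearEquiv.finrank_eq (Submodule.equivMapOfInjective ev hev _))
    _ ≤ Module.finrank (ZMod 2) (LinearMap.range L) := by
        refine Submodule.finrank_mono ?_
        rintro _ ⟨c, hc, rfl⟩
        obtain ⟨φ, hφ⟩ := h c hc
        exact ⟨φ, funext fun h => (hφ h).symm⟩
    _ ≤ Module.finrank (ZMod 2) (D.Piece → ZMod 2) := LinearMap.finrank_range_le L
    _ = Nat.card D.Piece := by rw [Module.finrank_fintype_fun_eq_card, Nat.card_eq_fintype_card]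

/-- On a planar diagram, the faces can be coloured like a checkerboard. -/
theorem IsLinkDiagram.exists_sourceSink {D : PD E n m} (hD : D.IsLinkDiagram) :
    ∃ ω, D.SourceSink ω := by
  classical
  have hsurj : Function.Surjective D.label := fun x => by
    obtain ⟨h, h', -, hx⟩ := exists_ends hD.two_ends x
    exact ⟨h, (hx h).2 (Or.inl rfl)⟩
  have : Finite E := Finite.of_surjective _ hsurj
  have : Finite D.Face := inferInstanceAs (Finite (Quot _))
  have : Finite D.Piece := inferInstanceAs (Finite (Quot _))
  have := Fintype.ofFinite E
  have := Fintype.ofFinite D.Face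
  have hopp : ∀ h, ∃ h', h' ≠ h ∧ ∀ g, D.label g = D.label h ↔ g = h ∨ g = h' := by
    intro h
    obtain ⟨a, b, hab, hx⟩ := exists_ends hD.two_ends (D.label h)
    rcases (hx h).1 rfl with rfl | rfl
    · exact ⟨b, hab.symm, hx⟩
    · exact ⟨a, hab, fun g => by rw [hx, or_comm]⟩
  choose opp hopp_ne hopp_iff using hopp
  have label_opp : ∀ h, D.label (opp h) = D.label h := fun h => (hopp_iff h _).2 (Or.inr rfl)
  have sum_label : ∀ (F : Slot n m → ZMod 2) h,
      (∑ g, if D.label g = D.label h then F g else 0) = F h + F (opp h) := by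
    intro F h
    rw [← Finset.sum_filter, ← Finset.sum_pair (hopp_ne h).symm]
    refine Finset.sum_congr ?_ fun _ _ => rfl
    ext g
    simp [hopp_iff]
  let face : Slot n m → D.Face := fun h => Quot.mk _ h
  have face_opp : ∀ h, face (opp (rot h)) = face h := fun h =>
    (Quot.sound ⟨(hopp_ne _).symm, (label_opp _).symm⟩ : face h = face (opp (rot h))).symm
  -- The cellular chain complex mod 2: `bd₂` maps faces to edges, and the incidence matrix `M` below
  -- maps edges to vertices.
  let bd₂ : (D.Face → ZMod 2) →ₗ[ZMod 2] (E → ZMod 2) :=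
    { toFun := fun c x => ∑ h, if D.label h = x then c (face h) else 0
      map_add' := fun c c' => funext fun x => by
        simp only [Pi.add_apply, ← Finset.sum_add_distrib]
        exact Finset.sum_congr rfl fun h _ => by split_ifs <;> simp
      map_smul' := fun a c => funext fun x => by
        simp only [Pi.smul_apply, smul_eq_mul, RingHom.id_apply, Finset.mul_sum, mul_ite, mul_zero] }
  let M : Matrix (Fin n ⊕ Fin m) E (ZMod 2) :=
    Matrix.of fun v x => ∑ h : Slot n m, if vert h = v ∧ D.label h = x then 1 else 0
  have hM : ∀ f v, M.mulVecLin f v = ∑ h : Slot n m, if vert h = v then f (D.label h) else 0 := by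
    intro f v
    simp only [M, Matrix.mulVecLin_apply, Matrix.mulVec, dotProduct, Matrix.of_apply,
      Finset.sum_mul]
    rw [Finset.sum_comm]
    refine Finset.sum_congr rfl fun h _ => ?_
    by_cases hv : vert h = v <;> simp [hv]
  have hMt : ∀ g x, M.transpose.mulVecLin g x =
      ∑ h : Slot n m, if D.label h = x then g (vert h) else 0 := by
    intro g x
    simp only [M, Matrix.mulVecLin_apply, Matrix.mulVec, dotProduct, Matrix.of_apply,
      Matrix.transpose_apply, Finset.sum_mul]
    rw [Finset.sum_comm]
    refine Finset.sum_congr rfl fun h _ => ?_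
    by_cases hv : D.label h = x <;> simp [hv]
  have h2 : ∀ c h, bd₂ c (D.label h) = c (face h) + c (face (opp h)) := fun c h =>
    sum_label (fun g => c (face g)) h
  -- A 2-cycle takes equal values on the two sides of each edge, and going around a vertex crosses
  -- edges; so it is constant on each piece.
  have dim2 : Module.finrank (ZMod 2) (LinearMap.ker bd₂) ≤ Nat.card D.Piece := by
    refine finrank_ker_le bd₂ (LinearMap.funLeft _ _ face)
      (LinearMap.funLeft_injective_of_surjective _ _ _ Quot.mk_surjective) ?_
    intro c hc
    have key : ∀ h, c (face (opp h)) = c (face h) := fun h => by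
      have := h2 c h
      rw [hc, Pi.zero_apply] at this
      exact (CharTwo.add_eq_zero.1 this.symm).symm
    refine exists_piece (ψ := fun h => c (face h)) hsurj (fun h => ?_) fun h h' e => ?_
    · rw [← key (rot h), face_opp]
    · rcases (hopp_iff h' h).1 e with rfl | rfl
      · rfl
      · exact key h'
  have dim1 : Module.finrank (ZMod 2) (LinearMap.ker M.transpose.mulVecLin) ≤
      Nat.card D.Piece := by
    refine finrank_ker_le M.transpose.mulVecLin (LinearMap.funLeft _ _ vert)
      (LinearMap.funLeft_injective_of_surjective _ _ _ ?_) ?_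
    · rintro (i | j)
      · exact ⟨.inl (i, 0), rfl⟩
      · exact ⟨.inr (j, 0), rfl⟩
    · intro g hg
      refine exists_piece (ψ := fun h => g (vert h)) hsurj (fun h => by rw [vert_rot])
        fun h h' e => ?_
      have h3 := hMt g (D.label h')
      rw [hg, Pi.zero_apply, sum_label (fun h => g (vert h))] at h3
      rcases (hopp_iff h' h).1 e with rfl | rfl
      · rfl
      · exact (CharTwo.add_eq_zero.1 h3.symm).symm
  have le : LinearMap.range bd₂ ≤ LinearMap.ker M.mulVecLin := by
    rintro _ ⟨c, rfl⟩
    refine LinearMap.mem_ker.2 (funext fun v => ?_)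
    rw [hM]
    simp only [h2, Pi.zero_apply]
    have e : ∑ h : Slot n m, (if vert h = v then c (face (opp h)) else 0) =
        ∑ h : Slot n m, if vert h = v then c (face h) else 0 := by
      rw [← Function.Bijective.sum_comp rot_bijective]
      exact Finset.sum_congr rfl fun h _ => by rw [vert_rot, face_opp]
    have e2 : ∀ h : Slot n m, (if vert h = v then c (face h) + c (face (opp h)) else 0) =
        (if vert h = v then c (face h) else 0) + if vert h = v then c (face (opp h)) else 0 :=
      fun h => by split_ifs <;> simp
    simp only [e2, Finset.sum_add_distrib, e]
    exact CharTwo.add_self_eq_zero _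
  -- With c pieces, `bd₂` has rank at least F − c and, by way of its transpose, `M` has rank at
  -- least V − c. The Euler characteristic 2c then makes the kernel of `M` no larger than the image
  -- of `bd₂`.
  have eq : LinearMap.range bd₂ = LinearMap.ker M.mulVecLin := by
    refine Submodule.eq_of_le_of_finrank_le le ?_
    have r1 := LinearMap.finrank_range_add_finrank_ker bd₂
    have r2 := LinearMap.finrank_range_add_finrank_ker M.mulVecLin
    have r3 := LinearMap.finrank_range_add_finrank_ker M.transpose.mulVecLin
    have r4 : Module.finrank (ZMod 2) (LinearMap.range M.transpose.mulVecLin) =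
        Module.finrank (ZMod 2) (LinearMap.range M.mulVecLin) := Matrix.rank_transpose M
    have pl := hD.planar
    have cv : Nat.card (Fin n ⊕ Fin m) = n + m := by simp
    simp only [Module.finrank_fintype_fun_eq_card, ← Nat.card_eq_fintype_card, cv] at r1 r2 r3
    omega
  -- Vertices have 4 or 2 ends, so the sum of all edges is a cycle.
  have one : (fun _ => 1 : E → ZMod 2) ∈ LinearMap.ker M.mulVecLin := by
    refine LinearMap.mem_ker.2 (funext fun v => ?_)
    rw [hM, Fintype.sum_sum_type, Fintype.sum_prod_type, Fintype.sum_prod_type]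
    rcases v with i | j
    · simp [vert]
      rfl
    · simp [vert]
      rfl
  rw [← eq] at one
  obtain ⟨c, hc⟩ := one
  have sum1 : ∀ h, c (face h) + c (face (opp h)) = 1 := fun h => by rw [← h2, hc]
  have neq : ∀ a b : ZMod 2, a + b = 1 → decide (a = 1) ≠ decide (b = 1) := by decide
  -- An end is oriented by the colour of the corner which it stands for. Edges separate colours, so
  -- the value changes both along an edge and around a vertex.
  refine ⟨fun h => decide (c (face h) = 1), fun h h' hne e => ?_, fun h => ?_⟩
  · rcases (hopp_iff h' h).1 e with rfl | rfl
    · exact (hne rfl).elim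
    · exact (neq _ _ (sum1 h')).symm
  · have := neq _ _ (sum1 (rot h))
    rwa [face_opp] at this

theorem IsLinkDiagram.finite {D : PD E n m} (hD : D.IsLinkDiagram) : Finite E :=
  Finite.of_surjective D.label fun x => by
    obtain ⟨h, h', -, hx⟩ := exists_ends hD.two_ends x
    exact ⟨h, (hx h).2 (Or.inl rfl)⟩

theorem IsLinkDiagram.dich [Finite E] {D : PD E n m} (hD : D.IsLinkDiagram) : D.Dich := by
  obtain ⟨ω, hω⟩ := hD.exists_sourceSink
  exact dich_of_sourceSink hD.two_ends hω

end PD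

/-! ### The composition of two saddles -/

namespace Saddle

variable {X : Type}

/-- The elements of the list lie in different classes. -/
def Transversal (r : Setoid X) (T : List X) : Prop := T.Pairwise fun x y => ¬ r x y

open Classical in
/-- The signs which are positive on the classes of the elements of the list. -/
noncomputable def plus (r : Setoid X) (T : List X) (x : X) : ℤˣ := if ∃ t ∈ T, r t x then 1 else -1

open Classical in
/-- The coefficients of the monomial given by a list. -/
noncomputable def mono (r : Setoid X) (T : List X) (ε : X → ℤˣ) : ℤ :=
  if Transversal r T ∧ ε = plus r T then 1 else 0

open Classical in
/-- The coefficients of the image of a monomial under a saddle. -/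
noncomputable def push (r r' : Setoid X) (T : List X) (ε' : X → ℤˣ) : ℤ :=
  if Transversal r T ∧ Sad r r' (plus r T) ε' then 1 else 0

noncomputable instance [Finite X] (r : Setoid X) : Fintype {ε : X → ℤˣ // Const r ε} :=
  Fintype.ofFinite _

theorem plus_congr {r r' : Setoid X} {T T' : List X} {x x' : X}
    (h : (∃ t ∈ T, r t x) ↔ ∃ t ∈ T', r' t x') : plus r T x = plus r' T' x' := by
  rw [plus, plus]
  by_cases hx : ∃ t ∈ T, r t x
  · rw [if_pos hx, if_pos (h.1 hx)]
  · rw [if_neg hx, if_neg fun e => hx (h.2 e)]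

theorem plus_const (r : Setoid X) (T : List X) : Const r (plus r T) := by
  intro x y h
  have : (∃ t ∈ T, r t x) ↔ ∃ t ∈ T, r t y :=
    ⟨fun ⟨t, ht, e⟩ => ⟨t, ht, r.trans e h⟩, fun ⟨t, ht, e⟩ => ⟨t, ht, r.trans e (r.symm h)⟩⟩
  exact plus_congr this

theorem exists_plus [Finite X] {r : Setoid X} {ε : X → ℤˣ} (h : Const r ε) :
    ∃ T, Transversal r T ∧ ε = plus r T := by
  classical
  have := Fintype.ofFinite (Quotient r)
  refine ⟨(Finset.univ.filter fun c : Quotient r => ε c.out = 1).toList.map Quotient.out, ?_, ?_⟩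
  · rw [Transversal, List.pairwise_map]
    refine (Finset.nodup_toList _).imp fun {a b} hab e => hab ?_
    rw [← Quotient.out_eq a, ← Quotient.out_eq b]
    exact Quotient.sound e
  · funext x
    rw [plus]
    split_ifs with hx
    · obtain ⟨t, ht, e⟩ := hx
      simp only [List.mem_map, Finset.mem_toList, Finset.mem_filter, Finset.mem_univ,
        true_and] at ht
      obtain ⟨c, hc, rfl⟩ := ht
      rw [← h _ _ e, hc]
    · refine (Int.units_eq_one_or (ε x)).resolve_left fun e => hx ⟨(Quotient.mk r x).out, ?_, ?_⟩
      · simp only [List.mem_map, Finset.mem_toList, Finset.mem_filter, Finset.mem_univ, true_and]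
        exact ⟨_, by rw [h.out, e], rfl⟩
      · exact Quotient.exact (Quotient.out_eq (Quotient.mk r x))

theorem mono_congr {r : Setoid X} {T T' : List X} (h : Transversal r T ↔ Transversal r T')
    (h' : ∀ x, (∃ t ∈ T, r t x) ↔ ∃ t ∈ T', r t x) : mono r T = mono r T' := by
  have : plus r T = plus r T' := funext fun x => plus_congr (h' x)
  funext ε
  rw [mono, mono, this]
  split_ifs <;> first | rfl | (exfalso; tauto)

theorem mono_cons_congr {r : Setoid X} {x y : X} (T : List X) (h : r x y) :
    mono r (x :: T) = mono r (y :: T) := by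
  have e : ∀ z, r x z ↔ r y z := fun z => ⟨r.trans (r.symm h), r.trans h⟩
  refine mono_congr ?_ fun z => ?_
  · simp only [Transversal, List.pairwise_cons, e]
  · simp only [List.exists_mem_cons_iff, e]

theorem mono_swap {r : Setoid X} (x y : X) (T : List X) :
    mono r (x :: y :: T) = mono r (y :: x :: T) := by
  have e : r x y ↔ r y x := ⟨r.symm, r.symm⟩
  refine mono_congr ?_ fun z => ?_
  · simp only [Transversal, List.pairwise_cons, List.forall_mem_cons, e]
    tauto
  · simp only [List.exists_mem_cons_iff]
    tauto

theorem sum_mono [Finite X] (r : Setoid X) (T : List X)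
    (G : (X → ℤˣ) → ℤ) [Decidable (Transversal r T)] :
    ∑ ε : {ε : X → ℤˣ // Const r ε}, mono r T ε.1 * G ε.1 =
      if Transversal r T then G (plus r T) else 0 := by
  split_ifs with h
  · rw [Finset.sum_eq_single ⟨plus r T, plus_const r T⟩]
    · simp [mono, h]
    · intro ε _ hε
      have : ε.1 ≠ plus r T := fun e => hε (Subtype.ext e)
      simp [mono, this]
    · simp
  · exact Finset.sum_eq_zero fun ε _ => by simp [mono, h]

namespace Merge

variable {r r' : Setoid X} {p q : X} {T : List X}

/-- A monomial dies under the joining exactly when it contains the variables of both circles, since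
the square of a variable is zero. -/
theorem transversal_iff (h : Merge r r' p q) : Transversal r' T ↔
    Transversal r T ∧ ¬ ((∃ t ∈ T, r t p) ∧ ∃ t ∈ T, r t q) := by
  constructor
  · intro hT
    refine ⟨hT.imp fun hn e => hn (h.le e), ?_⟩
    rintro ⟨⟨t, ht, e⟩, u, hu, e'⟩
    have hs : Std.Symm fun x y => ¬ r' x y := ⟨fun x y e f => e (r'.symm f)⟩
    have hne : t ≠ u := fun hh => h.1 (r.trans (r.symm e) (hh ▸ e'))
    refine (List.Pairwise.forall hT ht hu hne) ?_
    exact (h.2 t u).2 (Or.inr ⟨Or.inl e, Or.inr e'⟩)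
  · rintro ⟨hT, hn⟩
    refine hT.imp_of_mem fun {x y} hx hy hxy e => ?_
    rcases (h.2 x y).1 e with e | ⟨e1 | e1, e2 | e2⟩
    · exact hxy e
    · exact hxy (r.trans e1 (r.symm e2))
    · exact hn ⟨⟨x, hx, e1⟩, ⟨y, hy, e2⟩⟩
    · exact hn ⟨⟨y, hy, e2⟩, ⟨x, hx, e1⟩⟩
    · exact hxy (r.trans e1 (r.symm e2))

theorem plus_of_not (h : Merge r r' p q) {x : X} (h1 : ¬ r x p) (h2 : ¬ r x q) :
    plus r' T x = plus r T x := by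
  have e : ∀ t, r' t x ↔ r t x := fun t => by
    have := (h.unchanged_iff x).2 ⟨h1, h2⟩ t
    exact ⟨fun e => r.symm (this.2 (r'.symm e)), fun e => r'.symm (this.1 (r.symm e))⟩
  exact plus_congr (by simp only [e])

theorem exists_left_iff (h : Merge r r' p q) :
    (∃ t ∈ T, r' t p) ↔ (∃ t ∈ T, r t p) ∨ ∃ t ∈ T, r t q := by
  simp only [h.rel_left, ← exists_or, and_or_left]

theorem ext_upper (h : Merge r r' p q) {ε ε' : X → ℤˣ} (hε : Const r' ε) (hε' : Const r' ε')
    (h1 : ∀ x, ¬ r x p → ¬ r x q → ε x = ε' x) (h2 : ε p = ε' p) : ε = ε' := by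
  funext x
  by_cases hx : r' x p
  · rw [hε _ _ hx, hε' _ _ hx, h2]
  · rw [h.rel_left, not_or] at hx
    exact h1 x hx.1 hx.2

theorem ext_lower {ε ε' : X → ℤˣ} (hε : Const r ε) (hε' : Const r ε')
    (h1 : ∀ x, ¬ r x p → ¬ r x q → ε x = ε' x) (h2 : ε p = ε' p) (h3 : ε q = ε' q) : ε = ε' := by
  funext x
  by_cases hx : r x p
  · rw [hε _ _ hx, hε' _ _ hx, h2]
  by_cases hx' : r x q
  · rw [hε _ _ hx', hε' _ _ hx', h3]
  exact h1 x hx hx'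

/-- Joining circles is the ring homomorphism which identifies two variables, so a monomial keeps its
list. -/
theorem push_merge [Finite X] (h : Merge r r' p q) {ε' : X → ℤˣ} (hε' : Const r' ε') :
    push r r' T ε' = mono r' T ε' := by
  classical
  have key : (Transversal r T ∧ Sad r r' (plus r T) ε') ↔ (Transversal r' T ∧ ε' = plus r' T) := by
    rw [h.transversal_iff, h.sad_iff (plus_const r T) hε', and_assoc]
    refine and_congr_right fun hT => ?_
    by_cases hPQ : (∃ t ∈ T, r t p) ∧ ∃ t ∈ T, r t q
    · simp only [hPQ.1, hPQ.2, plus, and_self, not_true, false_and, iff_false, if_true]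
      rintro ⟨-, e⟩
      rcases Int.units_eq_one_or (ε' p) with e' | e' <;> rw [e'] at e <;> simp at e
    · have num : (plus r' T p : ℤ) = plus r T p + plus r T q + 1 := by
        simp only [plus, h.exists_left_iff]
        by_cases hP : ∃ t ∈ T, r t p <;> by_cases hQ : ∃ t ∈ T, r t q
        · exact (hPQ ⟨hP, hQ⟩).elim
        all_goals simp only [hP, hQ]; simp
      simp only [hPQ, not_false_iff, true_and]
      constructor
      · rintro ⟨e1, e2⟩
        refine h.ext_upper hε' (plus_const r' T)
          (fun x hx hx' => (e1 x hx hx').trans (h.plus_of_not hx hx').symm) ?_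
        exact Units.ext (e2.trans num.symm)
      · rintro rfl
        exact ⟨fun x hx hx' => h.plus_of_not hx hx', num⟩
  simp only [push, mono, key]

/-- Comultiplication sends 1 to X⊗1 + 1⊗X and X to X⊗X. Both are multiplication by the sum of the
variables of `p` and `q`, whichever of the two represents the old variable. -/
theorem push_split [Finite X] (h : Merge r' r p q) {ε' : X → ℤˣ} (hε' : Const r' ε') :
    push r r' T ε' = mono r' (p :: T) ε' + mono r' (q :: T) ε' := by
  classical
  have tp : Transversal r' (p :: T) ↔ (¬ ∃ t ∈ T, r' t p) ∧ Transversal r' T := by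
    have e : ∀ t, r' p t ↔ r' t p := fun t => ⟨r'.symm, r'.symm⟩
    simp only [Transversal, List.pairwise_cons, e, not_exists, not_and]
  have tq : Transversal r' (q :: T) ↔ (¬ ∃ t ∈ T, r' t q) ∧ Transversal r' T := by
    have e : ∀ t, r' q t ↔ r' t q := fun t => ⟨r'.symm, r'.symm⟩
    simp only [Transversal, List.pairwise_cons, e, not_exists, not_and]
  have hqp : ¬ r' q p := fun e => h.1 (r'.symm e)
  have hpp : r' p p := r'.refl p
  have hqq : r' q q := r'.refl q
  by_cases hT : Transversal r' T
  swap
  · have : ¬ Transversal r T := fun e => hT (h.transversal_iff.1 e).1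
    simp [push, mono, tp, tq, this, hT]
  by_cases hPQ : (∃ t ∈ T, r' t p) ∧ ∃ t ∈ T, r' t q
  · have : ¬ Transversal r T := fun e => (h.transversal_iff.1 e).2 hPQ
    simp [push, mono, tp, tq, this, hPQ.1, hPQ.2]
  have hT' : Transversal r T := h.transversal_iff.2 ⟨hT, hPQ⟩
  have off : ∀ (z : X) (x : X), (z = p ∨ z = q) → ¬ r' x p → ¬ r' x q →
      plus r' (z :: T) x = plus r T x := by
    intro z x hz h1 h2
    rw [h.plus_of_not h1 h2]
    have e : ¬ r' z x := by
      rcases hz with rfl | rfl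
      · exact fun e => h1 (r'.symm e)
      · exact fun e => h2 (r'.symm e)
    simp only [plus, List.exists_mem_cons_iff, e, false_or]
  have sad : ∀ z, (z = p ∨ z = q) →
      ((plus r' (z :: T) p : ℤ) + plus r' (z :: T) q = plus r T p + 1) →
      Sad r r' (plus r T) (plus r' (z :: T)) := by
    intro z hz hnum
    exact (h.sad_symm_iff (plus_const r' _) (plus_const r T)).2
      ⟨fun x h1 h2 => off z x hz h1 h2, hnum⟩
  have main : Sad r r' (plus r T) ε' →
      (ε' p : ℤ) + ε' q = plus r T p + 1 ∧ ∀ z, (z = p ∨ z = q) → ε' p = plus r' (z :: T) p →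
        ε' q = plus r' (z :: T) q → ε' = plus r' (z :: T) := by
    intro hs
    obtain ⟨e1, e2⟩ := (h.sad_symm_iff hε' (plus_const r T)).1 hs
    exact ⟨e2, fun z hz hp hq => ext_lower hε' (plus_const r' _)
      (fun x h1 h2 => (e1 x h1 h2).trans (off z x hz h1 h2).symm) hp hq⟩
  -- If the list already contains the variable at `p`, only the term with `q` survives, and
  -- conversely; if it contains neither, both terms occur and differ.
  by_cases hP : ∃ t ∈ T, r' t p
  · have hQ : ¬ ∃ t ∈ T, r' t q := fun e => hPQ ⟨hP, e⟩
    have vp : plus r T p = 1 := by simp [plus, h.exists_left_iff, hP]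
    have v1 : plus r' (q :: T) p = 1 := by
      simp only [plus, List.exists_mem_cons_iff, hP, or_true, if_true]
    have v2 : plus r' (q :: T) q = 1 := by simp [plus]
    have key : Sad r r' (plus r T) ε' ↔ ε' = plus r' (q :: T) := by
      constructor
      · intro hs
        obtain ⟨e1, e2⟩ := main hs
        rw [vp] at e1
        refine e2 q (Or.inr rfl) ?_ ?_ <;> simp only [v1, v2] <;>
          rcases Int.units_eq_one_or (ε' p) with a | a <;>
          rcases Int.units_eq_one_or (ε' q) with b | b <;> rw [a, b] at e1 <;> simp_all
      · rintro rfl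
        exact sad q (Or.inr rfl) (by rw [v1, v2, vp]; rfl)
    simp [push, mono, tp, tq, hT, hT', hP, hQ, key]
  by_cases hQ : ∃ t ∈ T, r' t q
  · have vp : plus r T p = 1 := by simp [plus, h.exists_left_iff, hQ]
    have v1 : plus r' (p :: T) p = 1 := by simp [plus]
    have v2 : plus r' (p :: T) q = 1 := by
      simp only [plus, List.exists_mem_cons_iff, hQ, or_true, if_true]
    have key : Sad r r' (plus r T) ε' ↔ ε' = plus r' (p :: T) := by
      constructor
      · intro hs
        obtain ⟨e1, e2⟩ := main hs
        rw [vp] at e1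
        refine e2 p (Or.inl rfl) ?_ ?_ <;> simp only [v1, v2] <;>
          rcases Int.units_eq_one_or (ε' p) with a | a <;>
          rcases Int.units_eq_one_or (ε' q) with b | b <;> rw [a, b] at e1 <;> simp_all
      · rintro rfl
        exact sad p (Or.inl rfl) (by rw [v1, v2, vp]; rfl)
    simp [push, mono, tp, tq, hT, hT', hP, hQ, key]
  · have vp : plus r T p = -1 := by simp only [plus, h.exists_left_iff, hP, hQ, or_self, if_false]
    have v1 : plus r' (p :: T) p = 1 := by simp [plus]
    have v2 : plus r' (p :: T) q = -1 := by
      simp only [plus, List.exists_mem_cons_iff, hQ, h.1, or_self, if_false]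
    have v3 : plus r' (q :: T) p = -1 := by
      simp only [plus, List.exists_mem_cons_iff, hP, hqp, or_self, if_false]
    have v4 : plus r' (q :: T) q = 1 := by simp [plus]
    have key : Sad r r' (plus r T) ε' ↔ ε' = plus r' (p :: T) ∨ ε' = plus r' (q :: T) := by
      constructor
      · intro hs
        obtain ⟨e1, e2⟩ := main hs
        rw [vp] at e1
        rcases Int.units_eq_one_or (ε' p) with a | a
        · refine Or.inl (e2 p (Or.inl rfl) ?_ ?_) <;> simp only [v1, v2] <;>
          rcases Int.units_eq_one_or (ε' q) with b | b <;> rw [a, b] at e1 <;> simp_all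
        · refine Or.inr (e2 q (Or.inr rfl) ?_ ?_) <;> simp only [v3, v4] <;>
          rcases Int.units_eq_one_or (ε' q) with b | b <;> rw [a, b] at e1 <;> simp_all
      · rintro (rfl | rfl)
        · exact sad p (Or.inl rfl) (by rw [v1, v2, vp]; rfl)
        · exact sad q (Or.inr rfl) (by rw [v3, v4, vp]; rfl)
    have hne : plus r' (p :: T) ≠ plus r' (q :: T) := fun e => by
      have := congrFun e p
      rw [v1, v3] at this
      exact absurd this (by decide)
    simp only [push, mono, tp, tq, hT, hT', hP, hQ, key, not_false_iff, true_and]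
    by_cases h1 : ε' = plus r' (p :: T)
    · have h2 : ε' ≠ plus r' (q :: T) := fun e => hne (h1.symm.trans e)
      simp [h1, hne]
    · simp [h1]

end Merge

open Classical in
/-- The number of ways to pass from `ε` to `ε''` by two saddles. -/
noncomputable def comp [Finite X] (r r' r'' : Setoid X) (ε ε'' : X → ℤˣ) : ℤ :=
  ∑ ε' : {ε : X → ℤˣ // Const r' ε},
    (if Sad r r' ε ε'.1 then 1 else 0) * if Sad r' r'' ε'.1 ε'' then 1 else 0

section

variable [Finite X] {r r' r'' : Setoid X} {p q : X} {T : List X} {ε'' : X → ℤˣ}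

theorem comp_merge (h : Merge r r' p q) (hT : Transversal r T) :
    comp r r' r'' (plus r T) ε'' = push r' r'' T ε'' := by
  classical
  have e : ∀ ε' : {ε : X → ℤˣ // Const r' ε},
      (if Sad r r' (plus r T) ε'.1 then (1 : ℤ) else 0) = mono r' T ε'.1 := fun ε' => by
    rw [← h.push_merge ε'.2]; simp [push, hT]
  rw [comp]
  simp only [e]
  rw [sum_mono r' T fun ε' => if Sad r' r'' ε' ε'' then 1 else 0]
  by_cases hT' : Transversal r' T <;> simp [push, hT']

theorem comp_split (h : Merge r' r p q) (hT : Transversal r T) :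
    comp r r' r'' (plus r T) ε'' = push r' r'' (p :: T) ε'' + push r' r'' (q :: T) ε'' := by
  classical
  have e : ∀ ε' : {ε : X → ℤˣ // Const r' ε},
      (if Sad r r' (plus r T) ε'.1 then (1 : ℤ) else 0) =
        mono r' (p :: T) ε'.1 + mono r' (q :: T) ε'.1 := fun ε' => by
    rw [← h.push_split ε'.2]; simp [push, hT]
  rw [comp]
  simp only [e, add_mul, Finset.sum_add_distrib]
  rw [sum_mono r' (p :: T) fun ε' => if Sad r' r'' ε' ε'' then 1 else 0,
    sum_mono r' (q :: T) fun ε' => if Sad r' r'' ε' ε'' then 1 else 0]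
  congr 1
  · by_cases hT' : Transversal r' (p :: T) <;> simp [push, hT']
  · by_cases hT' : Transversal r' (q :: T) <;> simp [push, hT']

/-- Two saddles commute. -/
theorem comp_comm {r₁ r₂ : Setoid X} {p₁ q₁ p₂ q₂ : X}
    (h1 : Merge r r₁ p₁ q₁ ∨ Merge r₁ r p₁ q₁) (h12 : Merge r₁ r'' p₂ q₂ ∨ Merge r'' r₁ p₂ q₂)
    (h2 : Merge r r₂ p₂ q₂ ∨ Merge r₂ r p₂ q₂) (h21 : Merge r₂ r'' p₁ q₁ ∨ Merge r'' r₂ p₁ q₁)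
    {ε : X → ℤˣ} (hε : Const r ε) (hε'' : Const r'' ε'') :
    comp r r₁ r'' ε ε'' = comp r r₂ r'' ε ε'' := by
  -- Of the sixteen combinations of joinings and splittings, those in which the two orders change
  -- the number of circles differently are contradictory; six remain.
  obtain ⟨T, hT, rfl⟩ := exists_plus hε
  rcases h1 with h1 | h1 <;> rcases h12 with h12 | h12 <;> rcases h2 with h2 | h2 <;>
    rcases h21 with h21 | h21 <;>
    have c1 := h1.tau_one <;> have c2 := h12.tau_one <;> have c3 := h2.tau_one <;>
    have c4 := h21.tau_one <;> try (exfalso; linarith)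
  · rw [comp_merge h1 hT, comp_merge h2 hT, h12.push_merge hε'', h21.push_merge hε'']
  -- Join and then split, in both orders: in `r''` the classes of `p₁`, `q₁` are those of `p₂`, `q₂`
  -- in some order, so the two sums have the same terms.
  · rw [comp_merge h1 hT, comp_merge h2 hT, h12.push_split hε'', h21.push_split hε'']
    have key : ∀ x, r₁ x p₂ → r'' x p₂ ∨ r'' x q₂ := fun x e => h12.rel_left.1 e
    have hj : r₁ p₂ q₂ := h12.joined
    have hpq : (r p₂ p₁ ∨ r p₂ q₁) := by
      rcases (h1.2 p₂ q₂).1 hj with e | e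
      · exact (h2.1 e).elim
      · exact e.1
    have hp₁ : r₁ p₁ p₂ := by
      rcases hpq with e | e
      · exact r₁.symm (h1.le e)
      · exact r₁.trans h1.joined (r₁.symm (h1.le e))
    have hq₁ : r₁ q₁ p₂ := r₁.trans (r₁.symm h1.joined) hp₁
    have hn : ¬ r'' p₁ q₁ := h21.1
    rcases key p₁ hp₁ with e | e <;> rcases key q₁ hq₁ with e' | e'
    · exact (hn (r''.trans e (r''.symm e'))).elim
    · rw [mono_cons_congr T e, mono_cons_congr T e']
    · rw [mono_cons_congr T e, mono_cons_congr T e', add_comm]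
    · exact (hn (r''.trans e (r''.symm e'))).elim
  · rw [comp_merge h1 hT, comp_split h2 hT, h12.push_split hε'', h21.push_merge hε'',
      h21.push_merge hε'']
  · rw [comp_split h1 hT, comp_merge h2 hT, h12.push_merge hε'', h21.push_split hε'',
      h12.push_merge hε'']
  -- Split and then join, in both orders: all four points lie in one class of `r''`, and both sides
  -- are twice the same monomial.
  · rw [comp_split h1 hT, comp_split h2 hT, h12.push_merge hε'', h21.push_merge hε'',
      h12.push_merge hε'', h21.push_merge hε'']
    have hp : r'' p₁ q₁ := h21.joined
    have hp' : r'' p₂ q₂ := h12.joined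
    have hpp : r'' p₁ p₂ := by
      rcases (h12.2 p₁ q₁).1 hp with e | ⟨e | e, -⟩
      · exact (h1.1 e).elim
      · exact h12.le e
      · exact r''.trans (h12.le e) (r''.symm hp')
    rw [mono_cons_congr T (r''.symm hp), mono_cons_congr T (r''.symm hp'), mono_cons_congr T hpp]
  · rw [comp_split h1 hT, comp_split h2 hT, h12.push_split hε'', h21.push_split hε'',
      h12.push_split hε'', h21.push_split hε'', mono_swap p₂ p₁, mono_swap p₂ q₁, mono_swap q₂ p₁,
      mono_swap q₂ q₁]
    ring

end

end Saddle

/-! ### The differential squares to zero -/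

namespace PD

open Saddle

variable {E : Type} {n m : ℕ}

/-- A new B-marker is counted by exactly the crossings before it; this makes the two orders of
changing two markers differ in sign. -/
theorem edgeSign_update {s : Fin n → Marker} {v w : Fin n} (hv : s v = .A) :
    edgeSign (Function.update s v .B) w = edgeSign s w * if w < v then -1 else 1 := by
  have e : (Finset.univ.filter fun x => w < x ∧ Function.update s v Marker.B x = .B) =
      if w < v then insert v (Finset.univ.filter fun x => w < x ∧ s x = .B)
        else Finset.univ.filter fun x => w < x ∧ s x = .B := by
    ext x
    by_cases hx : x = v
    · subst hx
      split_ifs with h <;> simp [h]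
    · split_ifs with h <;> simp [hx]
  rw [edgeSign, edgeSign, e]
  split_ifs with h
  · rw [Finset.card_insert_of_notMem (by simp [hv]), pow_succ]
  · rw [mul_one]

/-- An enhanced state is a Kauffman state with signs which are constant on its circles. -/
def stateEquiv (D : PD E n m) :
    D.EnhancedState ≃ Σ t : Fin n → Marker, {ε : E → ℤˣ // Const (D.circles t) ε} where
  toFun s := ⟨s.marker, s.sign, s.const⟩
  invFun x := EnhancedState.ofConst D x.1 x.2.1 x.2.2
  left_inv _ := rfl
  right_inv _ := rfl

theorem sum_states [Finite E] (D : PD E n m) (F : (t : Fin n → Marker) → (E → ℤˣ) → ℤ) :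
    ∑ s : D.EnhancedState, F s.marker s.sign =
      ∑ t : Fin n → Marker, ∑ ε : {ε : E → ℤˣ // Const (D.circles t) ε}, F t ε.1 := by
  rw [← Fintype.sum_sigma']
  exact Fintype.sum_equiv D.stateEquiv _ _ fun s => rfl

/-- The sum runs over ordered pairs of crossings whose markers change. Exchanging the order keeps
the number of intermediate states by `comp_comm` and reverses the sign, so the sum is its own
negative. -/
theorem sum_incidence_mul [Finite E] {D : PD E n m} (hD : D.Dich) (s s'' : D.EnhancedState) :
    ∑ s', s.incidence s' * s'.incidence s'' = 0 := by
  classical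
  simp only [incidence_eq hD]
  rw [sum_states D fun t ε => (ksgn s.marker t *
    if Sad (D.circles s.marker) (D.circles t) s.sign ε then 1 else 0) *
    (ksgn t s''.marker * if Sad (D.circles t) (D.circles s''.marker) ε s''.sign then 1 else 0)]
  have e1 : ∀ t, ∑ ε : {ε : E → ℤˣ // Const (D.circles t) ε}, (ksgn s.marker t *
      if Sad (D.circles s.marker) (D.circles t) s.sign ε.1 then 1 else 0) *
      (ksgn t s''.marker *
        if Sad (D.circles t) (D.circles s''.marker) ε.1 s''.sign then 1 else 0) =
      ksgn s.marker t * ksgn t s''.marker *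
        comp (D.circles s.marker) (D.circles t) (D.circles s''.marker) s.sign s''.sign := by
    intro t
    rw [comp, Finset.mul_sum]
    exact Finset.sum_congr rfl fun ε _ => by ring
  simp only [e1]
  set g : Fin n → Fin n → ℤ := fun v w =>
    if s.marker v = .A ∧ s.marker w = .A ∧ v ≠ w ∧
      s''.marker = Function.update (Function.update s.marker v .B) w .B then
    edgeSign s.marker v * (edgeSign s.marker w * if w < v then -1 else 1) *
      comp (D.circles s.marker) (D.circles (Function.update s.marker v .B))
        (D.circles s''.marker) s.sign s''.sign else 0 with hg
  have e2 : ∑ t, ksgn s.marker t * ksgn t s''.marker *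
      comp (D.circles s.marker) (D.circles t) (D.circles s''.marker) s.sign s''.sign =
      ∑ v, ∑ w, g v w := by
    have : ∀ t, ksgn s.marker t * ksgn t s''.marker *
        comp (D.circles s.marker) (D.circles t) (D.circles s''.marker) s.sign s''.sign =
        ∑ v, if t = Function.update s.marker v .B then (if s.marker v = .A then
          edgeSign s.marker v * ksgn t s''.marker * comp (D.circles s.marker) (D.circles t)
            (D.circles s''.marker) s.sign s''.sign else 0) else 0 := by
      intro t
      rw [ksgn, Finset.sum_mul, Finset.sum_mul]
      refine Finset.sum_congr rfl fun v _ => ?_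
      by_cases h1 : s.marker v = .A <;> by_cases h2 : t = Function.update s.marker v .B <;>
        simp [h1, h2]
    simp only [this]
    rw [Finset.sum_comm]
    refine Finset.sum_congr rfl fun v _ => ?_
    rw [Finset.sum_ite_eq' Finset.univ (Function.update s.marker v .B)]
    simp only [Finset.mem_univ, if_true]
    by_cases h1 : s.marker v = .A
    · rw [if_pos h1, ksgn, Finset.mul_sum, Finset.sum_mul]
      refine Finset.sum_congr rfl fun w _ => ?_
      by_cases h2 : v = w
      · subst h2
        simp [hg]
      · rw [edgeSign_update h1]
        have h3 : Function.update s.marker v Marker.B w = s.marker w :=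
          Function.update_of_ne (Ne.symm h2) _ _
        by_cases h4 : s.marker w = .A <;>
          by_cases h5 : s''.marker = Function.update (Function.update s.marker v .B) w .B <;>
          simp [hg, h1, h2, h3, h4, h5]
    · simp [hg, h1]
  have e3 : ∀ v w, g v w = - g w v := by
    intro v w
    by_cases h1 : s.marker v = .A ∧ s.marker w = .A ∧ v ≠ w ∧
      s''.marker = Function.update (Function.update s.marker v .B) w .B
    · have h2 : s.marker w = .A ∧ s.marker v = .A ∧ w ≠ v ∧
          s''.marker = Function.update (Function.update s.marker w .B) v .B := by
        refine ⟨h1.2.1, h1.1, h1.2.2.1.symm, ?_⟩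
        rw [Function.update_comm h1.2.2.1.symm]
        exact h1.2.2.2
      have hvw : Function.update s.marker v Marker.B w = .A := by
        rw [Function.update_of_ne h1.2.2.1.symm, h1.2.1]
      have hwv : Function.update s.marker w Marker.B v = .A := by
        rw [Function.update_of_ne h1.2.2.1, h1.1]
      have d1 := hD _ _ hvw
      have d2 := hD _ _ hwv
      rw [← h1.2.2.2] at d1
      rw [← h2.2.2.2] at d2
      simp only [hg]
      rw [if_pos h1, if_pos h2, comp_comm (hD _ _ h1.1) d1 (hD _ _ h2.1) d2 s.const s''.const]
      rcases lt_or_gt_of_ne h1.2.2.1 with h | h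
      · rw [if_neg h.not_gt, if_pos h]; ring
      · rw [if_pos h, if_neg h.not_gt]; ring
    · have h2 : ¬ (s.marker w = .A ∧ s.marker v = .A ∧ w ≠ v ∧
          s''.marker = Function.update (Function.update s.marker w .B) v .B) := by
        rintro ⟨a, b, c, d⟩
        refine h1 ⟨b, a, c.symm, ?_⟩
        rw [Function.update_comm c.symm]
        exact d
      simp only [hg]
      rw [if_neg h1, if_neg h2, neg_zero]
  have e4 : ∑ v, ∑ w, g v w = - ∑ v, ∑ w, g v w := by
    conv_lhs => rw [Finset.sum_comm]
    rw [← Finset.sum_neg_distrib]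
    refine Finset.sum_congr rfl fun w _ => ?_
    rw [← Finset.sum_neg_distrib]
    exact Finset.sum_congr rfl fun v _ => e3 v w
  rw [e2]
  linarith

end PD

/-! ### Complexes with a basis -/

/-- A doubly graded complex with a finite basis. -/
structure BasedComplex where
  basis : Type
  finite : Finite basis
  inc : basis → basis → ℤ
  wa : basis → ℤ
  wb : basis → ℤ

namespace BasedComplex

attribute [instance] finite

noncomputable instance (C : BasedComplex) : Fintype C.basis := Fintype.ofFinite _

variable {C C' C'' : BasedComplex}

/-- The linear map with a given matrix. -/
noncomputable def lin (M : Matrix C.basis C'.basis ℤ) : (C.basis →₀ ℤ) →ₗ[ℤ] (C'.basis →₀ ℤ) :=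
  Finsupp.linearCombination ℤ fun s => ∑ s', M s s' • Finsupp.single s' (1 : ℤ)

theorem lin_apply (M : Matrix C.basis C'.basis ℤ) (x : C.basis →₀ ℤ) (t : C'.basis) :
    lin M x t = ∑ s, x s * M s t := by
  classical
  rw [lin, Finsupp.linearCombination_apply, Finsupp.sum_fintype _ _ (by simp), Finsupp.finsetSum_apply]
  refine Finset.sum_congr rfl fun s _ => ?_
  simp [Finsupp.single_apply]

/-- Matrices act on row vectors, so products of matrices below are read from left to right. -/
theorem lin_mul (M : Matrix C.basis C'.basis ℤ) (N : Matrix C'.basis C''.basis ℤ)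
    (x : C.basis →₀ ℤ) : lin (M * N) x = lin N (lin M x) := by
  ext t
  simp only [lin_apply, Matrix.mul_apply, Finset.mul_sum, Finset.sum_mul]
  rw [Finset.sum_comm]
  exact Finset.sum_congr rfl fun _ _ => Finset.sum_congr rfl fun _ _ => by ring

theorem lin_one [DecidableEq C.basis] (x : C.basis →₀ ℤ) :
    lin (1 : Matrix C.basis C.basis ℤ) x = x := by
  ext t
  simp [lin_apply, Matrix.one_apply]

theorem lin_sub (M N : Matrix C.basis C'.basis ℤ) (x : C.basis →₀ ℤ) :
    lin (M - N) x = lin M x - lin N x := by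
  ext t
  simp [lin_apply, mul_sub, Finset.sum_sub_distrib]

theorem lin_zero (x : C.basis →₀ ℤ) : lin (0 : Matrix C.basis C'.basis ℤ) x = 0 := by
  ext t
  simp [lin_apply]

variable (C) in
/-- The matrix of the differential. -/
def diff : Matrix C.basis C.basis ℤ := Matrix.of C.inc

variable (C) in
/-- The differential. -/
noncomputable def bd : (C.basis →₀ ℤ) →ₗ[ℤ] (C.basis →₀ ℤ) :=
  Finsupp.linearCombination ℤ fun s => ∑ s', C.inc s s' • Finsupp.single s' (1 : ℤ)

theorem bd_eq (x : C.basis →₀ ℤ) : C.bd x = lin C.diff x := rfl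

variable (C) in
/-- The chains of given degrees. -/
noncomputable def chains (a b : ℤ) : Submodule ℤ (C.basis →₀ ℤ) :=
  Finsupp.supported ℤ ℤ {s | C.wa s = a ∧ C.wb s = b}

variable (C) in
/-- The cycles of given degrees. -/
noncomputable def cycles (a b : ℤ) : Submodule ℤ (C.basis →₀ ℤ) :=
  C.chains a b ⊓ LinearMap.ker C.bd

variable (C) in
/-- The boundaries of given degrees. -/
noncomputable def boundaries (a b : ℤ) : Submodule ℤ (C.basis →₀ ℤ) :=
  (C.chains (a + 2) b).map C.bd

variable (C) in
/-- The homology. -/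
abbrev Homology (a b : ℤ) : Type :=
  C.cycles a b ⧸ (C.boundaries a b).submoduleOf (C.cycles a b)

/-- Matrices of maps which shift the degrees. -/
def Homogeneous (k l : ℤ) (M : Matrix C.basis C'.basis ℤ) : Prop :=
  ∀ s t, M s t ≠ 0 → C'.wa t = C.wa s + k ∧ C'.wb t = C.wb s + l

theorem Homogeneous.mul {k l k' l' : ℤ} {M : Matrix C.basis C'.basis ℤ}
    {N : Matrix C'.basis C''.basis ℤ} (hM : Homogeneous k l M) (hN : Homogeneous k' l' N) :
    Homogeneous (k + k') (l + l') (M * N) := by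
  intro s t h
  rw [Matrix.mul_apply] at h
  obtain ⟨u, -, hu⟩ := Finset.exists_ne_zero_of_sum_ne_zero h
  obtain ⟨h1, h2⟩ := hM s u (left_ne_zero_of_mul hu)
  obtain ⟨h3, h4⟩ := hN u t (right_ne_zero_of_mul hu)
  constructor <;> linarith

theorem Homogeneous.sub {k l : ℤ} {M N : Matrix C.basis C'.basis ℤ} (hM : Homogeneous k l M)
    (hN : Homogeneous k l N) : Homogeneous k l (M - N) := by
  intro s t h
  by_cases h1 : M s t = 0
  · exact hN s t fun h2 => h (by simp [h1, h2])
  · exact hM s t h1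

theorem Homogeneous.one [DecidableEq C.basis] :
    Homogeneous 0 0 (1 : Matrix C.basis C.basis ℤ) := by
  intro s t h
  by_cases hst : s = t
  · simp [hst]
  · exact (h (Matrix.one_apply_ne hst)).elim

theorem Homogeneous.lin_mem {k l a b a' b' : ℤ} {M : Matrix C.basis C'.basis ℤ}
    (hM : Homogeneous k l M) {x : C.basis →₀ ℤ} (hx : x ∈ C.chains a b) (ha : a' = a + k)
    (hb : b' = b + l) : lin M x ∈ C'.chains a' b' := by
  refine (Finsupp.mem_supported _ _).2 fun t ht => ?_
  have ht : lin M x t ≠ 0 := Finsupp.mem_support_iff.1 ht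
  rw [lin_apply] at ht
  obtain ⟨s, -, hs⟩ := Finset.exists_ne_zero_of_sum_ne_zero ht
  obtain ⟨h1, h2⟩ := hM s t (right_ne_zero_of_mul hs)
  have h3 := (Finsupp.mem_supported _ _).1 hx (Finsupp.mem_support_iff.2 (left_ne_zero_of_mul hs))
  simp only [Set.mem_ofPred_eq] at h3 ⊢
  constructor <;> linarith

section

variable {a b a' b' : ℤ}

/-- The map on homology induced by a map of chains. -/
noncomputable def homologyMap (f : (C.basis →₀ ℤ) →ₗ[ℤ] (C'.basis →₀ ℤ))
    (h1 : ∀ x ∈ C.cycles a b, f x ∈ C'.cycles a' b')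
    (h2 : ∀ x ∈ C.boundaries a b, f x ∈ C'.boundaries a' b') :
    C.Homology a b →ₗ[ℤ] C'.Homology a' b' :=
  Submodule.mapQ _ _ (f.restrict h1) fun _ hx => h2 _ hx

theorem homologyMap_mk (f : (C.basis →₀ ℤ) →ₗ[ℤ] (C'.basis →₀ ℤ))
    (h1 : ∀ x ∈ C.cycles a b, f x ∈ C'.cycles a' b')
    (h2 : ∀ x ∈ C.boundaries a b, f x ∈ C'.boundaries a' b') (x : C.cycles a b) :
    homologyMap f h1 h2 (Submodule.Quotient.mk x) = Submodule.Quotient.mk ⟨f x, h1 x x.2⟩ := rfl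

theorem homology_mk_eq {x y : C.cycles a b} :
    (Submodule.Quotient.mk x : C.Homology a b) = Submodule.Quotient.mk y ↔
      (x : C.basis →₀ ℤ) - y ∈ C.boundaries a b :=
  Submodule.Quotient.eq _

end

/-- A deformation retraction: `g` followed by `f` is the identity of `C'`, and `f` followed by `g`
differs from the identity of `C` by the homotopy `h`. -/
theorem homology_equiv_of_homotopy [DecidableEq C.basis] [DecidableEq C'.basis] {k l : ℤ}
    {f : Matrix C.basis C'.basis ℤ} {g : Matrix C'.basis C.basis ℤ} {h : Matrix C.basis C.basis ℤ}
    (hf : Homogeneous k l f) (hg : Homogeneous (-k) (-l) g) (hh : Homogeneous 2 0 h)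
    (fd : C.diff * f = f * C'.diff)
    (gd : C'.diff * g = g * C.diff)
    (gf : g * f = 1)
    (fg : f * g = 1 - h * C.diff -
      C.diff * h) (a b : ℤ) :
    Nonempty (C.Homology a b ≃ₗ[ℤ] C'.Homology (a + k) (b + l)) := by
  have cf : ∀ x, lin f (C.bd x) = C'.bd (lin f x) := fun x => by
    rw [bd_eq, bd_eq, ← lin_mul, ← lin_mul, fd]
  have cg : ∀ x, lin g (C'.bd x) = C.bd (lin g x) := fun x => by
    rw [bd_eq, bd_eq, ← lin_mul, ← lin_mul, gd]
  have hgf : ∀ x, lin f (lin g x) = x := fun x => by rw [← lin_mul, gf, lin_one]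
  have hfg : ∀ x, lin g (lin f x) = x - C.bd (lin h x) - lin h (C.bd x) := fun x => by
    rw [← lin_mul, fg, lin_sub, lin_sub, lin_one, lin_mul, lin_mul]; rfl
  have f1 : ∀ x ∈ C.cycles a b, lin f x ∈ C'.cycles (a + k) (b + l) := fun x hx =>
    ⟨hf.lin_mem hx.1 rfl rfl, LinearMap.mem_ker.2 (by
      rw [← cf, LinearMap.mem_ker.1 hx.2, map_zero])⟩
  have g1 : ∀ x ∈ C'.cycles (a + k) (b + l), lin g x ∈ C.cycles a b := fun x hx =>
    ⟨hg.lin_mem hx.1 (by ring) (by ring), LinearMap.mem_ker.2 (by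
      rw [← cg, LinearMap.mem_ker.1 hx.2, map_zero])⟩
  have f2 : ∀ x ∈ C.boundaries a b, lin f x ∈ C'.boundaries (a + k) (b + l) := by
    rintro _ ⟨y, hy, rfl⟩
    exact ⟨lin f y, hf.lin_mem hy (by ring) rfl, (cf y).symm⟩
  have g2 : ∀ x ∈ C'.boundaries (a + k) (b + l), lin g x ∈ C.boundaries a b := by
    rintro _ ⟨y, hy, rfl⟩
    exact ⟨lin g y, hg.lin_mem hy (by ring) (by ring), (cg y).symm⟩
  refine ⟨LinearEquiv.ofLinearMap (homologyMap (lin f) f1 f2) (homologyMap (lin g) g1 g2) ?_ ?_⟩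
  · refine LinearMap.ext fun x => ?_
    obtain ⟨x, rfl⟩ := Submodule.Quotient.mk_surjective _ x
    simp only [LinearMap.comp_apply, homologyMap_mk, LinearMap.id_apply]
    exact congrArg _ (Subtype.ext (hgf x))
  · refine LinearMap.ext fun x => ?_
    obtain ⟨x, rfl⟩ := Submodule.Quotient.mk_surjective _ x
    simp only [LinearMap.comp_apply, homologyMap_mk, LinearMap.id_apply]
    refine homology_mk_eq.2 ⟨- lin h x, ?_, ?_⟩
    · exact Submodule.neg_mem _ (hh.lin_mem x.2.1 rfl (by ring))
    · change C.bd (- lin h x) = lin g (lin f x) - x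
      rw [hfg, LinearMap.mem_ker.1 x.2.2, map_zero, map_neg]
      abel

/-- Gaussian elimination: the elements `q` of the basis with `Q q` cancel against the elements
`up q`, and the other elements are the `j x`. -/
theorem homology_equiv_of_matching {k l : ℤ}
    (dd : ∀ s t, ∑ u, C.inc s u * C.inc u t = 0)
    (wt : ∀ s t, C.inc s t ≠ 0 → C.wa t = C.wa s - 2 ∧ C.wb t = C.wb s)
    (Q : C.basis → Prop) (up : C.basis → C.basis) (θ : C.basis → ℤ)
    (j : C'.basis → C.basis) (η : C'.basis → ℤ)
    (hj : Function.Injective j) (hη : ∀ x, η x * η x = 1) (hθ : ∀ q, Q q → θ q * θ q = 1)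
    (hQj : ∀ x, ¬ Q (j x)) (hQup : ∀ q, Q q → ¬ Q (up q)) (hupj : ∀ q x, Q q → up q ≠ j x)
    (cover : ∀ s, Q s ∨ (∃ x, j x = s) ∨ ∃ q, Q q ∧ up q = s)
    (self : ∀ q, Q q → C.inc (up q) q = θ q)
    (off : ∀ q q', Q q → Q q' → q ≠ q' → C.inc (up q) q' = 0)
    (wtj : ∀ x, C'.wa x = C.wa (j x) + k ∧ C'.wb x = C.wb (j x) + l)
    [DecidablePred Q]
    (hinc : ∀ x y, C'.inc x y = η x * η y * (C.inc (j x) (j y) -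
      ∑ q, if Q q then C.inc (j x) q * θ q * C.inc (up q) (j y) else 0)) (a b : ℤ) :
    Nonempty (C.Homology a b ≃ₗ[ℤ] C'.Homology (a + k) (b + l)) := by
  classical
  have θne : ∀ q, Q q → θ q ≠ 0 := fun q hq e => by simpa [e] using hθ q hq
  have ηne : ∀ x, η x ≠ 0 := fun x e => by simpa [e] using hη x
  have upinj : ∀ q q', Q q → Q q' → up q = up q' → q = q' := by
    intro q q' hq hq' e
    by_contra hne
    have := off q q' hq hq' hne
    rw [e, self q' hq'] at this
    exact θne q' hq' this
  let d : Matrix C.basis C.basis ℤ := C.diff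
  -- `h` sends a cancelled element to its partner and inverts the part of the differential going
  -- back; `i` is the signed inclusion of the surviving elements.
  let h : Matrix C.basis C.basis ℤ := fun q p => if Q q ∧ up q = p then θ q else 0
  let i : Matrix C'.basis C.basis ℤ := fun x s => if j x = s then η x else 0
  have h_apply : ∀ q p, h q p = if Q q ∧ up q = p then θ q else 0 := fun _ _ => rfl
  have i_apply : ∀ x s, i x s = if j x = s then η x else 0 := fun _ _ => rfl
  have h_mul : ∀ {D : BasedComplex} (M : Matrix C.basis D.basis ℤ) q t,
      (h * M) q t = if Q q then θ q * M (up q) t else 0 := by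
    intro D M q t
    rw [Matrix.mul_apply]
    by_cases hq : Q q <;> simp [h_apply, hq]
  have i_mul : ∀ {D : BasedComplex} (M : Matrix C.basis D.basis ℤ) x t,
      (i * M) x t = η x * M (j x) t := by
    intro D M x t
    rw [Matrix.mul_apply]
    simp [i_apply]
  have mul_it : ∀ {D : BasedComplex} (M : Matrix D.basis C.basis ℤ) s x,
      (M * i.transpose) s x = M s (j x) * η x := by
    intro D M s x
    rw [Matrix.mul_apply]
    simp [i_apply]
  have dd0 : d * d = 0 := by
    ext s t
    rw [Matrix.mul_apply]
    exact dd s t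
  have hh0 : h * h = 0 := by
    ext q t
    rw [h_mul]
    split_ifs with hq
    · simp [h_apply, hQup q hq]
    · rfl
  have hdh : h * d * h = h := by
    ext q t
    rw [Matrix.mul_assoc, h_mul, h_apply]
    by_cases hq : Q q
    · rw [if_pos hq, Matrix.mul_apply, Finset.sum_eq_single q]
      · have e : d (up q) q = θ q := self q hq
        rw [h_apply, e, ← mul_assoc, hθ q hq, one_mul]
      · intro q' _ hne
        rw [h_apply]
        by_cases hq' : Q q'
        · have e : d (up q) q' = 0 := off q q' hq hq' hne.symm
          rw [e, zero_mul]
        · simp [hq']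
      · simp
    · simp [hq]
  have ih0 : i * h = 0 := by
    ext x t
    rw [i_mul, h_apply]
    simp [hQj]
  have hp0 : h * i.transpose = 0 := by
    ext q x
    rw [mul_it, h_apply, Matrix.zero_apply, if_neg, zero_mul]
    rintro ⟨hq, e⟩
    exact hupj q x hq e
  have ip1 : i * i.transpose = 1 := by
    ext x y
    rw [mul_it, i_apply, Matrix.one_apply]
    by_cases hxy : x = y
    · simp [hxy, hη]
    · simp [hxy, hj.ne hxy]
  -- The three summands are the projections onto the elements with `Q`, their partners and the
  -- survivors; `cover` says that nothing else exists.
  have sum1 : h * h.transpose + h.transpose * h + i.transpose * i = 1 := by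
    ext s t
    rw [Matrix.add_apply, Matrix.add_apply, h_mul, Matrix.mul_apply, Matrix.mul_apply,
      Matrix.one_apply]
    simp only [Matrix.transpose_apply]
    have z1 : ∀ q, ¬ (Q q ∧ up q = s) → h q s * h q t = 0 := fun q hq => by
      rw [h_apply, if_neg hq, zero_mul]
    have z2 : ∀ x, j x ≠ s → i x s * i x t = 0 := fun x hx => by
      rw [i_apply, if_neg hx, zero_mul]
    rcases cover s with hs | ⟨x, rfl⟩ | ⟨q, hq, rfl⟩
    · rw [if_pos hs, Finset.sum_eq_zero fun q _ => z1 q fun e => hQup q e.1 (e.2 ▸ hs),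
        Finset.sum_eq_zero fun x _ => z2 x fun e => hQj x (e ▸ hs), h_apply]
      by_cases hst : s = t
      · subst hst; simp [hs, hθ]
      · have : ¬ (Q t ∧ up t = up s) := fun e => hst (upinj s t hs e.1 e.2.symm)
        simp [this, hst]
    · rw [if_neg (hQj x), Finset.sum_eq_zero fun q _ => z1 q fun e => hupj q x e.1 e.2,
        Finset.sum_eq_single x (fun y _ hy => z2 y (hj.ne hy)) (by simp), i_apply, i_apply]
      by_cases hst : j x = t <;> simp [hst, hη]
    · rw [if_neg (hQup q hq), Finset.sum_eq_single q
        (fun q' _ hne => z1 q' fun e => hne (upinj _ _ e.1 hq e.2)) (by simp),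
        Finset.sum_eq_zero fun x _ => z2 x (hupj q x hq).symm, h_apply, h_apply]
      by_cases hst : up q = t <;> simp [hst, hq, hθ]
  have d'_eq : C'.diff = i * (d - d * h * d) * i.transpose := by
    ext x y
    rw [mul_it, i_mul, Matrix.sub_apply, Matrix.mul_assoc, Matrix.mul_apply]
    have e : ∀ s, d (j x) s * (h * d) s (j y) =
        if Q s then C.inc (j x) s * θ s * C.inc (up s) (j y) else 0 := fun s => by
      rw [h_mul]
      split_ifs
      · rw [mul_assoc]; rfl
      · exact mul_zero _
    simp only [e]
    change C'.inc x y = η x * (C.inc (j x) (j y) - _) * η y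
    rw [hinc x y]
    ring
  have it_i : i.transpose * i = 1 - h * h.transpose - h.transpose * h := by
    rw [← sum1]; abel
  have a1 : h * (d - d * h * d) = 0 := by
    rw [mul_sub, ← mul_assoc, ← mul_assoc, hdh, sub_self]
  have a2 : (d - d * h * d) * h = 0 := by
    rw [sub_mul, mul_assoc, mul_assoc d h, ← mul_assoc h d h, hdh, sub_self]
  have a3 : h * (1 - d * h) = 0 := by
    rw [mul_sub, mul_one, ← mul_assoc, hdh, sub_self]
  have a4 : (1 - h * d) * h = 0 := by
    rw [sub_mul, one_mul, hdh, sub_self]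
  have a5 : (d - d * h * d) * d = 0 := by
    rw [sub_mul, mul_assoc (d * h), dd0, mul_zero, sub_zero]
  have a6 : d * (d - d * h * d) = 0 := by
    rw [mul_sub, ← mul_assoc, ← mul_assoc, dd0, zero_mul, zero_mul, sub_self]
  have wd : Homogeneous (C := C) (C' := C) (-2) 0 d := fun s t hst => by
    obtain ⟨h1, h2⟩ := wt s t hst
    constructor <;> linarith
  have wh : Homogeneous (C := C) (C' := C) 2 0 h := fun s t hst => by
    rw [h_apply] at hst
    have hs : Q s ∧ up s = t := by by_contra e; simp [e] at hst
    obtain ⟨h1, h2⟩ := wt (up s) s (by rw [self s hs.1]; exact θne s hs.1)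
    rw [← hs.2]
    constructor <;> linarith
  have wi : Homogeneous (C := C') (C' := C) (-k) (-l) i := fun x s hst => by
    rw [i_apply] at hst
    have hs : j x = s := by by_contra e; simp [e] at hst
    obtain ⟨h1, h2⟩ := wtj x
    rw [← hs]
    constructor <;> linarith
  have wit : Homogeneous (C := C) (C' := C') k l i.transpose := fun s x hst => by
    obtain ⟨h1, h2⟩ := wi x s hst
    constructor <;> linarith
  have w0 : Homogeneous (C := C) (C' := C) 0 0 (h * d) := by simpa using wh.mul wd
  have w0' : Homogeneous (C := C) (C' := C) 0 0 (d * h) := by simpa using wd.mul wh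
  -- Projection and inclusion are corrected by one zigzag through `h`. No higher corrections occur
  -- because the differential from partners to cancelled elements is diagonal.
  refine homology_equiv_of_homotopy (f := (1 - h * d) * i.transpose) (g := i * (1 - d * h)) (h := h)
    ?_ ?_ wh ?_ ?_ ?_ ?_ a b
  · simpa using (Homogeneous.one.sub w0).mul wit
  · simpa using wi.mul (Homogeneous.one.sub w0')
  · rw [d'_eq]
    change d * ((1 - h * d) * i.transpose) = _
    have e1 : d * ((1 - h * d) * i.transpose) = (d - d * h * d) * i.transpose := by
      simp only [Matrix.mul_sub, Matrix.sub_mul, Matrix.mul_assoc, Matrix.one_mul]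
    have e2 : (1 - h * d) * i.transpose * (i * (d - d * h * d) * i.transpose) =
        (1 - h * d) * (i.transpose * i) * (d - d * h * d) * i.transpose := by
      simp only [Matrix.mul_assoc]
    rw [e1, e2, it_i]
    congr 1
    calc d - d * h * d = (1 - h * d) * (d - d * h * d) := by
          rw [sub_mul, one_mul, mul_assoc h d, a6, mul_zero, sub_zero]
      _ = (1 - h * d) * (d - d * h * d) - (1 - h * d) * h * h.transpose * (d - d * h * d) -
          (1 - h * d) * h.transpose * (h * (d - d * h * d)) := by
          rw [a1, a4, zero_mul, zero_mul, mul_zero, sub_zero, sub_zero]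
      _ = _ := by noncomm_ring
  · rw [d'_eq]
    change _ = i * (1 - d * h) * d
    have e1 : i * (1 - d * h) * d = i * (d - d * h * d) := by
      simp only [Matrix.mul_sub, Matrix.sub_mul, Matrix.mul_assoc, Matrix.one_mul]
    have e2 : i * (d - d * h * d) * i.transpose * (i * (1 - d * h)) =
        i * ((d - d * h * d) * (i.transpose * i) * (1 - d * h)) := by
      simp only [Matrix.mul_assoc]
    rw [e1, e2, it_i]
    congr 1
    symm
    calc d - d * h * d = (d - d * h * d) * (1 - d * h) := by
          rw [mul_sub, mul_one, ← mul_assoc, a5, zero_mul, sub_zero]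
      _ = (d - d * h * d) * (1 - d * h) - (d - d * h * d) * h * h.transpose * (1 - d * h) -
          (d - d * h * d) * h.transpose * (h * (1 - d * h)) := by
          rw [a2, a3, zero_mul, zero_mul, mul_zero, sub_zero, sub_zero]
      _ = _ := by noncomm_ring
  · have e1 : i * (1 - d * h) * ((1 - h * d) * i.transpose) =
        i * i.transpose - (i * h) * d * i.transpose - i * d * (h * i.transpose) +
          i * d * (h * h) * d * i.transpose := by
      simp only [Matrix.mul_sub, Matrix.sub_mul, Matrix.mul_assoc, Matrix.one_mul, Matrix.mul_one]
      abel
    rw [e1, ip1, ih0, hp0, hh0]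
    simp
  · have e2 : (1 - h * d) * i.transpose * (i * (1 - d * h)) =
        (1 - h * d) * (i.transpose * i) * (1 - d * h) := by
      simp only [Matrix.mul_assoc]
    rw [e2, it_i]
    change _ = 1 - h * d - d * h
    calc (1 - h * d) * (1 - h * h.transpose - h.transpose * h) * (1 - d * h)
        = (1 - h * d) * (1 - d * h) - (1 - h * d) * h * h.transpose * (1 - d * h) -
          (1 - h * d) * h.transpose * (h * (1 - d * h)) := by noncomm_ring
      _ = 1 - h * d - d * h + h * (d * d) * h := by
          rw [a3, a4, zero_mul, zero_mul, mul_zero, sub_zero, sub_zero]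
          noncomm_ring
      _ = _ := by rw [dd0, mul_zero, zero_mul, add_zero]

end BasedComplex

namespace PD

variable {E : Type} {n m : ℕ}

/-- The complex of a diagram. -/
noncomputable def complex [Finite E] (D : PD E n m) : BasedComplex where
  basis := D.EnhancedState
  finite := inferInstance
  inc := EnhancedState.incidence
  wa := EnhancedState.a
  wb := EnhancedState.b

theorem incidence_weight [Finite E] {D : PD E n m} {s s' : D.EnhancedState}
    (h : s.incidence s' ≠ 0) : s'.a = s.a - 2 ∧ s'.b = s.b := by
  classical
  obtain ⟨v, -, hv⟩ := Finset.exists_ne_zero_of_sum_ne_zero h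
  have : s.AdjacentAt s' v := by
    by_contra hc
    exact hv (if_neg hc)
  exact ⟨this.a_eq, this.b_eq⟩

end PD

/-! ### Restriction of saddles to a part of the edges -/

namespace Saddle

variable {X Y : Type}

theorem Const.neg {r : Setoid X} {ε : X → ℤˣ} (h : Const r ε) : Const r (-ε) :=
  fun x y e => congrArg Neg.neg (h x y e)

theorem Const.comap {R : Setoid Y} {ε : Y → ℤˣ} (h : Const R ε) (f : X → Y) :
    Const (R.comap f) (ε ∘ f) := fun _ _ e => h _ _ e

/-- The self-duality of the algebra: read backwards with all signs reversed, multiplication becomes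
comultiplication. -/
theorem sad_neg_iff {r r' : Setoid X} {ε ε' : X → ℤˣ} : Sad r' r (-ε') (-ε) ↔ Sad r r' ε ε' := by
  rw [Sad, Sad, tau_neg, tau_neg]
  refine and_congr ⟨fun h => by linarith, fun h => by linarith⟩ (forall_congr' fun x => ?_)
  have e : (∀ y, r' x y ↔ r x y) ↔ ∀ y, r x y ↔ r' x y := forall_congr' fun _ => Iff.comm
  rw [e]
  refine imp_congr_right fun _ => ?_
  simp only [Pi.neg_apply, neg_inj]
  exact eq_comm

theorem Merge.comap {R R' : Setoid Y} {f : X → Y} {p q : X} (h : Merge R R' (f p) (f q)) :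
    Merge (R.comap f) (R'.comap f) p q := ⟨h.1, fun x y => h.2 (f x) (f y)⟩

/-- A class which `f` misses is unchanged with the same sign, so it plays no part in the saddle, and
the two joined points can be chosen in the image of `f`. The splitting case follows by duality. -/
theorem sad_comap_iff [Finite X] [Finite Y] {R R' : Setoid Y} {P Q : Y}
    (h : Merge R R' P Q ∨ Merge R' R P Q) (f : X → Y) {ε ε' : Y → ℤˣ} (hε : Const R ε)
    (hε' : Const R' ε')
    (hit : ∀ y, ((∃ x, R y (f x)) ∧ ∃ x, R' y (f x)) ∨ ((∀ z, R y z ↔ R' y z) ∧ ε' y = ε y)) :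
    Sad R R' ε ε' ↔ Sad (R.comap f) (R'.comap f) (ε ∘ f) (ε' ∘ f) := by
  have key : ∀ {R R' : Setoid Y} {ε ε' : Y → ℤˣ}, Const R ε → Const R' ε' → Merge R R' P Q →
      (∀ y, ((∃ x, R y (f x)) ∧ ∃ x, R' y (f x)) ∨ ((∀ z, R y z ↔ R' y z) ∧ ε' y = ε y)) →
      (Sad R R' ε ε' ↔ Sad (R.comap f) (R'.comap f) (ε ∘ f) (ε' ∘ f)) := by
    intro R R' ε ε' hε hε' h hit
    have changed : ∀ y, (R y P ∨ R y Q) → ∃ x, R y (f x) := fun y hy => by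
      rcases hit y with hy' | hy'
      · exact hy'.1
      · obtain ⟨h1, h2⟩ := (h.unchanged_iff y).1 hy'.1
        exact (hy.elim h1 h2).elim
    obtain ⟨p, hp⟩ := changed P (Or.inl (R.refl P))
    obtain ⟨q, hq⟩ := changed Q (Or.inr (R.refl Q))
    have h := h.congr hp hq
    rw [h.sad_iff hε hε', h.comap.sad_iff (hε.comap f) (hε'.comap f)]
    refine and_congr_left fun _ => ⟨fun H x hx hx' => H (f x) hx hx', fun H y hy hy' => ?_⟩
    rcases hit y with ⟨⟨x, hx⟩, -⟩ | hy''
    · have hx' := (((h.unchanged_iff y).2 ⟨hy, hy'⟩) (f x)).1 hx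
      rw [hε y _ hx, hε' y _ hx']
      exact H x (fun e => hy (R.trans hx e)) (fun e => hy' (R.trans hx e))
    · exact hy''.2
  rcases h with h | h
  · exact key hε hε' h hit
  · rw [← sad_neg_iff, ← sad_neg_iff (r := R.comap f)]
    refine key hε'.neg hε.neg h fun y => ?_
    rcases hit y with hy | hy
    · exact Or.inl hy.symm
    · refine Or.inr ⟨fun z => (hy.1 z).symm, ?_⟩
      simp [hy.2]

/-- A saddle splitting off a circle, with positive sign on the circle. -/
theorem sad_circle_iff [Finite X] {I : Type} [Finite I] {R R' : Setoid (X ⊕ I)} {P Q : X ⊕ I}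
    (h : Merge R R' P Q ∨ Merge R' R P Q) (i : I) (hc : ∀ i j, R' (.inr i) (.inr j))
    (hn : ∀ x i, ¬ R' (.inl x) (.inr i))
    (hcomap : ∀ x y, R (.inl x) (.inl y) ↔ R' (.inl x) (.inl y)) (hit : ∀ y, ∃ x, R y (.inl x))
    {ε ε' : X ⊕ I → ℤˣ} (hε : Const R ε) (hε' : Const R' ε') (hi : ε' (.inr i) = 1) :
    Sad R R' ε ε' ↔ ∀ x, ε' (.inl x) = ε (.inl x) := by
  -- The saddle cannot join classes: every class of `R` meets `X`, while the circle in `R'` does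
  -- not.
  have h : Merge R' R P Q := by
    rcases h with h | h
    · obtain ⟨x, hx⟩ := hit (.inr i)
      exact (hn x i (R'.symm (h.le hx))).elim
    · exact h
  have key : ∀ {P Q}, Merge R' R P Q → R' P (.inr i) →
      (Sad R R' ε ε' ↔ ∀ x, ε' (.inl x) = ε (.inl x)) := by
    intro P Q h hP
    have hQ : ∀ j, ¬ R' Q (.inr j) := fun j e =>
      h.1 (R'.trans hP (R'.trans (hc i j) (R'.symm e)))
    obtain ⟨q, rfl⟩ : ∃ q, Q = .inl q := by
      rcases Q with q | j
      · exact ⟨q, rfl⟩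
      · exact (hQ j (R'.refl _)).elim
    have hxP : ∀ x, ¬ R' (.inl x) P := fun x e => hn x i (R'.trans e hP)
    have e1 : ε' P = 1 := (hε' _ _ hP).trans hi
    have e2 : ε P = ε (.inl q) := hε _ _ h.joined
    rw [h.sad_symm_iff hε' hε, e1, e2]
    constructor
    · rintro ⟨H, hnum⟩ x
      have hq : ε' (.inl q) = ε (.inl q) := by
        refine Units.ext ?_
        simp only [Units.val_one] at hnum
        linarith
      by_cases hx : R' (.inl x) (.inl q)
      · rw [hε' _ _ hx, hε _ _ (h.le hx), hq]
      · exact H _ (hxP x) hx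
    · intro H
      refine ⟨fun y hy hy' => ?_, by rw [H q]; simp only [Units.val_one]; ring⟩
      rcases y with x | j
      · exact H x
      · exact (hy (R'.trans (hc j i) (R'.symm hP))).elim
  by_cases hP : R' P (.inr i)
  · exact key h hP
  by_cases hQ : R' Q (.inr i)
  · exact key h.symm hQ
  -- If neither point lies on the circle, both lie in `X`, where the two relations agree, so nothing
  -- would have been split.
  exfalso
  have inl : ∀ y, ¬ R' y (.inr i) → ∃ x, y = .inl x := by
    rintro (x | j) hy
    · exact ⟨x, rfl⟩
    · exact (hy (hc j i)).elim
  obtain ⟨p, rfl⟩ := inl P hP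
  obtain ⟨q, rfl⟩ := inl Q hQ
  exact h.1 ((hcomap p q).1 h.joined)

/-- A saddle absorbing a circle with negative sign. -/
theorem sad_circle_iff' [Finite X] {I : Type} [Finite I] {R R' : Setoid (X ⊕ I)} {P Q : X ⊕ I}
    (h : Merge R R' P Q ∨ Merge R' R P Q) (i : I) (hc : ∀ i j, R (.inr i) (.inr j))
    (hn : ∀ x i, ¬ R (.inl x) (.inr i))
    (hcomap : ∀ x y, R (.inl x) (.inl y) ↔ R' (.inl x) (.inl y)) (hit : ∀ y, ∃ x, R' y (.inl x))
    {ε ε' : X ⊕ I → ℤˣ} (hε : Const R ε) (hε' : Const R' ε') (hi : ε (.inr i) = -1) :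
    Sad R R' ε ε' ↔ ∀ x, ε' (.inl x) = ε (.inl x) := by
  rw [← sad_neg_iff, sad_circle_iff h.symm i hc hn (fun x y => (hcomap x y).symm) hit hε'.neg
    hε.neg (by simp [hi])]
  refine forall_congr' fun x => ?_
  simp only [Pi.neg_apply, neg_inj]
  exact eq_comm

/-- The sum of the signs when one circle lies outside. -/
theorem tau_circle [Finite X] {I : Type} [Finite I] {R : Setoid (X ⊕ I)} (i : I)
    (hc : ∀ i j, R (.inr i) (.inr j)) (hn : ∀ x i, ¬ R (.inl x) (.inr i)) {ε : X ⊕ I → ℤˣ}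
    (hε : Const R ε) (x₀ : X) :
    tau R ε = tau (R.comap Sum.inl) (ε ∘ Sum.inl) + ε (.inr i) := by
  -- Attach the outside circle to the class of `x₀`. The resulting classes are those of the
  -- restriction to `X`, and `Merge.tau_eq` compares the sums.
  let R' : Setoid (X ⊕ I) := Setoid.comap (Sum.elim id fun _ => x₀) (R.comap Sum.inl)
  have h : Merge R R' (.inl x₀) (.inr i) := by
    refine ⟨hn x₀ i, ?_⟩
    have e0 : R (.inl x₀) (.inl x₀) := R.refl _
    have hn' : ∀ x i, ¬ R (.inr i) (.inl x) := fun x i e => hn x i (R.symm e)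
    have hs : ∀ x y, R (.inl x) (.inl y) → R (.inl y) (.inl x) := fun x y e => R.symm e
    rintro (x | j) (y | j')
    · change R (.inl x) (.inl y) ↔ _
      have : R (.inl x) (.inl x₀) → R (.inl y) (.inl x₀) → R (.inl x) (.inl y) := fun a b =>
        R.trans a (R.symm b)
      have := hn x i
      have := hn y i
      tauto
    · change R (.inl x) (.inl x₀) ↔ _
      have := hn x j'
      have := hn x i
      have := hc j' i
      tauto
    · change R (.inl x₀) (.inl y) ↔ _
      have := hn' y j
      have := hn y i
      have := hc j i
      have := hs x₀ y
      have := hs y x₀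
      tauto
    · change R (.inl x₀) (.inl x₀) ↔ _
      have := hc j j'
      tauto
  have hε' : Const R' (ε ∘ Sum.inl ∘ Sum.elim id fun _ => x₀) := fun x y e => hε _ _ e
  have key := h.tau_eq hε hε' (by
    rintro (x | j) _ h2
    · rfl
    · exact (h2 (hc j i)).elim)
  have e : tau R' (ε ∘ Sum.inl ∘ Sum.elim id fun _ => x₀) =
      tau (R.comap Sum.inl) (ε ∘ Sum.inl) :=
    tau_comap (R.comap Sum.inl) (Sum.elim id fun _ => x₀)
      (fun y => ⟨.inl y, (R.comap Sum.inl).refl y⟩) (hε.comap Sum.inl)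
  rw [e] at key
  simp only [Function.comp, Sum.elim_inl, id] at key
  linarith

end Saddle

/-! ### Diagrams containing a tangle -/

namespace PD

open Saddle

variable {E : Type} {n m k b l : ℕ}

/-- The index of a crossing inside the tangle. -/
def inner (i : Fin k) : Fin (n + k) := ⟨i, by omega⟩

/-- The index of a crossing outside the tangle. -/
def outer (i : Fin n) : Fin (n + k) := ⟨i + k, by omega⟩

theorem inner_or_outer (i : Fin (n + k)) : (∃ j : Fin k, i = inner j) ∨ ∃ j : Fin n, i = outer j := by
  by_cases h : i.1 < k
  · exact Or.inl ⟨⟨i, h⟩, rfl⟩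
  · exact Or.inr ⟨⟨i - k, by omega⟩, Fin.ext (by simp [outer]; omega)⟩

/-- The markers inside and outside the tangle. -/
def joinMarkers (t : Fin k → Marker) (s : Fin n → Marker) (i : Fin (n + k)) : Marker :=
  if h : i.1 < k then t ⟨i, h⟩ else s ⟨i - k, by omega⟩

@[simp] theorem joinMarkers_inner (t : Fin k → Marker) (s : Fin n → Marker) (i : Fin k) :
    joinMarkers t s (inner i) = t i := by simp [joinMarkers, inner]

@[simp] theorem joinMarkers_outer (t : Fin k → Marker) (s : Fin n → Marker) (i : Fin n) :
    joinMarkers t s (outer i) = s i := by simp [joinMarkers, outer]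

theorem exists_joinMarkers (s : Fin (n + k) → Marker) : ∃ t s', s = joinMarkers t s' := by
  refine ⟨fun i => s (inner i), fun i => s (outer i), funext fun i => ?_⟩
  rcases inner_or_outer i with ⟨j, rfl⟩ | ⟨j, rfl⟩ <;> simp

theorem joinMarkers_inj {t t' : Fin k → Marker} {s s' : Fin n → Marker} :
    joinMarkers t s = joinMarkers t' s' ↔ t = t' ∧ s = s' := by
  refine ⟨fun h => ⟨funext fun i => ?_, funext fun i => ?_⟩, by rintro ⟨rfl, rfl⟩; rfl⟩
  · simpa using congrFun h (inner i)
  · simpa using congrFun h (outer i)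

/-- The crossings inside and outside the tangle. -/
noncomputable def sumFin (k n : ℕ) : Fin k ⊕ Fin n ≃ Fin (n + k) :=
  Equiv.ofBijective (Sum.elim inner outer) (by
    constructor
    · rintro (i | i) (j | j) h <;> simp only [Sum.elim_inl, Sum.elim_inr, inner, outer,
        Fin.mk.injEq] at h <;> first | (congr 1; ext; omega) | omega
    · intro i
      rcases inner_or_outer i with ⟨j, rfl⟩ | ⟨j, rfl⟩
      · exact ⟨.inl j, rfl⟩
      · exact ⟨.inr j, rfl⟩)

theorem sum_fin_add {M : Type} [AddCommMonoid M] (f : Fin (n + k) → M) :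
    ∑ i, f i = ∑ i : Fin k, f (inner i) + ∑ i : Fin n, f (outer i) := by
  rw [← Fintype.sum_equiv (sumFin k n) (fun i => f (sumFin k n i)) f fun _ => rfl,
    Fintype.sum_sum_type]
  rfl

theorem markerSum_join (t : Fin k → Marker) (s : Fin n → Marker) :
    markerSum (joinMarkers t s) = markerSum t + markerSum s := by
  simp [markerSum, sum_fin_add]

/-- The number of `B`-markers. -/
def countB (s : Fin n → Marker) : ℕ := (Finset.univ.filter fun w => s w = .B).card

/-- The crossings of the tangle come first, so every B-marker outside is counted after them. -/
theorem edgeSign_inner (t : Fin k → Marker) (s : Fin n → Marker) (v : Fin k) :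
    edgeSign (joinMarkers t s) (inner v) = (-1) ^ countB s * edgeSign t v := by
  rw [edgeSign, edgeSign, countB, ← pow_add, Finset.card_filter, Finset.card_filter,
    Finset.card_filter, sum_fin_add, add_comm]
  congr 2
  · refine Finset.sum_congr rfl fun i _ => ?_
    have : (inner v : Fin (n + k)) < outer i := by
      rw [Fin.lt_def]; simp only [inner, outer]; omega
    simp [this]
  · refine Finset.sum_congr rfl fun i _ => ?_
    have : (inner v : Fin (n + k)) < inner i ↔ v < i := Iff.rfl
    simp [this]

theorem edgeSign_outer (t : Fin k → Marker) (s : Fin n → Marker) (v : Fin n) :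
    edgeSign (joinMarkers t s) (outer v) = edgeSign s v := by
  rw [edgeSign, edgeSign, Finset.card_filter, Finset.card_filter, sum_fin_add]
  have e : ∀ i : Fin k, ¬ ((outer v : Fin (n + k)) < inner i) := fun i => by
    rw [Fin.lt_def]; simp only [inner, outer]; omega
  have e' : ∀ i : Fin n, ((outer v : Fin (n + k)) < outer i) ↔ v < i := fun i => by
    rw [Fin.lt_def, Fin.lt_def]; simp only [outer]; omega
  simp [e, e']

theorem update_inner (t : Fin k → Marker) (s : Fin n → Marker) (v : Fin k) (x : Marker) :
    Function.update (joinMarkers t s) (inner v) x = joinMarkers (Function.update t v x) s := by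
  funext i
  rcases inner_or_outer i with ⟨j, rfl⟩ | ⟨j, rfl⟩
  · by_cases h : j = v
    · subst h; simp
    · have : (inner j : Fin (n + k)) ≠ inner v := fun e => h (by
        simpa [inner, Fin.ext_iff] using e)
      simp [h, this]
  · have : (outer j : Fin (n + k)) ≠ inner v := fun e => by
      simp [inner, outer, Fin.ext_iff] at e; omega
    simp [this]

theorem update_outer (t : Fin k → Marker) (s : Fin n → Marker) (v : Fin n) (x : Marker) :
    Function.update (joinMarkers t s) (outer v) x = joinMarkers t (Function.update s v x) := by
  funext i
  rcases inner_or_outer i with ⟨j, rfl⟩ | ⟨j, rfl⟩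
  · have : (inner j : Fin (n + k)) ≠ outer v := fun e => by
      simp [inner, outer, Fin.ext_iff] at e; omega
    simp [this]
  · by_cases h : j = v
    · subst h; simp
    · have : (outer j : Fin (n + k)) ≠ outer v := fun e => h (by
        simpa [outer, Fin.ext_iff] using e)
      simp [h, this]

/-- The sign rule of a tensor product of complexes: one marker changes, either inside the tangle,
with a sign from the outside, or outside. -/
theorem ksgn_join (t t' : Fin k → Marker) (s s' : Fin n → Marker) :
    ksgn (joinMarkers t s) (joinMarkers t' s') =
      (if s = s' then (-1) ^ countB s * ksgn t t' else 0) + if t = t' then ksgn s s' else 0 := by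
  rw [ksgn, sum_fin_add]
  congr 1
  · rw [ksgn, Finset.mul_sum]
    split_ifs with h
    · subst h
      refine Finset.sum_congr rfl fun v _ => ?_
      simp only [update_inner, joinMarkers_inj, joinMarkers_inner, edgeSign_inner, and_true,
        mul_ite, mul_zero]
    · refine Finset.sum_eq_zero fun v _ => if_neg ?_
      rw [update_inner, joinMarkers_inj]
      exact fun e => h e.2.2.symm
  · rw [ksgn]
    split_ifs with h
    · subst h
      refine Finset.sum_congr rfl fun v _ => ?_
      simp only [update_outer, joinMarkers_inj, joinMarkers_outer, edgeSign_outer, true_and]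
    · refine Finset.sum_eq_zero fun v _ => if_neg ?_
      rw [update_outer, joinMarkers_inj]
      exact fun e => h e.2.1.symm

theorem ksgn_self (t : Fin k → Marker) : ksgn t t = 0 := by
  by_contra h
  obtain ⟨v, hv, e⟩ := exists_of_ksgn_ne_zero h
  have := congrFun e v
  rw [hv, Function.update_self] at this
  cases this

theorem ksgn_mul_self {t t' : Fin k → Marker} (h : ksgn t t' ≠ 0) : ksgn t t' * ksgn t t' = 1 := by
  obtain ⟨v, hv, rfl⟩ := exists_of_ksgn_ne_zero h
  rw [ksgn_update _ _ hv, edgeSign, ← pow_add, ← two_mul, pow_mul]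
  simp

theorem markerSum_of_ksgn {t t' : Fin k → Marker} (h : ksgn t t' ≠ 0) :
    markerSum t' = markerSum t - 2 := by
  obtain ⟨v, hv, rfl⟩ := exists_of_ksgn_ne_zero h
  exact markerSum_update _ _ hv

theorem Dich.merge {D : PD E n m} (hD : D.Dich) {s s' : Fin n → Marker} (h : ksgn s s' ≠ 0) :
    ∃ P Q, Merge (D.circles s) (D.circles s') P Q ∨ Merge (D.circles s') (D.circles s) P Q := by
  obtain ⟨v, hv, rfl⟩ := exists_of_ksgn_ne_zero h
  exact ⟨_, _, hD s v hv⟩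

/-- The equivalence relation on the edges outside a tangle given by the smoothing `s` outside the
tangle and the connections `r` of the end points of the tangle. -/
def outerCircles (G : PD E n m) (p : Fin b → E) (r : Fin b → Fin b → Prop)
    (s : Fin n → Marker) : Setoid E :=
  Relation.EqvGen.setoid fun x y => G.Joined s x y ∨ ∃ i j, r i j ∧ p i = x ∧ p j = y

theorem outerCircles_le {G : PD E n m} {p : Fin b → E} {r : Fin b → Fin b → Prop}
    {s : Fin n → Marker} {S : Setoid E} (h1 : ∀ x y, G.Joined s x y → S x y)
    (h2 : ∀ i j, r i j → S (p i) (p j)) {x y : E} (h : outerCircles G p r s x y) : S x y := by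
  have : outerCircles G p r s ≤ S := by
    refine Setoid.eqvGen_le fun x y hxy => ?_
    rcases hxy with hxy | ⟨i, j, hr, rfl, rfl⟩
    · exact h1 _ _ hxy
    · exact h2 _ _ hr
  exact this h

theorem outerCircles_joined {G : PD E n m} {p : Fin b → E} {r : Fin b → Fin b → Prop}
    {s : Fin n → Marker} {x y : E} (h : G.Joined s x y) : outerCircles G p r s x y :=
  Relation.EqvGen.rel _ _ (Or.inl h)

theorem outerCircles_tangle {G : PD E n m} {p : Fin b → E} {r : Fin b → Fin b → Prop}
    {s : Fin n → Marker} {i j : Fin b} (h : r i j) : outerCircles G p r s (p i) (p j) :=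
  Relation.EqvGen.rel _ _ (Or.inr ⟨i, j, h, rfl, rfl⟩)

/-- The diagram `D` consists of the tangle `T` with end points `p` and the diagram `G`. -/
structure IsGlued (D : PD (E ⊕ Fin l) (n + k) m) (G : PD E n m) (T : PD (Fin b ⊕ Fin l) k 0)
    (p : Fin b → E) : Prop where
  crossing_inner : ∀ i c, D.crossing (inner i) c = Sum.map p id (T.crossing i c)
  crossing_outer : ∀ i c, D.crossing (outer i) c = .inl (G.crossing i c)
  arc : ∀ j c, D.arc j c = .inl (G.arc j c)

/-- The connections of the end points of a smoothing of a tangle. -/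
def ends (T : PD (Fin b ⊕ Fin l) k 0) (t : Fin k → Marker) (i j : Fin b) : Prop :=
  T.circles t (.inl i) (.inl j)

namespace IsGlued

variable {D : PD (E ⊕ Fin l) (n + k) m} {G : PD E n m} {T : PD (Fin b ⊕ Fin l) k 0} {p : Fin b → E}

theorem joined_tangle (h : D.IsGlued G T p) {t : Fin k → Marker} {s : Fin n → Marker}
    {x y : Fin b ⊕ Fin l} (hxy : T.Joined t x y) :
    D.Joined (joinMarkers t s) (Sum.map p id x) (Sum.map p id y) := by
  rcases hxy with ⟨i, hi⟩ | ⟨i, hi⟩ | ⟨i, hi⟩ | ⟨i, hi⟩ | ⟨j⟩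
  · rw [← h.crossing_inner, ← h.crossing_inner]; exact Joined.A₁ _ (by simp [hi])
  · rw [← h.crossing_inner, ← h.crossing_inner]; exact Joined.A₂ _ (by simp [hi])
  · rw [← h.crossing_inner, ← h.crossing_inner]; exact Joined.B₁ _ (by simp [hi])
  · rw [← h.crossing_inner, ← h.crossing_inner]; exact Joined.B₂ _ (by simp [hi])
  · exact j.elim0

theorem joined_outer (h : D.IsGlued G T p) {t : Fin k → Marker} {s : Fin n → Marker}
    {x y : E} (hxy : G.Joined s x y) : D.Joined (joinMarkers t s) (.inl x) (.inl y) := by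
  rcases hxy with ⟨i, hi⟩ | ⟨i, hi⟩ | ⟨i, hi⟩ | ⟨i, hi⟩ | ⟨j⟩
  · rw [← h.crossing_outer, ← h.crossing_outer]; exact Joined.A₁ _ (by simp [hi])
  · rw [← h.crossing_outer, ← h.crossing_outer]; exact Joined.A₂ _ (by simp [hi])
  · rw [← h.crossing_outer, ← h.crossing_outer]; exact Joined.B₁ _ (by simp [hi])
  · rw [← h.crossing_outer, ← h.crossing_outer]; exact Joined.B₂ _ (by simp [hi])
  · rw [← h.arc, ← h.arc]; exact Joined.arc _

theorem circles_tangle (h : D.IsGlued G T p) {t : Fin k → Marker} {s : Fin n → Marker}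
    {x y : Fin b ⊕ Fin l} (hxy : T.circles t x y) :
    D.circles (joinMarkers t s) (Sum.map p id x) (Sum.map p id y) :=
  circles_le (r := (D.circles (joinMarkers t s)).comap (Sum.map p id))
    (fun _ _ e => circles_of_joined (h.joined_tangle e)) hxy

theorem circles_le_of (h : D.IsGlued G T p) {t : Fin k → Marker} {s : Fin n → Marker}
    {S : Setoid (E ⊕ Fin l)} (h1 : ∀ x y, T.Joined t x y → S (Sum.map p id x) (Sum.map p id y))
    (h2 : ∀ x y, G.Joined s x y → S (.inl x) (.inl y)) {x y : E ⊕ Fin l}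
    (hxy : D.circles (joinMarkers t s) x y) : S x y := by
  refine circles_le ?_ hxy
  rintro x y (⟨i, hi⟩ | ⟨i, hi⟩ | ⟨i, hi⟩ | ⟨i, hi⟩ | ⟨j⟩)
  · rcases inner_or_outer i with ⟨i, rfl⟩ | ⟨i, rfl⟩
    · rw [h.crossing_inner, h.crossing_inner]; exact h1 _ _ (Joined.A₁ _ (by simpa using hi))
    · rw [h.crossing_outer, h.crossing_outer]; exact h2 _ _ (Joined.A₁ _ (by simpa using hi))
  · rcases inner_or_outer i with ⟨i, rfl⟩ | ⟨i, rfl⟩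
    · rw [h.crossing_inner, h.crossing_inner]; exact h1 _ _ (Joined.A₂ _ (by simpa using hi))
    · rw [h.crossing_outer, h.crossing_outer]; exact h2 _ _ (Joined.A₂ _ (by simpa using hi))
  · rcases inner_or_outer i with ⟨i, rfl⟩ | ⟨i, rfl⟩
    · rw [h.crossing_inner, h.crossing_inner]; exact h1 _ _ (Joined.B₁ _ (by simpa using hi))
    · rw [h.crossing_outer, h.crossing_outer]; exact h2 _ _ (Joined.B₁ _ (by simpa using hi))
  · rcases inner_or_outer i with ⟨i, rfl⟩ | ⟨i, rfl⟩
    · rw [h.crossing_inner, h.crossing_inner]; exact h1 _ _ (Joined.B₂ _ (by simpa using hi))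
    · rw [h.crossing_outer, h.crossing_outer]; exact h2 _ _ (Joined.B₂ _ (by simpa using hi))
  · rw [h.arc, h.arc]; exact h2 _ _ (Joined.arc _)

end IsGlued

/-- A smoothing of a tangle without closed circles. -/
def Open (T : PD (Fin b ⊕ Fin l) k 0) (t : Fin k → Marker) : Prop :=
  ∀ i, ∃ j, T.circles t (.inr i) (.inl j)

/-- A smoothing of a tangle in which all the interior edges form one circle. -/
def Closed (T : PD (Fin b ⊕ Fin l) k 0) (t : Fin k → Marker) : Prop :=
  (∀ i j, T.circles t (.inr i) (.inr j)) ∧ ∀ i j, ¬ T.circles t (.inl i) (.inr j)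

namespace IsGlued

variable {D : PD (E ⊕ Fin l) (n + k) m} {G : PD E n m} {T : PD (Fin b ⊕ Fin l) k 0} {p : Fin b → E}

theorem outer_le (h : D.IsGlued G T p) {t : Fin k → Marker} {s : Fin n → Marker} {x y : E}
    (hxy : outerCircles G p (T.ends t) s x y) : D.circles (joinMarkers t s) (.inl x) (.inl y) :=
  outerCircles_le (S := (D.circles (joinMarkers t s)).comap Sum.inl)
    (fun _ _ e => circles_of_joined (h.joined_outer e)) (fun _ _ e => h.circles_tangle e) hxy

/-- The projection of the interior edges to edges outside the tangle, for a smoothing without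
closed circles. -/
theorem exists_projection (h : D.IsGlued G T p) {t : Fin k → Marker} (ht : T.Open t) :
    ∃ φ : E ⊕ Fin l → E, (∀ x, φ (.inl x) = x) ∧ ∀ s,
      (∀ y, D.circles (joinMarkers t s) y (.inl (φ y))) ∧
      ∀ x y, D.circles (joinMarkers t s) x y ↔ outerCircles G p (T.ends t) s (φ x) (φ y) := by
  choose ρ hρ using ht
  let φ : E ⊕ Fin l → E := Sum.elim id fun i => p (ρ i)
  have h1 : ∀ s y, D.circles (joinMarkers t s) y (.inl (φ y)) := by
    rintro s (x | i)
    · exact Setoid.refl' _ _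
    · exact h.circles_tangle (hρ i)
  refine ⟨φ, fun x => rfl, fun s => ⟨h1 s, fun x y => ⟨fun e => ?_, fun e => ?_⟩⟩⟩
  · refine h.circles_le_of (S := (outerCircles G p (T.ends t) s).comap φ) (fun x y hxy => ?_)
      (fun x y hxy => outerCircles_joined hxy) e
    have key : ∀ z, ∃ j, φ (Sum.map p id z) = p j ∧ T.circles t z (.inl j) := by
      rintro (j | i)
      · exact ⟨j, rfl, Setoid.refl' _ _⟩
      · exact ⟨ρ i, rfl, hρ i⟩
    obtain ⟨i, hi, hxi⟩ := key x
    obtain ⟨j, hj, hyj⟩ := key y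
    change outerCircles G p (T.ends t) s (φ _) (φ _)
    rw [hi, hj]
    refine outerCircles_tangle ?_
    exact Setoid.trans' _ (Setoid.symm' _ hxi) (Setoid.trans' _ (circles_of_joined hxy) hyj)
  · exact Setoid.trans' _ (h1 s x) (Setoid.trans' _ (h.outer_le e) (Setoid.symm' _ (h1 s y)))

/-- Send all interior edges to one additional class. This respects all generators, since a closed
circle is never joined to an end point. -/
theorem circles_closed (h : D.IsGlued G T p) {t : Fin k → Marker} (ht : T.Closed t)
    {s : Fin n → Marker} {x y : E ⊕ Fin l} (hxy : D.circles (joinMarkers t s) x y) :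
    (∃ x' y', x = .inl x' ∧ y = .inl y' ∧ outerCircles G p (T.ends t) s x' y') ∨
      ∃ i j, x = .inr i ∧ y = .inr j := by
  let ψ : E ⊕ Fin l → Option (Quotient (outerCircles G p (T.ends t) s)) :=
    Sum.elim (fun x => some (Quotient.mk _ x)) fun _ => none
  have key : ψ x = ψ y := by
    refine h.circles_le_of (S := Setoid.ker ψ) (fun x y hxy => ?_) (fun x y hxy => ?_) hxy
    · change ψ _ = ψ _
      rcases x with i | i <;> rcases y with j | j
      · exact congrArg some (Quotient.sound (outerCircles_tangle (circles_of_joined hxy)))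
      · exact (ht.2 i j (circles_of_joined hxy)).elim
      · exact (ht.2 j i (Setoid.symm' _ (circles_of_joined hxy))).elim
      · rfl
    · exact congrArg some (Quotient.sound (outerCircles_joined hxy))
  rcases x with x | i <;> rcases y with y | j
  · exact Or.inl ⟨x, y, rfl, rfl, Quotient.exact (Option.some.inj key)⟩
  · cases key
  · cases key
  · exact Or.inr ⟨i, j, rfl, rfl⟩

theorem closed_inr (h : D.IsGlued G T p) {t : Fin k → Marker} (ht : T.Closed t)
    (s : Fin n → Marker) (i j : Fin l) : D.circles (joinMarkers t s) (.inr i) (.inr j) :=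
  h.circles_tangle (ht.1 i j)

theorem closed_not (h : D.IsGlued G T p) {t : Fin k → Marker} (ht : T.Closed t)
    (s : Fin n → Marker) (x : E) (j : Fin l) : ¬ D.circles (joinMarkers t s) (.inl x) (.inr j) := by
  intro e
  rcases h.circles_closed ht e with ⟨_, _, -, e, -⟩ | ⟨_, _, e, -⟩ <;> cases e

/-- Outside the tangle, a smoothing is visible only through the connections of the end points. -/
theorem comap_inl (h : D.IsGlued G T p) {t : Fin k → Marker} (ht : T.Open t ∨ T.Closed t)
    (s : Fin n → Marker) :
    (D.circles (joinMarkers t s)).comap Sum.inl = outerCircles G p (T.ends t) s := by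
  ext x y
  refine ⟨fun e => ?_, h.outer_le⟩
  rcases ht with ht | ht
  · obtain ⟨φ, hφ, hs⟩ := h.exists_projection ht
    have := ((hs s).2 _ _).1 e
    rwa [hφ, hφ] at this
  · rcases h.circles_closed ht e with ⟨x', y', hx, hy, e⟩ | ⟨_, _, e, -⟩
    · cases hx; cases hy; exact e
    · cases e

theorem open_hit (h : D.IsGlued G T p) {t : Fin k → Marker} (ht : T.Open t) (s : Fin n → Marker)
    (y : E ⊕ Fin l) : ∃ x, D.circles (joinMarkers t s) y (.inl x) := by
  obtain ⟨φ, -, hs⟩ := h.exists_projection ht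
  exact ⟨φ y, (hs s).1 y⟩

theorem exists_state_open (h : D.IsGlued G T p) {t : Fin k → Marker} (ht : T.Open t)
    {s : Fin n → Marker} {ε : E → ℤˣ} (hε : Const (outerCircles G p (T.ends t) s) ε) :
    ∃ σ : D.EnhancedState, σ.marker = joinMarkers t s ∧ ∀ x, σ.sign (.inl x) = ε x := by
  obtain ⟨φ, hφ, hs⟩ := h.exists_projection ht
  exact ⟨.ofConst D (joinMarkers t s) (ε ∘ φ) fun x y e => hε _ _ (((hs s).2 x y).1 e), rfl,
    fun x => congrArg ε (hφ x)⟩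

theorem exists_state_closed (h : D.IsGlued G T p) {t : Fin k → Marker} (ht : T.Closed t)
    {s : Fin n → Marker} {ε : E → ℤˣ} (hε : Const (outerCircles G p (T.ends t) s) ε) (u : ℤˣ) :
    ∃ σ : D.EnhancedState, σ.marker = joinMarkers t s ∧ (∀ x, σ.sign (.inl x) = ε x) ∧
      ∀ i, σ.sign (.inr i) = u := by
  refine ⟨.ofConst D (joinMarkers t s) (Sum.elim ε fun _ => u) fun x y e => ?_, rfl,
    fun _ => rfl, fun _ => rfl⟩
  rcases h.circles_closed ht e with ⟨x', y', rfl, rfl, he⟩ | ⟨i, j, rfl, rfl⟩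
  · exact hε _ _ he
  · rfl

theorem state_ext_open (h : D.IsGlued G T p) {t : Fin k → Marker} (ht : T.Open t)
    {s : Fin n → Marker} {σ σ' : D.EnhancedState} (hσ : σ.marker = joinMarkers t s)
    (hσ' : σ'.marker = joinMarkers t s) (e : ∀ x, σ.sign (.inl x) = σ'.sign (.inl x)) :
    σ = σ' := by
  refine EnhancedState.ext (hσ.trans hσ'.symm) (funext fun y => ?_)
  obtain ⟨x, hx⟩ := h.open_hit ht s y
  rw [σ.const _ _ (hσ ▸ hx), σ'.const _ _ (hσ' ▸ hx), e]

theorem state_ext_closed (h : D.IsGlued G T p) {t : Fin k → Marker} (ht : T.Closed t)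
    {s : Fin n → Marker} {σ σ' : D.EnhancedState} (hσ : σ.marker = joinMarkers t s)
    (hσ' : σ'.marker = joinMarkers t s) (e : ∀ x, σ.sign (.inl x) = σ'.sign (.inl x)) (i : Fin l)
    (ei : σ.sign (.inr i) = σ'.sign (.inr i)) : σ = σ' := by
  refine EnhancedState.ext (hσ.trans hσ'.symm) (funext fun y => ?_)
  rcases y with x | j
  · exact e x
  · have := h.closed_inr ht s j i
    rw [σ.const _ _ (hσ ▸ this), σ'.const _ _ (hσ' ▸ this), ei]

theorem const_inl (h : D.IsGlued G T p) {t : Fin k → Marker} (ht : T.Open t ∨ T.Closed t)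
    {s : Fin n → Marker} {σ : D.EnhancedState} (hσ : σ.marker = joinMarkers t s) :
    Const (outerCircles G p (T.ends t) s) fun x => σ.sign (.inl x) := by
  rw [← h.comap_inl ht, ← hσ]
  exact σ.const.comap Sum.inl

open Classical in
theorem incidence_eq [Finite E] (hD : D.Dich) {σ σ' : D.EnhancedState} {t t' : Fin k → Marker}
    {s s' : Fin n → Marker} (hσ : σ.marker = joinMarkers t s) (hσ' : σ'.marker = joinMarkers t' s') :
    σ.incidence σ' = ((if s = s' then (-1) ^ countB s * ksgn t t' else 0) +
        if t = t' then ksgn s s' else 0) *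
      if Sad (D.circles (joinMarkers t s)) (D.circles (joinMarkers t' s')) σ.sign σ'.sign
        then 1 else 0 := by
  rw [PD.incidence_eq hD, hσ, hσ', ksgn_join]

-- Without closed circles every circle has an edge outside the tangle, so the whole saddle is
-- visible there.
open Classical in
theorem incidence_open [Finite E] (h : D.IsGlued G T p) (hD : D.Dich) {σ σ' : D.EnhancedState}
    {t t' : Fin k → Marker} {s s' : Fin n → Marker} (ht : T.Open t) (ht' : T.Open t')
    (hσ : σ.marker = joinMarkers t s) (hσ' : σ'.marker = joinMarkers t' s') :
    σ.incidence σ' = ((if s = s' then (-1) ^ countB s * ksgn t t' else 0) +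
        if t = t' then ksgn s s' else 0) *
      if Sad (outerCircles G p (T.ends t) s) (outerCircles G p (T.ends t') s')
        (fun x => σ.sign (.inl x)) (fun x => σ'.sign (.inl x)) then 1 else 0 := by
  rw [incidence_eq hD hσ hσ']
  by_cases hk : ksgn (joinMarkers t s) (joinMarkers t' s') = 0
  · rw [ksgn_join] at hk
    rw [hk, zero_mul, zero_mul]
  · obtain ⟨P, Q, hPQ⟩ := hD.merge hk
    have hε := σ.const
    have hε' := σ'.const
    rw [hσ] at hε
    rw [hσ'] at hε'
    have := sad_comap_iff hPQ Sum.inl hε hε' fun y =>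
      Or.inl ⟨h.open_hit ht s y, h.open_hit ht' s' y⟩
    rw [h.comap_inl (Or.inl ht), h.comap_inl (Or.inl ht')] at this
    congr 1
    exact if_congr this rfl rfl

-- The component of the comultiplication along X on the new circle is the identity on the remaining
-- signs.
open Classical in
theorem incidence_split [Finite E] (h : D.IsGlued G T p) (hD : D.Dich) {σ σ' : D.EnhancedState}
    {t t' : Fin k → Marker} {s s' : Fin n → Marker} (ht : T.Open t) (ht' : T.Closed t')
    (hends : T.ends t = T.ends t') (i : Fin l)
    (hσ : σ.marker = joinMarkers t s) (hσ' : σ'.marker = joinMarkers t' s')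
    (hi : σ'.sign (.inr i) = 1) :
    σ.incidence σ' = (if s = s' then (-1) ^ countB s * ksgn t t' else 0) *
      if ∀ x, σ'.sign (.inl x) = σ.sign (.inl x) then 1 else 0 := by
  have htt : t ≠ t' := by
    rintro rfl
    obtain ⟨j, hj⟩ := ht i
    exact ht'.2 j i (Setoid.symm' _ hj)
  rw [incidence_eq hD hσ hσ', if_neg htt, add_zero]
  by_cases hs : s = s'
  swap
  · rw [if_neg hs, zero_mul, zero_mul]
  subst hs
  by_cases hk : ksgn t t' = 0
  · rw [hk]; simp
  have hk' : ksgn (joinMarkers t s) (joinMarkers t' s) ≠ 0 := by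
    rw [ksgn_join, if_neg htt]; simpa using hk
  obtain ⟨P, Q, hPQ⟩ := hD.merge hk'
  have hε := σ.const
  have hε' := σ'.const
  rw [hσ] at hε
  rw [hσ'] at hε'
  have hcomap : ∀ x y, D.circles (joinMarkers t s) (.inl x) (.inl y) ↔
      D.circles (joinMarkers t' s) (.inl x) (.inl y) := fun x y => by
    have e : (D.circles (joinMarkers t s)).comap Sum.inl =
        (D.circles (joinMarkers t' s)).comap Sum.inl := by
      rw [h.comap_inl (Or.inl ht), h.comap_inl (Or.inr ht'), hends]
    exact iff_of_eq (congrArg (fun S : Setoid E => S x y) e)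
  congr 1
  exact if_congr (sad_circle_iff hPQ i (h.closed_inr ht' s) (h.closed_not ht' s) hcomap
    (h.open_hit ht s) hε hε' hi) rfl rfl

-- A circle with sign − is the unit of the algebra, so absorbing it leaves the other signs alone.
open Classical in
theorem incidence_absorb [Finite E] (h : D.IsGlued G T p) (hD : D.Dich) {σ σ' : D.EnhancedState}
    {t t' : Fin k → Marker} {s s' : Fin n → Marker} (ht : T.Closed t) (ht' : T.Open t')
    (hends : T.ends t = T.ends t') (i : Fin l)
    (hσ : σ.marker = joinMarkers t s) (hσ' : σ'.marker = joinMarkers t' s')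
    (hi : σ.sign (.inr i) = -1) :
    σ.incidence σ' = (if s = s' then (-1) ^ countB s * ksgn t t' else 0) *
      if ∀ x, σ'.sign (.inl x) = σ.sign (.inl x) then 1 else 0 := by
  have htt : t ≠ t' := by
    rintro rfl
    obtain ⟨j, hj⟩ := ht' i
    exact ht.2 j i (Setoid.symm' _ hj)
  rw [incidence_eq hD hσ hσ', if_neg htt, add_zero]
  by_cases hs : s = s'
  swap
  · rw [if_neg hs, zero_mul, zero_mul]
  subst hs
  by_cases hk : ksgn t t' = 0
  · rw [hk]; simp
  have hk' : ksgn (joinMarkers t s) (joinMarkers t' s) ≠ 0 := by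
    rw [ksgn_join, if_neg htt]; simpa using hk
  obtain ⟨P, Q, hPQ⟩ := hD.merge hk'
  have hε := σ.const
  have hε' := σ'.const
  rw [hσ] at hε
  rw [hσ'] at hε'
  have hcomap : ∀ x y, D.circles (joinMarkers t s) (.inl x) (.inl y) ↔
      D.circles (joinMarkers t' s) (.inl x) (.inl y) := fun x y => by
    have e : (D.circles (joinMarkers t s)).comap Sum.inl =
        (D.circles (joinMarkers t' s)).comap Sum.inl := by
      rw [h.comap_inl (Or.inr ht), h.comap_inl (Or.inl ht'), hends]
    exact iff_of_eq (congrArg (fun S : Setoid E => S x y) e)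
  congr 1
  exact if_congr (sad_circle_iff' hPQ i (h.closed_inr ht s) (h.closed_not ht s) hcomap
    (h.open_hit ht' s) hε hε' hi) rfl rfl

/-- Between states with the same closed circle, the incidence number is that of the outer part. -/
theorem sign_eq_of_closed [Finite E] (h : D.IsGlued G T p) (hD : D.Dich) {σ σ' : D.EnhancedState}
    {t : Fin k → Marker} {s s' : Fin n → Marker} (ht : T.Closed t) (i : Fin l)
    (hσ : σ.marker = joinMarkers t s) (hσ' : σ'.marker = joinMarkers t s')
    (hinc : σ.incidence σ' ≠ 0) : σ'.sign (.inr i) = σ.sign (.inr i) := by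
  classical
  rw [incidence_eq hD hσ hσ'] at hinc
  have hs : Sad (D.circles (joinMarkers t s)) (D.circles (joinMarkers t s')) σ.sign σ'.sign := by
    by_contra hc
    exact hinc (by rw [if_neg hc, mul_zero])
  refine hs.2 _ fun y => ?_
  rcases y with x | j
  · exact iff_of_false (fun e => h.closed_not ht s x i (Setoid.symm' _ e))
      fun e => h.closed_not ht s' x i (Setoid.symm' _ e)
  · exact iff_of_true (h.closed_inr ht s i j) (h.closed_inr ht s' i j)

open Classical in
theorem incidence_closed [Finite E] (h : D.IsGlued G T p) (hD : D.Dich) {σ σ' : D.EnhancedState}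
    {t : Fin k → Marker} {s s' : Fin n → Marker} (ht : T.Closed t) (i : Fin l)
    (hσ : σ.marker = joinMarkers t s) (hσ' : σ'.marker = joinMarkers t s')
    (hi : σ'.sign (.inr i) = σ.sign (.inr i)) :
    σ.incidence σ' = ksgn s s' *
      if Sad (outerCircles G p (T.ends t) s) (outerCircles G p (T.ends t) s')
        (fun x => σ.sign (.inl x)) (fun x => σ'.sign (.inl x)) then 1 else 0 := by
  rw [incidence_eq hD hσ hσ', ksgn_self, mul_zero, ite_self, zero_add, if_pos rfl]
  by_cases hk : ksgn s s' = 0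
  · rw [hk, zero_mul, zero_mul]
  have hk' : ksgn (joinMarkers t s) (joinMarkers t s') ≠ 0 := by
    rw [ksgn_join, if_pos rfl, ksgn_self]; simpa using hk
  obtain ⟨P, Q, hPQ⟩ := hD.merge hk'
  have hε := σ.const
  have hε' := σ'.const
  rw [hσ] at hε
  rw [hσ'] at hε'
  have := sad_comap_iff hPQ Sum.inl hε hε' fun y => by
    rcases y with x | j
    · exact Or.inl ⟨⟨x, Setoid.refl' _ _⟩, ⟨x, Setoid.refl' _ _⟩⟩
    · refine Or.inr ⟨fun z => ?_, ?_⟩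
      · rcases z with x | j'
        · exact iff_of_false (fun e => h.closed_not ht s x j (Setoid.symm' _ e))
            fun e => h.closed_not ht s' x j (Setoid.symm' _ e)
        · exact iff_of_true (h.closed_inr ht s j j') (h.closed_inr ht s' j j')
      · rw [hε _ _ (h.closed_inr ht s j i), hε' _ _ (h.closed_inr ht s' j i), hi]
  rw [h.comap_inl (Or.inr ht), h.comap_inl (Or.inr ht)] at this
  congr 1
  exact if_congr this rfl rfl

end IsGlued

end PD

/-! ### Cancellation of a closed circle in a tangle -/

namespace BasedComplex

theorem homology_equiv_of_iso {C C' : BasedComplex} {k l : ℤ}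
    (j : C'.basis → C.basis) (hj : Function.Bijective j) (η : C'.basis → ℤ)
    (hη : ∀ x, η x * η x = 1) (wtj : ∀ x, C'.wa x = C.wa (j x) + k ∧ C'.wb x = C.wb (j x) + l)
    (hinc : ∀ x y, C'.inc x y = η x * η y * C.inc (j x) (j y)) (a b : ℤ) :
    Nonempty (C.Homology a b ≃ₗ[ℤ] C'.Homology (a + k) (b + l)) := by
  classical
  let g : Matrix C'.basis C.basis ℤ := fun x s => if j x = s then η x else 0
  have g_apply : ∀ x s, g x s = if j x = s then η x else 0 := fun _ _ => rfl
  have g_mul : ∀ {D : BasedComplex} (M : Matrix C.basis D.basis ℤ) x t,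
      (g * M) x t = η x * M (j x) t := by
    intro D M x t
    rw [Matrix.mul_apply]
    simp [g_apply]
  have mul_gt : ∀ {D : BasedComplex} (M : Matrix D.basis C.basis ℤ) s x,
      (M * g.transpose) s x = M s (j x) * η x := by
    intro D M s x
    rw [Matrix.mul_apply]
    simp [g_apply]
  have gg : g * g.transpose = 1 := by
    ext x y
    rw [mul_gt, g_apply, Matrix.one_apply]
    by_cases hxy : x = y
    · simp [hxy, hη]
    · simp [hxy, hj.1.ne hxy]
  have gg' : g.transpose * g = 1 := by
    ext s t
    obtain ⟨x, rfl⟩ := hj.2 s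
    rw [Matrix.mul_apply, Finset.sum_eq_single x, Matrix.transpose_apply, g_apply, g_apply,
      Matrix.one_apply]
    · by_cases hst : j x = t <;> simp [hst, hη]
    · intro y _ hy
      rw [Matrix.transpose_apply, g_apply, if_neg (hj.1.ne hy), zero_mul]
    · simp
  have gd : C'.diff * g = g * C.diff := by
    have e : C'.diff = g * C.diff * g.transpose := by
      ext x y
      rw [mul_gt, g_mul]
      change C'.inc x y = η x * C.inc (j x) (j y) * η y
      rw [hinc]
      ring
    rw [e, Matrix.mul_assoc, gg', Matrix.mul_one]
  have wg : Homogeneous (C := C') (C' := C) (-k) (-l) g := fun x s hst => by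
    rw [g_apply] at hst
    have hs : j x = s := by by_contra e; simp [e] at hst
    obtain ⟨h1, h2⟩ := wtj x
    rw [← hs]
    constructor <;> linarith
  have wgt : Homogeneous (C := C) (C' := C') k l g.transpose := fun s x hst => by
    obtain ⟨h1, h2⟩ := wg x s hst
    constructor <;> linarith
  refine homology_equiv_of_homotopy (f := g.transpose) (g := g) (h := 0) wgt wg
    (fun _ _ h => (h rfl).elim) ?_ gd gg ?_ a b
  · calc C.diff * g.transpose = g.transpose * g * C.diff * g.transpose := by
          rw [gg', Matrix.one_mul]
      _ = g.transpose * C'.diff * (g * g.transpose) := by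
          rw [Matrix.mul_assoc g.transpose g, ← gd]; simp only [Matrix.mul_assoc]
      _ = _ := by rw [gg, Matrix.mul_one]
  · rw [gg', Matrix.zero_mul, Matrix.mul_zero, sub_zero, sub_zero]

end BasedComplex

namespace PD

open Saddle

variable {E : Type} {n m k b l : ℕ}

theorem complex_sum [Finite E] {D : PD E n m} (hD : D.Dich) (s t : D.complex.basis) :
    ∑ u, D.complex.inc s u * D.complex.inc u t = 0 := sum_incidence_mul hD s t

/-- The complex spanned by the smoothings of a tangle diagram `G` closed up by the connections
`r t` of its end points, for the `t` in `N`. -/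
noncomputable def model [Finite E] (G : PD E n m) (p : Fin b → E) (N : (Fin k → Marker) → Prop)
    (r : (Fin k → Marker) → Fin b → Fin b → Prop) (κ : (Fin k → Marker) → (Fin k → Marker) → ℤ) :
    BasedComplex where
  basis := {x : (Fin k → Marker) × (Fin n → Marker) × (E → ℤˣ) //
    N x.1 ∧ Const (outerCircles G p (r x.1) x.2.1) x.2.2}
  finite := inferInstance
  inc x y := by
    classical
    exact ((if x.1.2.1 = y.1.2.1 then (-1) ^ countB x.1.2.1 * κ x.1.1 y.1.1 else 0) +
        if x.1.1 = y.1.1 then ksgn x.1.2.1 y.1.2.1 else 0) *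
      if Sad (outerCircles G p (r x.1.1) x.1.2.1) (outerCircles G p (r y.1.1) y.1.2.1)
        x.1.2.2 y.1.2.2 then 1 else 0
  wa x := markerSum x.1.1 + markerSum x.1.2.1
  wb x := markerSum x.1.1 + markerSum x.1.2.1 +
    2 * tau (outerCircles G p (r x.1.1) x.1.2.1) x.1.2.2

/-- In the tangle `T`, the circle of the smoothing `t₀` can be cancelled against the smoothings
`tq` and `tp`. -/
structure Cancels (T : PD (Fin b ⊕ Fin l) k 0) (t₀ tq tp : Fin k → Marker) : Prop where
  closed : T.Closed t₀
  isOpen : ∀ t, t ≠ t₀ → T.Open t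
  down : ksgn t₀ tq ≠ 0
  up : ksgn tp t₀ ≠ 0
  ends_down : ∀ t, ksgn t₀ t ≠ 0 → T.ends t = T.ends t₀
  ends_up : ∀ t, ksgn t t₀ ≠ 0 → T.ends t = T.ends t₀

/-- The incidence numbers of the smoothings after the cancellation. -/
def cancelled (t₀ tq tp t t' : Fin k → Marker) : ℤ :=
  ksgn t t' - ksgn t tq * ksgn t₀ tq * ksgn t₀ t' - ksgn t t₀ * ksgn tp t₀ * ksgn tp t'

theorem neg_one_pow_mul_self (c : ℕ) : (-1 : ℤ) ^ c * (-1) ^ c = 1 := by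
  rw [← pow_add, ← two_mul, pow_mul]; simp

/-- Gaussian elimination: the closed circle with sign − maps isomorphically to `tq`, and `tp` maps
isomorphically to the circle with sign +. The two subtracted terms of `cancelled` are the zigzags
through these two isomorphisms. -/
theorem IsGlued.cancel [Finite E] {D : PD (E ⊕ Fin l) (n + k) m} {G : PD E n m}
    {T : PD (Fin b ⊕ Fin l) k 0} {p : Fin b → E} (h : D.IsGlued G T p) (hD : D.Dich)
    {t₀ tq tp : Fin k → Marker} (hT : T.Cancels t₀ tq tp) (i : Fin l) (a c : ℤ) :
    Nonempty (D.complex.Homology a c ≃ₗ[ℤ] (model G p (fun t => t ≠ t₀ ∧ t ≠ tq ∧ t ≠ tp) T.ends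
      (cancelled t₀ tq tp)).Homology a c) := by
  classical
  have mq := markerSum_of_ksgn hT.down
  have mp := markerSum_of_ksgn hT.up
  have hq0 : tq ≠ t₀ := by rintro rfl; omega
  have hp0 : tp ≠ t₀ := by rintro rfl; omega
  have hpq : tp ≠ tq := by rintro rfl; omega
  have kpq : ksgn tp tq = 0 := by
    by_contra e
    have := markerSum_of_ksgn e
    omega
  have oq := hT.isOpen tq hq0
  have op := hT.isOpen tp hp0
  have eq' := hT.ends_down tq hT.down
  have ep := hT.ends_up tp hT.up
  let inT : D.EnhancedState → Fin k → Marker := fun σ i => σ.marker (inner i)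
  let outS : D.EnhancedState → Fin n → Marker := fun σ i => σ.marker (outer i)
  let sg : D.EnhancedState → E → ℤˣ := fun σ x => σ.sign (.inl x)
  have hm : ∀ σ, σ.marker = joinMarkers (inT σ) (outS σ) := fun σ => by
    obtain ⟨t, s, e⟩ := exists_joinMarkers σ.marker
    simp only [inT, outS, e, joinMarkers_inner, joinMarkers_outer]
  have hm' : ∀ σ t, inT σ = t → σ.marker = joinMarkers t (outS σ) := fun σ t e => e ▸ hm σ
  have minT : ∀ {σ t s}, σ.marker = joinMarkers t s → inT σ = t := fun e => by
    simp only [inT, e, joinMarkers_inner]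
  have moutS : ∀ {σ t s}, σ.marker = joinMarkers t s → outS σ = s := fun e => by
    simp only [outS, e, joinMarkers_outer]
  have oc : ∀ t, T.Open t ∨ T.Closed t := fun t => by
    by_cases e : t = t₀
    · exact Or.inr (e ▸ hT.closed)
    · exact Or.inl (hT.isOpen t e)
  have hc : ∀ σ t, inT σ = t → Const (outerCircles G p (T.ends t) (outS σ)) (sg σ) :=
    fun σ t e => h.const_inl (oc t) (hm' σ t e)
  -- The lower elements of the cancelling pairs. The partner of a state over `tq` is the circle with
  -- sign −, and the partner of a circle with sign + is a state over `tp`.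
  let Q : D.EnhancedState → Prop := fun σ => inT σ = tq ∨ (inT σ = t₀ ∧ σ.sign (.inr i) = 1)
  have exup : ∀ σ, ∃ σ' : D.EnhancedState,
      (inT σ = tq → σ'.marker = joinMarkers t₀ (outS σ) ∧ σ'.sign (.inr i) = -1 ∧ sg σ' = sg σ) ∧
      (inT σ = t₀ → σ'.marker = joinMarkers tp (outS σ) ∧ sg σ' = sg σ) := by
    intro σ
    by_cases e : inT σ = tq
    · obtain ⟨σ', h1, h2, h3⟩ := h.exists_state_closed hT.closed (eq' ▸ hc σ tq e) (-1)
      exact ⟨σ', fun _ => ⟨h1, h3 i, funext h2⟩, fun e' => (hq0 (e.symm.trans e')).elim⟩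
    · by_cases e' : inT σ = t₀
      · obtain ⟨σ', h1, h2⟩ := h.exists_state_open op (ep.symm ▸ hc σ t₀ e')
        exact ⟨σ', fun e'' => (e e'').elim, fun _ => ⟨h1, funext h2⟩⟩
      · exact ⟨σ, fun e'' => (e e'').elim, fun e'' => (e' e'').elim⟩
  choose up hup1 hup2 using exup
  let θ : D.EnhancedState → ℤ := fun σ => (-1) ^ countB (outS σ) *
    if inT σ = tq then ksgn t₀ tq else ksgn tp t₀
  let C' := model G p (fun t => t ≠ t₀ ∧ t ≠ tq ∧ t ≠ tp) T.ends (cancelled t₀ tq tp)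
  have exj : ∀ x : C'.basis, ∃ σ : D.EnhancedState,
      σ.marker = joinMarkers x.1.1 x.1.2.1 ∧ sg σ = x.1.2.2 := fun x => by
    obtain ⟨σ, h1, h2⟩ := h.exists_state_open (hT.isOpen _ x.2.1.1) x.2.2
    exact ⟨σ, h1, funext h2⟩
  choose j hj1 hj2 using exj
  have ext_open : ∀ {σ σ'} t, T.Open t → inT σ = t → inT σ' = t → outS σ = outS σ' →
      sg σ = sg σ' → σ = σ' := fun {σ σ'} t ht e e' h1 h2 =>
    h.state_ext_open ht (hm' σ t e) (h1 ▸ hm' σ' t e') (congrFun h2)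
  have ext_closed : ∀ {σ σ'}, inT σ = t₀ → inT σ' = t₀ → outS σ = outS σ' →
      sg σ = sg σ' → σ.sign (.inr i) = σ'.sign (.inr i) → σ = σ' := fun {σ σ'} e e' h1 h2 h3 =>
    h.state_ext_closed hT.closed (hm' σ t₀ e) (h1 ▸ hm' σ' t₀ e') (congrFun h2) i h3
  -- the incidence numbers from and to the closed smoothing
  have absorb : ∀ σ σ' t, inT σ = t₀ → σ.sign (.inr i) = -1 → inT σ' = t → t ≠ t₀ →
      σ.incidence σ' = if outS σ = outS σ' ∧ sg σ = sg σ'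
        then (-1) ^ countB (outS σ) * ksgn t₀ t else 0 := by
    intro σ σ' t e1 e2 e3 hne
    by_cases hk : ksgn t₀ t = 0
    · rw [incidence_eq hD (hm' σ _ e1) (hm' σ' _ e3), hk, if_neg hne.symm]; simp
    · rw [h.incidence_absorb hD hT.closed (hT.isOpen t hne) (hT.ends_down t hk).symm i
        (hm' σ _ e1) (hm' σ' _ e3) e2]
      by_cases hs : outS σ = outS σ'
      · rw [if_pos hs]
        by_cases hg : sg σ = sg σ'
        · rw [if_pos fun x => (congrFun hg x).symm, if_pos ⟨hs, hg⟩, mul_one]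
        · rw [if_neg fun e => hg (funext fun x => (e x).symm), if_neg fun e => hg e.2, mul_zero]
      · rw [if_neg hs, zero_mul, if_neg fun e => hs e.1]
  have split : ∀ σ σ' t, inT σ = t → t ≠ t₀ → inT σ' = t₀ → σ'.sign (.inr i) = 1 →
      σ.incidence σ' = if outS σ = outS σ' ∧ sg σ = sg σ'
        then (-1) ^ countB (outS σ) * ksgn t t₀ else 0 := by
    intro σ σ' t e1 hne e2 e3
    by_cases hk : ksgn t t₀ = 0
    · rw [incidence_eq hD (hm' σ _ e1) (hm' σ' _ e2), hk, if_neg hne]; simp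
    · rw [h.incidence_split hD (hT.isOpen t hne) hT.closed (hT.ends_up t hk) i
        (hm' σ _ e1) (hm' σ' _ e2) e3]
      by_cases hs : outS σ = outS σ'
      · rw [if_pos hs]
        by_cases hg : sg σ = sg σ'
        · rw [if_pos fun x => (congrFun hg x).symm, if_pos ⟨hs, hg⟩, mul_one]
        · rw [if_neg fun e => hg (funext fun x => (e x).symm), if_neg fun e => hg e.2, mul_zero]
      · rw [if_neg hs, zero_mul, if_neg fun e => hs e.1]
  have uq : ∀ {q}, inT q = tq → inT (up q) = t₀ ∧ outS (up q) = outS q ∧ sg (up q) = sg q ∧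
      (up q).sign (.inr i) = -1 := fun {q} e =>
    ⟨minT (hup1 q e).1, moutS (hup1 q e).1, (hup1 q e).2.2, (hup1 q e).2.1⟩
  have u0 : ∀ {q}, inT q = t₀ → inT (up q) = tp ∧ outS (up q) = outS q ∧ sg (up q) = sg q :=
    fun {q} e => ⟨minT (hup2 q e).1, moutS (hup2 q e).1, (hup2 q e).2⟩
  have jT : ∀ x, inT (j x) = x.1.1 := fun x => minT (hj1 x)
  have jS : ∀ x, outS (j x) = x.1.2.1 := fun x => moutS (hj1 x)
  have hone : (-1 : ℤˣ) ≠ 1 := by decide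
  have key := BasedComplex.homology_equiv_of_matching (C := D.complex) (C' := C') (k := 0) (l := 0)
    (complex_sum hD) (fun s t e => incidence_weight e) Q up θ j (fun _ => 1) ?_ (fun _ => rfl) ?_
    ?_ ?_ ?_ ?_ ?_ ?_ ?_ ?_ a c
  · rw [add_zero, add_zero] at key
    exact key
  · intro x y e
    refine Subtype.ext (Prod.ext ?_ (Prod.ext ?_ ?_))
    · rw [← jT, ← jT, e]
    · rw [← jS, ← jS, e]
    · rw [← hj2, ← hj2, e]
  · rintro q -
    simp only [θ]
    rw [mul_mul_mul_comm, neg_one_pow_mul_self, one_mul]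
    split_ifs
    · exact ksgn_mul_self hT.down
    · exact ksgn_mul_self hT.up
  · rintro x (e | ⟨e, -⟩)
    · exact x.2.1.2.1 ((jT x).symm.trans e)
    · exact x.2.1.1 ((jT x).symm.trans e)
  · rintro q (e | ⟨e, -⟩) (e' | ⟨e', e''⟩)
    · exact hq0 (e'.symm.trans (uq e).1)
    · exact hone ((uq e).2.2.2.symm.trans e'')
    · exact hpq ((u0 e).1.symm.trans e')
    · exact hp0 ((u0 e).1.symm.trans e')
  · rintro q x (e | ⟨e, -⟩) hqx
    · exact x.2.1.1 (by rw [← jT, ← hqx]; exact (uq e).1)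
    · exact x.2.1.2.2 (by rw [← jT, ← hqx]; exact (u0 e).1)
  · intro σ
    by_cases e : inT σ = tq
    · exact Or.inl (Or.inl e)
    by_cases e0 : inT σ = t₀
    · rcases Int.units_eq_one_or (σ.sign (.inr i)) with hs | hs
      · exact Or.inl (Or.inr ⟨e0, hs⟩)
      · obtain ⟨q, h1, h2⟩ := h.exists_state_open oq (eq'.symm ▸ hc σ t₀ e0)
        have e1 : inT q = tq := minT h1
        refine Or.inr (Or.inr ⟨q, Or.inl e1, ext_closed (uq e1).1 e0 ?_ ?_ ?_⟩)
        · exact (uq e1).2.1.trans (moutS h1)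
        · exact (uq e1).2.2.1.trans (funext h2)
        · exact (uq e1).2.2.2.trans hs.symm
    by_cases e1 : inT σ = tp
    · obtain ⟨q, h1, h2, h3⟩ := h.exists_state_closed hT.closed (ep ▸ hc σ tp e1) 1
      have e2 : inT q = t₀ := minT h1
      refine Or.inr (Or.inr ⟨q, Or.inr ⟨e2, h3 i⟩, ext_open tp op (u0 e2).1 e1 ?_ ?_⟩)
      · exact (u0 e2).2.1.trans (moutS h1)
      · exact (u0 e2).2.2.trans (funext h2)
    · let x : C'.basis := ⟨(inT σ, outS σ, sg σ), ⟨e0, e, e1⟩, hc σ _ rfl⟩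
      exact Or.inr (Or.inl ⟨x, ext_open _ (hT.isOpen _ e0) (jT x) rfl (jS x) (hj2 x)⟩)
  · rintro q (e | ⟨e, e'⟩)
    · obtain ⟨h1, h2, h3, h4⟩ := uq e
      change (up q).incidence q = _
      rw [absorb _ _ tq h1 h4 e hq0, if_pos ⟨h2, h3⟩, h2]
      simp only [θ, if_pos e]
    · obtain ⟨h1, h2, h3⟩ := u0 e
      change (up q).incidence q = _
      have hne : inT q ≠ tq := fun e'' => hq0 (e''.symm.trans e)
      rw [split _ _ tp h1 hp0 e e', if_pos ⟨h2, h3⟩, h2]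
      simp only [θ, if_neg hne]
  · rintro q q' (e | ⟨e, es⟩) (e' | ⟨e', es'⟩) hne
    · obtain ⟨h1, h2, h3, h4⟩ := uq e
      change (up q).incidence q' = _
      rw [absorb _ _ tq h1 h4 e' hq0, if_neg]
      rintro ⟨h5, h6⟩
      exact hne (ext_open tq oq e e' (h2.symm.trans h5) (h3.symm.trans h6))
    · obtain ⟨h1, h2, h3, h4⟩ := uq e
      -- The differential does not change the sign of the closed circle while it stays closed.
      by_contra hc'
      have := h.sign_eq_of_closed hD hT.closed i (hm' _ _ h1) (hm' _ _ e') hc'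
      exact hone (h4.symm.trans (this.symm.trans es'))
    · obtain ⟨h1, h2, h3⟩ := u0 e
      change (up q).incidence q' = _
      rw [incidence_eq hD (hm' _ _ h1) (hm' _ _ e'), kpq, if_neg hpq]
      simp
    · obtain ⟨h1, h2, h3⟩ := u0 e
      change (up q).incidence q' = _
      rw [split _ _ tp h1 hp0 e' es', if_neg]
      rintro ⟨h5, h6⟩
      exact hne (ext_closed e e' (h2.symm.trans h5) (h3.symm.trans h6) (es.trans es'.symm))
  · intro x
    have ha : (j x).a = markerSum x.1.1 + markerSum x.1.2.1 := by
      rw [EnhancedState.a_eq, hj1, markerSum_join]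
    have ht : (j x).τ = tau (outerCircles G p (T.ends x.1.1) x.1.2.1) x.1.2.2 := by
      rw [EnhancedState.tau_eq, ← hj2 x, ← h.comap_inl (oc x.1.1) x.1.2.1, ← hj1 x]
      refine (tau_comap _ Sum.inl (fun y => ?_) (j x).const).symm
      rw [hj1 x]
      exact h.open_hit (hT.isOpen _ x.2.1.1) _ y
    constructor
    · change _ = (j x).a + 0
      rw [ha, add_zero]; rfl
    · change _ = (j x).b + 0
      rw [EnhancedState.b, ha, ht, add_zero]; rfl
  · intro x y
    have hx0 := x.2.1.1
    have hy0 := y.2.1.1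
    have hsplit : ∀ q, (if Q q then (j x).incidence q * θ q * (up q).incidence (j y) else 0) =
        (if inT q = tq then (j x).incidence q * θ q * (up q).incidence (j y) else 0) +
        (if inT q = t₀ ∧ q.sign (.inr i) = 1
          then (j x).incidence q * θ q * (up q).incidence (j y) else 0) := by
      intro q
      by_cases e : inT q = tq
      · rw [if_pos (show Q q from Or.inl e), if_pos e, if_neg fun e' => hq0 (e.symm.trans e'.1),
          add_zero]
      · rw [if_neg e, zero_add]
        exact if_congr ⟨fun e' => e'.resolve_left e, Or.inr⟩ rfl rfl
    -- Zigzags through `tq`: leaving the circle with sign − is an identity on the outside, so only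
    -- the `q` with the outside part of `y` contributes.
    have sum1 : ∑ q, (if inT q = tq then (j x).incidence q * θ q * (up q).incidence (j y) else 0) =
        ((if x.1.2.1 = y.1.2.1 then (-1) ^ countB x.1.2.1 *
          (ksgn x.1.1 tq * ksgn t₀ tq * ksgn t₀ y.1.1) else 0)) *
        if Sad (outerCircles G p (T.ends x.1.1) x.1.2.1) (outerCircles G p (T.ends y.1.1) y.1.2.1)
          x.1.2.2 y.1.2.2 then 1 else 0 := by
      have hterm : ∀ q, inT q = tq → (j x).incidence q * θ q * (up q).incidence (j y) =
          if outS q = y.1.2.1 ∧ sg q = y.1.2.2 then (j x).incidence q *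
            (ksgn t₀ tq * ksgn t₀ y.1.1) else 0 := by
        intro q e
        obtain ⟨h1, h2, h3, h4⟩ := uq e
        rw [absorb _ _ _ h1 h4 (jT y) hy0, h2, h3, jS, hj2]
        split_ifs with hc
        · simp only [θ, if_pos e]
          calc _ = (-1) ^ countB (outS q) * (-1) ^ countB (outS q) * ((j x).incidence q *
                (ksgn t₀ tq * ksgn t₀ y.1.1)) := by ring
            _ = _ := by rw [neg_one_pow_mul_self, one_mul]
        · exact mul_zero _
      by_cases hk : ksgn t₀ y.1.1 = 0
      · rw [Finset.sum_eq_zero fun q _ => ?_]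
        · rw [hk]; simp
        · split_ifs with e
          · rw [hterm q e, hk]; simp
          · rfl
      have ey := hT.ends_down _ hk
      obtain ⟨q, h1, h2⟩ := h.exists_state_open (t := tq) (s := y.1.2.1) (ε := y.1.2.2) oq
        (by rw [eq', ← ey]; exact y.2.2)
      have e1 := minT h1
      have e2 := moutS h1
      have e3 : sg q = y.1.2.2 := funext h2
      rw [Finset.sum_eq_single q]
      · rw [if_pos e1, hterm q e1, if_pos ⟨e2, e3⟩,
          h.incidence_open hD (hT.isOpen _ hx0) oq (hj1 x) h1, if_neg x.2.1.2.1, add_zero]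
        have e4 : (fun z => (j x).sign (.inl z)) = x.1.2.2 := hj2 x
        have e5 : (fun z => q.sign (.inl z)) = y.1.2.2 := e3
        rw [e4, e5, eq', ← ey]
        split_ifs <;> ring
      · intro q' _ hne
        split_ifs with e
        · rw [hterm q' e, if_neg]
          rintro ⟨h5, h6⟩
          exact hne (ext_open tq oq e e1 (h5.trans e2.symm) (h6.trans e3.symm))
        · rfl
      · intro hq; exact (hq (Finset.mem_univ _)).elim
    -- Zigzags through the circle with sign +: now entering the circle is an identity on the
    -- outside, so only the `q` with the outside part of `x` contributes.
    have sum2 : ∑ q, (if inT q = t₀ ∧ q.sign (.inr i) = 1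
          then (j x).incidence q * θ q * (up q).incidence (j y) else 0) =
        ((if x.1.2.1 = y.1.2.1 then (-1) ^ countB x.1.2.1 *
          (ksgn x.1.1 t₀ * ksgn tp t₀ * ksgn tp y.1.1) else 0)) *
        if Sad (outerCircles G p (T.ends x.1.1) x.1.2.1) (outerCircles G p (T.ends y.1.1) y.1.2.1)
          x.1.2.2 y.1.2.2 then 1 else 0 := by
      have hterm : ∀ q, inT q = t₀ ∧ q.sign (.inr i) = 1 →
          (j x).incidence q * θ q * (up q).incidence (j y) =
          if x.1.2.1 = outS q ∧ x.1.2.2 = sg q then ksgn x.1.1 t₀ * ksgn tp t₀ *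
            (up q).incidence (j y) else 0 := by
        rintro q ⟨e, es⟩
        rw [split _ _ _ (jT x) hx0 e es, jS, hj2]
        have hne : inT q ≠ tq := fun e'' => hq0 (e''.symm.trans e)
        split_ifs with hc
        · simp only [θ, if_neg hne, hc.1]
          calc _ = (-1) ^ countB (outS q) * (-1) ^ countB (outS q) *
                (ksgn x.1.1 t₀ * ksgn tp t₀ * (up q).incidence (j y)) := by ring
            _ = _ := by rw [neg_one_pow_mul_self, one_mul]
        · rw [zero_mul, zero_mul]
      by_cases hk : ksgn x.1.1 t₀ = 0
      · rw [Finset.sum_eq_zero fun q _ => ?_]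
        · rw [hk]; simp
        · split_ifs with e
          · rw [hterm q e, hk]; simp
          · rfl
      have ex := hT.ends_up _ hk
      obtain ⟨q, h1, h2, h3⟩ := h.exists_state_closed (s := x.1.2.1) (ε := x.1.2.2) hT.closed
        (by rw [← ex]; exact x.2.2) 1
      have e1 := minT h1
      have e2 := moutS h1
      have e3 : sg q = x.1.2.2 := funext h2
      rw [Finset.sum_eq_single q]
      · obtain ⟨u1, u2, u3⟩ := u0 e1
        rw [if_pos ⟨e1, h3 i⟩, hterm q ⟨e1, h3 i⟩, if_pos ⟨e2.symm, e3.symm⟩,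
          h.incidence_open hD op (hT.isOpen _ hy0) (hm' _ _ u1) (hj1 y),
          if_neg (Ne.symm y.2.1.2.2), add_zero]
        have e4 : (fun z => (j y).sign (.inl z)) = y.1.2.2 := hj2 y
        have e5 : (fun z => (up q).sign (.inl z)) = x.1.2.2 := u3.trans e3
        rw [e4, e5, ep, ← ex, u2, e2]
        split_ifs <;> ring
      · intro q' _ hne
        split_ifs with e
        · rw [hterm q' e, if_neg]
          rintro ⟨h5, h6⟩
          exact hne (ext_closed e.1 e1 (h5.symm.trans e2.symm) (h6.symm.trans e3.symm)
            (e.2.trans (h3 i).symm))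
        · rfl
      · intro hq; exact (hq (Finset.mem_univ _)).elim
    have sumQ : ∑ q, (if Q q then (j x).incidence q * θ q * (up q).incidence (j y) else 0) = _ :=
      (Finset.sum_congr rfl fun q _ => hsplit q).trans
        (Finset.sum_add_distrib.trans (congrArg₂ (· + ·) sum1 sum2))
    have hopen := h.incidence_open hD (hT.isOpen _ hx0) (hT.isOpen _ hy0) (hj1 x) (hj1 y)
    have e4 : (fun z => (j x).sign (.inl z)) = x.1.2.2 := hj2 x
    have e5 : (fun z => (j y).sign (.inl z)) = y.1.2.2 := hj2 y
    rw [e4, e5] at hopen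
    have goal' : C'.inc x y = (j x).incidence (j y) -
        ∑ q, (if Q q then (j x).incidence q * θ q * (up q).incidence (j y) else 0) := by
      rw [sumQ, hopen]
      change ((if x.1.2.1 = y.1.2.1 then (-1) ^ countB x.1.2.1 *
          cancelled t₀ tq tp x.1.1 y.1.1 else 0) +
          if x.1.1 = y.1.1 then ksgn x.1.2.1 y.1.2.1 else 0) *
        (if Sad (outerCircles G p (T.ends x.1.1) x.1.2.1) (outerCircles G p (T.ends y.1.1) y.1.2.1)
          x.1.2.2 y.1.2.2 then 1 else 0) = _
      rw [cancelled]
      split_ifs <;> ring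
    rw [one_mul, one_mul]
    exact goal'

end PD

/-! ### Tangles with one crossing, and comparison of the reduced complexes -/

namespace PD

open Saddle

variable {E : Type} {n m k b l : ℕ}

/-- Removal of a circle which is adjacent to only one other smoothing of the tangle. -/
theorem IsGlued.cancel_one [Finite E] {D : PD (E ⊕ Fin l) (n + k) m} {G : PD E n m}
    {T : PD (Fin b ⊕ Fin l) k 0} {p : Fin b → E} (h : D.IsGlued G T p) (hD : D.Dich)
    {t₀ t₁ : Fin k → Marker} (hclosed : T.Closed t₀) (hopen : T.Open t₁)
    (hends : T.ends t₁ = T.ends t₀) (hall : ∀ t, t = t₀ ∨ t = t₁) (i : Fin l) (i₀ : Fin b)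
    (a c : ℤ) :
    (ksgn t₀ t₁ ≠ 0 → Nonempty (D.complex.Homology a c ≃ₗ[ℤ]
      (model G p (fun t => t = t₀) T.ends fun _ _ => 0).Homology a (c - 2))) ∧
    (ksgn t₁ t₀ ≠ 0 → Nonempty (D.complex.Homology a c ≃ₗ[ℤ]
      (model G p (fun t => t = t₀) T.ends fun _ _ => 0).Homology a (c + 2))) := by
  classical
  have hne : t₁ ≠ t₀ := by
    rintro rfl
    obtain ⟨j, hj⟩ := hopen i
    exact hclosed.2 j i (Setoid.symm' _ hj)
  let inT : D.EnhancedState → Fin k → Marker := fun σ i => σ.marker (inner i)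
  let outS : D.EnhancedState → Fin n → Marker := fun σ i => σ.marker (outer i)
  let sg : D.EnhancedState → E → ℤˣ := fun σ x => σ.sign (.inl x)
  have hm : ∀ σ, σ.marker = joinMarkers (inT σ) (outS σ) := fun σ => by
    obtain ⟨t, s, e⟩ := exists_joinMarkers σ.marker
    simp only [inT, outS, e, joinMarkers_inner, joinMarkers_outer]
  have hm' : ∀ σ t, inT σ = t → σ.marker = joinMarkers t (outS σ) := fun σ t e => e ▸ hm σ
  have minT : ∀ {σ t s}, σ.marker = joinMarkers t s → inT σ = t := fun e => by
    simp only [inT, e, joinMarkers_inner]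
  have moutS : ∀ {σ t s}, σ.marker = joinMarkers t s → outS σ = s := fun e => by
    simp only [outS, e, joinMarkers_outer]
  have oc : ∀ t, T.Open t ∨ T.Closed t := fun t => by
    rcases hall t with rfl | rfl
    · exact Or.inr hclosed
    · exact Or.inl hopen
  have hc : ∀ σ t, inT σ = t → Const (outerCircles G p (T.ends t) (outS σ)) (sg σ) :=
    fun σ t e => h.const_inl (oc t) (hm' σ t e)
  have hc₀ : ∀ σ, Const (outerCircles G p (T.ends t₀) (outS σ)) (sg σ) := fun σ => by
    rcases hall (inT σ) with e | e
    · exact hc σ _ e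
    · exact hends ▸ hc σ _ e
  have ext_open : ∀ {σ σ'}, inT σ = t₁ → inT σ' = t₁ → outS σ = outS σ' →
      sg σ = sg σ' → σ = σ' := fun {σ σ'} e e' h1 h2 =>
    h.state_ext_open hopen (hm' σ _ e) (h1 ▸ hm' σ' _ e') (congrFun h2)
  have ext_closed : ∀ {σ σ'}, inT σ = t₀ → inT σ' = t₀ → outS σ = outS σ' →
      sg σ = sg σ' → σ.sign (.inr i) = σ'.sign (.inr i) → σ = σ' := fun {σ σ'} e e' h1 h2 h3 =>
    h.state_ext_closed hclosed (hm' σ t₀ e) (h1 ▸ hm' σ' t₀ e') (congrFun h2) i h3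
  have absorb : ∀ σ σ', inT σ = t₀ → σ.sign (.inr i) = -1 → inT σ' = t₁ →
      σ.incidence σ' = if outS σ = outS σ' ∧ sg σ = sg σ'
        then (-1) ^ countB (outS σ) * ksgn t₀ t₁ else 0 := by
    intro σ σ' e1 e2 e3
    rw [h.incidence_absorb hD hclosed hopen hends.symm i (hm' σ _ e1) (hm' σ' _ e3) e2]
    by_cases hs : outS σ = outS σ'
    · rw [if_pos hs]
      by_cases hg : sg σ = sg σ'
      · rw [if_pos fun x => (congrFun hg x).symm, if_pos ⟨hs, hg⟩, mul_one]
      · rw [if_neg fun e => hg (funext fun x => (e x).symm), if_neg fun e => hg e.2, mul_zero]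
    · rw [if_neg hs, zero_mul, if_neg fun e => hs e.1]
  have split : ∀ σ σ', inT σ = t₁ → inT σ' = t₀ → σ'.sign (.inr i) = 1 →
      σ.incidence σ' = if outS σ = outS σ' ∧ sg σ = sg σ'
        then (-1) ^ countB (outS σ) * ksgn t₁ t₀ else 0 := by
    intro σ σ' e1 e2 e3
    rw [h.incidence_split hD hopen hclosed hends i (hm' σ _ e1) (hm' σ' _ e2) e3]
    by_cases hs : outS σ = outS σ'
    · rw [if_pos hs]
      by_cases hg : sg σ = sg σ'
      · rw [if_pos fun x => (congrFun hg x).symm, if_pos ⟨hs, hg⟩, mul_one]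
      · rw [if_neg fun e => hg (funext fun x => (e x).symm), if_neg fun e => hg e.2, mul_zero]
    · rw [if_neg hs, zero_mul, if_neg fun e => hs e.1]
  let C' := model G p (fun t : Fin k → Marker => t = t₀) T.ends fun _ _ => 0
  have exj : ∀ (u : ℤˣ) (x : C'.basis), ∃ σ : D.EnhancedState,
      σ.marker = joinMarkers t₀ x.1.2.1 ∧ sg σ = x.1.2.2 ∧ σ.sign (.inr i) = u := fun u x => by
    have hx : x.1.1 = t₀ := x.2.1
    have hxc : Const (outerCircles G p (T.ends x.1.1) x.1.2.1) x.1.2.2 := x.2.2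
    rw [hx] at hxc
    obtain ⟨σ, h1, h2, h3⟩ := h.exists_state_closed hclosed hxc u
    exact ⟨σ, h1, funext h2, h3 i⟩
  choose j hj1 hj2 hj3 using exj
  have jT : ∀ u x, inT (j u x) = t₀ := fun u x => minT (hj1 u x)
  have jS : ∀ u x, outS (j u x) = x.1.2.1 := fun u x => moutS (hj1 u x)
  have hone : (-1 : ℤˣ) ≠ 1 := by decide
  have injj : ∀ u, Function.Injective (j u) := by
    intro u x y e
    have hx : x.1.1 = t₀ := x.2.1
    have hy : y.1.1 = t₀ := y.2.1
    refine Subtype.ext (Prod.ext (hx.trans hy.symm) (Prod.ext ?_ ?_))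
    · rw [← jS u, ← jS u, e]
    · rw [← hj2 u, ← hj2 u, e]
  have coverj : ∀ u σ, inT σ = t₀ → σ.sign (.inr i) = u → ∃ x, j u x = σ := by
    intro u σ e es
    let x : C'.basis := ⟨(t₀, outS σ, sg σ), rfl, hc₀ σ⟩
    exact ⟨x, ext_closed (jT u x) e (jS u x) (hj2 u x) ((hj3 u x).trans es.symm)⟩
  have wtj : ∀ u x, C'.wa x = (j u x).a ∧ C'.wb x = (j u x).b - 2 * u := by
    intro u x
    have hx : x.1.1 = t₀ := x.2.1
    have ha : (j u x).a = markerSum x.1.1 + markerSum x.1.2.1 := by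
      rw [EnhancedState.a_eq, hj1, markerSum_join, hx]
    have ht : (j u x).τ = tau (outerCircles G p (T.ends x.1.1) x.1.2.1) x.1.2.2 + u := by
      have e1 : ∀ i₁ i₂, D.circles (j u x).marker (.inr i₁) (.inr i₂) := by
        rw [hj1]; exact h.closed_inr hclosed _
      have e2 : ∀ x₁ i₁, ¬ D.circles (j u x).marker (.inl x₁) (.inr i₁) := by
        rw [hj1]; exact h.closed_not hclosed _
      rw [EnhancedState.tau_eq, tau_circle i e1 e2 (j u x).const (p i₀), hj3, hj1,
        h.comap_inl (oc t₀), hx]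
      congr 2
      exact hj2 u x
    constructor
    · rw [ha]; rfl
    · rw [EnhancedState.b, ha, ht]
      change _ + _ + 2 * tau _ _ = _
      ring
  have incj : ∀ u x y, C'.inc x y = (j u x).incidence (j u y) := by
    intro u x y
    have hx : x.1.1 = t₀ := x.2.1
    have hy : y.1.1 = t₀ := y.2.1
    rw [h.incidence_closed hD hclosed i (hj1 u x) (hj1 u y) ((hj3 u y).trans (hj3 u x).symm)]
    have e4 : (fun z => (j u x).sign (.inl z)) = x.1.2.2 := hj2 u x
    have e5 : (fun z => (j u y).sign (.inl z)) = y.1.2.2 := hj2 u y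
    rw [e4, e5]
    change ((if x.1.2.1 = y.1.2.1 then (-1) ^ countB x.1.2.1 * 0 else 0) +
        if x.1.1 = y.1.1 then ksgn x.1.2.1 y.1.2.1 else 0) *
      (if Sad (outerCircles G p (T.ends x.1.1) x.1.2.1) (outerCircles G p (T.ends y.1.1) y.1.2.1)
        x.1.2.2 y.1.2.2 then 1 else 0) = _
    rw [if_pos (hx.trans hy.symm), hx, hy, mul_zero, ite_self, zero_add]
  constructor
  -- The circle with sign − cancels against the smoothing which absorbs it. The circle with sign +
  -- survives, and forgetting it lowers `b` by 2.
  · intro hk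
    have exup : ∀ σ, ∃ σ' : D.EnhancedState, σ'.marker = joinMarkers t₀ (outS σ) ∧
        sg σ' = sg σ ∧ σ'.sign (.inr i) = -1 := fun σ => by
      obtain ⟨σ', h1, h2, h3⟩ := h.exists_state_closed hclosed (hc₀ σ) (-1)
      exact ⟨σ', h1, funext h2, h3 i⟩
    choose up hu1 hu2 hu3 using exup
    have uT : ∀ q, inT (up q) = t₀ := fun q => minT (hu1 q)
    have uS : ∀ q, outS (up q) = outS q := fun q => moutS (hu1 q)
    have key := BasedComplex.homology_equiv_of_matching (C := D.complex) (C' := C') (k := 0)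
      (l := -2) (complex_sum hD) (fun s t e => incidence_weight e) (fun σ => inT σ = t₁) up
      (fun σ => (-1) ^ countB (outS σ) * ksgn t₀ t₁) (j 1) (fun _ => 1) (injj 1) (fun _ => rfl)
      ?_ (fun x e => hne (e.symm.trans (jT 1 x))) (fun q _ e => hne (e.symm.trans (uT q))) ?_ ?_ ?_
      ?_ ?_ ?_ a c
    · rw [add_zero] at key
      exact key
    · rintro q -
      rw [mul_mul_mul_comm, neg_one_pow_mul_self, one_mul, ksgn_mul_self hk]
    · intro q x _ e
      exact hone ((hu3 q).symm.trans ((congrArg (fun σ : D.EnhancedState =>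
        σ.sign (.inr i)) e).trans (hj3 1 x)))
    · intro σ
      rcases hall (inT σ) with e | e
      · rcases Int.units_eq_one_or (σ.sign (.inr i)) with hs | hs
        · exact Or.inr (Or.inl (coverj 1 σ e hs))
        · obtain ⟨q, h1, h2⟩ := h.exists_state_open hopen (hends.symm ▸ hc₀ σ)
          exact Or.inr (Or.inr ⟨q, minT h1, ext_closed (uT q) e ((uS q).trans (moutS h1))
            ((hu2 q).trans (funext h2)) ((hu3 q).trans hs.symm)⟩)
      · exact Or.inl e
    · intro q e
      change (up q).incidence q = _
      rw [absorb _ _ (uT q) (hu3 q) e, if_pos ⟨uS q, hu2 q⟩]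
      exact congrArg (fun s => (-1) ^ countB s * _) (uS q)
    · intro q q' e e' hqq
      change (up q).incidence q' = _
      rw [absorb _ _ (uT q) (hu3 q) e', if_neg]
      rintro ⟨h5, h6⟩
      exact hqq (ext_open e e' ((uS q).symm.trans h5) ((hu2 q).symm.trans h6))
    · intro x
      obtain ⟨h1, h2⟩ := wtj 1 x
      exact ⟨h1.trans (add_zero _).symm, h2.trans (by simp; rfl)⟩
    · intro x y
      -- There are no zigzags: an arrow from a partner to a survivor would change the sign of the
      -- closed circle.
      rw [Finset.sum_eq_zero, sub_zero, one_mul, one_mul]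
      · exact incj 1 x y
      · intro q _
        split_ifs with e
        · have : (up q).incidence (j 1 y) = 0 := by
            by_contra hc'
            have := h.sign_eq_of_closed hD hclosed i (hm' _ _ (uT q)) (hm' _ _ (jT 1 y)) hc'
            exact hone ((hu3 q).symm.trans (this.symm.trans (hj3 1 y)))
          change _ * (up q).incidence (j 1 y) = 0
          rw [this, mul_zero]
        · rfl
  -- The circle with sign + cancels against the smoothing from which it splits off. The circle with
  -- sign − survives, and forgetting it raises `b` by 2.
  · intro hk
    have exup : ∀ σ, ∃ σ' : D.EnhancedState, σ'.marker = joinMarkers t₁ (outS σ) ∧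
        sg σ' = sg σ := fun σ => by
      obtain ⟨σ', h1, h2⟩ := h.exists_state_open hopen (hends.symm ▸ hc₀ σ)
      exact ⟨σ', h1, funext h2⟩
    choose up hu1 hu2 using exup
    have uT : ∀ q, inT (up q) = t₁ := fun q => minT (hu1 q)
    have uS : ∀ q, outS (up q) = outS q := fun q => moutS (hu1 q)
    have key := BasedComplex.homology_equiv_of_matching (C := D.complex) (C' := C') (k := 0)
      (l := 2) (complex_sum hD) (fun s t e => incidence_weight e)
      (fun σ => inT σ = t₀ ∧ σ.sign (.inr i) = 1) up
      (fun σ => (-1) ^ countB (outS σ) * ksgn t₁ t₀) (j (-1)) (fun _ => 1) (injj (-1))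
      (fun _ => rfl) ?_ (fun x e => hone ((hj3 (-1) x).symm.trans e.2))
      (fun q _ e => hne ((uT q).symm.trans e.1)) ?_ ?_ ?_ ?_ ?_ ?_ a c
    · rw [add_zero] at key
      exact key
    · rintro q -
      rw [mul_mul_mul_comm, neg_one_pow_mul_self, one_mul, ksgn_mul_self hk]
    · intro q x _ e
      exact hne ((uT q).symm.trans ((congrArg inT e).trans (jT (-1) x)))
    · intro σ
      rcases hall (inT σ) with e | e
      · rcases Int.units_eq_one_or (σ.sign (.inr i)) with hs | hs
        · exact Or.inl ⟨e, hs⟩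
        · exact Or.inr (Or.inl (coverj (-1) σ e hs))
      · obtain ⟨q, h1, h2, h3⟩ := h.exists_state_closed hclosed (hc₀ σ) 1
        exact Or.inr (Or.inr ⟨q, ⟨minT h1, h3 i⟩, ext_open (uT q) e ((uS q).trans (moutS h1))
            ((hu2 q).trans (funext h2))⟩)
    · rintro q ⟨e, es⟩
      change (up q).incidence q = _
      rw [split _ _ (uT q) e es, if_pos ⟨uS q, hu2 q⟩]
      exact congrArg (fun s => (-1) ^ countB s * _) (uS q)
    · rintro q q' ⟨e, es⟩ ⟨e', es'⟩ hqq
      change (up q).incidence q' = _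
      rw [split _ _ (uT q) e' es', if_neg]
      rintro ⟨h5, h6⟩
      exact hqq (ext_closed e e' ((uS q).symm.trans h5) ((hu2 q).symm.trans h6)
        (es.trans es'.symm))
    · intro x
      obtain ⟨h1, h2⟩ := wtj (-1) x
      exact ⟨h1.trans (add_zero _).symm, h2.trans (by simp; rfl)⟩
    · intro x y
      rw [Finset.sum_eq_zero, sub_zero, one_mul, one_mul]
      · exact incj (-1) x y
      · intro q _
        split_ifs with e
        · have : (j (-1) x).incidence q = 0 := by
            by_contra hc'
            have := h.sign_eq_of_closed hD hclosed i (hm' _ _ (jT (-1) x)) (hm' _ _ e.1) hc'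
            exact hone ((hj3 (-1) x).symm.trans (this.symm.trans e.2))
          change (j (-1) x).incidence q * _ * _ = 0
          rw [this, zero_mul, zero_mul]
        · rfl

/-- A diagram in which the tangle has only one smoothing. -/
theorem model_single [Finite E] {D' : PD E n l} {G : PD E n m} {p : Fin b → E} (hD' : D'.Dich)
    {N : (Fin k → Marker) → Prop} {t₀ : Fin k → Marker} (hN : ∀ t, N t ↔ t = t₀)
    {r : (Fin k → Marker) → Fin b → Fin b → Prop} {κ : (Fin k → Marker) → (Fin k → Marker) → ℤ}
    (hκ : κ t₀ t₀ = 0) (hr : ∀ s, outerCircles G p (r t₀) s = D'.circles s) (a c : ℤ) :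
    Nonempty ((model G p N r κ).Homology (a + markerSum t₀) (c + markerSum t₀) ≃ₗ[ℤ]
      D'.complex.Homology a c) := by
  classical
  let C := model G p N r κ
  let j : D'.EnhancedState → C.basis := fun σ => ⟨(t₀, σ.marker, σ.sign), (hN _).2 rfl, by
    rw [hr]; exact σ.const⟩
  have key := BasedComplex.homology_equiv_of_iso (C := C) (C' := D'.complex)
    (k := - markerSum t₀) (l := - markerSum t₀) j ⟨?_, ?_⟩ (fun _ => 1) (fun _ => rfl) ?_ ?_
    (a + markerSum t₀) (c + markerSum t₀)
  · rw [add_neg_cancel_right, add_neg_cancel_right] at key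
    exact key
  · intro σ σ' e
    have e1 := congrArg (fun x => x.1.2) e
    exact EnhancedState.ext (congrArg Prod.fst e1) (congrArg Prod.snd e1)
  · rintro ⟨⟨t, s, ε⟩, ht, hε⟩
    obtain rfl := (hN t).1 ht
    exact ⟨.ofConst D' s ε (by rw [← hr]; exact hε), rfl⟩
  · intro (σ : D'.EnhancedState)
    constructor
    · change σ.a = markerSum t₀ + markerSum σ.marker + _
      rw [EnhancedState.a_eq]; ring
    · change σ.b = markerSum t₀ + markerSum σ.marker +
        2 * tau (outerCircles G p (r t₀) σ.marker) σ.sign + _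
      rw [EnhancedState.b, EnhancedState.a_eq, EnhancedState.tau_eq, hr]; ring
  · intro (σ : D'.EnhancedState) (σ' : D'.EnhancedState)
    change σ.incidence σ' = 1 * 1 * (((if σ.marker = σ'.marker then _ * κ t₀ t₀ else 0) +
      if t₀ = t₀ then ksgn σ.marker σ'.marker else 0) * if Sad (outerCircles G p (r t₀) σ.marker)
        (outerCircles G p (r t₀) σ'.marker) σ.sign σ'.sign then 1 else 0)
    rw [hκ, mul_zero, ite_self, zero_add, if_pos rfl, hr, hr, PD.incidence_eq hD', one_mul, one_mul]

/-- Comparison of the models for two tangles. -/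
theorem model_congr [Finite E] {G : PD E n m} {p : Fin b → E}
    {N N' : (Fin k → Marker) → Prop}
    {r r' : (Fin k → Marker) → Fin b → Fin b → Prop}
    {κ κ' : (Fin k → Marker) → (Fin k → Marker) → ℤ} (Φ : (Fin k → Marker) → Fin k → Marker)
    (η : (Fin k → Marker) → ℤ) (hη : ∀ t, η t * η t = 1) (hinj : Function.Injective Φ)
    (hΦ : ∀ t, N (Φ t) ↔ N' t)
    (hsum : ∀ t, markerSum (Φ t) = markerSum t) (hr : ∀ t, N' t → r (Φ t) = r' t)
    (hκ : ∀ t t', N' t → N' t' → κ' t t' = η t * η t' * κ (Φ t) (Φ t')) (a c : ℤ) :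
    Nonempty ((model G p N r κ).Homology a c ≃ₗ[ℤ] (model G p N' r' κ').Homology a c) := by
  classical
  let C := model G p N r κ
  let C' := model G p N' r' κ'
  let j : C'.basis → C.basis := fun x => ⟨(Φ x.1.1, x.1.2), (hΦ _).2 x.2.1, by
    rw [hr _ x.2.1]; exact x.2.2⟩
  have key := BasedComplex.homology_equiv_of_iso (C := C) (C' := C')
    (k := 0) (l := 0) j ⟨?_, ?_⟩ (fun x => η x.1.1) (fun x => hη _) ?_ ?_ a c
  · rw [add_zero, add_zero] at key
    exact key
  · intro x y e
    have e1 : (Φ x.1.1, x.1.2) = (Φ y.1.1, y.1.2) := congrArg Subtype.val e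
    exact Subtype.ext (Prod.ext (hinj (Prod.ext_iff.1 e1).1) (Prod.ext_iff.1 e1).2)
  · rintro ⟨⟨t, s, ε⟩, ht, hε⟩
    obtain ⟨t, rfl⟩ := (Finite.surjective_of_injective hinj) t
    have ht' := (hΦ t).1 ht
    refine ⟨⟨(t, s, ε), ht', ?_⟩, rfl⟩
    rw [← hr t ht']; exact hε
  · intro x
    constructor
    · change markerSum x.1.1 + markerSum x.1.2.1 = markerSum (Φ x.1.1) + markerSum x.1.2.1 + 0
      rw [hsum, add_zero]
    · change markerSum x.1.1 + markerSum x.1.2.1 + 2 * tau _ _ =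
        markerSum (Φ x.1.1) + markerSum x.1.2.1 +
          2 * tau (outerCircles G p (r (Φ x.1.1)) x.1.2.1) x.1.2.2 + 0
      rw [hsum, add_zero, hr _ x.2.1]
  · intro x y
    change ((if x.1.2.1 = y.1.2.1 then (-1) ^ countB x.1.2.1 * κ' x.1.1 y.1.1 else 0) +
        if x.1.1 = y.1.1 then ksgn x.1.2.1 y.1.2.1 else 0) *
      (if Sad (outerCircles G p (r' x.1.1) x.1.2.1) (outerCircles G p (r' y.1.1) y.1.2.1)
        x.1.2.2 y.1.2.2 then 1 else 0) = η x.1.1 * η y.1.1 * (((if x.1.2.1 = y.1.2.1 then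
          (-1) ^ countB x.1.2.1 * κ (Φ x.1.1) (Φ y.1.1) else 0) +
        if Φ x.1.1 = Φ y.1.1 then ksgn x.1.2.1 y.1.2.1 else 0) *
      (if Sad (outerCircles G p (r (Φ x.1.1)) x.1.2.1) (outerCircles G p (r (Φ y.1.1)) y.1.2.1)
        x.1.2.2 y.1.2.2 then 1 else 0))
    rw [hr _ x.2.1, hr _ y.2.1, hκ _ _ x.2.1 y.2.1]
    by_cases e : x.1.1 = y.1.1
    · rw [if_pos e, if_pos (congrArg Φ e), e, hη, one_mul, one_mul]
    · rw [if_neg e, if_neg fun e' => e (hinj e')]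
      split_ifs <;> ring

end PD

/-! ### The tangles of the Reidemeister moves -/

namespace PD

open Saddle

variable {E : Type} {n m k b l : ℕ}

/-- The pairs of edges joined by the smoothing of a crossing. -/
def pairs {X : Type} (c : Fin 4 → X) : Marker → List (X × X)
  | .A => [(c 0, c 1), (c 2, c 3)]
  | .B => [(c 1, c 2), (c 3, c 0)]

/-- Colours of the elements of `X`, the same for the elements of each of the given pairs. -/
def colour {X C : Type} [DecidableEq C] : List (X × X) → (X → C) → X → C
  | [], f => f
  | (x, y) :: L, f => colour L fun z => if f z = f x then f y else f z

/-- Recolouring the colour class of one element of a pair with the colour of the other is passing to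
the quotient by one more pair; induction on the list. -/
theorem colour_eq_iff {X C : Type} [DecidableEq C] (L : List (X × X)) (f : X → C) (r : Setoid X)
    (hr : ∀ x y, f x = f y ↔ r x y) (x y : X) :
    colour L f x = colour L f y ↔
      Relation.EqvGen (fun x y => r x y ∨ (x, y) ∈ L) x y := by
  induction L generalizing f r with
  | nil =>
    simp only [colour, List.not_mem_nil, or_false]
    rw [hr]
    refine ⟨fun h => Relation.EqvGen.rel _ _ h, fun h => ?_⟩
    have : Relation.EqvGen.setoid (fun x y => r x y) ≤ r := Setoid.eqvGen_le fun _ _ h => h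
    exact this h
  | cons p L ih =>
    obtain ⟨p, q⟩ := p
    let g : X → C := fun z => if f z = f p then f q else f z
    have hg : ∀ x y, g x = g y ↔
        Relation.EqvGen.setoid (fun x y => r x y ∨ (x = p ∧ y = q)) x y := by
      intro x y
      have base : ∀ {x y}, f x = f y →
          Relation.EqvGen.setoid (fun x y => r x y ∨ (x = p ∧ y = q)) x y := fun e =>
        Relation.EqvGen.rel _ _ (Or.inl ((hr _ _).1 e))
      have hpq : Relation.EqvGen.setoid (fun x y => r x y ∨ (x = p ∧ y = q)) p q :=
        Relation.EqvGen.rel _ _ (Or.inr ⟨rfl, rfl⟩)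
      constructor
      · intro e
        have key : ∀ z, ∃ w, g z = f w ∧
            Relation.EqvGen.setoid (fun x y => r x y ∨ (x = p ∧ y = q)) z w := by
          intro z
          by_cases hz : f z = f p
          · exact ⟨q, if_pos hz, Setoid.trans' _ (base hz) hpq⟩
          · exact ⟨z, if_neg hz, Setoid.refl' _ _⟩
        obtain ⟨w, h1, h2⟩ := key x
        obtain ⟨w', h1', h2'⟩ := key y
        exact Setoid.trans' _ h2 (Setoid.trans' _ (base (h1.symm.trans (e.trans h1')))
          (Setoid.symm' _ h2'))
      · intro e
        have : Relation.EqvGen.setoid (fun x y => r x y ∨ (x = p ∧ y = q)) ≤ Setoid.ker g := by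
          refine Setoid.eqvGen_le ?_
          rintro x y (e | ⟨rfl, rfl⟩)
          · change g x = g y
            simp only [g, (hr _ _).2 e]
          · change g x = g y
            simp only [g]
            split_ifs <;> simp_all
        exact this e
    change colour L g x = colour L g y ↔ _
    rw [ih g _ hg]
    constructor
    · intro e
      have : Relation.EqvGen.setoid (fun x y => Relation.EqvGen.setoid
          (fun x y => r x y ∨ (x = p ∧ y = q)) x y ∨ (x, y) ∈ L) ≤
          Relation.EqvGen.setoid fun x y => r x y ∨ (x, y) ∈ (p, q) :: L := by
        refine Setoid.eqvGen_le ?_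
        rintro x y (e | e)
        · have : Relation.EqvGen.setoid (fun x y => r x y ∨ (x = p ∧ y = q)) ≤
              Relation.EqvGen.setoid fun x y => r x y ∨ (x, y) ∈ (p, q) :: L := by
            refine Setoid.eqvGen_le ?_
            rintro x y (e | ⟨rfl, rfl⟩)
            · exact Relation.EqvGen.rel _ _ (Or.inl e)
            · exact Relation.EqvGen.rel _ _ (Or.inr List.mem_cons_self)
          exact this e
        · exact Relation.EqvGen.rel _ _ (Or.inr (List.mem_cons_of_mem _ e))
      exact this e
    · intro e
      have : Relation.EqvGen.setoid (fun x y => r x y ∨ (x, y) ∈ (p, q) :: L) ≤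
          Relation.EqvGen.setoid (fun x y => Relation.EqvGen.setoid
            (fun x y => r x y ∨ (x = p ∧ y = q)) x y ∨ (x, y) ∈ L) := by
        refine Setoid.eqvGen_le ?_
        rintro x y (e | e)
        · exact Relation.EqvGen.rel _ _ (Or.inl (Relation.EqvGen.rel _ _ (Or.inl e)))
        · rcases List.mem_cons.1 e with e | e
          · exact Relation.EqvGen.rel _ _ (Or.inl (Relation.EqvGen.rel _ _
              (Or.inr (Prod.ext_iff.1 e))))
          · exact Relation.EqvGen.rel _ _ (Or.inr e)
      exact this e

/-- Colours of the edges of a tangle, the same for joined edges. -/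
def tangleColour (T : PD (Fin b ⊕ Fin l) k 0) (t : Fin k → Marker) : Fin b ⊕ Fin l → ℕ :=
  colour ((List.finRange k).flatMap fun i => pairs (T.crossing i) (t i))
    (Sum.elim (fun i => i.1) fun i => b + i.1)

/-- Makes the connections in a concrete tangle computable, so that the finitely many facts about the
Reidemeister tangles can be checked by evaluation. -/
theorem tangleColour_eq_iff (T : PD (Fin b ⊕ Fin l) k 0) (t : Fin k → Marker)
    (x y : Fin b ⊕ Fin l) : T.circles t x y ↔ tangleColour T t x = tangleColour T t y := by
  have hf : ∀ x y : Fin b ⊕ Fin l, (Sum.elim (fun i => i.1) fun i => b + i.1 : _ → ℕ) x =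
      (Sum.elim (fun i => i.1) fun i => b + i.1 : _ → ℕ) y ↔ (⊥ : Setoid (Fin b ⊕ Fin l)) x y := by
    intro x y
    change _ ↔ x = y
    rcases x with x | x <;> rcases y with y | y <;> have := x.2 <;> have := y.2 <;>
      simp only [Sum.elim_inl, Sum.elim_inr, Sum.inl.injEq, Sum.inr.injEq, reduceCtorEq,
        iff_false, Fin.ext_iff] <;> omega
  rw [tangleColour, colour_eq_iff _ _ ⊥ hf]
  constructor
  · refine circles_le (r := Relation.EqvGen.setoid _) fun x y h => Relation.EqvGen.rel _ _ ?_
    refine Or.inr (List.mem_flatMap.2 ?_)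
    rcases h with ⟨i, hi⟩ | ⟨i, hi⟩ | ⟨i, hi⟩ | ⟨i, hi⟩ | ⟨j⟩
    · exact ⟨i, List.mem_finRange i, by rw [hi]; simp [pairs]⟩
    · exact ⟨i, List.mem_finRange i, by rw [hi]; simp [pairs]⟩
    · exact ⟨i, List.mem_finRange i, by rw [hi]; simp [pairs]⟩
    · exact ⟨i, List.mem_finRange i, by rw [hi]; simp [pairs]⟩
    · exact j.elim0
  · intro e
    have : Relation.EqvGen.setoid (fun x y => (⊥ : Setoid (Fin b ⊕ Fin l)) x y ∨ (x, y) ∈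
        (List.finRange k).flatMap fun i => pairs (T.crossing i) (t i)) ≤ T.circles t := by
      refine Setoid.eqvGen_le ?_
      rintro x y (e | e)
      · obtain rfl : x = y := e
        exact Setoid.refl' _ _
      · obtain ⟨i, -, hi⟩ := List.mem_flatMap.1 e
        rcases ht : t i with _ | _ <;> rw [ht] at hi <;> simp only [pairs, List.mem_cons,
          Prod.mk.injEq, List.not_mem_nil, or_false] at hi <;>
          rcases hi with ⟨rfl, rfl⟩ | ⟨rfl, rfl⟩
        · exact circles_of_joined (Joined.A₁ i ht)
        · exact circles_of_joined (Joined.A₂ i ht)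
        · exact circles_of_joined (Joined.B₁ i ht)
        · exact circles_of_joined (Joined.B₂ i ht)
    exact this e

instance (T : PD (Fin b ⊕ Fin l) k 0) (t : Fin k → Marker) (x y : Fin b ⊕ Fin l) :
    Decidable (T.circles t x y) := decidable_of_iff _ (tangleColour_eq_iff T t x y).symm

instance (T : PD (Fin b ⊕ Fin l) k 0) (t : Fin k → Marker) : Decidable (T.Open t) :=
  inferInstanceAs (Decidable (∀ i, ∃ j, T.circles t (.inr i) (.inl j)))

instance (T : PD (Fin b ⊕ Fin l) k 0) (t : Fin k → Marker) : Decidable (T.Closed t) :=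
  inferInstanceAs (Decidable
    ((∀ i j, T.circles t (.inr i) (.inr j)) ∧ ∀ i j, ¬ T.circles t (.inl i) (.inr j)))

theorem ends_eq_iff (T : PD (Fin b ⊕ Fin l) k 0) (T' : PD (Fin b ⊕ Fin l) k 0)
    (t t' : Fin k → Marker) : T.ends t = T'.ends t' ↔
    ∀ i j, T.circles t (.inl i) (.inl j) ↔ T'.circles t' (.inl i) (.inl j) :=
  ⟨fun h i j => iff_of_eq (congrFun (congrFun h i) j),
    fun h => funext fun i => funext fun j => propext (h i j)⟩

instance (T : PD (Fin b ⊕ Fin l) k 0) (T' : PD (Fin b ⊕ Fin l) k 0)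
    (t t' : Fin k → Marker) : Decidable (T.ends t = T'.ends t') :=
  decidable_of_iff _ (ends_eq_iff T T' t t').symm

theorem cancels_iff (T : PD (Fin b ⊕ Fin l) k 0) (t₀ tq tp : Fin k → Marker) :
    T.Cancels t₀ tq tp ↔ T.Closed t₀ ∧ (∀ t, t ≠ t₀ → T.Open t) ∧ ksgn t₀ tq ≠ 0 ∧ ksgn tp t₀ ≠ 0 ∧
      (∀ t, ksgn t₀ t ≠ 0 → T.ends t = T.ends t₀) ∧ ∀ t, ksgn t t₀ ≠ 0 → T.ends t = T.ends t₀ :=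
  ⟨fun h => ⟨h.1, h.2, h.3, h.4, h.5, h.6⟩, fun h => ⟨h.1, h.2.1, h.2.2.1, h.2.2.2.1, h.2.2.2.2.1,
    h.2.2.2.2.2⟩⟩

instance (T : PD (Fin b ⊕ Fin l) k 0) (t₀ tq tp : Fin k → Marker) :
    Decidable (T.Cancels t₀ tq tp) := decidable_of_iff _ (cancels_iff T t₀ tq tp).symm

/-- The tangle of the first Reidemeister move. -/
def tangle₁ (u : Bool) : PD (Fin 2 ⊕ Fin 1) 1 0 where
  crossing := ![crossingOf u (.inr 0) (.inr 0) (.inl 0) (.inl 1)]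
  arc := Fin.elim0

/-- The tangle of the second Reidemeister move. -/
def tangle₂ : PD (Fin 4 ⊕ Fin 2) 2 0 where
  crossing := ![![.inr 1, .inl 0, .inl 2, .inr 0], ![.inl 3, .inl 1, .inr 1, .inr 0]]
  arc := Fin.elim0

/-- The first tangle of the third Reidemeister move. -/
def tangle₃ (u₁₂ u₁₃ u₂₃ : Bool) : PD (Fin 6 ⊕ Fin 3) 3 0 where
  crossing := ![crossingOf u₁₂ (.inl 0) (.inl 1) (.inr 0) (.inr 1),
    crossingOf u₁₃ (.inr 0) (.inl 2) (.inl 3) (.inr 2),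
    crossingOf u₂₃ (.inr 1) (.inr 2) (.inl 4) (.inl 5)]
  arc := Fin.elim0

/-- The second tangle of the third Reidemeister move. -/
def tangle₃' (u₁₂ u₁₃ u₂₃ : Bool) : PD (Fin 6 ⊕ Fin 3) 3 0 where
  crossing := ![crossingOf u₁₂ (.inr 0) (.inr 1) (.inl 3) (.inl 4),
    crossingOf u₁₃ (.inl 0) (.inr 2) (.inr 0) (.inl 5),
    crossingOf u₂₃ (.inl 1) (.inl 2) (.inr 1) (.inr 2)]
  arc := Fin.elim0

/-- In the smoothing `![.B, .A]` the bigon of the clasp closes up. The only smoothing left after the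
cancellation is `![.A, .B]`, the two separated strands. -/
theorem cancels₂ : tangle₂.Cancels ![.B, .A] ![.B, .B] ![.A, .A] := by decide +kernel

/-- The smoothing of the tangles of the third Reidemeister move in which the interior edges form a
circle. -/
def center (u₁₂ u₁₃ u₂₃ : Bool) : Fin 3 → Marker :=
  ![if u₁₂ then .A else .B, if u₁₃ then .B else .A, if u₂₃ then .A else .B]

/-- Two neighbours of the smoothing `center u₁₂ u₁₃ u₂₃` and a correspondence between smoothings
of the two tangles with the same connections, with a sign. -/
structure Slide where
  tq : Fin 3 → Marker
  tp : Fin 3 → Marker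
  corr : (Fin 3 → Marker) → Fin 3 → Marker
  sgn : (Fin 3 → Marker) → ℤ

/-- The smoothings which remain after the cancellation are the same on both sides of the move. -/
structure Slide.Valid (S : Slide) (u₁₂ u₁₃ u₂₃ : Bool) : Prop where
  cancels : (tangle₃ u₁₂ u₁₃ u₂₃).Cancels (center u₁₂ u₁₃ u₂₃) S.tq S.tp
  cancels' : (tangle₃' u₁₂ u₁₃ u₂₃).Cancels (center u₁₂ u₁₃ u₂₃) S.tq S.tp
  corr_iff : ∀ t, (S.corr t ≠ center u₁₂ u₁₃ u₂₃ ∧ S.corr t ≠ S.tq ∧ S.corr t ≠ S.tp) ↔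
    t ≠ center u₁₂ u₁₃ u₂₃ ∧ t ≠ S.tq ∧ t ≠ S.tp
  involutive : ∀ t, S.corr (S.corr t) = t
  sum_eq : ∀ t, markerSum (S.corr t) = markerSum t
  sgn_mul : ∀ t, S.sgn t * S.sgn t = 1
  ends_eq : ∀ t, t ≠ center u₁₂ u₁₃ u₂₃ ∧ t ≠ S.tq ∧ t ≠ S.tp →
    (tangle₃ u₁₂ u₁₃ u₂₃).ends (S.corr t) = (tangle₃' u₁₂ u₁₃ u₂₃).ends t
  compat : ∀ t t', t ≠ center u₁₂ u₁₃ u₂₃ ∧ t ≠ S.tq ∧ t ≠ S.tp →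
    t' ≠ center u₁₂ u₁₃ u₂₃ ∧ t' ≠ S.tq ∧ t' ≠ S.tp →
    cancelled (center u₁₂ u₁₃ u₂₃) S.tq S.tp t t' = S.sgn t * S.sgn t' *
      cancelled (center u₁₂ u₁₃ u₂₃) S.tq S.tp (S.corr t) (S.corr t')

/-- The correspondence which exchanges the markers at `i` and `j` if the marker at `c` is `m`. -/
def exchange (c i j : Fin 3) (m : Marker) (t : Fin 3 → Marker) : Fin 3 → Marker :=
  if t c = m then t ∘ Equiv.swap i j else t

/-- The slides for the six positions of three strands above one another. -/
def slide : Bool → Bool → Bool → Slide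
  | true, true, true => ⟨![.A, .B, .B], ![.A, .A, .A], exchange 0 2 1 .B,
      fun t => if t = ![.B, .B, .B] then -1 else 1⟩
  | true, true, false => ⟨![.B, .B, .B], ![.A, .B, .A], exchange 1 2 0 .A,
      fun t => if markerSum t = -1 then -1 else 1⟩
  | true, false, false => ⟨![.A, .B, .B], ![.A, .A, .A], exchange 0 1 2 .B,
      fun t => if t = ![.B, .B, .B] then -1 else 1⟩
  | false, true, true => ⟨![.B, .B, .B], ![.B, .A, .A], exchange 0 1 2 .A,
      fun t => if markerSum t = -1 then -1 else 1⟩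
  | false, false, true => ⟨![.B, .B, .A], ![.A, .A, .A], exchange 2 1 0 .B,
      fun t => if t = ![.B, .B, .B] then -1 else 1⟩
  -- This covers three values `false`, and also the two cyclic positions excluded in `slide_valid`,
  -- where the value is irrelevant.
  | _, _, _ => ⟨![.B, .B, .B], ![.B, .A, .A], exchange 0 2 1 .A,
      fun t => if markerSum t = -1 then -1 else 1⟩

/-- A finite check: the triangle closes up in one smoothing on either side, and five of the eight
smoothings remain. -/
theorem slide_valid (u₁₂ u₁₃ u₂₃ : Bool) (hu : u₁₂ = u₂₃ → u₁₃ = u₁₂) :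
    (slide u₁₂ u₁₃ u₂₃).Valid u₁₂ u₁₃ u₂₃ := by
  constructor <;> revert u₁₂ u₁₃ u₂₃ <;> decide +kernel

theorem isGlued₂ {p q r s : E} {G : PD E n m} :
    (⟨Matrix.vecCons ![.inr 1, .inl p, .inl r, .inr 0]
        (Matrix.vecCons ![.inl s, .inl q, .inr 1, .inr 0] (G.map .inl).crossing),
      (G.map .inl).arc⟩ : PD (E ⊕ Fin 2) (n + 2) m).IsGlued G tangle₂ ![p, q, r, s] where
  crossing_inner i c := by fin_cases i <;> fin_cases c <;> rfl
  crossing_outer i c := rfl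
  arc j c := rfl

theorem isGlued₁ {u : Bool} {p q : E} {G : PD E n m} :
    (⟨Matrix.vecCons (crossingOf u (.inr 0) (.inr 0) (.inl p) (.inl q)) (G.map .inl).crossing,
      (G.map .inl).arc⟩ : PD (E ⊕ Fin 1) (n + 1) m).IsGlued G (tangle₁ u) ![p, q] where
  crossing_inner i c := by cases u <;> fin_cases i <;> fin_cases c <;> rfl
  crossing_outer i c := rfl
  arc j c := rfl

theorem isGlued₃ {u₁₂ u₁₃ u₂₃ : Bool} {p : Fin 6 → E} {G : PD E n m} :
    (⟨Matrix.vecCons (crossingOf u₁₂ (.inl (p 0)) (.inl (p 1)) (.inr 0) (.inr 1))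
        (Matrix.vecCons (crossingOf u₁₃ (.inr 0) (.inl (p 2)) (.inl (p 3)) (.inr 2))
          (Matrix.vecCons (crossingOf u₂₃ (.inr 1) (.inr 2) (.inl (p 4)) (.inl (p 5)))
            (G.map .inl).crossing)),
      (G.map .inl).arc⟩ : PD (E ⊕ Fin 3) (n + 3) m).IsGlued G (tangle₃ u₁₂ u₁₃ u₂₃) p where
  crossing_inner i c := by
    fin_cases i <;> [cases u₁₂; cases u₁₃; cases u₂₃] <;> fin_cases c <;> rfl
  crossing_outer i c := rfl
  arc j c := rfl

theorem isGlued₃' {u₁₂ u₁₃ u₂₃ : Bool} {p : Fin 6 → E} {G : PD E n m} :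
    (⟨Matrix.vecCons (crossingOf u₁₂ (.inr 0) (.inr 1) (.inl (p 3)) (.inl (p 4)))
        (Matrix.vecCons (crossingOf u₁₃ (.inl (p 0)) (.inr 2) (.inr 0) (.inl (p 5)))
          (Matrix.vecCons (crossingOf u₂₃ (.inl (p 1)) (.inl (p 2)) (.inr 1) (.inr 2))
            (G.map .inl).crossing)),
      (G.map .inl).arc⟩ : PD (E ⊕ Fin 3) (n + 3) m).IsGlued G (tangle₃' u₁₂ u₁₃ u₂₃) p where
  crossing_inner i c := by
    fin_cases i <;> [cases u₁₂; cases u₁₃; cases u₂₃] <;> fin_cases c <;> rfl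
  crossing_outer i c := rfl
  arc j c := rfl

/-- The third Reidemeister move. -/
theorem homology_slide [Finite E] {u₁₂ u₁₃ u₂₃ : Bool} (hu : u₁₂ = u₂₃ → u₁₃ = u₁₂)
    {D D' : PD (E ⊕ Fin 3) (n + 3) m} {G : PD E n m} {p : Fin 6 → E}
    (h : D.IsGlued G (tangle₃ u₁₂ u₁₃ u₂₃) p) (h' : D'.IsGlued G (tangle₃' u₁₂ u₁₃ u₂₃) p)
    (hD : D.Dich) (hD' : D'.Dich) (a c : ℤ) :
    Nonempty (D.complex.Homology a c ≃ₗ[ℤ] D'.complex.Homology a c) := by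
  have hS := slide_valid u₁₂ u₁₃ u₂₃ hu
  obtain ⟨e₁⟩ := h.cancel hD hS.cancels 0 a c
  obtain ⟨e₂⟩ := h'.cancel hD' hS.cancels' 0 a c
  obtain ⟨e₃⟩ := model_congr (G := G) (p := p) (N := fun t => t ≠ center u₁₂ u₁₃ u₂₃ ∧
    t ≠ (slide u₁₂ u₁₃ u₂₃).tq ∧ t ≠ (slide u₁₂ u₁₃ u₂₃).tp) (slide u₁₂ u₁₃ u₂₃).corr (slide u₁₂ u₁₃ u₂₃).sgn
    hS.sgn_mul (Function.Involutive.injective hS.involutive) hS.corr_iff hS.sum_eq hS.ends_eq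
    hS.compat a c
  exact ⟨e₁.trans (e₃.trans e₂.symm)⟩

/-- The circles of a diagram with arcs instead of a tangle. -/
theorem outerCircles_eq {m' : ℕ} {G : PD E n m} {D' : PD E n m'} {p : Fin b → E}
    {r : Fin b → Fin b → Prop} {s : Fin n → Marker}
    (h1 : ∀ x y, G.Joined s x y → D'.Joined s x y)
    (h2 : ∀ i j, r i j → D'.circles s (p i) (p j))
    (h3 : ∀ x y, D'.Joined s x y → G.Joined s x y ∨ ∃ i j, r i j ∧ p i = x ∧ p j = y) :
    outerCircles G p r s = D'.circles s := by
  ext x y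
  refine ⟨outerCircles_le (fun x y e => circles_of_joined (h1 x y e)) h2, fun e => ?_⟩
  refine circles_le (r := outerCircles G p r s) (fun x y e => ?_) e
  exact Relation.EqvGen.rel _ _ (h3 x y e)

theorem joined_add_arcs {m' : ℕ} {D : PD E n m} {D' : PD E n m'} (hc : D'.crossing = D.crossing)
    (ha : ∀ j, ∃ j', D'.arc j' = D.arc j) {s : Fin n → Marker} {x y : E} (h : D.Joined s x y) :
    D'.Joined s x y := by
  rcases h with ⟨i, hi⟩ | ⟨i, hi⟩ | ⟨i, hi⟩ | ⟨i, hi⟩ | ⟨j⟩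
  · rw [← hc]; exact Joined.A₁ i hi
  · rw [← hc]; exact Joined.A₂ i hi
  · rw [← hc]; exact Joined.B₁ i hi
  · rw [← hc]; exact Joined.B₂ i hi
  · obtain ⟨j', e⟩ := ha j
    rw [← e]; exact Joined.arc j'

theorem joined_of_add_arc {D : PD E n m} {c : Fin 2 → E} {s : Fin n → Marker} {x y : E}
    (h : (⟨D.crossing, Matrix.vecCons c D.arc⟩ : PD E n (m + 1)).Joined s x y) :
    D.Joined s x y ∨ (x = c 0 ∧ y = c 1) := by
  rcases h with ⟨i, hi⟩ | ⟨i, hi⟩ | ⟨i, hi⟩ | ⟨i, hi⟩ | ⟨j⟩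
  · exact Or.inl (Joined.A₁ i hi)
  · exact Or.inl (Joined.A₂ i hi)
  · exact Or.inl (Joined.B₁ i hi)
  · exact Or.inl (Joined.B₂ i hi)
  · refine Fin.cases ?_ (fun j => ?_) j
    · exact Or.inr ⟨rfl, rfl⟩
    · exact Or.inl (Joined.arc j)

/-- The first Reidemeister move. -/
theorem homology_kink [Finite E] {u : Bool} {D : PD (E ⊕ Fin 1) (n + 1) m} {G : PD E n m}
    {p q : E} (h : D.IsGlued G (tangle₁ u) ![p, q]) (hD : D.Dich)
    (hD' : (⟨G.crossing, Matrix.vecCons ![p, q] G.arc⟩ : PD E n (m + 1)).Dich) (a c k : ℤ)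
    (hk : k = if u then -1 else 1) :
    Nonempty (D.complex.Homology a c ≃ₗ[ℤ] (⟨G.crossing, Matrix.vecCons ![p, q] G.arc⟩ :
      PD E n (m + 1)).complex.Homology (a + k) (c + 3 * k)) := by
  let D' : PD E n (m + 1) := ⟨G.crossing, Matrix.vecCons ![p, q] G.arc⟩
  have hr : ∀ t, (∀ i j, (tangle₁ u).ends t i j) → ∀ s,
      outerCircles G ![p, q] ((tangle₁ u).ends t) s = D'.circles s := by
    intro t ht s
    have hpq : D'.circles s p q := circles_of_joined (Joined.arc (D := D') 0)
    refine outerCircles_eq (fun x y => joined_add_arcs (D := G) (D' := D') rfl fun j => ⟨j.succ, rfl⟩) ?_ ?_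
    · intro i j _
      fin_cases i <;> fin_cases j
      · exact Setoid.refl' _ _
      · exact hpq
      · exact Setoid.symm' _ hpq
      · exact Setoid.refl' _ _
    · intro x y e
      rcases joined_of_add_arc e with e | ⟨rfl, rfl⟩
      · exact Or.inl e
      · exact Or.inr ⟨0, 1, ht 0 1, rfl, rfl⟩
  -- The loop of the kink closes up for the marker B if `u` is false and for A if `u` is true. The
  -- shift of `c` by `3 * k` is 2 from the sign of the surviving circle and 1 from the marker.
  cases u
  · obtain ⟨e₁⟩ := (h.cancel_one hD (t₀ := ![.B]) (t₁ := ![.A]) (by decide +kernel)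
      (by decide +kernel) (by decide +kernel) (by decide +kernel) 0 0 a c).2 (by decide +kernel)
    have := model_single (D' := D') (N := fun t => t = ![.B]) (κ := fun _ _ => 0) hD'
      (fun t => Iff.rfl) rfl (hr ![.B] (fun i j => by
        change (tangle₁ false).circles _ _ _
        revert i j; decide +kernel)) (a + 1) (c + 3)
    rw [show markerSum ![Marker.B] = -1 by decide +kernel, add_neg_cancel_right,
      show c + 3 + -1 = c + 2 by ring] at this
    obtain ⟨e₂⟩ := this
    subst hk
    exact ⟨e₁.trans e₂⟩
  · obtain ⟨e₁⟩ := (h.cancel_one hD (t₀ := ![.A]) (t₁ := ![.B]) (by decide +kernel)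
      (by decide +kernel) (by decide +kernel) (by decide +kernel) 0 0 a c).1 (by decide +kernel)
    have := model_single (D' := D') (N := fun t => t = ![.A]) (κ := fun _ _ => 0) hD'
      (fun t => Iff.rfl) rfl (hr ![.A] (fun i j => by
        change (tangle₁ true).circles _ _ _
        revert i j; decide +kernel)) (a + -1) (c + 3 * -1)
    rw [show markerSum ![Marker.A] = 1 by decide +kernel, neg_add_cancel_right,
      show c + 3 * -1 + 1 = c - 2 by ring] at this
    obtain ⟨e₂⟩ := this
    subst hk
    exact ⟨e₁.trans e₂⟩

/-- The second Reidemeister move. -/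
theorem homology_clasp [Finite E] {D : PD (E ⊕ Fin 2) (n + 2) m} {G : PD E n m} {p q r s : E}
    (h : D.IsGlued G tangle₂ ![p, q, r, s]) (hD : D.Dich)
    (hD' : (⟨G.crossing, Matrix.vecCons ![p, q] (Matrix.vecCons ![r, s] G.arc)⟩ :
      PD E n (m + 2)).Dich) (a c : ℤ) :
    Nonempty (D.complex.Homology a c ≃ₗ[ℤ] (⟨G.crossing, Matrix.vecCons ![p, q]
      (Matrix.vecCons ![r, s] G.arc)⟩ : PD E n (m + 2)).complex.Homology a c) := by
  let D' : PD E n (m + 2) := ⟨G.crossing, Matrix.vecCons ![p, q] (Matrix.vecCons ![r, s] G.arc)⟩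
  obtain ⟨e₁⟩ := h.cancel hD cancels₂ 0 a c
  have hr : ∀ σ, outerCircles G ![p, q, r, s] (tangle₂.ends ![.A, .B]) σ = D'.circles σ := by
    intro σ
    have h1 : D'.circles σ p q := circles_of_joined (Joined.arc (D := D') 0)
    have h2 : D'.circles σ r s := circles_of_joined (Joined.arc (D := D') 1)
    refine outerCircles_eq (fun x y => joined_add_arcs (D := G) (D' := D') rfl fun j => ⟨j.succ.succ, rfl⟩) ?_ ?_
    · intro i j e
      have hn : ∀ i j : Fin 4, tangle₂.circles ![.A, .B] (.inl i) (.inl j) →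
          i = j ∨ (i = 0 ∧ j = 1) ∨ (i = 1 ∧ j = 0) ∨ (i = 2 ∧ j = 3) ∨ (i = 3 ∧ j = 2) := by
        decide +kernel
      rcases hn i j e with rfl | ⟨rfl, rfl⟩ | ⟨rfl, rfl⟩ | ⟨rfl, rfl⟩ | ⟨rfl, rfl⟩
      · exact Setoid.refl' _ _
      · exact h1
      · exact Setoid.symm' _ h1
      · exact h2
      · exact Setoid.symm' _ h2
    · intro x y e
      rcases joined_of_add_arc (D := ⟨G.crossing, Matrix.vecCons ![r, s] G.arc⟩) e with
        e | ⟨rfl, rfl⟩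
      · rcases joined_of_add_arc (D := G) e with e | ⟨rfl, rfl⟩
        · exact Or.inl e
        · exact Or.inr ⟨2, 3, by change tangle₂.circles _ _ _; decide +kernel, rfl, rfl⟩
      · exact Or.inr ⟨0, 1, by change tangle₂.circles _ _ _; decide +kernel, rfl, rfl⟩
  have := model_single (D' := D') (t₀ := ![.A, .B])
    (N := fun t => t ≠ ![.B, .A] ∧ t ≠ ![.B, .B] ∧ t ≠ ![.A, .A])
    (κ := cancelled ![.B, .A] ![.B, .B] ![.A, .A]) hD' (by decide +kernel) (by decide +kernel) hr a c
  rw [show markerSum ![Marker.A, .B] = 0 by decide +kernel, add_zero, add_zero] at this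
  obtain ⟨e₂⟩ := this
  exact ⟨e₁.trans e₂⟩

end PD

/-! ### Planar isotopies -/

namespace PD

open Saddle

variable {E E' : Type} {n m m' : ℕ}

/-- On `E'`, relate two edges when all their preimages are related. As each fibre lies in one
circle, this is an equivalence relation, and it contains the generators for `D'`. -/
theorem circles_eq_comap {D : PD E n m} {D' : PD E' n m'} {f : E → E'} {s : Fin n → Marker}
    (hf : Function.Surjective f) (h1 : ∀ x y, D.Joined s x y → D'.circles s (f x) (f y))
    (h2 : ∀ x y, D'.Joined s x y → ∃ u v, f u = x ∧ f v = y ∧ D.circles s u v)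
    (h3 : ∀ u v, f u = f v → D.circles s u v) : D.circles s = (D'.circles s).comap f := by
  let S : Setoid E' :=
    { r := fun x y => ∀ u v, f u = x → f v = y → D.circles s u v
      iseqv := ⟨fun x u v hu hv => h3 u v (hu.trans hv.symm),
        fun h u v hu hv => Setoid.symm' _ (h v u hv hu), fun {x y z} h h' u v hu hv => by
          obtain ⟨w, hw⟩ := hf y
          exact Setoid.trans' _ (h u w hu hw) (h' w v hw hv)⟩ }
  ext x y
  refine ⟨circles_le (r := (D'.circles s).comap f) h1, fun e => ?_⟩
  refine circles_le (r := S) (fun x' y' e' => ?_) e x y rfl rfl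
  obtain ⟨u, v, hu, hv, huv⟩ := h2 x' y' e'
  exact fun u' v' hu' hv' => Setoid.trans' _ (h3 _ _ (hu'.trans hu.symm))
    (Setoid.trans' _ huv (h3 _ _ (hv.trans hv'.symm)))

/-- Homology does not change when edges are identified along a map which respects the circles. -/
theorem homology_of_circles_eq_comap [Finite E] [Finite E'] {D : PD E n m} {D' : PD E' n m'}
    {f : E → E'} (hf : Function.Surjective f) (hD : D.Dich) (hD' : D'.Dich)
    (h : ∀ s, D.circles s = (D'.circles s).comap f) (a c : ℤ) :
    Nonempty (D.complex.Homology a c ≃ₗ[ℤ] D'.complex.Homology a c) := by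
  classical
  let j : D'.EnhancedState → D.EnhancedState := fun σ =>
    .ofConst D σ.marker (σ.sign ∘ f) (by rw [h]; exact σ.const.comap f)
  have key := BasedComplex.homology_equiv_of_iso (C := D.complex) (C' := D'.complex)
    (k := 0) (l := 0) j ⟨?_, ?_⟩ (fun _ => 1) (fun _ => rfl) ?_ ?_ a c
  · rw [add_zero, add_zero] at key
    exact key
  · intro σ σ' e
    have e : j σ = j σ' := e
    exact EnhancedState.ext (congrArg (fun s : D.EnhancedState => s.marker) e)
      (hf.injective_comp_right (congrArg (fun s : D.EnhancedState => s.sign) e))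
  · intro (σ : D.EnhancedState)
    obtain ⟨g, hg⟩ := hf.hasRightInverse
    have hs := σ.const
    have hs' := hs
    rw [h] at hs'
    refine ⟨.ofConst D' σ.marker (σ.sign ∘ g) fun x y e => hs' _ _ ?_,
      EnhancedState.ext rfl (funext fun x => hs' _ _ ?_)⟩
    · change D'.circles _ (f (g x)) (f (g y))
      rwa [hg, hg]
    · change D'.circles _ (f (g (f x))) (f x)
      rw [hg]
  · intro (σ : D'.EnhancedState)
    have ha : (j σ).a = σ.a := by rw [EnhancedState.a_eq, EnhancedState.a_eq]; rfl
    have ht : (j σ).τ = σ.τ := by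
      rw [EnhancedState.tau_eq, EnhancedState.tau_eq]
      change tau (D.circles σ.marker) (σ.sign ∘ f) = _
      rw [h]
      refine tau_comap _ f (fun y => ?_) σ.const
      obtain ⟨x, rfl⟩ := hf y
      exact ⟨x, Setoid.refl' _ _⟩
    constructor
    · change σ.a = (j σ).a + 0
      rw [ha, add_zero]
    · change σ.b = (j σ).b + 0
      rw [EnhancedState.b, EnhancedState.b, ha, ht, add_zero]
  · intro (σ : D'.EnhancedState) (σ' : D'.EnhancedState)
    change σ.incidence σ' = 1 * 1 * (j σ).incidence (j σ')
    rw [one_mul, one_mul, incidence_eq hD, incidence_eq hD']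
    change _ = ksgn σ.marker σ'.marker * if Sad (D.circles σ.marker) (D.circles σ'.marker)
      (σ.sign ∘ f) (σ'.sign ∘ f) then 1 else 0
    by_cases hk : ksgn σ.marker σ'.marker = 0
    · rw [hk, zero_mul, zero_mul]
    obtain ⟨P, Q, hPQ⟩ := hD'.merge hk
    rw [h, h]
    congr 1
    refine if_congr (sad_comap_iff hPQ f σ.const σ'.const fun y => ?_) rfl rfl
    obtain ⟨x, rfl⟩ := hf y
    exact Or.inl ⟨⟨x, Setoid.refl' _ _⟩, ⟨x, Setoid.refl' _ _⟩⟩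

theorem Joined.map {D : PD E n m} (f : E → E') {s : Fin n → Marker} {x y : E}
    (h : D.Joined s x y) : (D.map f).Joined s (f x) (f y) := by
  rcases h with ⟨i, hi⟩ | ⟨i, hi⟩ | ⟨i, hi⟩ | ⟨i, hi⟩ | ⟨j⟩
  · exact Joined.A₁ (D := D.map f) i hi
  · exact Joined.A₂ (D := D.map f) i hi
  · exact Joined.B₁ (D := D.map f) i hi
  · exact Joined.B₂ (D := D.map f) i hi
  · exact Joined.arc (D := D.map f) j

theorem Joined.exists_of_map {D : PD E n m} {f : E → E'} {s : Fin n → Marker} {x y : E'}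
    (h : (D.map f).Joined s x y) : ∃ u v, f u = x ∧ f v = y ∧ D.Joined s u v := by
  rcases h with ⟨i, hi⟩ | ⟨i, hi⟩ | ⟨i, hi⟩ | ⟨i, hi⟩ | ⟨j⟩
  · exact ⟨_, _, rfl, rfl, Joined.A₁ i hi⟩
  · exact ⟨_, _, rfl, rfl, Joined.A₂ i hi⟩
  · exact ⟨_, _, rfl, rfl, Joined.B₁ i hi⟩
  · exact ⟨_, _, rfl, rfl, Joined.B₂ i hi⟩
  · exact ⟨_, _, rfl, rfl, Joined.arc j⟩

theorem homology_relabel [Finite E] [Finite E'] (f : E ≃ E') {D : PD E n m} (hD : D.Dich)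
    (hD' : (D.map f).Dich) (a c : ℤ) :
    Nonempty (D.complex.Homology a c ≃ₗ[ℤ] (D.map f).complex.Homology a c) := by
  refine homology_of_circles_eq_comap f.surjective hD hD' (fun s => ?_) a c
  refine circles_eq_comap f.surjective (fun x y h => circles_of_joined (h.map f))
    (fun x y h => ?_) fun u v e => f.injective e ▸ Setoid.refl' _ _
  obtain ⟨u, v, hu, hv, huv⟩ := h.exists_of_map
  exact ⟨u, v, hu, hv, circles_of_joined huv⟩

theorem homology_removeArc [Finite E] {y : E} {D : PD (Option E) n m}
    (hD : (⟨D.crossing, Matrix.vecCons ![none, some y] D.arc⟩ : PD (Option E) n (m + 1)).Dich)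
    (hD' : (D.map fun x => x.getD y).Dich) (a c : ℤ) :
    Nonempty ((⟨D.crossing, Matrix.vecCons ![none, some y] D.arc⟩ :
      PD (Option E) n (m + 1)).complex.Homology a c ≃ₗ[ℤ]
      (D.map fun x => x.getD y).complex.Homology a c) := by
  let D₀ : PD (Option E) n (m + 1) := ⟨D.crossing, Matrix.vecCons ![none, some y] D.arc⟩
  have hf : Function.Surjective fun x : Option E => x.getD y := fun x => ⟨some x, rfl⟩
  refine homology_of_circles_eq_comap hf hD hD' (fun s => ?_) a c
  have hD₀ : ∀ {x z}, D.Joined s x z → D₀.circles s x z := fun h => circles_of_joined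
    (joined_add_arcs (D := D) (D' := D₀) rfl (fun j => ⟨j.succ, rfl⟩) h)
  have hn : D₀.circles s none (some y) := circles_of_joined (Joined.arc (D := D₀) 0)
  have hx : ∀ x, D₀.circles s x (some (x.getD y)) := by
    rintro (_ | x)
    · exact hn
    · exact Setoid.refl' _ _
  refine circles_eq_comap hf (fun x z h => ?_) (fun x z h => ?_) fun u v e =>
    Setoid.trans' _ (hx u) (by
      have e : u.getD y = v.getD y := e
      rw [e]; exact Setoid.symm' _ (hx v))
  · rcases joined_of_add_arc h with h | ⟨rfl, rfl⟩
    · exact circles_of_joined (h.map _)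
    · exact Setoid.refl' _ _
  · obtain ⟨u, v, hu, hv, huv⟩ := h.exists_of_map
    exact ⟨u, v, hu, hv, hD₀ huv⟩

theorem homology_of_joined_iff [Finite E] {D : PD E n m} {D' : PD E n m'} (hD : D.Dich)
    (hD' : D'.Dich) (h : ∀ s x y, D.Joined s x y → D'.Joined s x y ∨ D'.Joined s y x)
    (h' : ∀ s x y, D'.Joined s x y → D.Joined s x y ∨ D.Joined s y x) (a c : ℤ) :
    Nonempty (D.complex.Homology a c ≃ₗ[ℤ] D'.complex.Homology a c) := by
  refine homology_of_circles_eq_comap Function.surjective_id hD hD' (fun s => ?_) a c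
  refine circles_eq_comap Function.surjective_id (fun x y e => ?_) (fun x y e => ⟨x, y, rfl, rfl, ?_⟩)
    fun u v (e : u = v) => e ▸ Setoid.refl' _ _
  · exact (h s x y e).elim circles_of_joined fun e => Setoid.symm' _ (circles_of_joined e)
  · exact (h' s x y e).elim circles_of_joined fun e => Setoid.symm' _ (circles_of_joined e)

theorem joined_halfTurn {D D' : PD E n m} (ha : D'.arc = D.arc)
    (hc : ∀ i, D'.crossing i = D.crossing i ∨ D'.crossing i = fun k => D.crossing i (k + 2))
    {s : Fin n → Marker} {x y : E} (h : D.Joined s x y) : D'.Joined s x y := by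
  rcases h with ⟨i, hi⟩ | ⟨i, hi⟩ | ⟨i, hi⟩ | ⟨i, hi⟩ | ⟨j⟩
  · rcases hc i with e | e
    · rw [← e]; exact Joined.A₁ i hi
    · have := Joined.A₂ (D := D') i hi; rwa [e] at this
  · rcases hc i with e | e
    · rw [← e]; exact Joined.A₂ i hi
    · have := Joined.A₁ (D := D') i hi; rwa [e] at this
  · rcases hc i with e | e
    · rw [← e]; exact Joined.B₁ i hi
    · have := Joined.B₂ (D := D') i hi; rwa [e] at this
  · rcases hc i with e | e
    · rw [← e]; exact Joined.B₂ i hi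
    · have := Joined.B₁ (D := D') i hi; rwa [e] at this
  · rw [← ha]; exact Joined.arc j

theorem homology_halfTurn [Finite E] {i : Fin n} {D : PD E n m} (hD : D.Dich)
    (hD' : (⟨Function.update D.crossing i fun k => D.crossing i (k + 2), D.arc⟩ : PD E n m).Dich)
    (a c : ℤ) : Nonempty (D.complex.Homology a c ≃ₗ[ℤ]
      (⟨Function.update D.crossing i fun k => D.crossing i (k + 2), D.arc⟩ :
        PD E n m).complex.Homology a c) := by
  let D' : PD E n m := ⟨Function.update D.crossing i fun k => D.crossing i (k + 2), D.arc⟩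
  refine homology_of_joined_iff hD hD' (fun s x y e => Or.inl (joined_halfTurn (D := D) (D' := D') rfl ?_ e))
    (fun s x y e => Or.inl (joined_halfTurn (D := D') (D' := D) rfl ?_ e)) a c
  · intro i'
    by_cases h : i' = i
    · subst h; exact Or.inr (Function.update_self ..)
    · exact Or.inl (Function.update_of_ne h ..)
  · intro i'
    by_cases h : i' = i
    · subst h
      refine Or.inr ?_
      funext k
      have e4 : k + 2 + 2 = k := by revert k; decide
      simp only [D', Function.update_self, e4]
    · exact Or.inl (Function.update_of_ne h ..).symm

theorem joined_flipArc {D D' : PD E n m} (hc : D'.crossing = D.crossing)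
    (ha : ∀ j, D'.arc j = D.arc j ∨ D'.arc j = fun k => D.arc j (k + 1))
    {s : Fin n → Marker} {x y : E} (h : D.Joined s x y) : D'.Joined s x y ∨ D'.Joined s y x := by
  rcases h with ⟨i, hi⟩ | ⟨i, hi⟩ | ⟨i, hi⟩ | ⟨i, hi⟩ | ⟨j⟩
  · rw [← hc]; exact Or.inl (Joined.A₁ i hi)
  · rw [← hc]; exact Or.inl (Joined.A₂ i hi)
  · rw [← hc]; exact Or.inl (Joined.B₁ i hi)
  · rw [← hc]; exact Or.inl (Joined.B₂ i hi)
  · rcases ha j with e | e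
    · rw [← e]; exact Or.inl (Joined.arc j)
    · have := Joined.arc (D := D') (s := s) j
      rw [e] at this
      exact Or.inr this

theorem homology_flipArc [Finite E] {j : Fin m} {D : PD E n m} (hD : D.Dich)
    (hD' : (⟨D.crossing, Function.update D.arc j fun k => D.arc j (k + 1)⟩ : PD E n m).Dich)
    (a c : ℤ) : Nonempty (D.complex.Homology a c ≃ₗ[ℤ]
      (⟨D.crossing, Function.update D.arc j fun k => D.arc j (k + 1)⟩ :
        PD E n m).complex.Homology a c) := by
  let D' : PD E n m := ⟨D.crossing, Function.update D.arc j fun k => D.arc j (k + 1)⟩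
  refine homology_of_joined_iff hD hD' (fun s x y e => joined_flipArc (D := D) (D' := D') rfl ?_ e)
    (fun s x y e => joined_flipArc (D := D') (D' := D) rfl ?_ e) a c
  · intro i'
    by_cases h : i' = j
    · subst h; exact Or.inr (Function.update_self ..)
    · exact Or.inl (Function.update_of_ne h ..)
  · intro i'
    by_cases h : i' = j
    · subst h
      refine Or.inr ?_
      funext k
      have e2 : k + 1 + 1 = k := by revert k; decide
      simp only [D', Function.update_self, e2]
    · exact Or.inl (Function.update_of_ne h ..).symm

/-- The sign of the permutation `σ` on the `B`-markers. -/
def shuffleSign (σ : Equiv.Perm (Fin n)) (t : Fin n → Marker) : ℤ :=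
  ∏ i, ∏ j, if i < j ∧ σ j < σ i ∧ t i = .B ∧ t j = .B then -1 else 1

theorem shuffleSign_mul_self (σ : Equiv.Perm (Fin n)) (t : Fin n → Marker) :
    shuffleSign σ t * shuffleSign σ t = 1 := by
  rw [shuffleSign, ← Finset.prod_mul_distrib]
  refine Finset.prod_eq_one fun i _ => ?_
  rw [← Finset.prod_mul_distrib]
  refine Finset.prod_eq_one fun j _ => ?_
  split_ifs <;> rfl

theorem edgeSign_eq_prod (s : Fin n → Marker) (v : Fin n) :
    edgeSign s v = ∏ w, if v < w ∧ s w = .B then (-1 : ℤ) else 1 := by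
  rw [edgeSign, Finset.prod_ite, Finset.prod_const, Finset.prod_const_one, mul_one]

/-- A new B-marker at `v` multiplies the shuffle sign by the inversions between `v` and the other
B-markers. These are the markers which lie after `v` in only one of the two orders. -/
theorem edgeSign_shuffle (σ : Equiv.Perm (Fin n)) (t : Fin n → Marker) (v : Fin n) (hv : t v = .A) :
    edgeSign t v = shuffleSign σ t * shuffleSign σ (Function.update t v .B) *
      edgeSign (t ∘ σ.symm) (σ v) := by
  have h1 : shuffleSign σ (Function.update t v .B) = shuffleSign σ t *
      ∏ j, (if v < j ∧ σ j < σ v ∧ t j = .B then -1 else 1) *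
        if j < v ∧ σ v < σ j ∧ t j = .B then -1 else 1 := by
    have e : ∏ j, ((if v < j ∧ σ j < σ v ∧ t j = .B then (-1 : ℤ) else 1) *
        if j < v ∧ σ v < σ j ∧ t j = .B then -1 else 1) =
        ∏ i, ∏ j, ((if i = v then (if v < j ∧ σ j < σ v ∧ t j = .B then (-1 : ℤ) else 1) else 1) *
          if j = v then (if i < v ∧ σ v < σ i ∧ t i = .B then -1 else 1) else 1) := by
      simp only [Finset.prod_mul_distrib, Finset.prod_ite_eq', Finset.mem_univ, if_true]
      congr 1
      rw [Finset.prod_comm]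
      simp
    rw [e, shuffleSign, shuffleSign, ← Finset.prod_mul_distrib]
    refine Finset.prod_congr rfl fun i _ => ?_
    rw [← Finset.prod_mul_distrib]
    refine Finset.prod_congr rfl fun j _ => ?_
    by_cases hi : i = v
    · subst hi
      by_cases hj : j = i
      · subst hj; simp
      · simp [hv, hj]
    · by_cases hj : j = v
      · subst hj; simp [hi, hv]
      · simp [hi, hj]
  have h2 : edgeSign (t ∘ σ.symm) (σ v) = ∏ w, if σ v < σ w ∧ t w = .B then (-1 : ℤ) else 1 := by
    rw [edgeSign_eq_prod]
    exact (Fintype.prod_equiv σ _ _ fun w => by simp).symm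
  rw [h1, ← mul_assoc, shuffleSign_mul_self, one_mul, h2, edgeSign_eq_prod,
    ← Finset.prod_mul_distrib]
  refine Finset.prod_congr rfl fun j _ => ?_
  rcases lt_trichotomy v j with h | rfl | h
  · rcases lt_or_gt_of_ne (σ.injective.ne h.ne) with h' | h' <;>
      simp [h, h', h.asymm, h'.asymm]
  · simp
  · rcases lt_or_gt_of_ne (σ.injective.ne h.ne) with h' | h' <;>
      simp [h, h', h.asymm, h'.asymm]
    split_ifs <;> rfl

theorem ksgn_shuffle (σ : Equiv.Perm (Fin n)) (t t' : Fin n → Marker) :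
    ksgn t t' = shuffleSign σ t * shuffleSign σ t' * ksgn (t ∘ σ.symm) (t' ∘ σ.symm) := by
  have hiff : ∀ v, t' ∘ σ.symm = Function.update (t ∘ σ.symm) (σ v) .B ↔
      t' = Function.update t v .B := fun v => by
    have : Function.update (t ∘ σ.symm) (σ v) .B = Function.update t v .B ∘ σ.symm := by
      funext w
      obtain ⟨w, rfl⟩ := σ.surjective w
      by_cases h : w = v
      · subst h; simp
      · simp [h]
    rw [this]
    exact σ.symm.surjective.injective_comp_right.eq_iff
  rw [ksgn, ksgn, Finset.mul_sum, ← Equiv.sum_comp σ fun v => shuffleSign σ t * shuffleSign σ t' *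
    if (t ∘ σ.symm) v = .A ∧ t' ∘ σ.symm = Function.update (t ∘ σ.symm) v .B then
      edgeSign (t ∘ σ.symm) v else 0]
  refine Finset.sum_congr rfl fun v _ => ?_
  by_cases h : t v = .A ∧ t' = Function.update t v .B
  · rw [if_pos h, if_pos ⟨by simpa using h.1, (hiff v).2 h.2⟩, edgeSign_shuffle σ t v h.1, h.2]
  · rw [if_neg h, if_neg, mul_zero]
    rintro ⟨h1, h2⟩
    exact h ⟨by simpa using h1, (hiff v).1 h2⟩

/-- Multiplying each state by its shuffle sign turns the incidence numbers for one order of the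
crossings into those for the other. -/
theorem homology_reorder [Finite E] {σ : Equiv.Perm (Fin n)} {ρ : Equiv.Perm (Fin m)}
    {D : PD E n m} (hD : D.Dich) (hD' : (⟨D.crossing ∘ σ, D.arc ∘ ρ⟩ : PD E n m).Dich) (a c : ℤ) :
    Nonempty (D.complex.Homology a c ≃ₗ[ℤ]
      (⟨D.crossing ∘ σ, D.arc ∘ ρ⟩ : PD E n m).complex.Homology a c) := by
  classical
  let D' : PD E n m := ⟨D.crossing ∘ σ, D.arc ∘ ρ⟩
  have h1 : ∀ t x y, D'.Joined t x y → D.Joined (t ∘ σ.symm) x y := by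
    rintro t x y (⟨i, hi⟩ | ⟨i, hi⟩ | ⟨i, hi⟩ | ⟨i, hi⟩ | ⟨j⟩)
    · exact Joined.A₁ (σ i) (by simpa using hi)
    · exact Joined.A₂ (σ i) (by simpa using hi)
    · exact Joined.B₁ (σ i) (by simpa using hi)
    · exact Joined.B₂ (σ i) (by simpa using hi)
    · exact Joined.arc (ρ j)
  have h2 : ∀ t x y, D.Joined (t ∘ σ.symm) x y → D'.Joined t x y := by
    rintro t x y (⟨i, hi⟩ | ⟨i, hi⟩ | ⟨i, hi⟩ | ⟨i, hi⟩ | ⟨j⟩)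
    · have := Joined.A₁ (D := D') (σ.symm i) hi
      simpa [D'] using this
    · have := Joined.A₂ (D := D') (σ.symm i) hi
      simpa [D'] using this
    · have := Joined.B₁ (D := D') (σ.symm i) hi
      simpa [D'] using this
    · have := Joined.B₂ (D := D') (σ.symm i) hi
      simpa [D'] using this
    · have := Joined.arc (D := D') (s := t) (ρ.symm j)
      simpa [D'] using this
  have hcirc : ∀ t, D.circles (t ∘ σ.symm) = D'.circles t := fun t => by
    ext x y
    exact ⟨circles_le fun x y e => circles_of_joined (h2 t x y e),
      circles_le fun x y e => circles_of_joined (h1 t x y e)⟩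
  let j : D'.EnhancedState → D.EnhancedState := fun s =>
    .ofConst D (s.marker ∘ σ.symm) s.sign (by rw [hcirc]; exact s.const)
  have key := BasedComplex.homology_equiv_of_iso (C := D.complex) (C' := D'.complex)
    (k := 0) (l := 0) j ⟨?_, ?_⟩ (fun s : D'.EnhancedState => shuffleSign σ s.marker)
    (fun _ => shuffleSign_mul_self _ _) ?_ ?_ a c
  · rw [add_zero, add_zero] at key
    exact key
  · intro s s' e
    have e : j s = j s' := e
    exact EnhancedState.ext (σ.symm.surjective.injective_comp_right
      (congrArg (fun s : D.EnhancedState => s.marker) e))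
      (congrArg (fun s : D.EnhancedState => s.sign) e)
  · intro (s : D.EnhancedState)
    refine ⟨.ofConst D' (s.marker ∘ σ) s.sign ?_, EnhancedState.ext ?_ rfl⟩
    · rw [← hcirc]
      have : (s.marker ∘ σ) ∘ σ.symm = s.marker := by funext; simp
      rw [this]
      exact s.const
    · change (s.marker ∘ σ) ∘ σ.symm = s.marker
      funext; simp
  · intro (s : D'.EnhancedState)
    have ha : (j s).a = s.a := by
      rw [EnhancedState.a_eq, EnhancedState.a_eq]
      exact (Fintype.sum_equiv σ _ _ fun i => by simp [j, EnhancedState.ofConst]).symm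
    have ht : (j s).τ = s.τ := by
      rw [EnhancedState.tau_eq, EnhancedState.tau_eq, ← hcirc]
      rfl
    constructor
    · change s.a = (j s).a + 0
      rw [ha, add_zero]
    · change s.b = (j s).b + 0
      rw [EnhancedState.b, EnhancedState.b, ha, ht, add_zero]
  · intro (s : D'.EnhancedState) (s' : D'.EnhancedState)
    change s.incidence s' = shuffleSign σ s.marker * shuffleSign σ s'.marker *
      (j s).incidence (j s')
    rw [incidence_eq hD, incidence_eq hD', ksgn_shuffle σ, mul_assoc, ← hcirc, ← hcirc]
    rfl

end PD

/-! ### Orientations of diagrams containing a tangle -/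

namespace PD

variable {E : Type} {n m k b l : ℕ}

/-- The orientations of the part of a diagram outside a tangle, with the directions `δ` at the end
points of the tangle; the end points `i` and `opp i` belong to one strand in the tangle. -/
structure Shadow (G : PD E n m) (p : Fin b → E) (opp : Fin b → Fin b) where
  inward : Slot n m → Bool
  ends : Fin b → Bool
  along_edge : ∀ h h', h ≠ h' → G.label h = G.label h' → inward h ≠ inward h'
  along_end : ∀ h i, G.label h = p i → inward h ≠ ends i
  along_ends : ∀ i j, i ≠ j → p i = p j → ends i ≠ ends j
  through_crossing : ∀ i c, inward (.inl (i, c + 2)) ≠ inward (.inl (i, c))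
  through_arc : ∀ j, inward (.inr (j, 1)) ≠ inward (.inr (j, 0))
  opposite : ∀ i, ends (opp i) = !ends i

/-- The sum of the signs of the crossings outside the tangle. -/
def Shadow.writhe {G : PD E n m} {p : Fin b → E} {opp : Fin b → Fin b} (S : G.Shadow p opp) : ℤ :=
  ∑ i : Fin n, if S.inward (.inl (i, 0)) = S.inward (.inl (i, 3)) then 1 else -1

/-- `T` consists of strands from `i` to `opp i` which go through two crossings each, and `e i` is
the place of the end point `i`. -/
structure Strands (T : PD (Fin b ⊕ Fin l) k 0) (opp : Fin b → Fin b) (e : Fin b → Fin k × Fin 4) :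
    Prop where
  label : ∀ i, T.crossing (e i).1 (e i).2 = .inl i
  place : ∀ c x i, T.crossing c x = .inl i → (c, x) = e i
  inside : ∀ i, ∃ j, T.crossing (e i).1 ((e i).2 + 2) = .inr j ∧
    T.crossing (e (opp i)).1 ((e (opp i)).2 + 2) = .inr j
  inside_ne : ∀ i, ((e i).1, (e i).2 + 2) ≠ ((e (opp i)).1, (e (opp i)).2 + 2)
  single : ∀ c x j, T.crossing c x = .inr j → ∃ i, e i = (c, x + 2)
  double : ∀ c x c' x' j, T.crossing c x = .inr j → T.crossing c' x' = .inr j →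
    (c, x) ≠ (c', x') → ∃ i, e i = (c, x + 2) ∧ e (opp i) = (c', x' + 2)

/-- The directions inside a tangle, given those at the end points. -/
def direction (T : PD (Fin b ⊕ Fin l) k 0) (δ : Fin b → Bool) (c : Fin k) (x : Fin 4) : Bool :=
  match T.crossing c x, T.crossing c (x + 2) with
  | .inl i, _ => δ i
  | .inr _, .inl i => !δ i
  | .inr _, .inr _ => true

/-- The sum of the signs of the crossings inside a tangle. -/
def localWrithe (T : PD (Fin b ⊕ Fin l) k 0) (δ : Fin b → Bool) : ℤ :=
  ∑ c : Fin k, if direction T δ c 0 = direction T δ c 3 then 1 else -1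

theorem add_two_add_two (x : Fin 4) : x + 2 + 2 = x := by revert x; decide

theorem Strands.direction_outside {T : PD (Fin b ⊕ Fin l) k 0} {δ : Fin b → Bool} {c : Fin k}
    {x : Fin 4} {i : Fin b} (h : T.crossing c x = .inl i) : direction T δ c x = δ i := by
  rw [direction, h]

theorem Strands.direction_inside {T : PD (Fin b ⊕ Fin l) k 0} {opp : Fin b → Fin b}
    {e : Fin b → Fin k × Fin 4} (hT : T.Strands opp e) {δ : Fin b → Bool} {c : Fin k} {x : Fin 4}
    {i : Fin b} (h : e i = (c, x + 2)) : direction T δ c x = !δ i := by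
  have h1 : T.crossing c (x + 2) = .inl i := by
    have := hT.label i
    rwa [h] at this
  obtain ⟨j, h2, -⟩ := hT.inside i
  rw [h] at h2
  simp only [add_two_add_two] at h2
  rw [direction, h1, h2]

/-- The slots of a diagram inside and outside a tangle. -/
theorem slot_cases {P : Slot (n + k) m → Prop} (h1 : ∀ c x, P (.inl (inner c, x)))
    (h2 : ∀ i x, P (.inl (outer i, x))) (h3 : ∀ j x, P (.inr (j, x))) (h : Slot (n + k) m) : P h := by
  rcases h with ⟨i, x⟩ | ⟨j, x⟩
  · rcases inner_or_outer i with ⟨c, rfl⟩ | ⟨i, rfl⟩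
    · exact h1 c x
    · exact h2 i x
  · exact h3 j x

/-- The slots outside a tangle. -/
def outerSlot : Slot n m → Slot (n + k) m
  | .inl (i, x) => .inl (outer i, x)
  | .inr (j, x) => .inr (j, x)

theorem inner_injective : Function.Injective (inner : Fin k → Fin (n + k)) := fun _ _ h =>
  Fin.ext (congrArg (fun x : Fin (n + k) => x.1) h)

theorem outer_injective : Function.Injective (outer : Fin n → Fin (n + k)) := fun i j h => by
  have := congrArg (fun x : Fin (n + k) => x.1) h
  simp only [outer] at this
  exact Fin.ext (by omega)

theorem outer_ne_inner (i : Fin n) (c : Fin k) : (outer i : Fin (n + k)) ≠ inner c := fun h => by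
  have := congrArg (fun x : Fin (n + k) => x.1) h
  simp only [outer, inner] at this
  omega

theorem outerSlot_injective : Function.Injective (outerSlot : Slot n m → Slot (n + k) m) := by
  rintro (⟨i, x⟩ | ⟨j, x⟩) (⟨i', x'⟩ | ⟨j', x'⟩) h
  · obtain ⟨h1, h2⟩ := Prod.ext_iff.1 (Sum.inl.inj h)
    exact congrArg Sum.inl (Prod.ext (outer_injective h1) h2)
  · cases h
  · cases h
  · exact congrArg Sum.inr (Sum.inr.inj h)

/-- The function on the slots given by functions inside and outside a tangle. -/
def glueSlots (f : Fin k → Fin 4 → Bool) (g : Slot n m → Bool) : Slot (n + k) m → Bool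
  | .inl (i, x) => if h : i.1 < k then f ⟨i, h⟩ x else g (.inl (⟨i - k, by omega⟩, x))
  | .inr (j, x) => g (.inr (j, x))

@[simp] theorem glueSlots_inner (f : Fin k → Fin 4 → Bool) (g : Slot n m → Bool) (c : Fin k)
    (x : Fin 4) : glueSlots f g (.inl (inner c, x)) = f c x := by simp [glueSlots, inner]

@[simp] theorem glueSlots_outer (f : Fin k → Fin 4 → Bool) (g : Slot n m → Bool) (h : Slot n m) :
    glueSlots f g (outerSlot h) = g h := by
  rcases h with ⟨i, x⟩ | ⟨j, x⟩ <;> simp [glueSlots, outerSlot, outer]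

theorem slot_cases' {P : Slot (n + k) m → Prop} (h1 : ∀ c x, P (.inl (inner c, x)))
    (h2 : ∀ h, P (outerSlot h)) (h : Slot (n + k) m) : P h :=
  slot_cases h1 (fun i x => h2 (.inl (i, x))) (fun j x => h2 (.inr (j, x))) h

theorem IsGlued.label_outer {D : PD (E ⊕ Fin l) (n + k) m} {G : PD E n m}
    {T : PD (Fin b ⊕ Fin l) k 0} {p : Fin b → E} (h : D.IsGlued G T p) (s : Slot n m) :
    D.label (outerSlot s) = .inl (G.label s) := by
  rcases s with ⟨i, x⟩ | ⟨j, x⟩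
  · exact h.crossing_outer i x
  · exact h.arc j x

/-- The directions at the end points determine those along the strands, so the tangle contributes to
the writhe only through them. -/
theorem IsGlued.exists_shadow {D : PD (E ⊕ Fin l) (n + k) m} {G : PD E n m}
    {T : PD (Fin b ⊕ Fin l) k 0} {p : Fin b → E} (h : D.IsGlued G T p) {opp : Fin b → Fin b}
    {e : Fin b → Fin k × Fin 4} (hT : T.Strands opp e) (o : D.Orientation) :
    ∃ S : G.Shadow p opp, o.writhe = S.writhe + localWrithe T S.ends := by
  let δ : Fin b → Bool := fun i => o.inward (.inl (inner (e i).1, (e i).2))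
  have hlab : ∀ i, D.label (.inl (inner (e i).1, (e i).2)) = .inl (p i) := fun i => by
    change D.crossing (inner (e i).1) (e i).2 = _
    rw [h.crossing_inner, hT.label]
    rfl
  have hdir : ∀ c x, o.inward (.inl (inner c, x)) = direction T δ c x := by
    intro c x
    rcases hc : T.crossing c x with i | j
    · rw [Strands.direction_outside hc]
      have := hT.place c x i hc
      simp only [δ, ← this]
    · obtain ⟨i, hi⟩ := hT.single c x j hc
      rw [hT.direction_inside hi]
      have := o.through_crossing (inner c) x
      simp only [δ, hi]
      exact Bool.eq_not_of_ne this.symm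
  have hS : ∀ s s' : Slot n m, s ≠ s' → G.label s = G.label s' →
      o.inward (outerSlot s) ≠ o.inward (outerSlot s') := fun s s' hne hl =>
    o.along_edge _ _ (outerSlot_injective.ne hne) (by rw [h.label_outer, h.label_outer, hl])
  refine ⟨⟨fun s => o.inward (outerSlot s), δ, hS, fun s i hl => ?_, fun i j hij hp => ?_,
    fun i c => o.through_crossing (outer i) c, fun j => o.through_arc j, fun i => ?_⟩, ?_⟩
  · refine o.along_edge _ _ ?_ (by rw [h.label_outer, hlab, hl])
    rcases s with ⟨i', x⟩ | ⟨j, x⟩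
    · exact fun e' => outer_ne_inner _ _ (Prod.ext_iff.1 (Sum.inl.inj e')).1
    · exact fun e' => by cases e'
  · refine o.along_edge _ _ (fun e' => hij ?_) (by rw [hlab, hlab, hp])
    obtain ⟨h1, h2⟩ := Prod.ext_iff.1 (Sum.inl.inj e')
    have h3 : e i = e j := Prod.ext (inner_injective h1) h2
    have := hT.label i
    rw [h3, hT.label] at this
    exact (Sum.inl.inj this).symm
  · obtain ⟨j, h1, h2⟩ := hT.inside i
    have h3 := o.through_crossing (inner (e i).1) (e i).2
    have h4 := o.through_crossing (inner (e (opp i)).1) (e (opp i)).2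
    have h5 := o.along_edge (.inl (inner (e i).1, (e i).2 + 2))
      (.inl (inner (e (opp i)).1, (e (opp i)).2 + 2)) (fun e' => hT.inside_ne i (by
        obtain ⟨h1, h2⟩ := Prod.ext_iff.1 (Sum.inl.inj e')
        exact Prod.ext (inner_injective h1) h2)) (by
        change D.crossing _ _ = D.crossing _ _
        rw [h.crossing_inner, h.crossing_inner, h1, h2])
    simp only [δ]
    revert h3 h4 h5
    generalize o.inward (.inl (inner (e i).1, (e i).2 + 2)) = b1
    generalize o.inward (.inl (inner (e (opp i)).1, (e (opp i)).2 + 2)) = b2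
    generalize o.inward (.inl (inner (e i).1, (e i).2)) = b3
    generalize o.inward (.inl (inner (e (opp i)).1, (e (opp i)).2)) = b4
    revert b1 b2 b3 b4
    decide
  · rw [Orientation.writhe, sum_fin_add, add_comm]
    congr 1
    refine Finset.sum_congr rfl fun c _ => ?_
    rw [Orientation.sign, hdir, hdir]

/-- Directions which are opposite at the two end points of each strand extend along the strands of
the tangle. -/
theorem IsGlued.exists_orientation {D : PD (E ⊕ Fin l) (n + k) m} {G : PD E n m}
    {T : PD (Fin b ⊕ Fin l) k 0} {p : Fin b → E} (h : D.IsGlued G T p) {opp : Fin b → Fin b}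
    {e : Fin b → Fin k × Fin 4} (hT : T.Strands opp e) (S : G.Shadow p opp) :
    ∃ o : D.Orientation, o.writhe = S.writhe + localWrithe T S.ends := by
  let f := glueSlots (direction T S.ends) S.inward
  have hlab : ∀ c x, D.label (.inl (inner c, x)) = Sum.map p id (T.crossing c x) := fun c x =>
    h.crossing_inner c x
  have hio : ∀ c x s, D.label (.inl (inner c, x)) = D.label (outerSlot s) →
      f (.inl (inner c, x)) ≠ f (outerSlot s) := by
    intro c x s hl
    simp only [f, glueSlots_inner, glueSlots_outer]
    rw [hlab, h.label_outer] at hl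
    rcases hc : T.crossing c x with i | j
    · rw [hc] at hl
      rw [Strands.direction_outside hc]
      exact (S.along_end s i (Sum.inl.inj hl).symm).symm
    · rw [hc] at hl
      cases hl
  refine ⟨⟨f, fun s s' => ?_, fun i x => ?_, fun j => ?_⟩, ?_⟩
  · revert s s'
    refine slot_cases' (fun c x => slot_cases' (fun c' x' hne hl => ?_) fun s' _ hl => hio c x s' hl)
      fun s => slot_cases' (fun c' x' _ hl => (hio c' x' s hl.symm).symm) fun s' hne hl => ?_
    · have hne' : (c, x) ≠ (c', x') := fun e' => hne (by
        obtain ⟨rfl, rfl⟩ := Prod.ext_iff.1 e'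
        rfl)
      rw [hlab, hlab] at hl
      simp only [f, glueSlots_inner]
      rcases hc : T.crossing c x with i | j <;> rcases hc' : T.crossing c' x' with i' | j' <;>
        rw [hc, hc'] at hl
      · rw [Strands.direction_outside hc, Strands.direction_outside hc']
        refine S.along_ends i i' (fun e' => hne' ?_) (Sum.inl.inj hl)
        rw [hT.place _ _ _ hc, hT.place _ _ _ hc', e']
      · cases hl
      · cases hl
      · obtain rfl : j = j' := Sum.inr.inj hl
        obtain ⟨i, h1, h2⟩ := hT.double c x c' x' j hc hc' hne'
        rw [hT.direction_inside h1, hT.direction_inside h2, S.opposite]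
        simp
    · simp only [f, glueSlots_outer]
      rw [h.label_outer, h.label_outer] at hl
      exact S.along_edge s s' (fun e' => hne (congrArg outerSlot e')) (Sum.inl.inj hl)
  · rcases inner_or_outer i with ⟨c, rfl⟩ | ⟨i, rfl⟩
    · simp only [f, glueSlots_inner]
      rcases hc : T.crossing c x with i | j
      · have h1 := hT.place c x i hc
        rw [Strands.direction_outside hc, hT.direction_inside (i := i) (by
          rw [add_two_add_two, ← h1])]
        simp
      · obtain ⟨i, hi⟩ := hT.single c x j hc
        have h1 := hT.label i
        rw [hi] at h1
        rw [hT.direction_inside hi, Strands.direction_outside h1]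
        simp
    · have h1 := glueSlots_outer (direction T S.ends) S.inward (.inl (i, x + 2))
      have h2 := glueSlots_outer (direction T S.ends) S.inward (.inl (i, x))
      change glueSlots _ _ (outerSlot (.inl (i, x + 2))) ≠ glueSlots _ _ (outerSlot (.inl (i, x)))
      rw [h1, h2]
      exact S.through_crossing i x
  · exact S.through_arc j
  · rw [Orientation.writhe, sum_fin_add, add_comm]
    congr 1
    · refine Finset.sum_congr rfl fun i _ => ?_
      have h1 := glueSlots_outer (direction T S.ends) S.inward (.inl (i, 0))
      have h2 := glueSlots_outer (direction T S.ends) S.inward (.inl (i, 3))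
      change (if glueSlots _ _ (outerSlot (.inl (i, 0))) = glueSlots _ _ (outerSlot (.inl (i, 3)))
        then (1 : ℤ) else -1) = _
      rw [h1, h2]
    · refine Finset.sum_congr rfl fun c _ => ?_
      change (if f (.inl (inner c, 0)) = f (.inl (inner c, 3)) then (1 : ℤ) else -1) = _
      simp only [f, glueSlots_inner]

/-- The place of the end `j` of `crossingOf u`. -/
def endOf (u : Bool) (j : Fin 4) : Fin 4 := if u then j else j + 3

theorem strands₁ (u : Bool) : (tangle₁ u).Strands ![1, 0] ![(0, endOf u 2), (0, endOf u 3)] := by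
  constructor <;> revert u <;> decide +kernel

theorem strands₂ : tangle₂.Strands ![1, 0, 3, 2] ![(0, 1), (1, 1), (0, 2), (1, 0)] := by
  constructor <;> decide +kernel

theorem strands₃ (u₁₂ u₁₃ u₂₃ : Bool) : (tangle₃ u₁₂ u₁₃ u₂₃).Strands ![3, 4, 5, 0, 1, 2]
    ![(0, endOf u₁₂ 0), (0, endOf u₁₂ 1), (1, endOf u₁₃ 1), (1, endOf u₁₃ 2), (2, endOf u₂₃ 2),
      (2, endOf u₂₃ 3)] := by
  constructor <;> revert u₁₂ u₁₃ u₂₃ <;> decide +kernel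

theorem strands₃' (u₁₂ u₁₃ u₂₃ : Bool) : (tangle₃' u₁₂ u₁₃ u₂₃).Strands ![3, 4, 5, 0, 1, 2]
    ![(1, endOf u₁₃ 0), (2, endOf u₂₃ 0), (2, endOf u₂₃ 1), (0, endOf u₁₂ 2), (0, endOf u₁₂ 3),
      (1, endOf u₁₃ 3)] := by
  constructor <;> revert u₁₂ u₁₃ u₂₃ <;> decide +kernel

/-- A kink is passed twice by one strand, so its sign is independent of the orientation. -/
theorem localWrithe₁ (u : Bool) (δ : Fin 2 → Bool) (h : ∀ i, δ (![1, 0] i) = !δ i) :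
    localWrithe (tangle₁ u) δ = if u then 1 else -1 := by
  revert u δ; decide +kernel

/-- The two crossings of a clasp have opposite signs, however the strands are oriented. -/
theorem localWrithe₂ (δ : Fin 4 → Bool) (h : ∀ i, δ (![1, 0, 3, 2] i) = !δ i) :
    localWrithe tangle₂ δ = 0 := by
  revert δ; decide +kernel

/-- Sliding the strands keeps each pair of strands crossing once, with the same sign; checked over
all directions. -/
theorem localWrithe₃ (u₁₂ u₁₃ u₂₃ : Bool) (δ : Fin 6 → Bool)
    (h : ∀ i, δ (![3, 4, 5, 0, 1, 2] i) = !δ i) :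
    localWrithe (tangle₃ u₁₂ u₁₃ u₂₃) δ = localWrithe (tangle₃' u₁₂ u₁₃ u₂₃) δ := by
  revert u₁₂ u₁₃ u₂₃ δ; decide +kernel

end PD

/-! ### Invariance of Khovanov homology under isotopy -/

namespace PD

variable {E E' : Type} {n m n' m' k b : ℕ}

/-- The diagram `D` consists of `G` and arcs between the points `p`. -/
structure IsCapped (D : PD E n (m + k)) (G : PD E n m) (p : Fin b → E)
    (A : Fin k → Fin 2 → Fin b) : Prop where
  crossing : D.crossing = G.crossing
  arc_inner : ∀ j x, D.arc (inner j) x = p (A j x)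
  arc_outer : ∀ j, D.arc (outer j) = G.arc j

/-- The slots outside the additional arcs. -/
def capSlot : Slot n m → Slot n (m + k)
  | .inl (i, x) => .inl (i, x)
  | .inr (j, x) => .inr (outer j, x)

theorem capSlot_injective : Function.Injective (capSlot : Slot n m → Slot n (m + k)) := by
  rintro (⟨i, x⟩ | ⟨j, x⟩) (⟨i', x'⟩ | ⟨j', x'⟩) h
  · exact congrArg Sum.inl (Sum.inl.inj h)
  · cases h
  · cases h
  · obtain ⟨h1, h2⟩ := Prod.ext_iff.1 (Sum.inr.inj h)
    exact congrArg Sum.inr (Prod.ext (outer_injective h1) h2)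

/-- The function on the slots given by functions on the additional arcs and outside. -/
def capSlots (f : Fin k → Fin 2 → Bool) (g : Slot n m → Bool) : Slot n (m + k) → Bool
  | .inl (i, x) => g (.inl (i, x))
  | .inr (j, x) => if h : j.1 < k then f ⟨j, h⟩ x else g (.inr (⟨j - k, by omega⟩, x))

@[simp] theorem capSlots_inner (f : Fin k → Fin 2 → Bool) (g : Slot n m → Bool) (c : Fin k)
    (x : Fin 2) : capSlots f g (.inr (inner c, x)) = f c x := by simp [capSlots, inner]

@[simp] theorem capSlots_outer (f : Fin k → Fin 2 → Bool) (g : Slot n m → Bool) (h : Slot n m) :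
    capSlots f g (capSlot h) = g h := by
  rcases h with ⟨i, x⟩ | ⟨j, x⟩ <;> simp [capSlots, capSlot, outer]

theorem capSlot_cases {P : Slot n (m + k) → Prop} (h1 : ∀ c x, P (.inr (inner c, x)))
    (h2 : ∀ h, P (capSlot h)) (h : Slot n (m + k)) : P h := by
  rcases h with ⟨i, x⟩ | ⟨j, x⟩
  · exact h2 (.inl (i, x))
  · rcases inner_or_outer j with ⟨c, rfl⟩ | ⟨i, rfl⟩
    · exact h1 c x
    · exact h2 (.inr (i, x))

namespace IsCapped

variable {D : PD E n (m + k)} {G : PD E n m} {p : Fin b → E} {A : Fin k → Fin 2 → Fin b}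

theorem label_outer (h : D.IsCapped G p A) (s : Slot n m) : D.label (capSlot s) = G.label s := by
  rcases s with ⟨i, x⟩ | ⟨j, x⟩
  · exact congrFun (congrFun h.crossing i) x
  · exact congrFun (h.arc_outer j) x

/-- The counterpart of `IsGlued.exists_shadow` with arcs instead of a tangle. Passing through a
common shadow compares the orientations before and after a move. -/
theorem exists_shadow (h : D.IsCapped G p A) {opp : Fin b → Fin b} {e : Fin b → Fin k × Fin 2}
    (he : ∀ i, A (e i).1 (e i).2 = i) (he' : ∀ j x, e (A j x) = (j, x))
    (hopp : ∀ j x, opp (A j x) = A j (x + 1)) (o : D.Orientation) :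
    ∃ S : G.Shadow p opp, o.writhe = S.writhe := by
  have hlab : ∀ i, D.label (.inr (inner (e i).1, (e i).2)) = p i := fun i => by
    change D.arc (inner (e i).1) (e i).2 = _
    rw [h.arc_inner, he]
  have h01 : ∀ j x, o.inward (.inr (j, x + 1)) = !o.inward (.inr (j, x)) := by
    intro j x
    have := o.through_arc j
    fin_cases x
    · exact Bool.eq_not_of_ne this
    · exact Bool.eq_not_of_ne this.symm
  refine ⟨⟨fun s => o.inward (capSlot s), fun i => o.inward (.inr (inner (e i).1, (e i).2)),
    fun s s' hne hl => o.along_edge _ _ (capSlot_injective.ne hne) (by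
      rw [h.label_outer, h.label_outer, hl]), fun s i hl => ?_, fun i j hij hp => ?_,
    fun i c => o.through_crossing i c, fun j => o.through_arc (outer j), fun i => ?_⟩, rfl⟩
  · refine o.along_edge _ _ ?_ (by rw [h.label_outer, hlab, hl])
    rcases s with ⟨i', x⟩ | ⟨j, x⟩
    · exact fun e' => by cases e'
    · exact fun e' => outer_ne_inner _ _ (Prod.ext_iff.1 (Sum.inr.inj e')).1
  · refine o.along_edge _ _ (fun e' => hij ?_) (by rw [hlab, hlab, hp])
    obtain ⟨h1, h2⟩ := Prod.ext_iff.1 (Sum.inr.inj e')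
    rw [← he i, ← he j, inner_injective h1, h2]
  · have h1 : e (opp i) = ((e i).1, (e i).2 + 1) := by
      conv_lhs => rw [← he i]
      rw [hopp, he']
    simp only [h1]
    exact h01 _ _

theorem exists_orientation (h : D.IsCapped G p A) {opp : Fin b → Fin b} {e : Fin b → Fin k × Fin 2}
    (he' : ∀ j x, e (A j x) = (j, x)) (hopp : ∀ j x, opp (A j x) = A j (x + 1))
    (S : G.Shadow p opp) : ∃ o : D.Orientation, o.writhe = S.writhe := by
  let f := capSlots (fun j x => S.ends (A j x)) S.inward
  have hlab : ∀ j x, D.label (.inr (inner j, x)) = p (A j x) := fun j x => h.arc_inner j x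
  have hio : ∀ c x s, D.label (.inr (inner c, x)) = D.label (capSlot s) →
      f (.inr (inner c, x)) ≠ f (capSlot s) := by
    intro c x s hl
    simp only [f, capSlots_inner, capSlots_outer]
    rw [hlab, h.label_outer] at hl
    exact (S.along_end s _ hl.symm).symm
  refine ⟨⟨f, fun s s' => ?_, fun i x => S.through_crossing i x, fun j => ?_⟩, rfl⟩
  · revert s s'
    refine capSlot_cases (fun c x => capSlot_cases (fun c' x' hne hl => ?_)
      fun s' _ hl => hio c x s' hl) fun s => capSlot_cases
        (fun c' x' _ hl => (hio c' x' s hl.symm).symm) fun s' hne hl => ?_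
    · simp only [f, capSlots_inner]
      rw [hlab, hlab] at hl
      refine S.along_ends _ _ (fun e' => hne ?_) hl
      have := congrArg e e'
      rw [he', he'] at this
      obtain ⟨rfl, rfl⟩ := Prod.ext_iff.1 this
      rfl
    · simp only [f, capSlots_outer]
      rw [h.label_outer, h.label_outer] at hl
      exact S.along_edge s s' (fun e' => hne (congrArg capSlot e')) hl
  · rcases inner_or_outer j with ⟨c, rfl⟩ | ⟨j, rfl⟩
    · simp only [f, capSlots_inner]
      have := S.opposite (A c 0)
      rw [hopp] at this
      rw [show (1 : Fin 2) = 0 + 1 from rfl, this]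
      simp
    · have h1 := capSlots_outer (fun j x => S.ends (A j x)) S.inward (.inr (j, 1))
      have h2 := capSlots_outer (fun j x => S.ends (A j x)) S.inward (.inr (j, 0))
      change capSlots _ _ (capSlot (.inr (j, 1))) ≠ capSlots _ _ (capSlot (.inr (j, 0)))
      rw [h1, h2]
      exact S.through_arc j

end IsCapped

/-- Each orientation of `D` corresponds to an orientation of `D'` whose writhe is larger by `c`. -/
def OrientationShift (D : PD E n m) (D' : PD E' n' m') (c : ℤ) : Prop :=
  ∀ o : D.Orientation, ∃ o' : D'.Orientation, o'.writhe = o.writhe + c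

theorem orientationShift_kink {u : Bool} {D : PD (E ⊕ Fin 1) (n + 1) m} {G : PD E n m} {p q : E}
    (h : D.IsGlued G (tangle₁ u) ![p, q]) {c : ℤ} (hc : c = if u then -1 else 1) :
    OrientationShift D (⟨G.crossing, Matrix.vecCons ![p, q] G.arc⟩ : PD E n (m + 1)) c ∧
      OrientationShift (⟨G.crossing, Matrix.vecCons ![p, q] G.arc⟩ : PD E n (m + 1)) D (-c) := by
  have hcap : (⟨G.crossing, Matrix.vecCons ![p, q] G.arc⟩ : PD E n (m + 1)).IsCapped G ![p, q]
      ![![0, 1]] :=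
    ⟨rfl, fun j x => by fin_cases j; fin_cases x <;> rfl, fun j => rfl⟩
  have he' : ∀ (j : Fin 1) (x : Fin 2), (![(0, 0), (0, 1)] : Fin 2 → Fin 1 × Fin 2)
      ((![![0, 1]] : Fin 1 → Fin 2 → Fin 2) j x) = (j, x) := by decide +kernel
  have hopp : ∀ (j : Fin 1) (x : Fin 2), (![1, 0] : Fin 2 → Fin 2)
      ((![![0, 1]] : Fin 1 → Fin 2 → Fin 2) j x) =
      (![![0, 1]] : Fin 1 → Fin 2 → Fin 2) j (x + 1) := by decide +kernel
  constructor
  · intro o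
    obtain ⟨S, hS⟩ := h.exists_shadow (strands₁ u) o
    obtain ⟨o', ho'⟩ := hcap.exists_orientation he' hopp S
    refine ⟨o', ?_⟩
    rw [ho', hS, localWrithe₁ u S.ends S.opposite, hc]
    split_ifs <;> ring
  · intro o
    obtain ⟨S, hS⟩ := hcap.exists_shadow (e := ![(0, 0), (0, 1)]) (by decide +kernel) he' hopp o
    obtain ⟨o', ho'⟩ := h.exists_orientation (strands₁ u) S
    refine ⟨o', ?_⟩
    rw [ho', hS, localWrithe₁ u S.ends S.opposite, hc]
    split_ifs <;> ring

theorem orientationShift_clasp {D : PD (E ⊕ Fin 2) (n + 2) m} {G : PD E n m} {p q r s : E}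
    (h : D.IsGlued G tangle₂ ![p, q, r, s]) :
    OrientationShift D (⟨G.crossing, Matrix.vecCons ![p, q] (Matrix.vecCons ![r, s] G.arc)⟩ :
      PD E n (m + 2)) 0 ∧
      OrientationShift (⟨G.crossing, Matrix.vecCons ![p, q] (Matrix.vecCons ![r, s] G.arc)⟩ :
        PD E n (m + 2)) D 0 := by
  have hcap : (⟨G.crossing, Matrix.vecCons ![p, q] (Matrix.vecCons ![r, s] G.arc)⟩ :
      PD E n (m + 2)).IsCapped G ![p, q, r, s] ![![0, 1], ![2, 3]] :=
    ⟨rfl, fun j x => by fin_cases j <;> fin_cases x <;> rfl, fun j => rfl⟩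
  have he' : ∀ (j : Fin 2) (x : Fin 2), (![(0, 0), (0, 1), (1, 0), (1, 1)] : Fin 4 → Fin 2 × Fin 2)
      ((![![0, 1], ![2, 3]] : Fin 2 → Fin 2 → Fin 4) j x) = (j, x) := by decide +kernel
  have hopp : ∀ (j : Fin 2) (x : Fin 2), (![1, 0, 3, 2] : Fin 4 → Fin 4)
      ((![![0, 1], ![2, 3]] : Fin 2 → Fin 2 → Fin 4) j x) =
      (![![0, 1], ![2, 3]] : Fin 2 → Fin 2 → Fin 4) j (x + 1) := by decide +kernel
  constructor
  · intro o
    obtain ⟨S, hS⟩ := h.exists_shadow strands₂ o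
    obtain ⟨o', ho'⟩ := hcap.exists_orientation he' hopp S
    refine ⟨o', ?_⟩
    rw [ho', hS, localWrithe₂ S.ends S.opposite]
    ring
  · intro o
    obtain ⟨S, hS⟩ := hcap.exists_shadow (e := ![(0, 0), (0, 1), (1, 0), (1, 1)])
      (by decide +kernel) he' hopp o
    obtain ⟨o', ho'⟩ := h.exists_orientation strands₂ S
    refine ⟨o', ?_⟩
    rw [ho', hS, localWrithe₂ S.ends S.opposite]

theorem orientationShift_slide {u₁₂ u₁₃ u₂₃ : Bool} {D D' : PD (E ⊕ Fin 3) (n + 3) m}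
    {G : PD E n m} {p : Fin 6 → E} (h : D.IsGlued G (tangle₃ u₁₂ u₁₃ u₂₃) p)
    (h' : D'.IsGlued G (tangle₃' u₁₂ u₁₃ u₂₃) p) :
    OrientationShift D D' 0 ∧ OrientationShift D' D 0 := by
  constructor
  · intro o
    obtain ⟨S, hS⟩ := h.exists_shadow (strands₃ u₁₂ u₁₃ u₂₃) o
    obtain ⟨o', ho'⟩ := h'.exists_orientation (strands₃' u₁₂ u₁₃ u₂₃) S
    exact ⟨o', by rw [ho', hS, localWrithe₃ _ _ _ _ S.opposite, add_zero]⟩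
  · intro o
    obtain ⟨S, hS⟩ := h'.exists_shadow (strands₃' u₁₂ u₁₃ u₂₃) o
    obtain ⟨o', ho'⟩ := h.exists_orientation (strands₃ u₁₂ u₁₃ u₂₃) S
    exact ⟨o', by rw [ho', hS, localWrithe₃ _ _ _ _ S.opposite, add_zero]⟩

/-- Transport of orientations along a map of the slots. -/
theorem orientationShift_of_slots {D : PD E n m} {D' : PD E' n' m'} (f : Slot n' m' → Slot n m)
    (hf : Function.Injective f)
    (hlab : ∀ h h', D'.label h = D'.label h' → D.label (f h) = D.label (f h'))
    (hcr : ∀ (o : D.Orientation) i x,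
      o.inward (f (.inl (i, x + 2))) ≠ o.inward (f (.inl (i, x))))
    (harc : ∀ (o : D.Orientation) j, o.inward (f (.inr (j, 1))) ≠ o.inward (f (.inr (j, 0))))
    (hw : ∀ o : D.Orientation, ∑ i, (if o.inward (f (.inl (i, 0))) = o.inward (f (.inl (i, 3)))
      then (1 : ℤ) else -1) = o.writhe) : OrientationShift D D' 0 := fun o =>
  ⟨⟨o.inward ∘ f, fun h h' hne hl => o.along_edge _ _ (hf.ne hne) (hlab h h' hl), hcr o, harc o⟩,
    (hw o).trans (add_zero _).symm⟩

theorem orientationShift_relabel (f : E ≃ E') (D : PD E n m) :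
    OrientationShift D (D.map f) 0 ∧ OrientationShift (D.map f) D 0 := by
  have hl : ∀ h, (D.map f).label h = f (D.label h) := by rintro (h | h) <;> rfl
  constructor
  · refine orientationShift_of_slots id Function.injective_id (fun h h' e => ?_)
      (fun o => o.through_crossing) (fun o => o.through_arc) fun o => rfl
    rw [hl, hl] at e
    exact f.injective e
  · refine orientationShift_of_slots id Function.injective_id (fun h h' e => ?_)
      (fun o => o.through_crossing) (fun o => o.through_arc) fun o => rfl
    change (D.map f).label h = (D.map f).label h'
    rw [hl, hl, e]

theorem orientationShift_reorder_aux {σ : Equiv.Perm (Fin n)} {ρ : Equiv.Perm (Fin m)}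
    {D D' : PD E n m} (hc : D'.crossing = D.crossing ∘ σ) (ha : D'.arc = D.arc ∘ ρ) :
    OrientationShift D D' 0 := by
  refine orientationShift_of_slots (Sum.map (Prod.map σ id) (Prod.map ρ id)) ?_ (fun h h' => ?_)
      (fun o i x => o.through_crossing (σ i) x) (fun o j => o.through_arc (ρ j)) fun o => ?_
  · exact Function.Injective.sumMap (σ.injective.prodMap Function.injective_id)
      (ρ.injective.prodMap Function.injective_id)
  · have hl : ∀ h, D'.label h = D.label (Sum.map (Prod.map σ id) (Prod.map ρ id) h) := by
      rintro (⟨i, x⟩ | ⟨j, x⟩)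
      · exact congrFun (congrFun hc i) x
      · exact congrFun (congrFun ha j) x
    rw [← hl, ← hl]
    exact id
  · exact Equiv.sum_comp σ o.sign

theorem orientationShift_reorder (σ : Equiv.Perm (Fin n)) (ρ : Equiv.Perm (Fin m)) (D : PD E n m) :
    OrientationShift D ⟨D.crossing ∘ σ, D.arc ∘ ρ⟩ 0 ∧
      OrientationShift ⟨D.crossing ∘ σ, D.arc ∘ ρ⟩ D 0 := by
  refine ⟨orientationShift_reorder_aux rfl rfl,
    orientationShift_reorder_aux (σ := σ.symm) (ρ := ρ.symm) ?_ ?_⟩ <;> funext <;> simp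

/-- A half turn moves the ends 0, 3 of a crossing to 2, 1, where both directions are reversed; so
the sign of the crossing is unchanged. -/
theorem orientationShift_turn {D D' : PD E n m} {d : Fin n → Fin 4} {r : Fin m → Fin 2}
    (hd : ∀ i, d i = 0 ∨ d i = 2) (hc : ∀ i x, D'.crossing i x = D.crossing i (x + d i))
    (ha : ∀ j x, D'.arc j x = D.arc j (x + r j)) : OrientationShift D D' 0 := by
  refine orientationShift_of_slots (Sum.map (fun h => (h.1, h.2 + d h.1)) fun h => (h.1, h.2 + r h.1))
    ?_ (fun h h' => ?_) (fun o i x => ?_) (fun o j => ?_) fun o => ?_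
  · refine Function.Injective.sumMap ?_ ?_
    · rintro ⟨i, x⟩ ⟨i', x'⟩ h
      obtain ⟨rfl, h2⟩ := Prod.ext_iff.1 h
      exact Prod.ext rfl (add_right_cancel h2)
    · rintro ⟨i, x⟩ ⟨i', x'⟩ h
      obtain ⟨rfl, h2⟩ := Prod.ext_iff.1 h
      exact Prod.ext rfl (add_right_cancel h2)
  · have hl : ∀ h, D'.label h = D.label (Sum.map (fun h => (h.1, h.2 + d h.1))
        (fun h => (h.1, h.2 + r h.1)) h) := by
      rintro (⟨i, x⟩ | ⟨j, x⟩)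
      · exact hc i x
      · exact ha j x
    rw [← hl, ← hl]
    exact id
  · have := o.through_crossing i (x + d i)
    rwa [add_right_comm] at this
  · have h1 := o.through_arc j
    change o.inward (.inr (j, 1 + r j)) ≠ o.inward (.inr (j, 0 + r j))
    rcases (by omega : r j = 0 ∨ r j = 1) with h | h <;> rw [h]
    · exact h1
    · exact h1.symm
  · refine Finset.sum_congr rfl fun i _ => ?_
    change (if o.inward (.inl (i, 0 + d i)) = o.inward (.inl (i, 3 + d i)) then (1 : ℤ) else -1) = _
    rw [Orientation.sign]
    rcases hd i with h | h <;> rw [h]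
    · rfl
    · have h0 := o.through_crossing i 0
      have h1 := o.through_crossing i 1
      refine if_congr ?_ rfl rfl
      change o.inward (.inl (i, 2)) = o.inward (.inl (i, 1)) ↔ _
      change o.inward (.inl (i, 2)) ≠ o.inward (.inl (i, 0)) at h0
      change o.inward (.inl (i, 3)) ≠ o.inward (.inl (i, 1)) at h1
      revert h0 h1
      generalize o.inward (.inl (i, 0)) = b0
      generalize o.inward (.inl (i, 1)) = b1
      generalize o.inward (.inl (i, 2)) = b2
      generalize o.inward (.inl (i, 3)) = b3
      revert b0 b1 b2 b3
      decide

theorem orientationShift_halfTurn (i : Fin n) (D : PD E n m) :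
    OrientationShift D ⟨Function.update D.crossing i fun x => D.crossing i (x + 2), D.arc⟩ 0 ∧
      OrientationShift ⟨Function.update D.crossing i fun x => D.crossing i (x + 2), D.arc⟩ D 0 := by
  have hd : ∀ i', (if i' = i then (2 : Fin 4) else 0) = 0 ∨ (if i' = i then (2 : Fin 4) else 0) = 2 :=
    fun i' => by by_cases h : i' = i <;> simp [h]
  constructor
  · refine orientationShift_turn (d := fun i' => if i' = i then 2 else 0) (r := fun _ => 0) hd
      (fun i' x => ?_) fun j x => by rw [add_zero]
    by_cases h : i' = i
    · subst h; simp
    · simp [h]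
  · refine orientationShift_turn (d := fun i' => if i' = i then 2 else 0) (r := fun _ => 0) hd
      (fun i' x => ?_) fun j x => by rw [add_zero]
    by_cases h : i' = i
    · subst h; simp [add_two_add_two]
    · simp [h]

theorem orientationShift_flipArc (j : Fin m) (D : PD E n m) :
    OrientationShift D ⟨D.crossing, Function.update D.arc j fun x => D.arc j (x + 1)⟩ 0 ∧
      OrientationShift ⟨D.crossing, Function.update D.arc j fun x => D.arc j (x + 1)⟩ D 0 := by
  constructor
  · refine orientationShift_turn (d := fun _ => 0) (r := fun j' => if j' = j then 1 else 0)
      (fun _ => Or.inl rfl) (fun i x => by rw [add_zero]) fun j' x => ?_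
    by_cases h : j' = j
    · subst h; simp
    · simp [h]
  · refine orientationShift_turn (d := fun _ => 0) (r := fun j' => if j' = j then 1 else 0)
      (fun _ => Or.inl rfl) (fun i x => by rw [add_zero]) fun j' x => ?_
    by_cases h : j' = j
    · subst h
      have : x + 1 + 1 = x := by revert x; decide
      simp [this]
    · simp [h]

end PD

/-! ### Removal of bivalent vertices, and transport of homology along isotopies -/

namespace PD

variable {E E' : Type} {n m n' m' : ℕ}

/-- The link passes straight through the bivalent vertex: one of its two edges points in and the
other out, so together they are one oriented edge. -/
theorem orientationShift_removeArc {y : E} {D : PD (Option E) n m}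
    (hD : (⟨D.crossing, Matrix.vecCons ![none, some y] D.arc⟩ :
      PD (Option E) n (m + 1)).IsLinkDiagram) :
    OrientationShift (⟨D.crossing, Matrix.vecCons ![none, some y] D.arc⟩ :
        PD (Option E) n (m + 1)) (D.map fun x => x.getD y) 0 ∧
      OrientationShift (D.map fun x => x.getD y) (⟨D.crossing,
        Matrix.vecCons ![none, some y] D.arc⟩ : PD (Option E) n (m + 1)) 0 := by
  let p : Fin 2 → Option E := ![none, some y]
  let D₀ : PD (Option E) n (m + 1) := ⟨D.crossing, Matrix.vecCons ![none, some y] D.arc⟩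
  have hp : ∀ i j, p i = p j → i = j := by
    intro i j
    fin_cases i <;> fin_cases j <;> simp [p]
  have hcap : D₀.IsCapped D p ![![0, 1]] :=
    ⟨rfl, fun j x => by fin_cases j; fin_cases x <;> rfl, fun j => rfl⟩
  have he' : ∀ (j : Fin 1) (x : Fin 2), (![(0, 0), (0, 1)] : Fin 2 → Fin 1 × Fin 2)
      ((![![0, 1]] : Fin 1 → Fin 2 → Fin 2) j x) = (j, x) := by decide +kernel
  have hopp : ∀ (j : Fin 1) (x : Fin 2), (![1, 0] : Fin 2 → Fin 2)
      ((![![0, 1]] : Fin 1 → Fin 2 → Fin 2) j x) =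
      (![![0, 1]] : Fin 1 → Fin 2 → Fin 2) j (x + 1) := by decide +kernel
  have hl : ∀ h, (D.map fun x => x.getD y).label h = (D.label h).getD y := by
    rintro (h | h) <;> rfl
  constructor
  · intro o
    obtain ⟨S, hS⟩ := hcap.exists_shadow (e := ![(0, 0), (0, 1)]) (by decide +kernel) he' hopp o
    have h01 := S.opposite 0
    change S.ends 1 = !S.ends 0 at h01
    have key : ∀ h h', D.label h = none → D.label h' = some y → S.inward h ≠ S.inward h' := by
      intro h h' e e'
      have h1 := S.along_end h 0 e
      have h2 := S.along_end h' 1 e'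
      rw [h01] at h2
      intro e''
      rw [e''] at h1
      revert h1 h2
      generalize S.inward h' = b1
      generalize S.ends 0 = b2
      revert b1 b2
      decide
    refine ⟨⟨S.inward, fun h h' hne e => ?_, S.through_crossing, S.through_arc⟩, ?_⟩
    · rw [hl, hl] at e
      rcases h1 : D.label h with _ | z <;> rcases h2 : D.label h' with _ | z' <;>
        rw [h1, h2] at e
      · exact S.along_edge h h' hne (h1.trans h2.symm)
      · obtain rfl : y = z' := e
        exact key h h' h1 h2
      · obtain rfl : z = y := e
        exact (key h' h h2 h1).symm
      · obtain rfl : z = z' := e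
        exact S.along_edge h h' hne (h1.trans h2.symm)
    · rw [hS, add_zero]
      rfl
  · intro o
    have hend : ∀ i, D₀.label (.inr (inner 0, i)) = p i := fun i => by
      fin_cases i <;> rfl
    -- Each of the two edges has exactly two ends, one of them at the removed vertex; the other one
    -- is the end sought.
    have hex : ∀ i, ∃ h, D.label h = p i ∧ ∀ h', D.label h' = p i → h' = h := by
      intro i
      obtain ⟨g, g', hne, hg⟩ := exists_ends hD.two_ends (p i)
      have key : ∀ g g', g ≠ g' → (∀ x, D₀.label x = p i ↔ x = g ∨ x = g') →
          (.inr (inner 0, i) : Slot n (m + 1)) = g →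
          ∃ h, D.label h = p i ∧ ∀ h', D.label h' = p i → h' = h := by
        intro g g' hne hg e
        have hg' : D₀.label g' = p i := (hg g').2 (Or.inr rfl)
        refine capSlot_cases (P := fun g' => g ≠ g' → (∀ x, D₀.label x = p i ↔ x = g ∨ x = g') →
          D₀.label g' = p i → ∃ h, D.label h = p i ∧ ∀ h', D.label h' = p i → h' = h)
          (fun c x hne hg hg' => ?_) (fun h hne hg hg' => ?_) g' hne hg hg'
        · obtain rfl : c = 0 := Subsingleton.elim _ _
          rw [hend] at hg'
          obtain rfl := hp _ _ hg'
          exact (hne e.symm).elim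
        · rw [hcap.label_outer] at hg'
          refine ⟨h, hg', fun h' e' => ?_⟩
          rw [← hcap.label_outer] at e'
          rcases (hg _).1 e' with e'' | e''
          · rw [← e] at e''
            rcases h' with ⟨i', x⟩ | ⟨j, x⟩
            · cases e''
            · exact (outer_ne_inner _ _ (Prod.ext_iff.1 (Sum.inr.inj e'')).1).elim
          · exact capSlot_injective e''
      rcases (hg _).1 (hend i) with e | e
      · exact key g g' hne hg e
      · exact key g' g hne.symm (fun x => (hg x).trans or_comm) e
    choose s hs hs' using hex
    have h01 : o.inward (s 0) ≠ o.inward (s 1) := by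
      refine o.along_edge _ _ (fun e => ?_) (by rw [hl, hl, hs, hs]; rfl)
      have := hs 0
      rw [e, hs 1] at this
      exact absurd (hp _ _ this) (by decide)
    -- The direction at the removed vertex is the opposite of that at the far end of the same edge.
    let S : D.Shadow p ![1, 0] := ⟨o.inward, fun i => !o.inward (s i),
      fun h h' hne e => o.along_edge h h' hne (by rw [hl, hl, e]),
      fun h i e => by rw [hs' i h e]; simp, fun i j hij e => (hij (hp _ _ e)).elim,
      o.through_crossing, o.through_arc, fun i => by
        have h10 : o.inward (s 1) = !o.inward (s 0) := Bool.eq_not_of_ne h01.symm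
        fin_cases i
        · exact congrArg Bool.not h10
        · exact congrArg Bool.not (Bool.eq_not_of_ne h01)⟩
    obtain ⟨o', ho'⟩ := hcap.exists_orientation he' hopp S
    refine ⟨o', ?_⟩
    rw [ho', add_zero]
    rfl

/-- For each orientation of `D` there is one of `D'` with the same Khovanov homology. -/
def Transport [Finite E] [Finite E'] (D : PD E n m) (D' : PD E' n' m') : Prop :=
  ∀ o : D.Orientation, ∃ o' : D'.Orientation, ∀ i j, Nonempty (o.Kh i j ≃ₗ[ℤ] o'.Kh i j)

/-- The framed indices w − 2i and 3w − 2j move by c and 3c when the writhe grows by c, so such a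
shift disappears in the classical grading. -/
theorem transport_of_shift [Finite E] [Finite E'] {D : PD E n m} {D' : PD E' n' m'} {c : ℤ}
    (h : OrientationShift D D' c ∧ OrientationShift D' D (-c))
    (hH : ∀ a b, Nonempty (D.complex.Homology a b ≃ₗ[ℤ]
      D'.complex.Homology (a + c) (b + 3 * c))) : Transport D D' ∧ Transport D' D := by
  constructor
  · intro o
    obtain ⟨o', ho'⟩ := h.1 o
    refine ⟨o', fun i j => ?_⟩
    have := hH (o.writhe - 2 * i) (3 * o.writhe - 2 * j)
    rw [show o.writhe - 2 * i + c = o'.writhe - 2 * i by rw [ho']; ring,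
      show 3 * o.writhe - 2 * j + 3 * c = 3 * o'.writhe - 2 * j by rw [ho']; ring] at this
    exact this
  · intro o
    obtain ⟨o', ho'⟩ := h.2 o
    refine ⟨o', fun i j => ?_⟩
    have := hH (o'.writhe - 2 * i) (3 * o'.writhe - 2 * j)
    rw [show o'.writhe - 2 * i + c = o.writhe - 2 * i by rw [ho']; ring,
      show 3 * o'.writhe - 2 * j + 3 * c = 3 * o.writhe - 2 * j by rw [ho']; ring] at this
    exact this.map LinearEquiv.symm

theorem transport_of_shift_zero [Finite E] [Finite E'] {D : PD E n m} {D' : PD E' n' m'}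
    (h : OrientationShift D D' 0 ∧ OrientationShift D' D 0)
    (hH : ∀ a b, Nonempty (D.complex.Homology a b ≃ₗ[ℤ] D'.complex.Homology a b)) :
    Transport D D' ∧ Transport D' D :=
  transport_of_shift (c := 0) (by rwa [neg_zero]) fun a b => by
    rw [mul_zero, add_zero, add_zero]
    exact hH a b

theorem Move.transport [Finite E] [Finite E'] {D : PD E n m} {D' : PD E' n' m'} (h : Move D D')
    (hD : D.IsLinkDiagram) (hD' : D'.IsLinkDiagram) : Transport D D' ∧ Transport D' D := by
  have d := hD.dich
  have d' := hD'.dich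
  cases h with
  | relabel f D =>
    exact transport_of_shift_zero (orientationShift_relabel f D) (homology_relabel f d d')
  | reorder σ ρ D =>
    exact transport_of_shift_zero (orientationShift_reorder σ ρ D) (homology_reorder d d')
  | halfTurn i D =>
    exact transport_of_shift_zero (orientationShift_halfTurn i D) (homology_halfTurn d d')
  | flipArc j D =>
    exact transport_of_shift_zero (orientationShift_flipArc j D) (homology_flipArc d d')
  | removeArc y D =>
    exact transport_of_shift_zero (orientationShift_removeArc hD) (homology_removeArc d d')
  | reidemeister₁ under p q D =>
    exact transport_of_shift (orientationShift_kink isGlued₁ rfl) fun a b =>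
      homology_kink isGlued₁ d d' a b _ rfl
  | reidemeister₂ p q r s D =>
    exact transport_of_shift_zero (orientationShift_clasp isGlued₂) (homology_clasp isGlued₂ d d')
  | @reidemeister₃ E n m u₁₂ u₁₃ u₂₃ hu p D =>
    have : Finite E := Finite.of_injective (Sum.inl : E → E ⊕ Fin 3) Sum.inl_injective
    exact transport_of_shift_zero (orientationShift_slide isGlued₃ isGlued₃')
      (homology_slide hu isGlued₃ isGlued₃' d d')

theorem Transport.trans {E'' : Type} {n'' m'' : ℕ} [Finite E] [Finite E'] [Finite E'']
    {D : PD E n m} {D' : PD E' n' m'} {D'' : PD E'' n'' m''} (h : Transport D D')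
    (h' : Transport D' D'') : Transport D D'' := by
  intro o
  obtain ⟨o', ho'⟩ := h o
  obtain ⟨o'', ho''⟩ := h' o'
  refine ⟨o'', fun i j => ?_⟩
  obtain ⟨e⟩ := ho' i j
  obtain ⟨e'⟩ := ho'' i j
  exact ⟨e.trans e'⟩

/-- Finiteness of the edge types is carried through the induction, because nothing else is known
about the intermediate diagrams of a composition. -/
theorem Isotopic.transport {D : PD E n m} {D' : PD E' n' m'} (h : Isotopic D D') :
    (Finite E ↔ Finite E') ∧ ∀ [Finite E] [Finite E'], Transport D D' ∧ Transport D' D := by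
  induction h with
  | move hD hD' h =>
    exact ⟨iff_of_true hD.finite hD'.finite, h.transport hD hD'⟩
  | refl D => exact ⟨Iff.rfl, fun o => ⟨o, fun i j => ⟨.refl ..⟩⟩, fun o => ⟨o, fun i j => ⟨.refl ..⟩⟩⟩
  | symm _ ih => exact ⟨ih.1.symm, ih.2.symm⟩
  | trans _ _ ih ih' =>
    refine ⟨ih.1.trans ih'.1, ?_⟩
    intro f f''
    have := ih.1.1 f
    exact ⟨ih.2.1.trans ih'.2.1, ih'.2.2.trans ih.2.2⟩

/-! ### The circle -/

theorem circle_boundary (x : circle.Chain) : circle.boundary x = 0 := by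
  have : circle.boundary = 0 := by
    refine Finsupp.lhom_ext fun s c => ?_
    rw [boundary, Finsupp.linearCombination_single]
    simp [EnhancedState.incidence]
  rw [this, LinearMap.zero_apply]

theorem circle_a (s : circle.EnhancedState) : s.a = 0 := by simp [EnhancedState.a]

theorem circle_b (s : circle.EnhancedState) : s.b = 2 * s.sign () := by
  have : Subsingleton (circle.Circle s.marker) :=
    ⟨by rintro ⟨⟨⟩⟩ ⟨⟨⟩⟩; rfl⟩
  rw [EnhancedState.b, circle_a, zero_add, EnhancedState.τ,
    finsum_eq_single _ (s.circle ()) fun c hc => (hc (Subsingleton.elim _ _)).elim]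
  rfl

theorem circle_framedKh (a b : ℤ) : Nonempty (circle.FramedKh a b ≃ₗ[ℤ] circle.chains a b) := by
  have h1 : circle.cycles a b = circle.chains a b :=
    inf_eq_left.2 fun x _ => LinearMap.mem_ker.2 (circle_boundary x)
  have h2 : (circle.boundaries a b).submoduleOf (circle.cycles a b) = ⊥ := by
    rw [eq_bot_iff]
    rintro ⟨x, hx⟩ ⟨y, -, e⟩
    rw [circle_boundary] at e
    exact (Submodule.mem_bot _).2 (Subtype.ext e.symm)
  exact ⟨(Submodule.quotEquivOfEqBot _ h2).trans (LinearEquiv.ofEq _ _ h1)⟩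

theorem circle_framedKh_of_ne {a b : ℤ} (h : ¬ (a = 0 ∧ (b = 2 ∨ b = -2))) :
    Subsingleton (circle.FramedKh a b) := by
  obtain ⟨e⟩ := circle_framedKh a b
  have : circle.chains a b = ⊥ := by
    rw [chains, show {s : circle.EnhancedState | s.a = a ∧ s.b = b} = ∅ from ?_,
      Finsupp.supported_empty]
    refine Set.eq_empty_of_forall_notMem fun s hs => h ?_
    rw [Set.mem_ofPred_eq, circle_a, circle_b] at hs
    refine ⟨hs.1.symm, ?_⟩
    rcases Int.units_eq_one_or (s.sign ()) with e | e <;> rw [e] at hs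
    · exact Or.inl hs.2.symm
    · exact Or.inr hs.2.symm
  rw [this] at e
  exact e.toEquiv.subsingleton

theorem circle_framedKh_int (u : ℤˣ) {a b : ℤ} (ha : a = 0) (hb : b = 2 * u) :
    Nonempty (circle.FramedKh a b ≃ₗ[ℤ] ℤ) := by
  subst ha hb
  obtain ⟨e⟩ := circle_framedKh 0 (2 * u)
  let s : circle.EnhancedState := ⟨Fin.elim0, fun _ => u, fun _ _ _ => rfl⟩
  have hs : {s : circle.EnhancedState | s.a = 0 ∧ s.b = 2 * u} = {s} := by
    ext s'
    rw [Set.mem_ofPred_eq, Set.mem_singleton_iff, circle_a, circle_b]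
    constructor
    · rintro ⟨-, e⟩
      refine EnhancedState.ext (funext fun i => i.elim0) (funext fun x => Units.ext ?_)
      change (s'.sign () : ℤ) = u
      omega
    · rintro rfl
      exact ⟨rfl, rfl⟩
  have hc : circle.chains 0 (2 * u) = Finsupp.supported ℤ ℤ {s} := by rw [chains, hs]
  exact ⟨e.trans ((LinearEquiv.ofEq _ _ hc).trans ((Finsupp.supportedEquivFinsupp {s}).trans
    (Finsupp.uniqueLinearEquiv ℤ ℤ (⟨s, rfl⟩ : ({s} : Set circle.EnhancedState)))))⟩

/-- The Khovanov homology of the trivial knot. -/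
theorem IsTrivialKnot.kh [Finite E] {D : PD E n m} (h : D.IsTrivialKnot) (o : D.Orientation) :
    Nonempty (o.Kh 0 1 ≃ₗ[ℤ] ℤ) ∧ Nonempty (o.Kh 0 (-1) ≃ₗ[ℤ] ℤ) ∧
      ∀ i j, ¬ (i = 0 ∧ (j = 1 ∨ j = -1)) → Subsingleton (o.Kh i j) := by
  obtain ⟨o', ho'⟩ := h.transport.2.1 o
  have hw : o'.writhe = 0 := by simp [Orientation.writhe]
  refine ⟨?_, ?_, fun i j hij => ?_⟩
  · obtain ⟨e⟩ := ho' 0 1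
    -- With writhe 0 the index `b` is −2j, so j = 1 belongs to the circle with sign −, and j = −1 to
    -- sign +.
    obtain ⟨e'⟩ := circle_framedKh_int (-1) (a := o'.writhe - 2 * 0)
      (b := 3 * o'.writhe - 2 * 1) (by rw [hw]; rfl) (by rw [hw]; rfl)
    exact ⟨e.trans e'⟩
  · obtain ⟨e⟩ := ho' 0 (-1)
    obtain ⟨e'⟩ := circle_framedKh_int 1 (a := o'.writhe - 2 * 0)
      (b := 3 * o'.writhe - 2 * (-1)) (by rw [hw]; rfl) (by rw [hw]; rfl)
    exact ⟨e.trans e'⟩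
  · obtain ⟨e⟩ := ho' i j
    have := circle_framedKh_of_ne (a := o'.writhe - 2 * i) (b := 3 * o'.writhe - 2 * j) (by
      rw [hw]; omega)
    exact e.toEquiv.subsingleton

end PD

/-! ### The long exact sequence of a crossing -/

namespace PD

open Saddle

variable {E : Type} {n m : ℕ}

theorem update_insertNth_succAbove (v : Fin (n + 1)) (μ : Marker) (s : Fin n → Marker) (w : Fin n)
    (x : Marker) : Function.update (v.insertNth μ s : Fin (n + 1) → Marker) (v.succAbove w) x =
      (v.insertNth μ (Function.update s w x) : Fin (n + 1) → Marker) := by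
  funext i
  rcases Fin.eq_self_or_eq_succAbove v i with rfl | ⟨i, rfl⟩
  · rw [Function.update_of_ne (Fin.ne_succAbove _ _)]
    simp
  · by_cases h : i = w
    · subst h; simp
    · rw [Function.update_of_ne (fun e => h (Fin.succAbove_right_injective e))]
      simp [h]

theorem circles_insertNth_A (D : PD E (n + 1) m) (v : Fin (n + 1)) (s : Fin n → Marker) :
    D.circles (v.insertNth Marker.A s : Fin (n + 1) → Marker) = (D.smoothA v).circles s := by
  refine Setoid.ext fun x y => ⟨circles_le fun x y h => circles_of_joined ?_,
    circles_le fun x y h => circles_of_joined (Joined.smoothA (v := v) ?_ ?_)⟩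
  · cases h with
    | A₁ i h =>
      rcases Fin.eq_self_or_eq_succAbove v i with rfl | ⟨i, rfl⟩
      · exact Joined.arc (D := D.smoothA i) 0
      · exact Joined.A₁ (D := D.smoothA v) i (by simpa using h)
    | A₂ i h =>
      rcases Fin.eq_self_or_eq_succAbove v i with rfl | ⟨i, rfl⟩
      · exact Joined.arc (D := D.smoothA i) 1
      · exact Joined.A₂ (D := D.smoothA v) i (by simpa using h)
    | B₁ i h =>
      rcases Fin.eq_self_or_eq_succAbove v i with rfl | ⟨i, rfl⟩
      · simp at h
      · exact Joined.B₁ (D := D.smoothA v) i (by simpa using h)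
    | B₂ i h =>
      rcases Fin.eq_self_or_eq_succAbove v i with rfl | ⟨i, rfl⟩
      · simp at h
      · exact Joined.B₂ (D := D.smoothA v) i (by simpa using h)
    | arc j => exact Joined.arc (D := D.smoothA v) j.succ.succ
  · simp
  · simpa using h

theorem circles_insertNth_B (D : PD E (n + 1) m) (v : Fin (n + 1)) (s : Fin n → Marker) :
    D.circles (v.insertNth Marker.B s : Fin (n + 1) → Marker) = (D.smoothB v).circles s := by
  refine Setoid.ext fun x y => ⟨circles_le fun x y h => circles_of_joined h.of_insertNth_B,
    circles_le fun x y h => circles_of_joined ?_⟩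
  cases h with
  | A₁ i h => exact Joined.A₁ (v.succAbove i) (by simpa using h)
  | A₂ i h => exact Joined.A₂ (v.succAbove i) (by simpa using h)
  | B₁ i h => exact Joined.B₁ (v.succAbove i) (by simpa using h)
  | B₂ i h => exact Joined.B₂ (v.succAbove i) (by simpa using h)
  | arc j =>
    refine Fin.cases ?_ (fun j => Fin.cases ?_ (fun j => ?_) j) j
    · exact Joined.B₁ v (by simp)
    · exact Joined.B₂ v (by simp)
    · exact Joined.arc j

/-- The states of a smoothed diagram are states of `D`, so the dichotomy is inherited and the
planarity of the smoothed diagram is not needed. -/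
theorem Dich.smoothA {D : PD E (n + 1) m} (hD : D.Dich) (v : Fin (n + 1)) :
    (D.smoothA v).Dich := by
  intro s w hw
  simp only [← circles_insertNth_A, ← update_insertNth_succAbove]
  exact hD _ (v.succAbove w) (by simpa using hw)

theorem Dich.smoothB {D : PD E (n + 1) m} (hD : D.Dich) (v : Fin (n + 1)) :
    (D.smoothB v).Dich := by
  intro s w hw
  simp only [← circles_insertNth_B, ← update_insertNth_succAbove]
  exact hD _ (v.succAbove w) (by simpa using hw)

/-- The sign in the definition of `alpha`. -/
def alphaSign (v : Fin (n + 1)) (s : Fin n → Marker) : ℤ :=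
  (-1) ^ (Finset.univ.filter fun w => v.succAbove w < v ∧ s w = .B).card

theorem alphaSign_mul_self (v : Fin (n + 1)) (s : Fin n → Marker) :
    alphaSign v s * alphaSign v s = 1 := neg_one_pow_mul_self _

theorem alphaSign_update {v : Fin (n + 1)} {s : Fin n → Marker} {w : Fin n} (hw : s w = .A) :
    alphaSign v (Function.update s w .B) =
      alphaSign v s * if v.succAbove w < v then -1 else 1 := by
  have e : (Finset.univ.filter fun x => v.succAbove x < v ∧ Function.update s w Marker.B x = .B) =
      if v.succAbove w < v then insert w (Finset.univ.filter fun x => v.succAbove x < v ∧ s x = .B)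
        else Finset.univ.filter fun x => v.succAbove x < v ∧ s x = .B := by
    ext x
    by_cases hx : x = w
    · subst hx
      split_ifs with h <;> simp [h]
    · split_ifs with h <;> simp [hx]
  rw [alphaSign, alphaSign, e]
  split_ifs with h
  · rw [Finset.card_insert_of_notMem (by simp [hw]), pow_succ]
  · rw [mul_one]

theorem edgeSign_insertNth (v : Fin (n + 1)) (μ : Marker) (s : Fin n → Marker) (w : Fin n) :
    edgeSign (v.insertNth μ s : Fin (n + 1) → Marker) (v.succAbove w) =
      (if v.succAbove w < v ∧ μ = .B then -1 else 1) * edgeSign s w := by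
  rw [edgeSign_eq_prod, edgeSign_eq_prod, Fin.prod_univ_succAbove _ v]
  simp [Fin.succAbove_lt_succAbove_iff]

theorem ksgn_insertNth (v : Fin (n + 1)) (μ : Marker) (s s' : Fin n → Marker) :
    ksgn (v.insertNth μ s : Fin (n + 1) → Marker) (v.insertNth μ s' : Fin (n + 1) → Marker) =
      ∑ w, if s w = .A ∧ s' = Function.update s w .B then
        (if v.succAbove w < v ∧ μ = .B then -1 else 1) * edgeSign s w else 0 := by
  rw [ksgn, Fin.sum_univ_succAbove _ v, if_neg, zero_add]
  · refine Finset.sum_congr rfl fun w _ => ?_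
    rw [edgeSign_insertNth, update_insertNth_succAbove, Fin.insertNth_apply_succAbove]
    have : (v.insertNth μ s' : Fin (n + 1) → Marker) = v.insertNth μ (Function.update s w .B) ↔
        s' = Function.update s w .B := ⟨fun h => by
      funext i
      simpa using congrFun h (v.succAbove i), fun h => by rw [h]⟩
    exact if_congr (and_congr Iff.rfl this) rfl rfl
  · rintro ⟨h1, h2⟩
    have h3 := congrFun h2 v
    simp only [Fin.insertNth_apply_same, Function.update_self] at h1 h3
    rw [h1] at h3
    cases h3

theorem ksgn_insertNth_A (v : Fin (n + 1)) (s s' : Fin n → Marker) :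
    ksgn (v.insertNth Marker.A s : Fin (n + 1) → Marker)
      (v.insertNth Marker.A s' : Fin (n + 1) → Marker) = ksgn s s' := by
  rw [ksgn_insertNth]
  simp [ksgn]

/-- The marker B at `v` reverses the signs of the changes at crossings before `v`, and just these
changes also reverse `alphaSign`. -/
theorem ksgn_insertNth_B (v : Fin (n + 1)) (s s' : Fin n → Marker) :
    ksgn (v.insertNth Marker.B s : Fin (n + 1) → Marker)
      (v.insertNth Marker.B s' : Fin (n + 1) → Marker) =
      alphaSign v s * alphaSign v s' * ksgn s s' := by
  rw [ksgn_insertNth, ksgn, Finset.mul_sum]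
  refine Finset.sum_congr rfl fun w _ => ?_
  by_cases h : s w = .A ∧ s' = Function.update s w .B
  · rw [if_pos h, if_pos h, h.2, alphaSign_update h.1, ← mul_assoc (alphaSign v s),
      alphaSign_mul_self]
    simp
  · rw [if_neg h, if_neg h, mul_zero]

theorem ksgn_eq_zero {s s' : Fin n → Marker} {v : Fin n} (hs : s v = .B) (hs' : s' v = .A) :
    ksgn s s' = 0 := by
  by_contra h
  obtain ⟨w, hw, rfl⟩ := exists_of_ksgn_ne_zero h
  by_cases hvw : v = w
  · subst hvw
    rw [hs] at hw
    cases hw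
  · rw [Function.update_of_ne hvw, hs] at hs'
    cases hs'

theorem markerSum_insertNth (v : Fin (n + 1)) (μ : Marker) (s : Fin n → Marker) :
    markerSum (v.insertNth μ s : Fin (n + 1) → Marker) =
      (if μ = .A then 1 else -1) + markerSum s := by
  rw [markerSum, Fin.sum_univ_succAbove _ v]
  simp [markerSum]

namespace EnhancedState

variable {D : PD E (n + 1) m} {v : Fin (n + 1)}

/-- The enhanced state of `D` with label `A` at `v` given by an enhanced state of `D_A`. -/
def extendA (s : (D.smoothA v).EnhancedState) : D.EnhancedState :=
  ofConst D (v.insertNth Marker.A s.marker) s.sign (by rw [circles_insertNth_A]; exact s.const)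

theorem marker_extendA (s : (D.smoothA v).EnhancedState) : s.extendA.marker v = .A :=
  Fin.insertNth_apply_same (α := fun _ => Marker) v _ _

theorem marker_extendB (s : (D.smoothB v).EnhancedState) : s.extendB.marker v = .B :=
  Fin.insertNth_apply_same (α := fun _ => Marker) v _ _

theorem restrictA_extendA (s : (D.smoothA v).EnhancedState) (h : s.extendA.marker v = .A) :
    s.extendA.restrictA h = s := by
  refine EnhancedState.ext ?_ rfl
  simp [restrictA, extendA, ofConst]

theorem extendA_restrictA (s : D.EnhancedState) (h : s.marker v = .A) :
    (s.restrictA h).extendA = s := by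
  refine EnhancedState.ext ?_ rfl
  simp [restrictA, extendA, ofConst, ← h]

theorem extendA_injective :
    Function.Injective (extendA : (D.smoothA v).EnhancedState → D.EnhancedState) := fun s t h => by
  rw [← restrictA_extendA s (marker_extendA s), ← restrictA_extendA t (marker_extendA t)]
  congr 1

theorem extendB_injective :
    Function.Injective (extendB : (D.smoothB v).EnhancedState → D.EnhancedState) := fun s t h => by
  refine EnhancedState.ext ?_ (congrArg (fun u => u.sign) h)
  funext w
  simpa [extendB] using congrFun (congrArg (fun u => u.marker) h) (v.succAbove w)

theorem exists_extendB {s : D.EnhancedState} (h : s.marker v ≠ .A) :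
    ∃ t : (D.smoothB v).EnhancedState, t.extendB = s := by
  have hs : s.marker v = .B := by
    cases e : s.marker v
    · exact (h e).elim
    · rfl
  have e : (v.insertNth Marker.B (v.removeNth s.marker) : Fin (n + 1) → Marker) = s.marker := by
    simp [← hs]
  refine ⟨ofConst (D.smoothB v) (v.removeNth s.marker) s.sign ?_, EnhancedState.ext e rfl⟩
  rw [← circles_insertNth_B, e]
  exact s.const

theorem a_extendA (s : (D.smoothA v).EnhancedState) : s.extendA.a = s.a + 1 := by
  rw [a_eq, a_eq, extendA, ofConst, markerSum_insertNth]
  simp [add_comm]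

theorem a_extendB (s : (D.smoothB v).EnhancedState) : s.extendB.a = s.a - 1 := by
  rw [a_eq, a_eq, extendB, markerSum_insertNth]
  simp only [reduceCtorEq, if_false]
  ring

theorem b_extendA (s : (D.smoothA v).EnhancedState) : s.extendA.b = s.b + 1 := by
  have : s.extendA.τ = s.τ := by
    rw [tau_eq, tau_eq]
    exact congrArg (fun r => tau r s.sign) (circles_insertNth_A D v s.marker)
  rw [b, b, a_extendA, this]
  ring

theorem b_extendB (s : (D.smoothB v).EnhancedState) : s.extendB.b = s.b - 1 := by
  have : s.extendB.τ = s.τ := by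
    rw [tau_eq, tau_eq]
    exact congrArg (fun r => tau r s.sign) (circles_insertNth_B D v s.marker)
  rw [b, b, a_extendB, this]
  ring

variable [Finite E]

theorem incidence_extendA (hD : D.Dich) (s t : (D.smoothA v).EnhancedState) :
    s.extendA.incidence t.extendA = s.incidence t := by
  rw [incidence_eq hD, incidence_eq (hD.smoothA v), ← circles_insertNth_A, ← circles_insertNth_A,
    ← ksgn_insertNth_A v]
  rfl

theorem incidence_extendB (hD : D.Dich) (s t : (D.smoothB v).EnhancedState) :
    s.extendB.incidence t.extendB =
      alphaSign v s.marker * alphaSign v t.marker * s.incidence t := by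
  rw [incidence_eq hD, incidence_eq (hD.smoothB v), ← circles_insertNth_B, ← circles_insertNth_B,
    ← mul_assoc, ← ksgn_insertNth_B v]
  rfl

/-- The differential only turns A into B, so the states with B at `v` span a subcomplex. -/
theorem incidence_eq_zero (hD : D.Dich) {s t : D.EnhancedState} (hs : s.marker v = .B)
    (ht : t.marker v = .A) : s.incidence t = 0 := by
  rw [incidence_eq hD, ksgn_eq_zero hs ht, zero_mul]

end EnhancedState

open EnhancedState

theorem mem_chains {D : PD E n m} {x : D.Chain} {a b : ℤ} :
    x ∈ D.chains a b ↔ ∀ s, x s ≠ 0 → s.a = a ∧ s.b = b :=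
  ⟨fun h _ hs => (Finsupp.mem_supported _ _).1 h (Finsupp.mem_support_iff.2 hs),
    fun h => (Finsupp.mem_supported _ _).2 fun s hs => h s (Finsupp.mem_support_iff.1 hs)⟩

theorem boundary_single [Finite E] {D : PD E n m} (s t : D.EnhancedState) :
    D.boundary (Finsupp.single s 1) t = s.incidence t := by
  classical
  simp [boundary, Finsupp.single_apply]

theorem boundary_boundary [Finite E] {D : PD E n m} (hD : D.Dich) (x : D.Chain) :
    D.boundary (D.boundary x) = 0 := by
  have e : D.complex.diff * D.complex.diff = 0 := by
    ext s t
    rw [Matrix.mul_apply]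
    exact sum_incidence_mul hD s t
  exact (BasedComplex.lin_mul D.complex.diff D.complex.diff x).symm.trans
    (by rw [e]; exact BasedComplex.lin_zero (C := D.complex) x)

theorem boundary_mem_chains [Finite E] {D : PD E n m} {x : D.Chain} {a a' b : ℤ}
    (hx : x ∈ D.chains a b) (ha : a' = a - 2) : D.boundary x ∈ D.chains a' b :=
  BasedComplex.Homogeneous.lin_mem (C := D.complex) (C' := D.complex) (k := -2) (l := 0)
    (fun _ _ h => by
      obtain ⟨h1, h2⟩ := incidence_weight h
      exact ⟨h1, h2.trans (add_zero _).symm⟩) hx ha (add_zero _).symm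

section

variable {D : PD E (n + 1) m} {v : Fin (n + 1)}

theorem beta_apply (x : D.Chain) (t : (D.smoothA v).EnhancedState) :
    D.beta v x t = x t.extendA := by
  classical
  have : (Finsupp.lapply t ∘ₗ D.beta v) = Finsupp.lapply (R := ℤ) t.extendA := by
    refine Finsupp.lhom_ext' fun s => LinearMap.ext_ring ?_
    simp only [LinearMap.comp_apply, Finsupp.lsingle_apply, Finsupp.lapply_apply, beta,
      Finsupp.linearCombination_single, one_smul]
    split_ifs with h
    · rw [Finsupp.single_apply, Finsupp.single_apply]
      refine if_congr ⟨fun e => ?_, fun e => ?_⟩ rfl rfl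
      · rw [← e, extendA_restrictA]
      · subst e
        exact restrictA_extendA t h
    · rw [Finsupp.single_apply, if_neg]
      · rfl
      · rintro rfl
        exact h (marker_extendA t)
  exact LinearMap.congr_fun this x

theorem alpha_extendB (y : (D.smoothB v).Chain) (t : (D.smoothB v).EnhancedState) :
    D.alpha v y t.extendB = alphaSign v t.marker * y t := by
  classical
  have : (Finsupp.lapply t.extendB ∘ₗ D.alpha v) =
      alphaSign v t.marker • Finsupp.lapply (R := ℤ) t := by
    refine Finsupp.lhom_ext' fun s => LinearMap.ext_ring ?_
    simp only [LinearMap.comp_apply, Finsupp.lsingle_apply, Finsupp.lapply_apply, alpha,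
      Finsupp.linearCombination_single, one_smul, LinearMap.smul_apply, smul_eq_mul,
      Finsupp.single_apply, extendB_injective.eq_iff]
    split_ifs with h
    · rw [h, mul_one]; rfl
    · rw [mul_zero]
  exact LinearMap.congr_fun this y

theorem alpha_of_marker_eq (y : (D.smoothB v).Chain) {t : D.EnhancedState} (ht : t.marker v = .A) :
    D.alpha v y t = 0 := by
  classical
  have : (Finsupp.lapply t ∘ₗ D.alpha v) = 0 := by
    refine Finsupp.lhom_ext' fun s => LinearMap.ext_ring ?_
    simp only [LinearMap.comp_apply, Finsupp.lsingle_apply, Finsupp.lapply_apply, alpha,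
      Finsupp.linearCombination_single, one_smul, LinearMap.zero_apply, Finsupp.single_apply]
    refine if_neg ?_
    rintro rfl
    rw [marker_extendB] at ht
    cases ht
  exact LinearMap.congr_fun this y

theorem beta_alpha (y : (D.smoothB v).Chain) : D.beta v (D.alpha v y) = 0 :=
  Finsupp.ext fun t => by rw [beta_apply, alpha_of_marker_eq _ (marker_extendA t)]; rfl

theorem alpha_injective : Function.Injective (D.alpha v) := by
  intro x y h
  ext t
  have := congrArg (fun z => alphaSign v t.marker * z t.extendB) h
  simpa only [alpha_extendB, ← mul_assoc, alphaSign_mul_self, one_mul] using this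

theorem alpha_mem_chains {y : (D.smoothB v).Chain} {a b a' b' : ℤ}
    (hy : y ∈ (D.smoothB v).chains a' b') (ha : a' = a + 1) (hb : b' = b + 1) :
    D.alpha v y ∈ D.chains a b := by
  refine mem_chains.2 fun s hs => ?_
  have hv : s.marker v ≠ .A := fun h => hs (alpha_of_marker_eq y h)
  obtain ⟨t, rfl⟩ := exists_extendB hv
  rw [alpha_extendB] at hs
  obtain ⟨h1, h2⟩ := mem_chains.1 hy t (right_ne_zero_of_mul hs)
  rw [a_extendB, b_extendB]
  omega

theorem mem_chains_of_alpha_mem {y : (D.smoothB v).Chain} {a b a' b' : ℤ}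
    (hy : D.alpha v y ∈ D.chains a b) (ha : a' = a + 1) (hb : b' = b + 1) :
    y ∈ (D.smoothB v).chains a' b' := by
  refine mem_chains.2 fun t ht => ?_
  have hne : D.alpha v y t.extendB ≠ 0 := by
    rw [alpha_extendB]
    exact mul_ne_zero (fun e => by simpa [e] using alphaSign_mul_self v t.marker) ht
  obtain ⟨h1, h2⟩ := mem_chains.1 hy _ hne
  rw [a_extendB] at h1
  rw [b_extendB] at h2
  omega

theorem beta_mem_chains {x : D.Chain} {a b a' b' : ℤ} (hx : x ∈ D.chains a b) (ha : a = a' + 1)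
    (hb : b = b' + 1) : D.beta v x ∈ (D.smoothA v).chains a' b' := by
  refine mem_chains.2 fun s hs => ?_
  rw [beta_apply] at hs
  obtain ⟨h1, h2⟩ := mem_chains.1 hx _ hs
  rw [a_extendA] at h1
  rw [b_extendA] at h2
  omega

/-- The section of `β` which maps states to states. -/
noncomputable def betaSection (D : PD E (n + 1) m) (v : Fin (n + 1)) :
    (D.smoothA v).Chain →ₗ[ℤ] D.Chain := Finsupp.lmapDomain ℤ ℤ extendA

theorem beta_betaSection (x : (D.smoothA v).Chain) : D.beta v (D.betaSection v x) = x :=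
  Finsupp.ext fun t => by
    rw [beta_apply]
    exact Finsupp.mapDomain_apply extendA_injective x t

theorem betaSection_mem_chains {x : (D.smoothA v).Chain} {a b a' b' : ℤ}
    (hx : x ∈ (D.smoothA v).chains a' b') (ha : a = a' + 1) (hb : b = b' + 1) :
    D.betaSection v x ∈ D.chains a b := by
  refine mem_chains.2 fun s hs => ?_
  by_cases h : s ∈ Set.range (extendA : (D.smoothA v).EnhancedState → D.EnhancedState)
  · obtain ⟨t, rfl⟩ := h
    have e : D.betaSection v x t.extendA = x t := Finsupp.mapDomain_apply extendA_injective x t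
    rw [e] at hs
    obtain ⟨h1, h2⟩ := mem_chains.1 hx t hs
    rw [a_extendA, b_extendA]
    omega
  · exact (hs (Finsupp.mapDomain_of_notMem_range x s h)).elim

variable [Finite E]

/-- The left inverse of `α` which vanishes on the states with label `A` at `v`. -/
noncomputable def alphaRetraction (D : PD E (n + 1) m) (v : Fin (n + 1)) :
    D.Chain →ₗ[ℤ] (D.smoothB v).Chain :=
  (Finsupp.linearEquivFunOnFinite ℤ ℤ (D.smoothB v).EnhancedState).symm.toLinearMap ∘ₗ
    LinearMap.pi fun t => alphaSign v t.marker • Finsupp.lapply t.extendB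

theorem alphaRetraction_apply (x : D.Chain) (t : (D.smoothB v).EnhancedState) :
    D.alphaRetraction v x t = alphaSign v t.marker * x t.extendB := rfl

theorem alphaRetraction_alpha (y : (D.smoothB v).Chain) :
    D.alphaRetraction v (D.alpha v y) = y :=
  Finsupp.ext fun t => by
    rw [alphaRetraction_apply, alpha_extendB, ← mul_assoc, alphaSign_mul_self, one_mul]

/-- The kernel of β consists of the chains on states with label B at `v`, which are all states of
the B-smoothing. -/
theorem exists_alpha_eq {x : D.Chain} (hx : D.beta v x = 0) : ∃ y, D.alpha v y = x := by
  refine ⟨D.alphaRetraction v x, Finsupp.ext fun s => ?_⟩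
  by_cases hs : s.marker v = .A
  · have := DFunLike.congr_fun hx (s.restrictA hs)
    rw [beta_apply, extendA_restrictA] at this
    rw [alpha_of_marker_eq _ hs, this]; rfl
  · obtain ⟨t, rfl⟩ := exists_extendB hs
    rw [alpha_extendB, alphaRetraction_apply, ← mul_assoc, alphaSign_mul_self, one_mul]

theorem alpha_boundary (hD : D.Dich) (y : (D.smoothB v).Chain) :
    D.alpha v ((D.smoothB v).boundary y) = D.boundary (D.alpha v y) := by
  have : D.alpha v ∘ₗ (D.smoothB v).boundary = D.boundary ∘ₗ D.alpha v := by
    refine Finsupp.lhom_ext' fun s => LinearMap.ext_ring (Finsupp.ext fun t => ?_)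
    have e : D.alpha v (Finsupp.single s 1) =
        alphaSign v s.marker • Finsupp.single s.extendB (1 : ℤ) := by
      simp [alpha, alphaSign]
    simp only [LinearMap.comp_apply, Finsupp.lsingle_apply]
    rw [e, map_smul, Finsupp.smul_apply, boundary_single, smul_eq_mul]
    by_cases ht : t.marker v = .A
    · rw [alpha_of_marker_eq _ ht, incidence_eq_zero hD (marker_extendB s) ht, mul_zero]
    · obtain ⟨t, rfl⟩ := exists_extendB ht
      rw [alpha_extendB, boundary_single, incidence_extendB hD, ← mul_assoc, ← mul_assoc,
        alphaSign_mul_self, one_mul]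
  exact LinearMap.congr_fun this y

theorem beta_boundary (hD : D.Dich) (x : D.Chain) :
    D.beta v (D.boundary x) = (D.smoothA v).boundary (D.beta v x) := by
  have : D.beta v ∘ₗ D.boundary = (D.smoothA v).boundary ∘ₗ D.beta v := by
    refine Finsupp.lhom_ext' fun s => LinearMap.ext_ring (Finsupp.ext fun t => ?_)
    simp only [LinearMap.comp_apply, Finsupp.lsingle_apply]
    rw [beta_apply, boundary_single]
    by_cases hs : s.marker v = .A
    · have e : D.beta v (Finsupp.single s 1) = Finsupp.single (s.restrictA hs) 1 := by
        simp [beta, hs]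
      rw [e, boundary_single, ← incidence_extendA hD, extendA_restrictA]
    · obtain ⟨s, rfl⟩ := exists_extendB hs
      have e : D.beta v (Finsupp.single s.extendB 1) = 0 := by
        simp [beta, marker_extendB]
      rw [e, map_zero, incidence_eq_zero hD (marker_extendB s) (marker_extendA t)]
      rfl
  exact LinearMap.congr_fun this x

end

end PD

/-! ### The connecting map and exactness -/

namespace PD

variable {E : Type} {n m : ℕ} [Finite E] {D : PD E (n + 1) m} {v : Fin (n + 1)}
  {a b a' b' a'' b'' : ℤ}

theorem homologyClass_surjective {n : ℕ} {D : PD E n m} (x : D.FramedKh a b) :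
    ∃ (z : D.Chain) (hz : z ∈ D.cycles a b), D.homologyClass z hz = x := by
  obtain ⟨⟨z, hz⟩, rfl⟩ := Submodule.Quotient.mk_surjective _ x
  exact ⟨z, hz, rfl⟩

theorem homologyClass_eq_iff {n : ℕ} {D : PD E n m} {z z' : D.Chain} {hz : z ∈ D.cycles a b}
    {hz' : z' ∈ D.cycles a b} :
    D.homologyClass z hz = D.homologyClass z' hz' ↔ z - z' ∈ D.boundaries a b :=
  Submodule.Quotient.eq _

theorem homologyClass_eq_zero_iff {n : ℕ} {D : PD E n m} {z : D.Chain} {hz : z ∈ D.cycles a b} :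
    D.homologyClass z hz = 0 ↔ z ∈ D.boundaries a b :=
  Submodule.Quotient.mk_eq_zero _

theorem exists_isInduced {n n' m' : ℕ} {D : PD E n m} {D' : PD E n' m'}
    (f : D.Chain →ₗ[ℤ] D'.Chain) (hf : ∀ x, f (D.boundary x) = D'.boundary (f x))
    (h : ∀ x ∈ D.chains a b, f x ∈ D'.chains a' b')
    (h' : ∀ x ∈ D.chains (a + 2) b, f x ∈ D'.chains (a' + 2) b') :
    ∃ F : D.FramedKh a b →ₗ[ℤ] D'.FramedKh a' b', IsInduced f F := by
  have h1 : ∀ x ∈ D.cycles a b, f x ∈ D'.cycles a' b' := fun x hx =>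
    ⟨h x hx.1, LinearMap.mem_ker.2 (by rw [← hf, LinearMap.mem_ker.1 hx.2, map_zero])⟩
  have h2 : ∀ x ∈ D.boundaries a b, f x ∈ D'.boundaries a' b' := by
    rintro _ ⟨x, hx, rfl⟩
    exact ⟨f x, h' x hx, (hf x).symm⟩
  exact ⟨BasedComplex.homologyMap (C := D.complex) (C' := D'.complex) f h1 h2,
    fun z hz => ⟨h1 z hz, rfl⟩⟩

theorem exists_isInduced_alpha (hD : D.Dich) (v : Fin (n + 1)) (ha : a' = a + 1) (hb : b' = b + 1) :
    ∃ F : (D.smoothB v).FramedKh a' b' →ₗ[ℤ] D.FramedKh a b, IsInduced (D.alpha v) F :=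
  exists_isInduced _ (alpha_boundary hD) (fun _ hx => alpha_mem_chains hx ha hb)
    fun _ hx => alpha_mem_chains hx (by omega) hb

theorem exists_isInduced_beta (hD : D.Dich) (v : Fin (n + 1)) (ha : a = a' + 1) (hb : b = b' + 1) :
    ∃ F : D.FramedKh a b →ₗ[ℤ] (D.smoothA v).FramedKh a' b', IsInduced (D.beta v) F :=
  exists_isInduced _ (beta_boundary hD) (fun _ hx => beta_mem_chains hx ha hb)
    fun _ hx => beta_mem_chains hx (by omega) hb

theorem boundary_eq_zero_of_alpha (hD : D.Dich) {y : (D.smoothB v).Chain}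
    (h : D.boundary (D.alpha v y) = 0) : (D.smoothB v).boundary y = 0 := by
  rw [← alpha_boundary hD] at h
  exact alpha_injective (h.trans (map_zero _).symm)

/-- The boundary of a lift of a cycle of `D_A`. -/
theorem exists_alpha_eq_boundary (hD : D.Dich) {z : D.Chain} (hz : z ∈ D.chains (a + 1) (b + 1))
    (h : D.beta v z ∈ (D.smoothA v).cycles a b) (hb : b' = b + 2) :
    ∃ y ∈ (D.smoothB v).cycles a b', D.alpha v y = D.boundary z := by
  obtain ⟨y, hy⟩ := exists_alpha_eq (v := v) (x := D.boundary z) (by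
    rw [beta_boundary hD, LinearMap.mem_ker.1 h.2])
  refine ⟨y, ⟨mem_chains_of_alpha_mem (a := a - 1) (b := b + 1) ?_ (by ring) (by omega), ?_⟩, hy⟩
  · rw [hy]
    exact boundary_mem_chains hz (by ring)
  · exact boundary_eq_zero_of_alpha hD (by rw [hy, boundary_boundary hD])

/-- Lifts of homologous cycles of `D_A` have homologous images under the connecting map. -/
theorem mem_boundaries_of_boundary_eq_alpha (hD : D.Dich) {z : D.Chain}
    (hz : z ∈ D.chains (a + 1) (b + 1)) (h : D.beta v z ∈ (D.smoothA v).boundaries a b)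
    (hb : b' = b + 2) {y : (D.smoothB v).Chain} (hy : D.boundary z = D.alpha v y) :
    y ∈ (D.smoothB v).boundaries a b' := by
  obtain ⟨w, hw, hwz⟩ := h
  have hσ := betaSection_mem_chains (v := v) (a := a + 1 + 2) (b := b + 1) hw (by ring) rfl
  obtain ⟨y', hy'⟩ := exists_alpha_eq (v := v) (x := z - D.boundary (D.betaSection v w)) (by
    rw [map_sub, beta_boundary hD, beta_betaSection, hwz, sub_self])
  refine ⟨y', mem_chains_of_alpha_mem (a := a + 1) (b := b + 1) ?_ (by ring) (by omega), ?_⟩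
  · rw [hy']
    exact Submodule.sub_mem _ hz (boundary_mem_chains hσ (by ring))
  · refine alpha_injective (v := v) ?_
    rw [alpha_boundary hD, hy', map_sub, boundary_boundary hD, sub_zero, hy]

/-- Lift by the section of β, take the boundary, and retract along α. The lift raises `b` by 1, and
inverting α raises it by 1 again. -/
theorem exists_isConnecting (hD : D.Dich) (v : Fin (n + 1)) (ha : a' = a) (hb : b' = b + 2) :
    ∃ γ : (D.smoothA v).FramedKh a b →ₗ[ℤ] (D.smoothB v).FramedKh a' b', D.IsConnecting v γ := by
  subst ha
  let δ := D.alphaRetraction v ∘ₗ D.boundary ∘ₗ D.betaSection v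
  have hδ : ∀ x ∈ (D.smoothA v).cycles a' b, δ x ∈ (D.smoothB v).cycles a' b' ∧
      D.boundary (D.betaSection v x) = D.alpha v (δ x) := by
    intro x hx
    obtain ⟨y, hy, e⟩ := exists_alpha_eq_boundary (b' := b') hD
      (betaSection_mem_chains (v := v) hx.1 rfl rfl) (by rwa [beta_betaSection]) hb
    have : δ x = y := by
      change D.alphaRetraction v (D.boundary (D.betaSection v x)) = y
      rw [← e, alphaRetraction_alpha]
    rw [this]
    exact ⟨hy, e.symm⟩
  have hδ' : ∀ x ∈ (D.smoothA v).boundaries a' b, δ x ∈ (D.smoothB v).boundaries a' b' := by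
    intro x hx
    have hc : x ∈ (D.smoothA v).cycles a' b := by
      obtain ⟨w, hw, rfl⟩ := hx
      exact ⟨boundary_mem_chains hw (by ring), boundary_boundary (hD.smoothA v) w⟩
    exact mem_boundaries_of_boundary_eq_alpha hD (betaSection_mem_chains (v := v) hc.1 rfl rfl)
      (by rwa [beta_betaSection]) hb (hδ x hc).2
  refine ⟨BasedComplex.homologyMap (C := (D.smoothA v).complex) (C' := (D.smoothB v).complex) δ
    (fun x hx => (hδ x hx).1) hδ', fun z hz hc y hy e => ?_⟩
  -- The standard lift and `z` differ by a chain in the kernel of β, so the two values differ by a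
  -- boundary.
  refine (homologyClass_eq_iff (hz := (hδ _ hc).1)).2 (mem_boundaries_of_boundary_eq_alpha (v := v)
    (z := D.betaSection v (D.beta v z) - z) hD (Submodule.sub_mem _
      (betaSection_mem_chains hc.1 rfl rfl) hz) ?_ hb ?_)
  · rw [map_sub, beta_betaSection, sub_self]
    exact Submodule.zero_mem _
  · rw [map_sub, map_sub, (hδ _ hc).2, e]

theorem exact_alpha_beta (hD : D.Dich) (ha : a' = a + 1) (hb : b' = b + 1) (ha' : a = a'' + 1)
    (hb' : b = b'' + 1) {F : (D.smoothB v).FramedKh a' b' →ₗ[ℤ] D.FramedKh a b}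
    {G : D.FramedKh a b →ₗ[ℤ] (D.smoothA v).FramedKh a'' b''} (hF : IsInduced (D.alpha v) F)
    (hG : IsInduced (D.beta v) G) : Function.Exact F G := by
  intro x
  obtain ⟨z, hz, rfl⟩ := homologyClass_surjective x
  obtain ⟨h1, h2⟩ := hG z hz
  rw [h2, homologyClass_eq_zero_iff]
  constructor
  · rintro ⟨w, hw, hwz⟩
    have hσ := betaSection_mem_chains (v := v) (a := a + 2) (b := b) hw (by omega) hb'
    -- Subtracting the boundary of a lift of `w` does not change the class of `z` and brings it into
    -- the image of α.
    obtain ⟨y, hy⟩ := exists_alpha_eq (v := v) (x := z - D.boundary (D.betaSection v w)) (by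
      rw [map_sub, beta_boundary hD, beta_betaSection, hwz, sub_self])
    have hc : y ∈ (D.smoothB v).cycles a' b' := by
      refine ⟨mem_chains_of_alpha_mem (a := a) (b := b) ?_ ha hb, ?_⟩
      · rw [hy]
        exact Submodule.sub_mem _ hz.1 (boundary_mem_chains hσ (by ring))
      · refine boundary_eq_zero_of_alpha hD ?_
        rw [hy, map_sub, boundary_boundary hD, LinearMap.mem_ker.1 hz.2, sub_zero]
    obtain ⟨h3, h4⟩ := hF y hc
    refine ⟨_, h4.trans (homologyClass_eq_iff.2 ⟨- D.betaSection v w, Submodule.neg_mem _ hσ, ?_⟩)⟩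
    rw [hy, map_neg]
    abel
  · rintro ⟨y, hy⟩
    obtain ⟨y, hc, rfl⟩ := homologyClass_surjective y
    obtain ⟨h3, h4⟩ := hF y hc
    obtain ⟨w, hw, e⟩ := homologyClass_eq_iff.1 (h4.symm.trans hy)
    refine ⟨- D.beta v w, Submodule.neg_mem _ (beta_mem_chains hw (by omega) hb'), ?_⟩
    rw [map_neg, ← beta_boundary hD, e, map_sub, beta_alpha, zero_sub, neg_neg]

theorem exact_beta_connecting (hD : D.Dich) (ha : a = a' + 1) (hb : b = b' + 1) (ha' : a'' = a')
    (hb' : b'' = b' + 2) {F : D.FramedKh a b →ₗ[ℤ] (D.smoothA v).FramedKh a' b'}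
    {G : (D.smoothA v).FramedKh a' b' →ₗ[ℤ] (D.smoothB v).FramedKh a'' b''}
    (hF : IsInduced (D.beta v) F) (hG : D.IsConnecting v G) : Function.Exact F G := by
  subst ha hb ha'
  intro x
  constructor
  · intro hx
    obtain ⟨x, hc, rfl⟩ := homologyClass_surjective x
    obtain ⟨z, hz, rfl⟩ : ∃ z ∈ D.chains (a'' + 1) (b' + 1), D.beta v z = x :=
      ⟨_, betaSection_mem_chains hc.1 rfl rfl, beta_betaSection x⟩
    obtain ⟨y, hy, e⟩ := exists_alpha_eq_boundary hD hz hc hb'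
    rw [hG z hz hc y hy e.symm, homologyClass_eq_zero_iff] at hx
    obtain ⟨w, hw, rfl⟩ := hx
    -- The boundary of the lift is α of a boundary, so correcting the lift by `alpha v w` makes it a
    -- cycle with the same image under β.
    have h1 : z - D.alpha v w ∈ D.cycles (a'' + 1) (b' + 1) :=
      ⟨Submodule.sub_mem _ hz (alpha_mem_chains hw (by ring) (by omega)), LinearMap.mem_ker.2 (by
        rw [map_sub, ← e, alpha_boundary hD, sub_self])⟩
    obtain ⟨h2, h3⟩ := hF _ h1
    refine ⟨_, h3.trans (homologyClass_eq_iff.2 ?_)⟩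
    rw [map_sub, beta_alpha, sub_zero, sub_self]
    exact Submodule.zero_mem _
  · rintro ⟨z, rfl⟩
    obtain ⟨z, hz, rfl⟩ := homologyClass_surjective z
    obtain ⟨h1, h2⟩ := hF z hz
    rw [h2, hG z hz.1 h1 0 (Submodule.zero_mem _) (by rw [LinearMap.mem_ker.1 hz.2, map_zero]),
      homologyClass_eq_zero_iff]
    exact Submodule.zero_mem _

theorem exact_connecting_alpha (hD : D.Dich) (ha : a' = a) (hb : b' = b + 2) (ha' : a' = a'' + 1)
    (hb' : b' = b'' + 1) {F : (D.smoothA v).FramedKh a b →ₗ[ℤ] (D.smoothB v).FramedKh a' b'}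
    {G : (D.smoothB v).FramedKh a' b' →ₗ[ℤ] D.FramedKh a'' b''}
    (hF : D.IsConnecting v F) (hG : IsInduced (D.alpha v) G) : Function.Exact F G := by
  subst ha
  intro y
  constructor
  · intro hy
    obtain ⟨y, hc, rfl⟩ := homologyClass_surjective y
    obtain ⟨h1, h2⟩ := hG y hc
    rw [h2, homologyClass_eq_zero_iff] at hy
    obtain ⟨z, hz, e⟩ := hy
    have hz : z ∈ D.chains (a' + 1) (b + 1) := by
      rw [ha', show b + 1 = b'' by omega, show a'' + 1 + 1 = a'' + 2 by ring]
      exact hz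
    have h3 : D.beta v z ∈ (D.smoothA v).cycles a' b :=
      ⟨beta_mem_chains hz rfl rfl, LinearMap.mem_ker.2 (by rw [← beta_boundary hD, e, beta_alpha])⟩
    exact ⟨_, hF z hz h3 y hc e⟩
  · rintro ⟨x, rfl⟩
    obtain ⟨x, hc, rfl⟩ := homologyClass_surjective x
    obtain ⟨z, hz, rfl⟩ : ∃ z ∈ D.chains (a' + 1) (b + 1), D.beta v z = x :=
      ⟨_, betaSection_mem_chains hc.1 rfl rfl, beta_betaSection x⟩
    obtain ⟨y, hy, e⟩ := exists_alpha_eq_boundary hD hz hc hb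
    rw [hF z hz hc y hy e.symm]
    obtain ⟨h1, h2⟩ := hG y hy
    rw [h2, homologyClass_eq_zero_iff]
    refine ⟨z, ?_, e.symm⟩
    rw [show a'' + 2 = a' + 1 by omega, show b'' = b + 1 by omega]
    exact hz

/-! ### Torsion -/

/-- Under an injective map, the preimage of a torsion element is torsion, killed by the same
integer. -/
theorem torsion_equiv_of_injective {M N : Type} [AddCommGroup M] [AddCommGroup N] (f : M →ₗ[ℤ] N)
    (hf : Function.Injective f) (h : ∀ x ∈ Submodule.torsion ℤ N, ∃ y, f y = x) :
    Nonempty (Submodule.torsion ℤ M ≃ₗ[ℤ] Submodule.torsion ℤ N) := by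
  have h1 : ∀ x ∈ Submodule.torsion ℤ M, f x ∈ Submodule.torsion ℤ N := by
    intro x hx
    obtain ⟨c, hc⟩ := (Submodule.mem_torsion_iff x).1 hx
    exact (Submodule.mem_torsion_iff _).2 ⟨c, by
      rw [Submonoid.smul_def] at hc ⊢
      rw [← map_smul, hc, map_zero]⟩
  refine ⟨LinearEquiv.ofBijective (f.restrict h1) ⟨fun x y e => ?_, fun x => ?_⟩⟩
  · exact Subtype.ext (hf (congrArg Subtype.val e))
  · obtain ⟨y, hy⟩ := h x x.2
    refine ⟨⟨y, (Submodule.mem_torsion_iff y).2 ?_⟩, Subtype.ext hy⟩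
    obtain ⟨c, hc⟩ := (Submodule.mem_torsion_iff _).1 x.2
    refine ⟨c, hf ?_⟩
    rw [Submonoid.smul_def] at hc ⊢
    rw [map_smul, hy, hc, map_zero]

theorem eq_zero_of_mem_torsion {M : Type} [AddCommGroup M] (f : M →ₗ[ℤ] ℤ) {x : M}
    (hx : x ∈ Submodule.torsion ℤ M) : f x = 0 := by
  obtain ⟨c, hc⟩ := (Submodule.mem_torsion_iff x).1 hx
  rw [Submonoid.smul_def] at hc
  have := congrArg f hc
  rw [map_smul, map_zero, smul_eq_mul] at this
  exact (mul_eq_zero.1 this).resolve_left (nonZeroDivisors.coe_ne_zero c)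

/-! ### The writhe -/

omit [Finite E] in
theorem Orientation.sign_emod_two {n : ℕ} {D : PD E n m} (o : D.Orientation) (i : Fin n) :
    (2 : ℤ) ∣ o.sign i - 1 := by
  unfold Orientation.sign
  split_ifs <;> norm_num

omit [Finite E] in
theorem Orientation.two_dvd_writhe_sub {n : ℕ} {D : PD E n m} (o : D.Orientation) :
    (2 : ℤ) ∣ o.writhe - n := by
  have : o.writhe - n = ∑ i, (o.sign i - 1) := by
    simp [Orientation.writhe, Finset.sum_sub_distrib]
  rw [this]
  exact Finset.dvd_sum fun i _ => o.sign_emod_two i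

omit [Finite E] in
theorem Orientation.writhe_smoothA (o : D.Orientation) (hv : o.sign v = 1) :
    (o.smoothA v hv).writhe = o.writhe - 1 := by
  rw [Orientation.writhe, Orientation.writhe, Fin.sum_univ_succAbove _ v, hv, add_sub_cancel_left]
  rfl

end PD


/-! ### The long exact sequence in the classical grading -/

namespace PD

section

variable {E : Type} [Finite E] {n m : ℕ} {D : PD E (n + 1) m} {o : D.Orientation}
  {v : Fin (n + 1)} {hv : o.sign v = 1} {oB : (D.smoothB v).Orientation} {u i j i' j' : ℤ}

/-- Solving w_B − 2i' = w − 2i + 1 and 3w_B − 2j' = 3w − 2j + 1 with 2u = w − w_B + 1 gives i' = i −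
u and j' = j − 3u + 1. -/
theorem exists_isInduced_alpha_kh (hD : D.Dich) (o : D.Orientation)
    (hu : 2 * u = o.writhe - oB.writhe + 1) (hi : i' = i - u) (hj : j' = j - 3 * u + 1) :
    ∃ F : oB.Kh i' j' →ₗ[ℤ] o.Kh i j, IsInduced (D.alpha v) F :=
  exists_isInduced_alpha hD v (by omega) (by omega)

theorem exists_isInduced_beta_kh (hD : D.Dich) (hv : o.sign v = 1) (hj : j' = j - 1) :
    ∃ F : o.Kh i j →ₗ[ℤ] (o.smoothA v hv).Kh i j', IsInduced (D.beta v) F :=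
  exists_isInduced_beta hD v (by rw [o.writhe_smoothA]; omega) (by rw [o.writhe_smoothA]; omega)

theorem exists_isConnecting_kh (hD : D.Dich) (hv : o.sign v = 1)
    (hu : 2 * u = o.writhe - oB.writhe + 1) (hi : i' = i - u + 1) (hj : j' = j - 3 * u + 2) :
    ∃ γ : (o.smoothA v hv).Kh i j →ₗ[ℤ] oB.Kh i' j', D.IsConnecting v γ :=
  exists_isConnecting hD v (by rw [o.writhe_smoothA]; omega) (by rw [o.writhe_smoothA]; omega)

theorem exact_alpha_beta_kh (hD : D.Dich) (hu : 2 * u = o.writhe - oB.writhe + 1) (hi : i' = i - u)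
    (hj : j' = j - 3 * u + 1) {jA : ℤ} (hA : jA = j - 1) {F : oB.Kh i' j' →ₗ[ℤ] o.Kh i j}
    {G : o.Kh i j →ₗ[ℤ] (o.smoothA v hv).Kh i jA} (hF : IsInduced (D.alpha v) F)
    (hG : IsInduced (D.beta v) G) : Function.Exact F G :=
  exact_alpha_beta hD (by omega) (by omega) (by rw [o.writhe_smoothA]; omega)
    (by rw [o.writhe_smoothA]; omega) hF hG

theorem exact_beta_connecting_kh (hD : D.Dich) (hu : 2 * u = o.writhe - oB.writhe + 1) {jA : ℤ}
    (hA : jA = j - 1) (hi : i' = i - u + 1) (hj : j' = j - 3 * u + 1)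
    {F : o.Kh i j →ₗ[ℤ] (o.smoothA v hv).Kh i jA}
    {G : (o.smoothA v hv).Kh i jA →ₗ[ℤ] oB.Kh i' j'} (hF : IsInduced (D.beta v) F)
    (hG : D.IsConnecting v G) : Function.Exact F G :=
  exact_beta_connecting hD (by rw [o.writhe_smoothA]; omega) (by rw [o.writhe_smoothA]; omega)
    (by rw [o.writhe_smoothA]; omega) (by rw [o.writhe_smoothA]; omega) hF hG

theorem exact_connecting_alpha_kh (hD : D.Dich) (hu : 2 * u = o.writhe - oB.writhe + 1) {k jA : ℤ}
    (hk : k = i + 1) (hA : jA = j - 1) (hi : i' = i - u + 1) (hj : j' = j - 3 * u + 1)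
    {F : (o.smoothA v hv).Kh i jA →ₗ[ℤ] oB.Kh i' j'} {G : oB.Kh i' j' →ₗ[ℤ] o.Kh k j}
    (hF : D.IsConnecting v F) (hG : IsInduced (D.alpha v) G) : Function.Exact F G :=
  exact_connecting_alpha hD (by rw [o.writhe_smoothA]; omega) (by rw [o.writhe_smoothA]; omega)
    (by omega) (by omega) hF hG

theorem injective_beta_kh (hD : D.Dich) (hu : 2 * u = o.writhe - oB.writhe + 1) (hj : j' = j - 1)
    (h0 : Subsingleton (oB.Kh (i - u) (j - 3 * u + 1)))
    {F : o.Kh i j →ₗ[ℤ] (o.smoothA v hv).Kh i j'} (hF : IsInduced (D.beta v) F) :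
    Function.Injective F := by
  obtain ⟨α, hα⟩ := exists_isInduced_alpha_kh (v := v) (i := i) (j := j) hD o hu rfl rfl
  refine (injective_iff_map_eq_zero F).2 fun x hx => ?_
  obtain ⟨y, rfl⟩ := (exact_alpha_beta_kh hD hu rfl rfl hj hα hF x).1 hx
  rw [Subsingleton.elim y 0, map_zero]

theorem surjective_beta_kh (hD : D.Dich) (hu : 2 * u = o.writhe - oB.writhe + 1) (hj : j' = j - 1)
    (h0 : Subsingleton (oB.Kh (i - u + 1) (j - 3 * u + 1)))
    {F : o.Kh i j →ₗ[ℤ] (o.smoothA v hv).Kh i j'} (hF : IsInduced (D.beta v) F) :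
    Function.Surjective F := by
  obtain ⟨γ, hγ⟩ := exists_isConnecting_kh (v := v) (i := i) (j := j') (i' := i - u + 1)
    (j' := j - 3 * u + 1) hD hv hu rfl (by omega)
  exact fun x => (exact_beta_connecting_kh hD hu hj rfl rfl hF hγ x).1 (Subsingleton.elim _ _)

/-- The neighbouring groups of D_B in the row `jB` vanish, which turns the long sequence into five
terms with ℤ in the middle. -/
theorem exact_sequence_kh (hD : D.Dich) (hu : 2 * u = o.writhe - oB.writhe + 1) {jA jB : ℤ}
    (hB : oB.Kh 0 jB ≃ₗ[ℤ] ℤ) (hneg : Subsingleton (oB.Kh (-1) jB))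
    (hpos : Subsingleton (oB.Kh 1 jB)) (hj : j = 3 * u - 1 + jB) (hA : jA = j - 1) :
    ∃ (e : oB.Kh 0 jB ≃ₗ[ℤ] ℤ) (β : o.Kh (u - 1) j →ₗ[ℤ] (o.smoothA v hv).Kh (u - 1) jA)
      (γ : (o.smoothA v hv).Kh (u - 1) jA →ₗ[ℤ] oB.Kh 0 jB) (α : oB.Kh 0 jB →ₗ[ℤ] o.Kh u j)
      (β' : o.Kh u j →ₗ[ℤ] (o.smoothA v hv).Kh u jA),
      IsInduced (D.beta v) β ∧ D.IsConnecting v γ ∧ IsInduced (D.alpha v) α ∧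
      IsInduced (D.beta v) β' ∧ Function.Injective β ∧ Function.Exact β (e ∘ γ) ∧
      Function.Exact (e ∘ γ) (α ∘ e.symm) ∧ Function.Exact (α ∘ e.symm) β' ∧
      Function.Surjective β' := by
  obtain ⟨β, hβ⟩ := exists_isInduced_beta_kh (i := u - 1) hD hv hA
  obtain ⟨γ, hγ⟩ := exists_isConnecting_kh (i := u - 1) (j := jA) (i' := 0) (j' := jB) hD hv hu
    (by omega) (by omega)
  obtain ⟨α, hα⟩ := exists_isInduced_alpha_kh (v := v) (i := u) (j := j) (i' := 0) (j' := jB) hD o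
    hu (by omega) (by omega)
  obtain ⟨β', hβ'⟩ := exists_isInduced_beta_kh (i := u) hD hv hA
  have e1 : (u - 1) - u = -1 := by ring
  have e2 : u - u + 1 = 1 := by ring
  have e3 : j - 3 * u + 1 = jB := by omega
  have x1 := exact_beta_connecting_kh hD hu hA (by omega) (by omega) hβ hγ
  have x2 := exact_connecting_alpha_kh hD hu (by omega) hA (by omega) (by omega) hγ hα
  have x3 := exact_alpha_beta_kh hD hu (by omega) (by omega) hA hα hβ'
  refine ⟨hB, β, γ, α, β', hβ, hγ, hα, hβ', injective_beta_kh hD hu hA (by rwa [e1, e3]) hβ, ?_, ?_,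
    ?_, surjective_beta_kh hD hu hA (by rwa [e2, e3]) hβ'⟩
  · exact fun y => (hB.map_eq_zero_iff).trans (x1 y)
  · refine fun y => (x2 (hB.symm y)).trans ⟨?_, ?_⟩
    · rintro ⟨x, hx⟩
      exact ⟨x, by rw [Function.comp_apply, hx, hB.apply_symm_apply]⟩
    · rintro ⟨x, rfl⟩
      exact ⟨x, (hB.symm_apply_apply _).symm⟩
  · refine fun y => (x3 y).trans ⟨?_, ?_⟩
    · rintro ⟨x, rfl⟩
      exact ⟨hB x, by rw [Function.comp_apply, hB.symm_apply_apply]⟩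
    · rintro ⟨x, rfl⟩
      exact ⟨hB.symm x, rfl⟩

end

end PD

/-! ### Crossings whose B-smoothing is the trivial knot -/

theorem mainTheorem1 {E : Type} [Finite E] {n m : ℕ} (D : PD E (n + 1) m)
    (hD : D.IsLinkDiagram) (o : D.Orientation) (v : Fin (n + 1)) (hv : o.sign v = 1)
    (hB : (D.smoothB v).IsTrivialKnot) (oB : (D.smoothB v).Orientation) :
    ∃ u : ℤ, 2 * u = o.writhe - oB.writhe + 1 ∧
      (∀ i j : ℤ,
        (i, j) ∉ ({(u, 3 * u), (u, 3 * u - 2), (u - 1, 3 * u), (u - 1, 3 * u - 2)} : Set (ℤ × ℤ)) →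
        Nonempty (o.Kh i j ≃ₗ[ℤ] (o.smoothA v hv).Kh i (j - 1))) ∧
      (∃ (e : oB.Kh 0 1 ≃ₗ[ℤ] ℤ)
        (β : o.Kh (u - 1) (3 * u) →ₗ[ℤ] (o.smoothA v hv).Kh (u - 1) (3 * u - 1))
        (γ : (o.smoothA v hv).Kh (u - 1) (3 * u - 1) →ₗ[ℤ] oB.Kh 0 1)
        (α : oB.Kh 0 1 →ₗ[ℤ] o.Kh u (3 * u))
        (β' : o.Kh u (3 * u) →ₗ[ℤ] (o.smoothA v hv).Kh u (3 * u - 1)),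
        PD.IsInduced (D.beta v) β ∧ D.IsConnecting v γ ∧
        PD.IsInduced (D.alpha v) α ∧ PD.IsInduced (D.beta v) β' ∧
        Function.Injective β ∧ Function.Exact β (e ∘ γ) ∧
        Function.Exact (e ∘ γ) (α ∘ e.symm) ∧ Function.Exact (α ∘ e.symm) β' ∧
        Function.Surjective β') ∧
      (∃ (e : oB.Kh 0 (-1) ≃ₗ[ℤ] ℤ)
        (β : o.Kh (u - 1) (3 * u - 2) →ₗ[ℤ] (o.smoothA v hv).Kh (u - 1) (3 * u - 3))
        (γ : (o.smoothA v hv).Kh (u - 1) (3 * u - 3) →ₗ[ℤ] oB.Kh 0 (-1))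
        (α : oB.Kh 0 (-1) →ₗ[ℤ] o.Kh u (3 * u - 2))
        (β' : o.Kh u (3 * u - 2) →ₗ[ℤ] (o.smoothA v hv).Kh u (3 * u - 3)),
        PD.IsInduced (D.beta v) β ∧ D.IsConnecting v γ ∧
        PD.IsInduced (D.alpha v) α ∧ PD.IsInduced (D.beta v) β' ∧
        Function.Injective β ∧ Function.Exact β (e ∘ γ) ∧
        Function.Exact (e ∘ γ) (α ∘ e.symm) ∧ Function.Exact (α ∘ e.symm) β' ∧
        Function.Surjective β') ∧
      (∀ i j : ℤ, (i, j) ∉ ({(u, 3 * u), (u, 3 * u - 2)} : Set (ℤ × ℤ)) →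
        Nonempty (Submodule.torsion ℤ (o.Kh i j) ≃ₗ[ℤ]
          Submodule.torsion ℤ ((o.smoothA v hv).Kh i (j - 1)))) := by
  obtain ⟨⟨e⟩, ⟨e'⟩, hsub⟩ := hB.kh oB
  -- A writhe has the parity of the number of crossings, which is `n + 1` for `D` and `n` for the
  -- B-smoothing.
  obtain ⟨u, hu⟩ : ∃ u : ℤ, 2 * u = o.writhe - oB.writhe + 1 := by
    obtain ⟨p, hp⟩ := o.two_dvd_writhe_sub
    obtain ⟨q, hq⟩ := oB.two_dvd_writhe_sub
    push_cast at hp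
    exact ⟨p - q + 1, by omega⟩
  have hd := hD.dich
  -- The source of α_* can be nonzero only if (i − u, j − 3u + 1) is (0, 1) or (0, −1).
  have inj : ∀ i j : ℤ, (i, j) ∉ ({(u, 3 * u), (u, 3 * u - 2)} : Set (ℤ × ℤ)) →
      Subsingleton (oB.Kh (i - u) (j - 3 * u + 1)) := by
    intro i j h
    simp only [Set.mem_insert_iff, Set.mem_singleton_iff, Prod.mk.injEq] at h
    exact hsub _ _ (by omega)
  -- The same for the target of γ_*, whose first index is larger by one.
  have sur : ∀ i j : ℤ, (i, j) ∉ ({(u - 1, 3 * u), (u - 1, 3 * u - 2)} : Set (ℤ × ℤ)) →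
      Subsingleton (oB.Kh (i - u + 1) (j - 3 * u + 1)) := by
    intro i j h
    simp only [Set.mem_insert_iff, Set.mem_singleton_iff, Prod.mk.injEq] at h
    exact hsub _ _ (by omega)
  refine ⟨u, hu, fun i j h => ?_, ?_, ?_, fun i j h => ?_⟩
  · simp only [Set.mem_insert_iff, not_or] at h
    obtain ⟨β, hβ⟩ := PD.exists_isInduced_beta_kh (i := i) hd hv (rfl : j - 1 = j - 1)
    exact ⟨LinearEquiv.ofBijective β
      ⟨PD.injective_beta_kh hd hu rfl (inj i j (by rintro (h' | h') <;> tauto)) hβ,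
        PD.surjective_beta_kh hd hu rfl (sur i j (by rintro (h' | h') <;> tauto)) hβ⟩⟩
  · exact PD.exact_sequence_kh hd hu e (hsub _ _ (by omega)) (hsub _ _ (by omega)) (by ring) rfl
  · exact PD.exact_sequence_kh hd hu e' (hsub _ _ (by omega)) (hsub _ _ (by omega)) (by ring)
      (by ring)
  · obtain ⟨β, hβ⟩ := PD.exists_isInduced_beta_kh (i := i) hd hv (rfl : j - 1 = j - 1)
    refine PD.torsion_equiv_of_injective β (PD.injective_beta_kh hd hu rfl (inj i j h) hβ) ?_
    intro x hx
    obtain ⟨γ, hγ⟩ := PD.exists_isConnecting_kh (oB := oB) (i := i) (j := j - 1)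
      (i' := i - u + 1) (j' := j - 3 * u + 1) hd hv hu rfl (by ring)
    refine (PD.exact_beta_connecting_kh hd hu rfl rfl rfl hβ hγ x).1 ?_
    -- The target of γ_* is ℤ or zero, so γ_* kills torsion, and the torsion class lies in the image
    -- of β_*.
    by_cases hs : i - u + 1 = 0 ∧ (j - 3 * u + 1 = 1 ∨ j - 3 * u + 1 = -1)
    · obtain ⟨f⟩ : Nonempty (oB.Kh (i - u + 1) (j - 3 * u + 1) ≃ₗ[ℤ] ℤ) := by
        rw [hs.1]
        rcases hs.2 with h1 | h1 <;> rw [h1]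
        exacts [⟨e⟩, ⟨e'⟩]
      exact f.map_eq_zero_iff.1 (PD.eq_zero_of_mem_torsion (f.toLinearMap ∘ₗ γ) hx)
    · have := hsub _ _ hs
      exact Subsingleton.elim _ _
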